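/- A knot is a tame knot in $\mathbb{R}^3$, represented by a simple closed polygon; two polygons represent the same knot if they are joined by a finite sequence of triangle moves (replacing an edge $AB$ by $AC\cup CB$, where the triangle $ABC$ meets the polygon only in $AB$) and their inverses. A diagram of a knot $K$ is a regular projection to the plane of a polygon representing $K$ (finitely many multiple points, all of them double points, called crossings, and none of them the image of a vertex), together with the over/under information. A diagram with $n$ crossings is straight if, for some starting point on the knot that is not at a crossing and some direction of travel, going once around the knot and labelling the crossings $1,2,\dots$ in the order in which they are first met, the sequence of labels of the crossings met is $(1,2,\dots,n,\sigma(1),\dots,\sigma(n))$ for some permutation $\sigma\in S_n$. The crossing number $c(K)$ is the least number of crossings of a diagram of $K$, and the straight number $\mathtt{str}(K)$ is the least number of crossings of a straight diagram of $K$. Theorem. Let $K$ be a nontrivial knot, that is, $c(K)=n$ with $n\ge 1$. Then $K$ has a straight diagram, and $\mathtt{str}(K)\le 2^{n-1}-1$. -/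

import Mathlib

/-- The plane that carries the knot diagrams. -/
abbrev Plane : Type := ℝ × ℝ

/-- Euclidean three-space: a point is a pair (point of the horizontal plane, height). Knots are
projected vertically, by `Prod.fst`, and the height decides which strand of a crossing is over. -/
abbrev Space : Type := Plane × ℝ

/-- The closed polygonal path with vertices `v`: on `[i, i + 1]`, with `i` an integer, it runs
affinely from `v i` to `v (i + 1)`. -/
noncomputable def polygonalPath (v : ℤ → Space) (t : ℝ) : Space :=
  AffineMap.lineMap (v ⌊t⌋) (v (⌊t⌋ + 1)) (Int.fract t)

/-- A polygonal knot: a simple closed polygon in space, given by its cyclic sequence of vertices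
(indexed by the integers, with period the number of vertices). -/
structure PolygonalKnot where
  /-- the number of vertices -/
  size : ℕ
  three_le_size : 3 ≤ size
  /-- the vertices, in cyclic order -/
  vertex : ℤ → Space
  periodic : ∀ i : ℤ, vertex (i + size) = vertex i
  /-- the polygon is simple: going round once, no point is met twice -/
  simple : Set.InjOn (polygonalPath vertex) (Set.Ico (0 : ℝ) size)

namespace PolygonalKnot

/-- The periodic parametrization of the polygon (period `P.size`). -/
noncomputable def path (P : PolygonalKnot) : ℝ → Space := polygonalPath P.vertex

/-- The polygon as a set of points. -/
def carrier (P : PolygonalKnot) : Set Space := Set.range P.path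

/-- `Q` has the same cyclic sequence of vertices as `P`, numbered from another vertex. -/
def IsShift (P Q : PolygonalKnot) : Prop :=
  Q.size = P.size ∧ ∃ c : ℤ, ∀ i : ℤ, Q.vertex i = P.vertex (i + c)

/-- `Q` is `P` run through backwards. -/
def IsReverse (P Q : PolygonalKnot) : Prop :=
  Q.size = P.size ∧ ∀ i : ℤ, Q.vertex i = P.vertex (-i)

/-- A triangle move (elementary deformation): with `A` the last and `B` the first vertex of `P`,
the edge `AB` is replaced by the two edges `AC` and `CB`, where the triangle `ABC` meets `P` only
in the edge `AB`. (If `C` lies on the edge `AB`, this inserts a vertex into the edge.) -/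
def IsTriangleMove (P Q : PolygonalKnot) : Prop :=
  Q.size = P.size + 1 ∧
  (∀ i : ℤ, 0 ≤ i → i < P.size → Q.vertex i = P.vertex i) ∧
  convexHull ℝ {P.vertex (P.size - 1), P.vertex 0, Q.vertex P.size} ∩ P.carrier
    = segment ℝ (P.vertex (P.size - 1)) (P.vertex 0)

/-- Two polygonal knots are equivalent (represent the same unoriented knot) if they are joined by
a finite sequence of triangle moves and inverses of triangle moves; the numbering of the vertices
and the direction of travel do not matter. -/
def Equivalent : PolygonalKnot → PolygonalKnot → Prop :=
  Relation.EqvGen fun P Q => IsShift P Q ∨ IsReverse P Q ∨ IsTriangleMove P Q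

/-- The crossings of the vertical projection of `P`: the points of the plane that are the
projection of at least two points of `P`. -/
def crossings (P : PolygonalKnot) : Set Plane :=
  {q | ∃ x ∈ P.carrier, ∃ y ∈ P.carrier, x ≠ y ∧ x.1 = q ∧ y.1 = q}

/-- The vertical projection of `P` is regular, so that `P` presents a knot diagram: there are
finitely many multiple points, all of them are double points, and no vertex lies over one.
(It follows that two edges meeting in a crossing do so transversally.) -/
structure IsRegular (P : PolygonalKnot) : Prop where
  finite_crossings : P.crossings.Finite
  no_triple_point : ∀ x ∈ P.carrier, ∀ y ∈ P.carrier, ∀ z ∈ P.carrier,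
    x.1 = y.1 → y.1 = z.1 → x = y ∨ y = z ∨ x = z
  vertex_not_crossing : ∀ i : ℤ, (P.vertex i).1 ∉ P.crossings

/-- `w` is a knot word of the diagram presented by `P`, a diagram with `n` crossings: there are a
starting point `P.path a` on the knot that is not at a crossing, a direction of travel `ε = ±1`,
and a labelling `cross` of the crossings by `0, …, n - 1` (instead of `1, …, n`) such that
* `t 0 < t 1 < ⋯` are the moments at which one comes to a crossing when going round the knot once,
* `w j` is the label of the crossing that is met at the moment `t j`,
* labels are given in the order in which the crossings are first met. -/
def IsKnotWord (P : PolygonalKnot) {n : ℕ} (w : Fin (n + n) → Fin n) : Prop :=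
  ∃ (a ε : ℝ) (t : Fin (n + n) → ℝ) (cross : Fin n → Plane),
    (P.path a).1 ∉ P.crossings ∧ (ε = 1 ∨ ε = -1) ∧
    Function.Injective cross ∧ Set.range cross = P.crossings ∧
    StrictMono t ∧
    Set.range t = {u : ℝ | 0 < u ∧ u < P.size ∧ (P.path (a + ε * u)).1 ∈ P.crossings} ∧
    (∀ j, (P.path (a + ε * t j)).1 = cross (w j)) ∧
    (∀ j, ∀ m < w j, ∃ i < j, w i = m)

/-- The diagram presented by `P` is straight: it has a knot word of the form
`(1, 2, …, n, σ(1), σ(2), …, σ(n))` with a permutation `σ`. -/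
def IsStraight (P : PolygonalKnot) : Prop :=
  ∃ (n : ℕ) (σ : Equiv.Perm (Fin n)), P.IsKnotWord (Fin.append id σ)

/-- The crossing number `c(K)`: the least number of crossings of a diagram of `K`
(as an extended natural number, `⊤` if there were no diagram). -/
noncomputable def crossingNumber (K : PolygonalKnot) : ℕ∞ :=
  sInf {n : ℕ∞ | ∃ P : PolygonalKnot, K.Equivalent P ∧ P.IsRegular ∧ P.crossings.encard = n}

/-- The straight number `str(K)`: the least number of crossings of a straight diagram of `K`
(as an extended natural number, `⊤` if there were no straight diagram). -/
noncomputable def straightNumber (K : PolygonalKnot) : ℕ∞ :=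
  sInf {n : ℕ∞ | ∃ P : PolygonalKnot, K.Equivalent P ∧ P.IsRegular ∧ P.IsStraight ∧
    P.crossings.encard = n}

end PolygonalKnot

/-! Cut a diagram into two arcs `α` and `β` with common endpoints. If neither arc crosses itself,
then travelling along `α` and afterwards along `β` meets each crossing once on either arc, so the
diagram is straight (`Diagram.isStraight`).

Now let only `α` be free of self-crossings, let `a` be the number of crossings of `α` with `β` and
`b` the number of self-crossings of `β`. Behind its last self-crossing, `β` ends in an embedded tail
that is crossed by `α` only. The strand that crosses `β` at this point is pushed along the tail, as
a thin finger, until it has passed the endpoint of `β`. This removes the self-crossing and adds at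
most two crossings with `α` for each crossing of `α` with the tail, and at most one more at the tip
of the finger (`exists_finger`). The same can be done at the other end of `β`. The two tails meet
`α` in disjoint sets of crossings, so at the cheaper end `a` grows to at most `2 * a + 1`
(`exists_reduce`): the number `a + 1` at most doubles while `b` drops. Iteration ends with two
simple arcs and at most `2 ^ b * (a + 1) - 1` crossings (`exists_two_simple`).

In a diagram with the least number `n` of crossings, `α` can be chosen with `a ≥ 3` and `a + b = n`
(`exists_simple_arc`): starting just before a crossing, the first three crossings met are distinct
(`exists_three_crossings`). Two successive passages through the same crossing bound a kink, which
can be removed (`Diagram.exists_unkink`), against minimality. A pattern `p, q, p` would be a loop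
that the rest of the curve crosses exactly once, which the winding number forbids
(`Gen.not_crossed_once`). Finally `a + 1 ≤ 2 ^ (a - 1)` for `a ≥ 3`, whence `2 ^ b * (a + 1) ≤ 2 ^
(n - 1)`.

Everything is done with closed polygons given by lists of vertices, up to rotation and reversal.
`cov` counts the edges through a point, and `Gen k` bounds it by `k`: `Gen 1` in space is
simplicity, and `Gen 2` in the plane is the absence of triple points. One principle yields all
isotopies: two arcs with the same endpoints that lie over everything else are interchangeable
(`LEq.overpass`), since either can be coned off to one very high point, triangle by triangle
(`LEq.fan`). A finger is a succession of slides, each past one vertex and along a thin triangle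
(`Diagram.exists_slide`). Strands that lie below are treated by reflection or by reversal of the
direction. -/

namespace KnotDiagram

/-! ### Edges of open and closed polygons as lists -/

section Lists
variable {E F : Type*}

/-- The edges of the open polygonal path with the given vertices. -/
def segs : List E → List (E × E)
  | a :: b :: l => (a, b) :: segs (b :: l)
  | _ => []

/-- The edges of the closed polygon with the given vertices. -/
def cedges : List E → List (E × E)
  | [] => []
  | x :: l => segs (x :: l ++ [x])

@[simp] theorem segs_nil : segs ([] : List E) = [] := rfl
@[simp] theorem segs_singleton (a : E) : segs [a] = [] := rfl
@[simp] theorem segs_cons_cons (a b : E) (l : List E) :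
    segs (a :: b :: l) = (a, b) :: segs (b :: l) := rfl

theorem segs_append_cons (l₁ : List E) (a : E) (l₂ : List E) :
    segs (l₁ ++ a :: l₂) = segs (l₁ ++ [a]) ++ segs (a :: l₂) := by
  induction l₁ with
  | nil => simp
  | cons x l₁ ih =>
    cases l₁ with
    | nil => simp
    | cons y l₁ => simpa using ih

theorem segs_append_cons_cons (l₁ : List E) (a b : E) (l₂ : List E) :
    segs (l₁ ++ a :: b :: l₂) = segs (l₁ ++ [a]) ++ (a, b) :: segs (b :: l₂) := by
  rw [segs_append_cons, segs_cons_cons]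

theorem fst_mem_of_mem_segs {l : List E} {e : E × E} (h : e ∈ segs l) : e.1 ∈ l := by
  induction l with
  | nil => simp at h
  | cons x l ih =>
    cases l with
    | nil => simp at h
    | cons y l =>
      rw [segs_cons_cons, List.mem_cons] at h
      rcases h with rfl | h
      · simp
      · exact List.mem_cons_of_mem _ (ih h)

theorem snd_mem_of_mem_segs {x : E} {l : List E} {e : E × E} (h : e ∈ segs (x :: l)) :
    e.2 ∈ l := by
  induction l generalizing x with
  | nil => simp at h
  | cons y l ih =>
    rw [segs_cons_cons, List.mem_cons] at h
    rcases h with rfl | h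
    · simp
    · exact List.mem_cons_of_mem _ (ih h)

theorem segs_map (f : E → F) (l : List E) : segs (l.map f) = (segs l).map (Prod.map f f) := by
  induction l with
  | nil => simp
  | cons x l ih =>
    cases l with
    | nil => simp
    | cons y l => simpa using ih

theorem segs_reverse (l : List E) : segs l.reverse = ((segs l).map Prod.swap).reverse := by
  induction l with
  | nil => simp
  | cons x l ih =>
    cases l with
    | nil => simp
    | cons y l =>
      rw [segs_cons_cons, List.map_cons, List.reverse_cons (a := x),
        List.reverse_cons (a := (x, y).swap), ← ih, List.reverse_cons, List.append_assoc,
        List.cons_append, List.nil_append, segs_append_cons]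
      simp

theorem map_fst_segs (x : E) (l : List E) (z : E) :
    (segs (x :: l ++ [z])).map Prod.fst = x :: l := by
  induction l generalizing x with
  | nil => simp
  | cons y l ih => simpa using ih y

theorem map_snd_segs (x : E) (l : List E) : (segs (x :: l)).map Prod.snd = l := by
  induction l generalizing x with
  | nil => simp
  | cons y l ih => simpa using ih y

/-- Turns a cut of the list of edges into a cut of the list of vertices: edges are selected for
their crossings, whereas moves are performed on vertices. -/
theorem segs_eq_append {l : List E} {e : E × E} {l₁ l₂ : List (E × E)}
    (h : segs l = l₁ ++ e :: l₂) :
    ∃ m₁ m₂, l = m₁ ++ e.1 :: e.2 :: m₂ ∧ segs (m₁ ++ [e.1]) = l₁ ∧ segs (e.2 :: m₂) = l₂ := by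
  induction l generalizing l₁ with
  | nil => simp at h
  | cons x l ih =>
    cases l with
    | nil => simp at h
    | cons y l =>
      rw [segs_cons_cons] at h
      cases l₁ with
      | nil =>
        simp only [List.nil_append, List.cons.injEq] at h
        obtain ⟨rfl, h⟩ := h
        exact ⟨[], l, by simp, by simp, h⟩
      | cons d l₁ =>
        simp only [List.cons_append, List.cons.injEq] at h
        obtain ⟨rfl, h⟩ := h
        obtain ⟨m₁, m₂, h₁, h₂, h₃⟩ := ih h
        cases m₁ with
        | nil =>
          simp only [List.nil_append, List.cons.injEq] at h₁
          obtain ⟨rfl, rfl⟩ := h₁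
          exact ⟨[x], m₂, by simp, by simpa using h₂, h₃⟩
        | cons z m₁ =>
          simp only [List.cons_append, List.cons.injEq] at h₁
          obtain ⟨rfl, rfl⟩ := h₁
          exact ⟨x :: y :: m₁, m₂, by simp, by simpa using h₂, h₃⟩

theorem segs_splitAt {l : List E} {e : E × E} (h : e ∈ segs l) :
    ∃ m₁ m₂, l = m₁ ++ e.1 :: e.2 :: m₂ := by
  obtain ⟨l₁, l₂, h⟩ := List.append_of_mem h
  obtain ⟨m₁, m₂, h, -⟩ := segs_eq_append h
  exact ⟨m₁, m₂, h⟩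

theorem cedges_cons_append_cons (x : E) (A : List E) (y : E) (B : List E) :
    cedges (x :: A ++ y :: B) = segs (x :: A ++ [y]) ++ segs (y :: B ++ [x]) := by
  rw [List.cons_append, cedges, ← List.cons_append, List.append_assoc, List.cons_append (a := y),
    segs_append_cons (x :: A)]

/-- Renumbering the vertices of a closed polygon changes the list of edges only by a permutation, so
quantities such as `cov` are unaffected and any edge may be assumed to be the closing one. -/
theorem cedges_append_perm (l₁ l₂ : List E) :
    (cedges (l₁ ++ l₂)).Perm (cedges (l₂ ++ l₁)) := by
  cases l₁ with
  | nil => simp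
  | cons x A =>
    cases l₂ with
    | nil => simp
    | cons y B =>
      rw [cedges_cons_append_cons, cedges_cons_append_cons]
      exact List.perm_append_comm

/-- The closed polygon made of the kept path `b, …, a` and the arc `a, X, b`. -/
theorem cedges_arc (b : E) (m : List E) (a : E) (X : List E) :
    cedges (b :: m ++ [a] ++ X) = segs (b :: m ++ [a]) ++ segs (a :: X ++ [b]) := by
  have : b :: m ++ [a] ++ X = b :: (m ++ [a] ++ X) := by simp
  rw [this, cedges]
  have : b :: (m ++ [a] ++ X) ++ [b] = b :: m ++ a :: (X ++ [b]) := by simp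
  rw [this, segs_append_cons]
  simp

theorem cedges_map (f : E → F) (l : List E) :
    cedges (l.map f) = (cedges l).map (Prod.map f f) := by
  cases l with
  | nil => simp [cedges]
  | cons x l =>
    rw [List.map_cons, cedges, cedges, ← segs_map]
    simp

theorem map_fst_cedges (l : List E) : (cedges l).map Prod.fst = l := by
  cases l with
  | nil => simp [cedges]
  | cons x l => exact map_fst_segs x l x

theorem length_cedges (l : List E) : (cedges l).length = l.length := by
  conv_rhs => rw [← map_fst_cedges l, List.length_map]

theorem map_snd_cedges_perm (l : List E) : ((cedges l).map Prod.snd).Perm l := by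
  cases l with
  | nil => simp [cedges]
  | cons x l =>
    rw [cedges, List.cons_append, map_snd_segs]
    exact List.perm_append_comm

theorem fst_mem_of_mem_cedges {l : List E} {e : E × E} (h : e ∈ cedges l) : e.1 ∈ l := by
  rw [← map_fst_cedges l]; exact List.mem_map_of_mem h

theorem snd_mem_of_mem_cedges {l : List E} {e : E × E} (h : e ∈ cedges l) : e.2 ∈ l :=
  (map_snd_cedges_perm l).subset (List.mem_map_of_mem h)

theorem exists_cedge_fst {l : List E} {v : E} (h : v ∈ l) : ∃ e ∈ cedges l, e.1 = v := by
  rw [← map_fst_cedges l, List.mem_map] at h; exact h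

theorem cedges_fst_inj {l : List E} (hl : l.Nodup) {e f : E × E} (he : e ∈ cedges l)
    (hf : f ∈ cedges l) (h : e.1 = f.1) : e = f := by
  rw [← map_fst_cedges l] at hl
  exact List.inj_on_of_nodup_map hl he hf h

theorem cedges_snd_inj {l : List E} (hl : l.Nodup) {e f : E × E} (he : e ∈ cedges l)
    (hf : f ∈ cedges l) (h : e.2 = f.2) : e = f :=
  List.inj_on_of_nodup_map ((map_snd_cedges_perm l).nodup_iff.2 hl) he hf h

theorem nodup_cedges {l : List E} (hl : l.Nodup) : (cedges l).Nodup := by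
  rw [← map_fst_cedges l] at hl
  exact List.Nodup.of_map _ hl

theorem cedges_reverse_perm (l : List E) :
    (cedges l.reverse).Perm ((cedges l).map Prod.swap) := by
  cases l with
  | nil => simp [cedges]
  | cons x l =>
    rw [List.reverse_cons]
    refine (cedges_append_perm _ _).trans ?_
    rw [List.cons_append, List.nil_append, cedges, cedges]
    have : x :: l.reverse ++ [x] = (x :: l ++ [x]).reverse := by simp
    rw [this, segs_reverse]
    exact List.reverse_perm _

theorem cedges_ne {l : List E} (hl : l.Nodup) (h2 : 2 ≤ l.length) {e : E × E}
    (he : e ∈ cedges l) : e.1 ≠ e.2 := by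
  intro h
  -- Rotate until `e` starts at the head of the list; its end is then the second entry, which
  -- differs from the first.
  obtain ⟨l₁, l₂, hs⟩ := List.append_of_mem (fst_mem_of_mem_cedges he)
  have hp := cedges_append_perm l₁ (e.1 :: l₂)
  rw [← hs] at hp
  have he' := hp.subset he
  have hp2 : (l₁ ++ e.1 :: l₂).Perm (e.1 :: l₂ ++ l₁) := List.perm_append_comm
  rw [← hs] at hp2
  have hn : (e.1 :: (l₂ ++ l₁)).Nodup := by simpa using hp2.nodup_iff.1 hl
  have hlen : (l₂ ++ l₁).length + 1 = l.length := by
    rw [hp2.length_eq]; simp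
  rw [List.cons_append] at he'
  revert hn he' hlen
  generalize l₂ ++ l₁ = m
  intro he' hn hlen
  cases m with
  | nil => simp at hlen; omega
  | cons y m =>
    have h1 : (e.1, y) ∈ cedges (e.1 :: y :: m) := by simp [cedges]
    have := cedges_fst_inj hn he' h1 rfl
    have h3 : y = e.1 := by rw [h]; exact (congrArg Prod.snd this).symm
    simp [h3] at hn

end Lists

/-! ### Covering numbers and polygons in general position -/

section Cover
variable {E F : Type*} [AddCommGroup E] [Module ℝ E] [AddCommGroup F] [Module ℝ F]

/-- The edge without its endpoints. -/
def oseg (e : E × E) : Set E := openSegment ℝ e.1 e.2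

/-- The edge with its endpoints. -/
def cseg (e : E × E) : Set E := segment ℝ e.1 e.2

/-- The number of edges in the list whose interior contains the point. -/
noncomputable def cov (l : List (E × E)) (p : E) : ℕ :=
  (l.map fun e => (oseg e).indicator (fun _ => 1) p).sum

@[simp] theorem cov_nil (p : E) : cov [] p = 0 := rfl
theorem cov_cons (e : E × E) (l : List (E × E)) (p : E) :
    cov (e :: l) p = (oseg e).indicator (fun _ => 1) p + cov l p := by simp [cov]
theorem cov_append (l₁ l₂ : List (E × E)) (p : E) :
    cov (l₁ ++ l₂) p = cov l₁ p + cov l₂ p := by simp [cov]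
theorem cov_perm {l₁ l₂ : List (E × E)} (h : l₁.Perm l₂) (p : E) : cov l₁ p = cov l₂ p :=
  (h.map _).sum_eq

theorem oseg_swap (e : E × E) : oseg e.swap = oseg e := openSegment_symm ℝ _ _
theorem cseg_swap (e : E × E) : cseg e.swap = cseg e := segment_symm ℝ _ _

theorem cov_map_swap (l : List (E × E)) (p : E) : cov (l.map Prod.swap) p = cov l p := by
  induction l with
  | nil => simp
  | cons e l ih => rw [List.map_cons, cov_cons, cov_cons, ih, oseg_swap]

theorem cov_cons_of_mem {e : E × E} {l : List (E × E)} {p : E} (h : p ∈ oseg e) :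
    cov (e :: l) p = 1 + cov l p := by rw [cov_cons, Set.indicator_of_mem h]
theorem cov_cons_of_notMem {e : E × E} {l : List (E × E)} {p : E} (h : p ∉ oseg e) :
    cov (e :: l) p = cov l p := by rw [cov_cons, Set.indicator_of_notMem h, zero_add]

theorem cov_pos_iff {l : List (E × E)} {p : E} : 1 ≤ cov l p ↔ ∃ e ∈ l, p ∈ oseg e := by
  induction l with
  | nil => simp
  | cons e l ih =>
    by_cases h : p ∈ oseg e
    · rw [cov_cons_of_mem h]; simp [h]
    · rw [cov_cons_of_notMem h, ih]; simp [h]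

theorem cov_eq_zero_iff {l : List (E × E)} {p : E} : cov l p = 0 ↔ ∀ e ∈ l, p ∉ oseg e := by
  have := cov_pos_iff (l := l) (p := p)
  have h : cov l p = 0 ↔ ¬ 1 ≤ cov l p := by omega
  rw [h, this]
  push Not
  rfl

theorem cov_sublist {l₁ l₂ : List (E × E)} (h : l₁.Sublist l₂) (p : E) : cov l₁ p ≤ cov l₂ p :=
  (h.map _).sum_le_sum (by simp)

theorem two_le_cov {l : List (E × E)} {p : E} (hl : l.Nodup) :
    2 ≤ cov l p ↔ ∃ e ∈ l, ∃ f ∈ l, e ≠ f ∧ p ∈ oseg e ∧ p ∈ oseg f := by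
  induction l with
  | nil => simp
  | cons e l ih =>
    have hel := (List.nodup_cons.1 hl).1
    by_cases h : p ∈ oseg e
    · rw [cov_cons_of_mem h]
      have : 2 ≤ 1 + cov l p ↔ 1 ≤ cov l p := by omega
      rw [this, cov_pos_iff]
      constructor
      · rintro ⟨f, hf, hp⟩
        exact ⟨e, by simp, f, by simp [hf], fun h => hel (h ▸ hf), h, hp⟩
      · rintro ⟨a, ha, b, hb, hab, hpa, hpb⟩
        rcases List.mem_cons.1 ha with rfl | ha
        · rcases List.mem_cons.1 hb with rfl | hb
          · exact absurd rfl hab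
          · exact ⟨b, hb, hpb⟩
        · exact ⟨a, ha, hpa⟩
    · rw [cov_cons_of_notMem h, ih (List.nodup_cons.1 hl).2]
      constructor
      · rintro ⟨a, ha, b, hb, h3⟩
        exact ⟨a, by simp [ha], b, by simp [hb], h3⟩
      · rintro ⟨a, ha, b, hb, hab, hpa, hpb⟩
        rcases List.mem_cons.1 ha with rfl | ha
        · exact absurd hpa h
        rcases List.mem_cons.1 hb with rfl | hb
        · exact absurd hpb h
        exact ⟨a, ha, b, hb, hab, hpa, hpb⟩

theorem three_le_cov {l : List (E × E)} {p : E} {e f g : E × E} (he : e ∈ l)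
    (hf : f ∈ l) (hg : g ∈ l) (hef : e ≠ f) (heg : e ≠ g) (hfg : f ≠ g) (hpe : p ∈ oseg e)
    (hpf : p ∈ oseg f) (hpg : p ∈ oseg g) : 3 ≤ cov l p := by
  have hs : List.Subperm [e, f, g] l := by
    refine List.subperm_of_subset (by simp [*]) ?_
    simp [he, hf, hg]
  obtain ⟨l', h1, h2⟩ := hs
  have := cov_sublist h2 p
  rw [cov_perm h1, cov_cons_of_mem hpe, cov_cons_of_mem hpf, cov_cons_of_mem hpg] at this
  simpa using this

/-- If a nodup list of edges covers a point three times, three edges witness it. -/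
theorem exists_of_three_le_cov {l : List (E × E)} {p : E} (hl : l.Nodup) (h : 3 ≤ cov l p) :
    ∃ e ∈ l, ∃ f ∈ l, ∃ g ∈ l, e ≠ f ∧ e ≠ g ∧ f ≠ g ∧ p ∈ oseg e ∧ p ∈ oseg f ∧ p ∈ oseg g := by
  induction l with
  | nil => simp at h
  | cons e l ih =>
    have hel := (List.nodup_cons.1 hl).1
    by_cases hp : p ∈ oseg e
    · rw [cov_cons_of_mem hp] at h
      obtain ⟨f, hf, g, hg, hfg, hpf, hpg⟩ :=
        (two_le_cov (List.nodup_cons.1 hl).2).1 (by omega : 2 ≤ cov l p)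
      exact ⟨e, by simp, f, by simp [hf], g, by simp [hg], fun h => hel (h ▸ hf),
        fun h => hel (h ▸ hg), hfg, hp, hpf, hpg⟩
    · rw [cov_cons_of_notMem hp] at h
      obtain ⟨a, ha, b, hb, c, hc, h⟩ := ih (List.nodup_cons.1 hl).2 h
      exact ⟨a, by simp [ha], b, by simp [hb], c, by simp [hc], h⟩

/-- The closed polygon with vertices `U` covers no point more than `k` times, and no vertex
is met again. -/
structure Gen (k : ℕ) (U : List E) : Prop where
  nodup : U.Nodup
  vertex_notMem : ∀ v ∈ U, ∀ e ∈ cedges U, v ∉ oseg e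
  cov_le : ∀ p, cov (cedges U) p ≤ k

theorem Gen.rotate {k : ℕ} {l₁ l₂ : List E} (h : Gen k (l₁ ++ l₂)) : Gen k (l₂ ++ l₁) where
  nodup := List.perm_append_comm.nodup_iff.1 h.nodup
  vertex_notMem v hv e he := h.vertex_notMem v (List.perm_append_comm.subset hv) e
    ((cedges_append_perm l₂ l₁).subset he)
  cov_le p := by rw [cov_perm (cedges_append_perm l₂ l₁)]; exact h.cov_le p

theorem Gen.reverse {k : ℕ} {l : List E} (h : Gen k l) : Gen k l.reverse where
  nodup := List.nodup_reverse.2 h.nodup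
  vertex_notMem v hv e he := by
    have := (cedges_reverse_perm l).subset he
    obtain ⟨f, hf, rfl⟩ := List.mem_map.1 this
    rw [oseg_swap]
    exact h.vertex_notMem v (List.mem_reverse.1 hv) f hf
  cov_le p := by
    rw [cov_perm (cedges_reverse_perm l), cov_map_swap]; exact h.cov_le p

theorem oseg_map (f : E →ₗ[ℝ] F) (e : E × E) : oseg (Prod.map f f e) = f '' oseg e := by
  simp only [oseg, Prod.map_fst, Prod.map_snd]
  exact (image_openSegment ℝ f.toAffineMap e.1 e.2).symm

theorem cseg_map (f : E →ₗ[ℝ] F) (e : E × E) : cseg (Prod.map f f e) = f '' cseg e := by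
  simp only [cseg, Prod.map_fst, Prod.map_snd]
  exact (image_segment ℝ f.toAffineMap e.1 e.2).symm

theorem oseg_subset_cseg (e : E × E) : oseg e ⊆ cseg e := openSegment_subset_segment ℝ _ _

theorem mem_cseg_iff {e : E × E} {p : E} : p ∈ cseg e ↔ p = e.1 ∨ p = e.2 ∨ p ∈ oseg e := by
  rw [cseg, ← insert_endpoints_openSegment]
  rfl

theorem mem_oseg_of_mem_cseg {e : E × E} {p : E} (h : p ∈ cseg e) (h1 : p ≠ e.1) (h2 : p ≠ e.2) :
    p ∈ oseg e := by
  rcases mem_cseg_iff.1 h with h | h | h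
  · exact absurd h h1
  · exact absurd h h2
  · exact h

/-- The set of all points of the edges. -/
def carr (l : List (E × E)) : Set E := {p | ∃ e ∈ l, p ∈ cseg e}

theorem Gen.mem_of_mem_cseg {k : ℕ} {U : List E} (h : Gen k U) {v : E} (hv : v ∈ U) {e : E × E}
    (he : e ∈ cedges U) (hp : v ∈ cseg e) : v = e.1 ∨ v = e.2 := by
  rcases mem_cseg_iff.1 hp with h1 | h1 | h1
  · exact Or.inl h1
  · exact Or.inr h1
  · exact absurd h1 (h.vertex_notMem v hv e he)

/-- Two edges of a generic polygon meet in common endpoints or in a common interior point. -/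
theorem Gen.meet {k : ℕ} {U : List E} (h : Gen k U) {e f : E × E}
    (he : e ∈ cedges U) (hf : f ∈ cedges U) {p : E} (hpe : p ∈ cseg e) (hpf : p ∈ cseg f) :
    (p ∈ U ∧ (p = e.1 ∨ p = e.2) ∧ (p = f.1 ∨ p = f.2)) ∨ (p ∈ oseg e ∧ p ∈ oseg f) := by
  by_cases hp : p ∈ U
  · exact Or.inl ⟨hp, h.mem_of_mem_cseg hp he hpe, h.mem_of_mem_cseg hp hf hpf⟩
  · refine Or.inr ⟨mem_oseg_of_mem_cseg hpe ?_ ?_, mem_oseg_of_mem_cseg hpf ?_ ?_⟩ <;>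
      rintro rfl <;> apply hp
    · exact fst_mem_of_mem_cedges he
    · exact snd_mem_of_mem_cedges he
    · exact fst_mem_of_mem_cedges hf
    · exact snd_mem_of_mem_cedges hf

theorem Gen.disjoint_of_one {U : List E} (h : Gen 1 U) {e f : E × E}
    (he : e ∈ cedges U) (hf : f ∈ cedges U) (hef : e ≠ f) {p : E} (hpe : p ∈ oseg e)
    (hpf : p ∈ oseg f) : False := by
  have := (two_le_cov (nodup_cedges h.nodup)).2 ⟨e, he, f, hf, hef, hpe, hpf⟩
  have := h.cov_le p
  omega

theorem Gen.eq_of_two {U : List E} (h : Gen 2 U) {e f g : E × E}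
    (he : e ∈ cedges U) (hf : f ∈ cedges U) (hg : g ∈ cedges U) (hef : e ≠ f) (hge : g ≠ e)
    {p : E} (hpe : p ∈ oseg e) (hpf : p ∈ oseg f) (hpg : p ∈ oseg g) : g = f := by
  by_contra hgf
  have := three_le_cov he hf hg hef hge.symm (Ne.symm hgf) hpe hpf hpg
  have := h.cov_le p
  omega

theorem mem_oseg_split {a b x : E} (hx : x ∈ openSegment ℝ a b) (p : E) :
    p ∈ oseg (a, b) ↔ p ∈ oseg (a, x) ∨ p = x ∨ p ∈ oseg (x, b) := by
  obtain ⟨s, t, hs, ht, hst, rfl⟩ := hx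
  simp only [oseg]
  constructor
  · rintro ⟨u, v, hu, hv, huv, rfl⟩
    rcases lt_trichotomy v t with h | h | h
    · left
      refine ⟨1 - v / t, v / t, ?_, by positivity, by ring, ?_⟩
      · rw [sub_pos, div_lt_one ht]; exact h
      · have h1 : u = 1 - v := by linarith
        have h2 : s = 1 - t := by linarith
        subst h1 h2
        rw [smul_add, smul_smul, smul_smul, ← add_assoc, ← add_smul]
        congr 2 <;> field_simp <;> ring
    · right; left
      have h1 : u = s := by linarith
      rw [h, h1]
    · right; right
      refine ⟨u / s, 1 - u / s, by positivity, ?_, by ring, ?_⟩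
      · rw [sub_pos, div_lt_one hs]; linarith
      · have h1 : v = 1 - u := by linarith
        have h2 : t = 1 - s := by linarith
        subst h1 h2
        rw [smul_add, smul_smul, smul_smul, add_assoc, ← add_smul]
        congr 2 <;> field_simp <;> ring
  · rintro (⟨u, v, hu, hv, huv, rfl⟩ | rfl | ⟨u, v, hu, hv, huv, rfl⟩)
    · refine ⟨u + v * s, v * t, by positivity, by positivity, ?_, ?_⟩
      · rw [add_assoc, ← mul_add, hst, mul_one, huv]
      · rw [smul_add, smul_smul, smul_smul, ← add_assoc, ← add_smul]
    · exact ⟨s, t, hs, ht, hst, rfl⟩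
    · refine ⟨u * s, u * t + v, by positivity, by positivity, ?_, ?_⟩
      · rw [← add_assoc, ← mul_add, hst, mul_one, huv]
      · rw [smul_add, smul_smul, smul_smul, add_assoc, ← add_smul]

theorem left_notMem_oseg {a b : E} (h : a ≠ b) : a ∉ oseg (a, b) := by
  rw [oseg, left_mem_openSegment_iff]; exact h
theorem right_notMem_oseg {a b : E} (h : a ≠ b) : b ∉ oseg (a, b) := by
  rw [oseg, right_mem_openSegment_iff]; exact h

/-- A common point of the two halves would make a positive multiple of `b - a` vanish. -/
theorem notMem_oseg_left_right {a b x p : E} (hab : a ≠ b) (hx : x ∈ openSegment ℝ a b)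
    (h1 : p ∈ oseg (a, x)) (h2 : p ∈ oseg (x, b)) : False := by
  obtain ⟨s, t, hs, ht, hst, rfl⟩ := hx
  obtain ⟨u, v, hu, hv, huv, rfl⟩ := h1
  obtain ⟨u', v', hu', hv', huv', h⟩ := h2
  simp only at h
  have h1 : s = 1 - t := by linarith
  have h2 : u = 1 - v := by linarith
  have h3 : u' = 1 - v' := by linarith
  subst h1 h2 h3
  have h4 : ((1 - v') * t + v' - v * t) • (b - a) = 0 := by
    have h5 : ((1 - v') • ((1 - t) • a + t • b) + v' • b) -
      ((1 - v) • a + v • ((1 - t) • a + t • b)) = 0 := sub_eq_zero.2 h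
    rw [← h5]; module
  rcases smul_eq_zero.1 h4 with h5 | h5
  · have : 0 < (1 - v') * t + v' - v * t := by nlinarith
    linarith
  · exact hab (sub_eq_zero.1 h5).symm

/-- The two halves together cover what the edge covered, except for the point `x`, which has become
a vertex. -/
theorem cov_split {a b x : E} (hab : a ≠ b) (hx : x ∈ openSegment ℝ a b) (l : List (E × E))
    (p : E) : cov ((a, b) :: l) p
      = cov ((a, x) :: (x, b) :: l) p + ({x} : Set E).indicator (fun _ => 1) p := by
  have hax : a ≠ x := by
    rintro rfl; exact left_notMem_oseg hab hx
  have hxb : x ≠ b := by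
    rintro rfl; exact right_notMem_oseg hab hx
  have key := mem_oseg_split hx p
  simp only [cov_cons]
  by_cases h1 : p ∈ oseg (a, x)
  · have h2 : p ∉ oseg (x, b) := fun h => notMem_oseg_left_right hab hx h1 h
    have h3 : p ≠ x := by rintro rfl; exact right_notMem_oseg hax h1
    rw [Set.indicator_of_mem (key.2 (Or.inl h1)), Set.indicator_of_mem h1,
      Set.indicator_of_notMem h2, Set.indicator_of_notMem (by simpa using h3)]
    ring
  · by_cases h2 : p ∈ oseg (x, b)
    · have h3 : p ≠ x := by rintro rfl; exact left_notMem_oseg hxb h2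
      rw [Set.indicator_of_mem (key.2 (Or.inr (Or.inr h2))), Set.indicator_of_mem h2,
        Set.indicator_of_notMem h1, Set.indicator_of_notMem (by simpa using h3)]
      ring
    · by_cases h3 : p = x
      · rw [Set.indicator_of_mem (key.2 (Or.inr (Or.inl h3))), Set.indicator_of_notMem h2,
          Set.indicator_of_notMem h1, Set.indicator_of_mem (by simpa using h3)]
        ring
      · rw [Set.indicator_of_notMem (by rw [key]; tauto), Set.indicator_of_notMem h2,
          Set.indicator_of_notMem h1, Set.indicator_of_notMem (by simpa using h3)]
        ring

end Cover
-- Polygonal knots from lists of vertices, and their equivalence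
open PolygonalKnot

/-- The vertex with the given index, indices being read modulo the length of the list. -/
noncomputable def vtx (V : List Space) (i : ℤ) : Space := V.getD (i % V.length).toNat 0

theorem vtx_periodic (V : List Space) (i : ℤ) : vtx V (i + V.length) = vtx V i := by
  simp [vtx]

theorem vtx_natCast (V : List Space) {i : ℕ} (h : i < V.length) : vtx V i = V[i] := by
  rw [vtx, Int.emod_eq_of_lt (by positivity) (by exact_mod_cast h)]
  rw [Int.toNat_natCast, List.getD_eq_getElem _ _ h]

theorem cedges_getElem {E : Type*} (V : List E) {i : ℕ} (h : i < V.length) :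
    (cedges V)[i]'(by rwa [length_cedges]) =
      (V[i], V[(i + 1) % V.length]'(Nat.mod_lt _ (by omega))) := by
  have h1 : ((cedges V).map Prod.fst)[i]'(by rwa [List.length_map, length_cedges]) = V[i] := by
    simp only [map_fst_cedges]
  rw [List.getElem_map] at h1
  refine Prod.ext h1 ?_
  cases V with
  | nil => simp at h
  | cons x l =>
    have h2 : ((cedges (x :: l)).map Prod.snd) = l ++ [x] := by
      rw [cedges, List.cons_append, map_snd_segs]
    have h3 : ((cedges (x :: l)).map Prod.snd)[i]'(by
      rwa [List.length_map, length_cedges]) = (l ++ [x])[i]'(by simpa using h) := by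
      simp only [h2]
    rw [List.getElem_map] at h3
    rw [h3]
    simp only [List.length_cons] at h ⊢
    by_cases hi : i = l.length
    · subst hi; simp
    · have : (i + 1) % (l.length + 1) = i + 1 := Nat.mod_eq_of_lt (by omega)
      simp only [this, List.getElem_cons_succ]
      rw [List.getElem_append_left (by omega)]

theorem vtx_pair_natCast (V : List Space) {i : ℕ} (h : i < V.length) :
    (vtx V i, vtx V (i + 1)) = (cedges V)[i]'(by rwa [length_cedges]) := by
  rw [cedges_getElem V h, vtx_natCast V h]
  congr 1
  rw [vtx]
  have : ((i : ℤ) + 1) % V.length = ((i + 1) % V.length : ℕ) := by push_cast; rfl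
  rw [this, Int.toNat_natCast, List.getD_eq_getElem]

theorem vtx_emod (V : List Space) (i : ℤ) : vtx V (i % V.length) = vtx V i := by
  simp [vtx]

theorem vtx_add_emod (V : List Space) (i j : ℤ) : vtx V (i % V.length + j) = vtx V (i + j) := by
  simp [vtx]

theorem vtx_pair_mem {V : List Space} (h : 0 < V.length) (i : ℤ) :
    (vtx V i, vtx V (i + 1)) ∈ cedges V := by
  have hN : (0 : ℤ) < V.length := by exact_mod_cast h
  obtain ⟨k, hk⟩ := Int.eq_ofNat_of_zero_le (Int.emod_nonneg i hN.ne')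
  have hk2 : k < V.length := by
    have := Int.emod_lt_of_pos i hN
    omega
  rw [← vtx_emod V i, ← vtx_add_emod V i 1, hk, vtx_pair_natCast V hk2]
  exact List.getElem_mem _

theorem exists_vtx_pair {V : List Space} {e : Space × Space} (he : e ∈ cedges V) :
    ∃ i : ℕ, i < V.length ∧ e = (vtx V i, vtx V (i + 1)) := by
  obtain ⟨i, hi, rfl⟩ := List.getElem_of_mem he
  rw [length_cedges] at hi
  exact ⟨i, hi, (vtx_pair_natCast V hi).symm⟩

theorem vtx_inj {V : List Space} (hV : V.Nodup) {i j : ℤ} (hi : 0 ≤ i) (hi' : i < V.length)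
    (hj : 0 ≤ j) (hj' : j < V.length) (h : vtx V i = vtx V j) : i = j := by
  lift i to ℕ using hi
  lift j to ℕ using hj
  have hi2 : i < V.length := by exact_mod_cast hi'
  have hj2 : j < V.length := by exact_mod_cast hj'
  rw [vtx_natCast V hi2, vtx_natCast V hj2] at h
  rw [(List.Nodup.getElem_inj_iff hV).1 h]

theorem lineMap_mem_oseg {E : Type*} [AddCommGroup E] [Module ℝ E] {a b : E} {t : ℝ}
    (h0 : 0 < t) (h1 : t < 1) : AffineMap.lineMap a b t ∈ oseg (a, b) := by
  rw [oseg, openSegment_eq_image_lineMap]; exact ⟨t, ⟨h0, h1⟩, rfl⟩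

theorem lineMap_mem_cseg {E : Type*} [AddCommGroup E] [Module ℝ E] {a b : E} {t : ℝ}
    (h0 : 0 ≤ t) (h1 : t ≤ 1) : AffineMap.lineMap a b t ∈ cseg (a, b) := by
  rw [cseg, segment_eq_image_lineMap]; exact ⟨t, ⟨h0, h1⟩, rfl⟩

theorem polygonalPath_add (v : ℤ → Space) (i : ℤ) {s : ℝ} (h0 : 0 ≤ s) (h1 : s < 1) :
    polygonalPath v (i + s) = AffineMap.lineMap (v i) (v (i + 1)) s := by
  have : ⌊(i : ℝ) + s⌋ = i := by
    rw [Int.floor_intCast_add, Int.floor_eq_zero_iff.2 ⟨h0, h1⟩, add_zero]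
  rw [polygonalPath, this, Int.fract, this]
  simp

/-- The vertex list of a simple closed polygon. -/
def Simple (V : List Space) : Prop := 3 ≤ V.length ∧ Gen 1 V

theorem Simple.ne {V : List Space} (h : Simple V) {e : Space × Space} (he : e ∈ cedges V) :
    e.1 ≠ e.2 := cedges_ne h.2.nodup (by have := h.1; omega) he

theorem floor_mem {N : ℕ} {t : ℝ} (ht : t ∈ Set.Ico (0 : ℝ) N) : 0 ≤ ⌊t⌋ ∧ ⌊t⌋ < N :=
  ⟨Int.floor_nonneg.2 ht.1, Int.floor_lt.2 (by exact_mod_cast ht.2)⟩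

/-- The polygonal knot with the given vertices. -/
noncomputable def ofList (V : List Space) (h : Simple V) : PolygonalKnot where
  size := V.length
  three_le_size := h.1
  vertex := vtx V
  periodic := vtx_periodic V
  simple := by
    intro t ht t' ht' htt
    have hN : 0 < V.length := by have := h.1; omega
    obtain ⟨hi, hi'⟩ := floor_mem ht
    obtain ⟨hj, hj'⟩ := floor_mem ht'
    rw [polygonalPath, polygonalPath] at htt
    have hs0 := Int.fract_nonneg t
    have hs1 := Int.fract_lt_one t
    have hr0 := Int.fract_nonneg t'
    have hr1 := Int.fract_lt_one t'
    have e1 := vtx_pair_mem hN ⌊t⌋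
    have e2 := vtx_pair_mem hN ⌊t'⌋
    -- Each of the two points is a vertex or an inner point of its edge. Two vertices differ because
    -- the list has no repetition, a vertex lies inside no edge, and the interiors of different
    -- edges are disjoint.
    have key : ⌊t⌋ = ⌊t'⌋ := by
      rcases hs0.eq_or_lt with hs | hs <;> rcases hr0.eq_or_lt with hr | hr
      · rw [← hs, ← hr] at htt
        simp only [AffineMap.lineMap_apply_zero] at htt
        exact vtx_inj h.2.nodup hi hi' hj hj' htt
      · rw [← hs, AffineMap.lineMap_apply_zero] at htt
        exact absurd (htt ▸ lineMap_mem_oseg hr hr1)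
          (h.2.vertex_notMem _ (fst_mem_of_mem_cedges e1) _ e2)
      · rw [← hr, AffineMap.lineMap_apply_zero] at htt
        exact absurd (htt ▸ lineMap_mem_oseg hs hs1)
          (h.2.vertex_notMem _ (fst_mem_of_mem_cedges e2) _ e1)
      · by_contra hne
        refine h.2.disjoint_of_one e1 e2 (fun he => hne ?_) (lineMap_mem_oseg hs hs1)
          (htt ▸ lineMap_mem_oseg hr hr1)
        exact vtx_inj h.2.nodup hi hi' hj hj' (congrArg Prod.fst he)
    rw [key] at htt e1
    have := AffineMap.lineMap_injective ℝ (h.ne e1) htt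
    rw [← Int.floor_add_fract t, ← Int.floor_add_fract t', key, this]

theorem carrier_ofList {V : List Space} (h : Simple V) :
    (ofList V h).carrier = carr (cedges V) := by
  have hN : 0 < V.length := by have := h.1; omega
  ext p
  constructor
  · rintro ⟨t, rfl⟩
    exact ⟨_, vtx_pair_mem hN ⌊t⌋,
      lineMap_mem_cseg (Int.fract_nonneg t) (Int.fract_lt_one t).le⟩
  · rintro ⟨e, he, hp⟩
    obtain ⟨i, hi, rfl⟩ := exists_vtx_pair he
    rw [cseg, segment_eq_image_lineMap] at hp
    obtain ⟨s, ⟨hs0, hs1⟩, rfl⟩ := hp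
    -- The path uses parameters in `[0, 1)` on each edge, so the end of an edge is reached only as
    -- the start of the next one.
    rcases hs1.eq_or_lt with rfl | hs1
    · refine ⟨((i + 1 : ℤ) : ℝ) + 0, ?_⟩
      rw [path, polygonalPath_add _ _ le_rfl one_pos]
      simp [ofList]
    · refine ⟨((i : ℤ) : ℝ) + s, ?_⟩
      rw [path, polygonalPath_add _ _ hs0 hs1]
      simp [ofList]

/-- The two lists are the vertex lists of equivalent polygonal knots. -/
def LEq (V W : List Space) : Prop :=
  ∃ (hV : Simple V) (hW : Simple W), (ofList V hV).Equivalent (ofList W hW)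

theorem LEq.refl {V : List Space} (h : Simple V) : LEq V V := ⟨h, h, Relation.EqvGen.refl _⟩
theorem LEq.symm {V W : List Space} (h : LEq V W) : LEq W V := by
  obtain ⟨h1, h2, h⟩ := h
  exact ⟨h2, h1, Relation.EqvGen.symm _ _ h⟩
theorem LEq.trans {V W X : List Space} (h : LEq V W) (h' : LEq W X) : LEq V X := by
  obtain ⟨h1, h2, h⟩ := h
  obtain ⟨h3, h4, h'⟩ := h'
  exact ⟨h1, h4, Relation.EqvGen.trans _ _ _ h h'⟩

theorem vtx_append_comm (l₁ l₂ : List Space) (i : ℤ) :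
    vtx (l₂ ++ l₁) i = vtx (l₁ ++ l₂) (i + l₁.length) := by
  rcases Nat.eq_zero_or_pos (l₁ ++ l₂).length with h | h
  · rw [List.length_append] at h
    have h1 : l₁ = [] := List.eq_nil_of_length_eq_zero (by omega)
    subst h1; simp
  · have hr : l₂ ++ l₁ = (l₁ ++ l₂).rotate l₁.length := by
      rw [List.rotate_append_length_eq]
    have hlen : (l₂ ++ l₁).length = (l₁ ++ l₂).length := by simp [add_comm]
    have hN : (0 : ℤ) < (l₁ ++ l₂).length := by exact_mod_cast h
    obtain ⟨k, hk⟩ := Int.eq_ofNat_of_zero_le (Int.emod_nonneg i hN.ne')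
    have hk2 : k < (l₁ ++ l₂).length := by
      have := Int.emod_lt_of_pos i hN
      omega
    rw [← vtx_emod (l₂ ++ l₁) i, hlen, ← vtx_add_emod (l₁ ++ l₂) i, hk,
      vtx_natCast _ (by omega)]
    rw [vtx]
    have h2 : ((k : ℤ) + l₁.length) % (l₁ ++ l₂).length
        = ((k + l₁.length) % (l₁ ++ l₂).length : ℕ) := by push_cast; rfl
    rw [h2, Int.toNat_natCast, List.getD_eq_getElem _ _ (Nat.mod_lt _ h)]
    simp only [hr, List.getElem_rotate]

theorem Simple.rotate {l₁ l₂ : List Space} (h : Simple (l₁ ++ l₂)) : Simple (l₂ ++ l₁) :=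
  ⟨by have := h.1; simp at this ⊢; omega, h.2.rotate⟩

theorem LEq.rotate {l₁ l₂ : List Space} (h : Simple (l₁ ++ l₂)) : LEq (l₁ ++ l₂) (l₂ ++ l₁) :=
  ⟨h, h.rotate, Relation.EqvGen.rel _ _ (Or.inl ⟨by simp [ofList, add_comm],
    l₁.length, fun i => vtx_append_comm l₁ l₂ i⟩)⟩

theorem Simple.reverse {V : List Space} (h : Simple V) : Simple V.reverse :=
  ⟨by simpa using h.1, h.2.reverse⟩

theorem vtx_cons_reverse (x : Space) (l : List Space) (i : ℤ) :
    vtx (x :: l.reverse) i = vtx (x :: l) (-i) := by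
  have hlen : (x :: l.reverse).length = (x :: l).length := by simp
  have hN : (0 : ℤ) < (x :: l).length := by simp
  obtain ⟨k, hk⟩ := Int.eq_ofNat_of_zero_le (Int.emod_nonneg i hN.ne')
  have hk2 : k < (x :: l).length := by
    have := Int.emod_lt_of_pos i hN
    omega
  have h1 : vtx (x :: l) (-i) = vtx (x :: l) (-k) := by
    rw [← vtx_emod _ (-i), ← vtx_emod _ (-(k : ℤ)), ← hk]
    congr 1
    exact (Int.ModEq.neg (Int.mod_modEq i _)).symm
  rw [h1, ← vtx_emod (x :: l.reverse) i, hlen, hk, vtx_natCast _ (by simpa using hk2)]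
  rcases Nat.eq_zero_or_pos k with rfl | hk0
  · simp [vtx]
  · rw [← vtx_periodic (x :: l) (-k)]
    have h2 : (-(k : ℤ) + (x :: l).length) = (((x :: l).length - k : ℕ) : ℤ) := by
      rw [Nat.cast_sub hk2.le]; ring
    rw [h2, vtx_natCast _ (by omega)]
    obtain ⟨k, rfl⟩ : ∃ j, k = j + 1 := ⟨k - 1, by omega⟩
    simp only [List.length_cons] at hk2
    have h3 : (x :: l).length - (k + 1) = (l.length - 1 - k) + 1 := by
      simp; omega
    simp only [h3, List.getElem_cons_succ, List.getElem_reverse]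

theorem LEq.reverse {V : List Space} (h : Simple V) : LEq V V.reverse := by
  -- Reversal of a polygonal knot fixes the vertex with index `0`. The last vertex is therefore
  -- moved to the front first, since it heads the reversed list.
  obtain ⟨l, x, rfl⟩ : ∃ l x, V = l ++ [x] := by
    refine ⟨V.dropLast, V.getLast ?_, (List.dropLast_append_getLast _).symm⟩
    rintro rfl; simpa using h.1
  refine (LEq.rotate h).trans ?_
  have h2 : Simple (x :: l) := h.rotate
  rw [List.reverse_append]
  have h3 : Simple (x :: l.reverse) := by simpa using h.reverse
  exact ⟨h2, h3, Relation.EqvGen.rel _ _ (Or.inr (Or.inl ⟨by simp [ofList],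
    fun i => vtx_cons_reverse x l i⟩))⟩

/-- Both the triangle and the polygon contain the edge `ab`, so only one inclusion of the condition
on triangle moves has to be assumed. -/
theorem LEq.insert_last {b : Space} {m : List Space} {a C : Space} (h : Simple (b :: m ++ [a]))
    (h' : Simple (b :: m ++ [a] ++ [C]))
    (hc : convexHull ℝ {a, b, C} ∩ carr (cedges (b :: m ++ [a])) ⊆ segment ℝ a b) :
    LEq (b :: m ++ [a]) (b :: m ++ [a] ++ [C]) := by
  refine ⟨h, h', Relation.EqvGen.rel _ _ (Or.inr (Or.inr ⟨by simp [ofList], ?_, ?_⟩))⟩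
  · intro i hi hi'
    lift i to ℕ using hi
    have hi2 : i < (b :: m ++ [a]).length := by exact_mod_cast hi'
    change vtx _ _ = vtx _ _
    rw [vtx_natCast _ hi2, vtx_natCast _ (by rw [List.length_append]; omega)]
    rw [List.getElem_append_left]
  · have ha : (ofList _ h).vertex ((ofList _ h).size - 1) = a := by
      change vtx _ _ = a
      have : (((ofList _ h).size : ℤ) - 1) = ((m.length + 1 : ℕ) : ℤ) := by simp [ofList]
      rw [this, vtx_natCast _ (by simp)]
      simp
    have hb : (ofList _ h).vertex 0 = b := by
      change vtx (b :: m ++ [a]) 0 = b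
      simp [vtx]
    have hC : (ofList _ h').vertex (ofList _ h).size = C := by
      change vtx _ _ = C
      have : (((ofList _ h).size : ℤ)) = ((m.length + 2 : ℕ) : ℤ) := by
        simp [ofList]; ring
      rw [this, vtx_natCast _ (by simp)]
      simp
    rw [ha, hb, hC, carrier_ofList]
    refine hc.antisymm fun p hp => ⟨?_, (a, b), ?_, hp⟩
    · exact (convex_convexHull ℝ _).segment_subset (subset_convexHull ℝ _ (by simp))
        (subset_convexHull ℝ _ (by simp)) hp
    · have := cedges_arc b m a []
      rw [List.append_nil] at this
      rw [this]
      simp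

/-- A triangle move that inserts a vertex between two lists of vertices. -/
theorem LEq.insert {l₁ : List Space} {u w : Space} {l₂ : List Space} {C : Space}
    (h : Simple (l₁ ++ [u] ++ w :: l₂)) (h' : Simple (l₁ ++ [u] ++ C :: w :: l₂))
    (hc : convexHull ℝ {u, w, C} ∩ carr (cedges (l₁ ++ [u] ++ w :: l₂)) ⊆ segment ℝ u w) :
    LEq (l₁ ++ [u] ++ w :: l₂) (l₁ ++ [u] ++ C :: w :: l₂) := by
  have e1 : w :: (l₂ ++ l₁) ++ [u] = w :: l₂ ++ (l₁ ++ [u]) := by simp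
  have e2 : w :: (l₂ ++ l₁) ++ [u] ++ [C] = w :: l₂ ++ (l₁ ++ [u] ++ [C]) := by simp
  have e3 : l₁ ++ [u] ++ C :: w :: l₂ = (l₁ ++ [u] ++ [C]) ++ w :: l₂ := by simp
  have key := LEq.insert_last (b := w) (m := l₂ ++ l₁) (a := u) (C := C)
    (by rw [e1]; exact h.rotate) (by rw [e2]; rw [e3] at h'; exact h'.rotate) (by
      rintro p ⟨hp, e, he, hpe⟩
      refine hc ⟨hp, e, ?_, hpe⟩
      rw [e1] at he
      exact (cedges_append_perm _ _).subset he)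
  rw [e2, e1] at key
  rw [e3] at h' ⊢
  exact (LEq.rotate h).trans (key.trans (LEq.rotate h').symm)

/-! ### Reflection in the horizontal plane -/

section Mirror

/-- Reflection in the horizontal plane. -/
noncomputable def mir : Space →ₗ[ℝ] Space := LinearMap.prodMap LinearMap.id (-LinearMap.id)

@[simp] theorem mir_fst (x : Space) : (mir x).1 = x.1 := rfl
@[simp] theorem mir_snd (x : Space) : (mir x).2 = -x.2 := rfl
@[simp] theorem mir_mir (x : Space) : mir (mir x) = x := by ext <;> simp
theorem mir_injective : Function.Injective mir := fun x y h => by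
  rw [← mir_mir x, h, mir_mir]

theorem polygonalPath_mir (v : ℤ → Space) (t : ℝ) :
    polygonalPath (fun i => mir (v i)) t = mir (polygonalPath v t) := by
  rw [polygonalPath, polygonalPath, AffineMap.lineMap_apply_module, AffineMap.lineMap_apply_module]
  simp

/-- The mirror image of a polygonal knot. -/
noncomputable def mirror (P : PolygonalKnot) : PolygonalKnot where
  size := P.size
  three_le_size := P.three_le_size
  vertex i := mir (P.vertex i)
  periodic i := by rw [P.periodic]
  simple := by
    intro t ht t' ht' h
    rw [polygonalPath_mir, polygonalPath_mir] at h
    exact P.simple ht ht' (mir_injective h)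

theorem carrier_mirror (P : PolygonalKnot) : (mirror P).carrier = mir '' P.carrier := by
  rw [carrier, carrier, ← Set.range_comp]
  congr 1
  ext1 t
  exact polygonalPath_mir P.vertex t

/-- The reflection is linear and injective, so it carries triangle moves to triangle moves. It
exchanges over and under without changing the projection, which halves the later case distinctions.
-/
theorem equivalent_mirror {P Q : PolygonalKnot} (h : P.Equivalent Q) :
    (mirror P).Equivalent (mirror Q) := by
  induction h with
  | refl => exact Relation.EqvGen.refl _
  | symm _ _ _ ih => exact Relation.EqvGen.symm _ _ ih
  | trans _ _ _ _ _ ih₁ ih₂ => exact Relation.EqvGen.trans _ _ _ ih₁ ih₂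
  | rel P Q h =>
    refine Relation.EqvGen.rel _ _ ?_
    rcases h with ⟨h, c, hc⟩ | ⟨h, hc⟩ | ⟨h, hv, hc⟩
    · exact Or.inl ⟨h, c, fun i => congrArg mir (hc i)⟩
    · exact Or.inr (Or.inl ⟨h, fun i => congrArg mir (hc i)⟩)
    · refine Or.inr (Or.inr ⟨h, fun i h0 h1 => congrArg mir (hv i h0 h1), ?_⟩)
      have h1 : (mirror P).carrier = mir '' P.carrier := carrier_mirror P
      have h2 : ({(mirror P).vertex ((mirror P).size - 1), (mirror P).vertex 0,
          (mirror Q).vertex (mirror P).size} : Set Space) =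
          mir '' {P.vertex (P.size - 1), P.vertex 0, Q.vertex P.size} := by
        rw [Set.image_insert_eq, Set.image_pair]; rfl
      rw [h1, h2, ← mir.isLinear.image_convexHull, ← Set.image_inter mir_injective, hc]
      exact image_segment ℝ mir.toAffineMap _ _

theorem Gen.map_injective {E F : Type*} [AddCommGroup E] [Module ℝ E] [AddCommGroup F]
    [Module ℝ F] {k : ℕ} {V : List E} (h : Gen k V) (f : E →ₗ[ℝ] F)
    (hf : Function.Injective f) : Gen k (V.map f) where
  nodup := h.nodup.map hf
  vertex_notMem v hv e he := by
    rw [cedges_map] at he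
    obtain ⟨w, hw, rfl⟩ := List.mem_map.1 hv
    obtain ⟨d, hd, rfl⟩ := List.mem_map.1 he
    rw [oseg_map, hf.mem_set_image]
    exact h.vertex_notMem w hw d hd
  cov_le p := by
    by_cases hp : p ∈ Set.range f
    · obtain ⟨p, rfl⟩ := hp
      refine le_trans (le_of_eq ?_) (h.cov_le p)
      rw [cedges_map, cov, cov, List.map_map]
      congr 2
      ext e
      simp only [Function.comp, oseg_map]
      by_cases he : p ∈ oseg e
      · rw [Set.indicator_of_mem he, Set.indicator_of_mem (Set.mem_image_of_mem _ he)]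
      · rw [Set.indicator_of_notMem he, Set.indicator_of_notMem]
        rwa [hf.mem_set_image]
    · have : cov (cedges (V.map f)) p = 0 := by
        rw [cov_eq_zero_iff]
        intro e he
        rw [cedges_map] at he
        obtain ⟨d, hd, rfl⟩ := List.mem_map.1 he
        rw [oseg_map]
        rintro ⟨x, -, rfl⟩
        exact hp ⟨x, rfl⟩
      omega

theorem Simple.mirror {V : List Space} (h : Simple V) : Simple (V.map mir) :=
  ⟨by simpa using h.1, h.2.map_injective mir mir_injective⟩

theorem map_mir_map_mir (V : List Space) : (V.map mir).map mir = V := by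
  rw [List.map_map]
  convert List.map_id V
  ext x <;> simp

theorem mirror_ofList {V : List Space} (h : Simple V) :
    mirror (ofList V h) = ofList (V.map mir) h.mirror := by
  have : (fun i => mir (vtx V i)) = vtx (V.map mir) := by
    ext1 i
    rw [vtx, vtx, List.length_map, ← map_zero mir, List.getD_map, map_zero]
  simp only [mirror, ofList, List.length_map, PolygonalKnot.mk.injEq, true_and]
  exact this

theorem LEq.mirror {V W : List Space} (h : LEq V W) : LEq (V.map mir) (W.map mir) := by
  obtain ⟨h1, h2, h⟩ := h
  refine ⟨h1.mirror, h2.mirror, ?_⟩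
  rw [← mirror_ofList h1, ← mirror_ofList h2]
  exact equivalent_mirror h

end Mirror

/-! ### Diagrams: simple closed polygons with regular projection -/

/-- The vertical projection of a list of vertices. -/
def pl (V : List Space) : List Plane := V.map Prod.fst

/-- The crossings of the projected closed polygon. -/
def crs (U : List Plane) : Set Plane := {p | 2 ≤ cov (cedges U) p}

/-- The vertices of a simple closed polygon with regular vertical projection. -/
structure Diagram (V : List Space) : Prop where
  simple : Simple V
  gen : Gen 2 (pl V)
  fin : (crs (pl V)).Finite

/-- The projection of an edge. -/
def pe (e : Space × Space) : Plane × Plane := Prod.map Prod.fst Prod.fst e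

theorem oseg_pe (e : Space × Space) : oseg (pe e) = Prod.fst '' oseg e :=
  oseg_map (LinearMap.fst ℝ Plane ℝ) e
theorem cseg_pe (e : Space × Space) : cseg (pe e) = Prod.fst '' cseg e :=
  cseg_map (LinearMap.fst ℝ Plane ℝ) e

theorem cedges_pl (V : List Space) : cedges (pl V) = (cedges V).map pe := cedges_map _ _
theorem segs_pl (V : List Space) : segs (pl V) = (segs V).map pe := segs_map _ _
theorem pl_append (V W : List Space) : pl (V ++ W) = pl V ++ pl W := List.map_append

theorem Diagram.rotate {l₁ l₂ : List Space} (h : Diagram (l₁ ++ l₂)) : Diagram (l₂ ++ l₁) where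
  simple := h.simple.rotate
  gen := by
    have := h.gen
    rw [pl_append] at this ⊢
    exact this.rotate
  fin := by
    have := h.fin
    rw [pl_append] at this ⊢
    convert this using 1
    ext p
    simp only [crs, Set.mem_ofPred_eq]
    rw [cov_perm (cedges_append_perm _ _)]

theorem crs_rotate (l₁ l₂ : List Plane) : crs (l₁ ++ l₂) = crs (l₂ ++ l₁) := by
  ext p
  simp only [crs, Set.mem_ofPred_eq]
  rw [cov_perm (cedges_append_perm _ _)]

theorem crs_reverse (U : List Plane) : crs U.reverse = crs U := by
  ext p
  simp only [crs, Set.mem_ofPred_eq]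
  rw [cov_perm (cedges_reverse_perm _), cov_map_swap]

theorem pl_reverse (V : List Space) : pl V.reverse = (pl V).reverse := List.map_reverse

theorem pl_mir (V : List Space) : pl (V.map mir) = pl V := by
  rw [pl, pl, List.map_map]
  rfl

theorem Diagram.reverse {V : List Space} (h : Diagram V) : Diagram V.reverse where
  simple := h.simple.reverse
  gen := by rw [pl_reverse]; exact h.gen.reverse
  fin := by rw [pl_reverse, crs_reverse]; exact h.fin

theorem Diagram.mirror {V : List Space} (h : Diagram V) : Diagram (V.map mir) where
  simple := h.simple.mirror
  gen := by rw [pl_mir]; exact h.gen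
  fin := by rw [pl_mir]; exact h.fin

theorem Diagram.pe_inj {V : List Space} (h : Diagram V) {e f : Space × Space}
    (he : e ∈ cedges V) (hf : f ∈ cedges V) (hef : pe e = pe f) : e = f := by
  have h1 : (pe e).1 = (pe f).1 := by rw [hef]
  have := List.inj_on_of_nodup_map h.gen.nodup (fst_mem_of_mem_cedges he)
    (fst_mem_of_mem_cedges hf) h1
  exact cedges_fst_inj h.simple.2.nodup he hf this

theorem Diagram.pe_mem {V : List Space} {e : Space × Space} (he : e ∈ cedges V) :
    pe e ∈ cedges (pl V) := by
  rw [cedges_pl]; exact List.mem_map_of_mem he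

theorem Diagram.pe_ne {V : List Space} (h : Diagram V) {e : Space × Space}
    (he : e ∈ cedges V) : (pe e).1 ≠ (pe e).2 :=
  cedges_ne h.gen.nodup (by have := h.simple.1; rw [pl, List.length_map]; omega)
    (Diagram.pe_mem he)

/-- The vertical projection is injective on an edge whose projection is not a point. -/
theorem fst_injOn_cseg {e : Space × Space} (h : (pe e).1 ≠ (pe e).2) {x y : Space}
    (hx : x ∈ cseg e) (hy : y ∈ cseg e) (hxy : x.1 = y.1) : x = y := by
  rw [cseg, segment_eq_image_lineMap] at hx hy
  obtain ⟨s, -, rfl⟩ := hx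
  obtain ⟨t, -, rfl⟩ := hy
  have h1 : ∀ r : ℝ, (AffineMap.lineMap e.1 e.2 r : Space).1
      = AffineMap.lineMap (pe e).1 (pe e).2 r := by
    intro r
    rw [AffineMap.lineMap_apply_module, AffineMap.lineMap_apply_module]
    rfl
  rw [h1, h1] at hxy
  rw [AffineMap.lineMap_injective ℝ h hxy]

/-- Two points of a diagram over the same point of the plane agree, or lie in the interior of
different edges that cross there. -/
theorem Diagram.over {V : List Space} (h : Diagram V) {e f : Space × Space}
    (he : e ∈ cedges V) (hf : f ∈ cedges V) {x y : Space} (hx : x ∈ cseg e) (hy : y ∈ cseg f)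
    (hxy : x.1 = y.1) : x = y ∨ (e ≠ f ∧ x.1 ∈ oseg (pe e) ∧ x.1 ∈ oseg (pe f)) := by
  by_cases hef : e = f
  · subst hef
    exact Or.inl (fst_injOn_cseg (h.pe_ne he) hx hy hxy)
  have hx' : x.1 ∈ cseg (pe e) := by rw [cseg_pe]; exact ⟨x, hx, rfl⟩
  have hy' : x.1 ∈ cseg (pe f) := by rw [cseg_pe, hxy]; exact ⟨y, hy, rfl⟩
  rcases h.gen.meet (Diagram.pe_mem he) (Diagram.pe_mem hf) hx' hy' with ⟨-, h1, h2⟩ | h1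
  · left
    have hx1 : x = e.1 ∨ x = e.2 := by
      rcases h1 with h1 | h1
      · exact Or.inl (fst_injOn_cseg (h.pe_ne he) hx (left_mem_segment ℝ _ _) h1)
      · exact Or.inr (fst_injOn_cseg (h.pe_ne he) hx (right_mem_segment ℝ _ _) h1)
    have hy1 : y = f.1 ∨ y = f.2 := by
      rw [hxy] at h2
      rcases h2 with h1 | h1
      · exact Or.inl (fst_injOn_cseg (h.pe_ne hf) hy (left_mem_segment ℝ _ _) h1)
      · exact Or.inr (fst_injOn_cseg (h.pe_ne hf) hy (right_mem_segment ℝ _ _) h1)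
    have hxV : x ∈ V := by
      rcases hx1 with rfl | rfl
      · exact fst_mem_of_mem_cedges he
      · exact snd_mem_of_mem_cedges he
    have hyV : y ∈ V := by
      rcases hy1 with rfl | rfl
      · exact fst_mem_of_mem_cedges hf
      · exact snd_mem_of_mem_cedges hf
    exact List.inj_on_of_nodup_map h.gen.nodup hxV hyV hxy
  · exact Or.inr ⟨hef, h1⟩

theorem Diagram.mem_crs {V : List Space} (h : Diagram V) {p : Plane} :
    p ∈ crs (pl V) ↔ ∃ e ∈ cedges V, ∃ f ∈ cedges V, e ≠ f ∧ p ∈ oseg (pe e) ∧ p ∈ oseg (pe f) := by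
  rw [crs, Set.mem_ofPred_eq, two_le_cov (nodup_cedges h.gen.nodup)]
  constructor
  · rintro ⟨e, he, f, hf, hef, h1, h2⟩
    rw [cedges_pl, List.mem_map] at he hf
    obtain ⟨e, he, rfl⟩ := he
    obtain ⟨f, hf, rfl⟩ := hf
    exact ⟨e, he, f, hf, fun h => hef (h ▸ rfl), h1, h2⟩
  · rintro ⟨e, he, f, hf, hef, h1, h2⟩
    exact ⟨_, Diagram.pe_mem he, _, Diagram.pe_mem hf, fun h' => hef (h.pe_inj he hf h'), h1, h2⟩

theorem Diagram.crossings_eq {V : List Space} (h : Diagram V) :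
    (ofList V h.simple).crossings = crs (pl V) := by
  ext q
  rw [h.mem_crs]
  constructor
  · rintro ⟨x, hx, y, hy, hxy, rfl, hq⟩
    rw [carrier_ofList] at hx hy
    obtain ⟨e, he, hxe⟩ := hx
    obtain ⟨f, hf, hyf⟩ := hy
    rcases h.over he hf hxe hyf hq.symm with h1 | h1
    · exact absurd h1 hxy
    · exact ⟨e, he, f, hf, h1⟩
  · rintro ⟨e, he, f, hf, hef, h1, h2⟩
    rw [oseg_pe] at h1 h2
    obtain ⟨x, hx, rfl⟩ := h1
    obtain ⟨y, hy, hxy⟩ := h2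
    refine ⟨x, ?_, y, ?_, ?_, rfl, hxy⟩
    · rw [carrier_ofList]; exact ⟨e, he, oseg_subset_cseg e hx⟩
    · rw [carrier_ofList]; exact ⟨f, hf, oseg_subset_cseg f hy⟩
    · rintro rfl
      exact h.simple.2.disjoint_of_one he hf hef hx hy

theorem Diagram.isRegular {V : List Space} (h : Diagram V) : (ofList V h.simple).IsRegular where
  finite_crossings := by rw [h.crossings_eq]; exact h.fin
  no_triple_point := by
    intro x hx y hy z hz hxy hyz
    rw [carrier_ofList] at hx hy hz
    obtain ⟨e, he, hx⟩ := hx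
    obtain ⟨f, hf, hy⟩ := hy
    obtain ⟨g, hg, hz⟩ := hz
    rcases h.over he hf hx hy hxy with h1 | ⟨hef, h1, h2⟩
    · exact Or.inl h1
    rcases h.over hf hg hy hz hyz with h3 | ⟨hfg, h3, h4⟩
    · exact Or.inr (Or.inl h3)
    rcases h.over he hg hx hz (hxy.trans hyz) with h5 | ⟨heg, h5, h6⟩
    · exact Or.inr (Or.inr h5)
    exfalso
    have := three_le_cov (Diagram.pe_mem he) (Diagram.pe_mem hf) (Diagram.pe_mem hg)
      (fun h' => hef (h.pe_inj he hf h')) (fun h' => heg (h.pe_inj he hg h'))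
      (fun h' => hfg (h.pe_inj hf hg h')) h1 h2 h6
    have := h.gen.cov_le x.1
    omega
  vertex_not_crossing := by
    intro i hi
    rw [h.crossings_eq, h.mem_crs] at hi
    obtain ⟨e, he, -, -, -, h1, -⟩ := hi
    refine h.gen.vertex_notMem _ ?_ _ (Diagram.pe_mem he) h1
    exact List.mem_map_of_mem
      (fst_mem_of_mem_cedges (vtx_pair_mem (by have := h.simple.1; omega) i))

/-! ### From regular polygonal knots to diagrams -/

section OfKnot

/-- The list of vertices of a polygonal knot. -/
noncomputable def toList (P : PolygonalKnot) : List Space :=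
  (List.range P.size).map fun i : ℕ => P.vertex i

theorem length_toList (P : PolygonalKnot) : (toList P).length = P.size := by simp [toList]

theorem vertex_emod (P : PolygonalKnot) (i : ℤ) : P.vertex (i % P.size) = P.vertex i := by
  have : Function.Periodic P.vertex (P.size : ℤ) := P.periodic
  conv_rhs => rw [← Int.emod_add_mul_ediv i P.size, mul_comm]
  exact (this.int_mul _ _).symm

theorem vtx_toList (P : PolygonalKnot) : vtx (toList P) = P.vertex := by
  ext1 i
  have hN : (0 : ℤ) < P.size := by have := P.three_le_size; omega
  obtain ⟨k, hk⟩ := Int.eq_ofNat_of_zero_le (Int.emod_nonneg i hN.ne')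
  have hk2 : k < P.size := by
    have := Int.emod_lt_of_pos i hN
    omega
  rw [← vtx_emod, length_toList, ← vertex_emod, hk, vtx_natCast _ (by rwa [length_toList])]
  simp [toList]

/-- Simplicity of the knot in terms of edge and parameter; with parameters in `[0, 1)` every point,
vertices included, has only one address. -/
theorem path_inj (P : PolygonalKnot) {i j : ℕ} (hi : i < P.size) (hj : j < P.size) {s t : ℝ}
    (hs0 : 0 ≤ s) (hs1 : s < 1) (ht0 : 0 ≤ t) (ht1 : t < 1)
    (h : (AffineMap.lineMap (P.vertex i) (P.vertex (i + 1)) s : Space)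
      = AffineMap.lineMap (P.vertex j) (P.vertex (j + 1)) t) : i = j ∧ s = t := by
  rw [← polygonalPath_add _ _ hs0 hs1, ← polygonalPath_add _ _ ht0 ht1] at h
  have key := P.simple (x₁ := ((i : ℤ) : ℝ) + s) (x₂ := ((j : ℤ) : ℝ) + t)
    ⟨by push_cast; positivity, by
      have : (i : ℝ) + 1 ≤ P.size := by exact_mod_cast hi
      push_cast; linarith⟩
    ⟨by push_cast; positivity, by
      have : (j : ℝ) + 1 ≤ P.size := by exact_mod_cast hj
      push_cast; linarith⟩ h
  push_cast at key
  have h1 : (i : ℝ) < j + 1 := by linarith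
  have h2 : (j : ℝ) < i + 1 := by linarith
  have h3 : i = j := by
    have : i < j + 1 := by exact_mod_cast h1
    have : j < i + 1 := by exact_mod_cast h2
    omega
  subst h3
  exact ⟨rfl, by linarith⟩

theorem exists_of_mem_cedges_toList (P : PolygonalKnot) {e : Space × Space}
    (he : e ∈ cedges (toList P)) : ∃ i : ℕ, i < P.size ∧ e = (P.vertex i, P.vertex (i + 1)) := by
  obtain ⟨i, hi, h⟩ := exists_vtx_pair he
  rw [length_toList] at hi
  rw [vtx_toList] at h
  exact ⟨i, hi, h⟩

theorem exists_of_mem_toList (P : PolygonalKnot) {v : Space} (hv : v ∈ toList P) :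
    ∃ i : ℕ, i < P.size ∧ v = P.vertex i := by
  simp only [toList, List.mem_map, List.mem_range] at hv
  obtain ⟨i, hi, rfl⟩ := hv
  exact ⟨i, hi, rfl⟩

theorem exists_of_mem_oseg {E : Type*} [AddCommGroup E] [Module ℝ E] {a b p : E}
    (h : p ∈ oseg (a, b)) : ∃ t : ℝ, 0 < t ∧ t < 1 ∧ p = AffineMap.lineMap a b t := by
  rw [oseg, openSegment_eq_image_lineMap] at h
  obtain ⟨t, ⟨h0, h1⟩, rfl⟩ := h
  exact ⟨t, h0, h1, rfl⟩

theorem simple_toList (P : PolygonalKnot) : Simple (toList P) := by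
  have hnd : (toList P).Nodup := by
    refine List.Nodup.map_on ?_ List.nodup_range
    intro i hi j hj hij
    rw [List.mem_range] at hi hj
    exact (path_inj P hi hj le_rfl one_pos le_rfl one_pos (by simpa using hij)).1
  refine ⟨by rw [length_toList]; exact P.three_le_size, hnd, ?_, ?_⟩
  · intro v hv e he hve
    obtain ⟨i, hi, rfl⟩ := exists_of_mem_toList P hv
    obtain ⟨j, hj, rfl⟩ := exists_of_mem_cedges_toList P he
    obtain ⟨t, h0, h1, h⟩ := exists_of_mem_oseg hve
    have := (path_inj P hi hj le_rfl one_pos h0.le h1 (by simpa using h)).2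
    linarith
  · intro p
    by_contra hp
    obtain ⟨e, he, f, hf, hef, h1, h2⟩ := (two_le_cov (nodup_cedges hnd)).1 (by omega :
      2 ≤ cov (cedges (toList P)) p)
    obtain ⟨i, hi, rfl⟩ := exists_of_mem_cedges_toList P he
    obtain ⟨j, hj, rfl⟩ := exists_of_mem_cedges_toList P hf
    obtain ⟨t, h0, h1', rfl⟩ := exists_of_mem_oseg h1
    obtain ⟨s, h2', h3', h⟩ := exists_of_mem_oseg h2
    have := (path_inj P hi hj h0.le h1' h2'.le h3' h).1
    subst this
    exact hef rfl

theorem equivalent_ofList_toList (P : PolygonalKnot) :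
    P.Equivalent (ofList (toList P) (simple_toList P)) :=
  Relation.EqvGen.rel _ _ (Or.inl ⟨length_toList P, 0, fun i => by
    simp only [ofList, vtx_toList, add_zero]⟩)

theorem carrier_eq_toList (P : PolygonalKnot) : P.carrier = carr (cedges (toList P)) := by
  rw [← carrier_ofList (simple_toList P), carrier, carrier, path, path]
  simp only [ofList, vtx_toList]

/-- A second point of the polygon over or under the vertex would put the vertex over a crossing. -/
theorem pl_fst_eq_imp {P : PolygonalKnot} (hP : P.IsRegular) {v x : Space} (hv : v ∈ toList P)
    (hx : x ∈ carr (cedges (toList P))) (h : v.1 = x.1) : v = x := by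
  by_contra hne
  obtain ⟨e, he, rfl⟩ := exists_cedge_fst hv
  have hv' : e.1 ∈ P.carrier := by
    rw [carrier_eq_toList]; exact ⟨e, he, left_mem_segment ℝ _ _⟩
  rw [← carrier_eq_toList] at hx
  obtain ⟨i, -, h2⟩ := exists_of_mem_toList P hv
  refine hP.vertex_not_crossing i ?_
  rw [← h2]
  exact ⟨e.1, hv', x, hx, hne, rfl, h.symm⟩

theorem diagram_toList {P : PolygonalKnot} (hP : P.IsRegular) : Diagram (toList P) := by
  have hS := simple_toList P
  have hnd : (pl (toList P)).Nodup := by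
    refine List.Nodup.map_on ?_ hS.2.nodup
    intro v hv w hw hvw
    obtain ⟨e, he, rfl⟩ := exists_cedge_fst hw
    exact pl_fst_eq_imp hP hv ⟨e, he, left_mem_segment ℝ _ _⟩ hvw
  have hlift : ∀ {e p}, e ∈ cedges (pl (toList P)) → p ∈ oseg e →
      ∃ d ∈ cedges (toList P), pe d = e ∧ ∃ x ∈ oseg d, x.1 = p := by
    intro e p he hp
    rw [cedges_pl, List.mem_map] at he
    obtain ⟨d, hd, rfl⟩ := he
    rw [oseg_pe] at hp
    obtain ⟨x, hx, rfl⟩ := hp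
    exact ⟨d, hd, rfl, x, hx, rfl⟩
  have hmem : ∀ {d x}, d ∈ cedges (toList P) → x ∈ oseg d → x ∈ P.carrier := by
    intro d x hd hx
    rw [carrier_eq_toList]
    exact ⟨d, hd, oseg_subset_cseg d hx⟩
  refine ⟨hS, ⟨hnd, ?_, ?_⟩, ?_⟩
  · intro v hv e he hve
    obtain ⟨d, hd, rfl, x, hx, hxv⟩ := hlift he hve
    obtain ⟨w, hw, rfl⟩ := List.mem_map.1 hv
    have := pl_fst_eq_imp hP hw ⟨d, hd, oseg_subset_cseg d hx⟩ hxv.symm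
    subst this
    exact hS.2.vertex_notMem _ hw d hd hx
  · intro p
    by_contra hp
    obtain ⟨e, he, f, hf, g, hg, hef, heg, hfg, h1, h2, h3⟩ :=
      exists_of_three_le_cov (nodup_cedges hnd) (by omega : 3 ≤ cov (cedges (pl (toList P))) p)
    obtain ⟨e, he', rfl, x, hx, hxp⟩ := hlift he h1
    obtain ⟨f, hf', rfl, y, hy, hyp⟩ := hlift hf h2
    obtain ⟨g, hg', rfl, z, hz, hzp⟩ := hlift hg h3
    rcases hP.no_triple_point x (hmem he' hx) y (hmem hf' hy) z (hmem hg' hz) (hxp.trans hyp.symm)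
      (hyp.trans hzp.symm) with rfl | rfl | rfl
    · exact hS.2.disjoint_of_one he' hf' (fun h => hef (h ▸ rfl)) hx hy
    · exact hS.2.disjoint_of_one hf' hg' (fun h => hfg (h ▸ rfl)) hy hz
    · exact hS.2.disjoint_of_one he' hg' (fun h => heg (h ▸ rfl)) hx hz
  · refine hP.finite_crossings.subset ?_
    intro p hp
    obtain ⟨e, he, f, hf, hef, h1, h2⟩ := (two_le_cov (nodup_cedges hnd)).1 hp
    obtain ⟨e, he', rfl, x, hx, hxp⟩ := hlift he h1
    obtain ⟨f, hf', rfl, y, hy, hyp⟩ := hlift hf h2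
    refine ⟨x, hmem he' hx, y, hmem hf' hy, ?_, hxp, hyp⟩
    rintro rfl
    exact hS.2.disjoint_of_one he' hf' (fun h => hef (h ▸ rfl)) hx hy

theorem crossings_eq_toList {P : PolygonalKnot} (hP : P.IsRegular) :
    P.crossings = crs (pl (toList P)) := by
  rw [← (diagram_toList hP).crossings_eq, crossings, crossings, carrier_ofList,
    carrier_eq_toList]

end OfKnot

/-! ### Subdivision of edges -/

open PolygonalKnot Filter Topology

theorem cedges_last {E : Type*} (b : E) (m : List E) (a : E) :
    cedges (b :: m ++ [a]) = segs (b :: m ++ [a]) ++ [(a, b)] := by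
  have := cedges_arc b m a []
  rw [List.append_nil] at this
  rw [this]; rfl

theorem cedges_last_insert {E : Type*} (b : E) (m : List E) (a x : E) :
    cedges (b :: m ++ [a] ++ [x]) = segs (b :: m ++ [a]) ++ [(a, x), (x, b)] :=
  cedges_arc b m a [x]

section Subdivision
variable {E : Type*} [AddCommGroup E] [Module ℝ E]

theorem cov_insert {b : E} {m : List E} {a x : E} (hab : a ≠ b) (hx : x ∈ oseg (a, b)) (p : E) :
    cov (cedges (b :: m ++ [a])) p
      = cov (cedges (b :: m ++ [a] ++ [x])) p + ({x} : Set E).indicator (fun _ => 1) p := by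
  rw [cedges_last, cedges_last_insert, cov_append, cov_append, cov_split hab hx, add_assoc]

/-- As `x` is covered at most once, it lies inside no edge but the one from `a` to `b`. Once that
edge is split at `x`, the point is inside no edge and is admissible as a vertex. -/
theorem Gen.subdivide {k : ℕ} {b : E} {m : List E} {a x : E} (h : Gen k (b :: m ++ [a]))
    (hx : x ∈ oseg (a, b)) (hx1 : cov (cedges (b :: m ++ [a])) x ≤ 1) :
    Gen k (b :: m ++ [a] ++ [x]) := by
  have hab : a ≠ b := by
    refine cedges_ne h.nodup (by simp) (e := (a, b)) ?_
    rw [cedges_last]; simp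
  have hxv : x ∉ b :: m ++ [a] := fun hm =>
    h.vertex_notMem x hm (a, b) (by rw [cedges_last]; simp) hx
  have hx0 : cov (cedges (b :: m ++ [a] ++ [x])) x = 0 := by
    have := cov_insert (m := m) hab hx x
    rw [Set.indicator_of_mem (Set.mem_singleton x)] at this
    omega
  refine ⟨?_, ?_, fun p => ?_⟩
  · rw [List.nodup_append]
    exact ⟨h.nodup, by simp, by
      intro u hu w hw
      rw [List.mem_singleton] at hw
      rintro rfl
      exact hxv (hw ▸ hu)⟩
  · intro v hv e he
    rw [List.mem_append, List.mem_singleton] at hv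
    rcases hv with hv | rfl
    · rw [cedges_last_insert] at he
      have hs : e ∈ segs (b :: m ++ [a]) ∨ e = (a, x) ∨ e = (x, b) := by simpa using he
      have hab' := h.vertex_notMem v hv (a, b) (by rw [cedges_last]; simp)
      rw [mem_oseg_split hx] at hab'
      rcases hs with hs | rfl | rfl
      · exact h.vertex_notMem v hv e
          (by rw [cedges_last]; exact List.mem_append_left _ hs)
      · tauto
      · tauto
    · exact cov_eq_zero_iff.1 hx0 e he
  · refine le_trans ?_ (h.cov_le p)
    rw [cov_insert hab hx p]
    exact Nat.le_add_right _ _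

theorem infinite_oseg {e : E × E} (h : e.1 ≠ e.2) : (oseg e).Infinite := by
  rw [oseg, openSegment_eq_image_lineMap]
  exact (Set.Ioo_infinite one_pos).image ((AffineMap.lineMap_injective ℝ h).injOn)

end Subdivision

theorem Simple.subdivide {b : Space} {m : List Space} {a x : Space} (h : Simple (b :: m ++ [a]))
    (hx : x ∈ oseg (a, b)) : Simple (b :: m ++ [a] ++ [x]) :=
  ⟨by have := h.1; rw [List.length_append]; omega, h.2.subdivide hx (h.2.cov_le x)⟩

/-- The triangle of this move is degenerate: it is the edge itself. -/
theorem LEq.subdivide {b : Space} {m : List Space} {a x : Space} (h : Simple (b :: m ++ [a]))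
    (hx : x ∈ oseg (a, b)) : LEq (b :: m ++ [a]) (b :: m ++ [a] ++ [x]) := by
  refine LEq.insert_last h (h.subdivide hx) (Set.inter_subset_left.trans ?_)
  refine convexHull_min ?_ (convex_segment a b)
  intro y hy
  rcases hy with rfl | rfl | rfl
  · exact left_mem_segment ℝ _ _
  · exact right_mem_segment ℝ _ _
  · exact openSegment_subset_segment ℝ _ _ hx

theorem pl_last (b : Space) (m : List Space) (a : Space) :
    pl (b :: m ++ [a]) = b.1 :: pl m ++ [a.1] := by simp [pl]

theorem mem_oseg_pe {e : Space × Space} {x : Space} (h : x ∈ oseg e) : x.1 ∈ oseg (pe e) := by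
  rw [oseg_pe]; exact ⟨x, h, rfl⟩

theorem mem_cseg_pe {e : Space × Space} {x : Space} (h : x ∈ cseg e) : x.1 ∈ cseg (pe e) := by
  rw [cseg_pe]; exact ⟨x, h, rfl⟩

theorem crs_subdivide {b : Plane} {m : List Plane} {a x : Plane} (hab : a ≠ b)
    (hx : x ∈ oseg (a, b)) (hx1 : x ∉ crs (b :: m ++ [a])) :
    crs (b :: m ++ [a] ++ [x]) = crs (b :: m ++ [a]) := by
  ext p
  have key := cov_insert (m := m) hab hx p
  simp only [crs, Set.mem_ofPred_eq] at hx1 ⊢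
  by_cases hp : p = x
  · subst hp
    rw [Set.indicator_of_mem (Set.mem_singleton _)] at key
    omega
  · rw [Set.indicator_of_notMem (by simpa using hp)] at key
    omega

theorem Diagram.subdivide {b : Space} {m : List Space} {a x : Space}
    (h : Diagram (b :: m ++ [a])) (hx : x ∈ oseg (a, b))
    (hx1 : x.1 ∉ crs (pl (b :: m ++ [a]))) :
    Diagram (b :: m ++ [a] ++ [x]) ∧ crs (pl (b :: m ++ [a] ++ [x])) = crs (pl (b :: m ++ [a])) := by
  have hab : a.1 ≠ b.1 := h.pe_ne (e := (a, b)) (by rw [cedges_last]; simp)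
  have hxp : x.1 ∈ oseg (a.1, b.1) := mem_oseg_pe hx
  have h1 : crs (pl (b :: m ++ [a] ++ [x])) = crs (pl (b :: m ++ [a])) := by
    rw [pl_append, pl_last] at *
    exact crs_subdivide hab hxp hx1
  refine ⟨⟨h.simple.subdivide hx, ?_, ?_⟩, h1⟩
  · have h2 := h.gen
    rw [pl_append]
    rw [pl_last] at h2 hx1 ⊢
    refine h2.subdivide hxp ?_
    rw [crs, Set.mem_ofPred_eq] at hx1
    omega
  · rw [h1]; exact h.fin

/-- A triangle move at any edge of the closed polygon. -/
theorem LEq.insert_arc {b : Space} {m : List Space} {u : Space} {Z : List Space} {C w : Space}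
    {Z' : List Space} (hw : Z ++ [b] = w :: Z')
    (h : Simple (b :: m ++ [u] ++ Z)) (h' : Simple (b :: m ++ [u] ++ C :: Z))
    (hc : convexHull ℝ {u, w, C} ∩ carr (cedges (b :: m ++ [u] ++ Z)) ⊆ segment ℝ u w) :
    LEq (b :: m ++ [u] ++ Z) (b :: m ++ [u] ++ C :: Z) := by
  cases Z with
  | nil =>
    simp only [List.nil_append, List.cons.injEq] at hw
    obtain ⟨rfl, -⟩ := hw
    rw [List.append_nil] at *
    exact LEq.insert_last h h' hc
  | cons z Z =>
    simp only [List.cons_append, List.cons.injEq] at hw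
    obtain ⟨rfl, -⟩ := hw
    exact LEq.insert (l₁ := b :: m) h h' hc

/-! ### Coning off an arc that is seen from a point -/

section Fan

/-- Two segments that end in `N` and share another point lie on one ray from `N`, and the shorter
one is contained in the longer one. -/
theorem sameRay_of_mem_segment {E : Type*} [AddCommGroup E] [Module ℝ E] {x y z N : E}
    (h1 : z ∈ segment ℝ x N) (h2 : z ∈ segment ℝ y N) (hz : z ≠ N) :
    x ∈ segment ℝ y N ∨ y ∈ segment ℝ x N := by
  obtain ⟨s, s', hs, hs', hss, rfl⟩ := h1
  obtain ⟨t, t', ht, ht', htt, h⟩ := h2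
  have es : s' = 1 - s := by linarith
  have et : t' = 1 - t := by linarith
  subst es et
  have hs0 : 0 < s := by
    rcases hs.eq_or_lt with rfl | h0
    · simp at hz
    · exact h0
  have ht0 : 0 < t := by
    rcases ht.eq_or_lt with rfl | h0
    · rw [← h] at hz; simp at hz
    · exact h0
  have key : t • (y - N) = s • (x - N) := by
    rw [← sub_eq_zero] at h ⊢
    rw [← h]; module
  rcases le_total s t with hst | hst
  · right
    refine ⟨s / t, 1 - s / t, by positivity, by rw [sub_nonneg, div_le_one ht0]; exact hst,
      by ring, ?_⟩
    have : y - N = (s / t) • (x - N) := by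
      rw [div_eq_inv_mul, mul_smul, ← key, smul_smul, inv_mul_cancel₀ ht0.ne', one_smul]
    rw [← sub_eq_zero] at this ⊢
    rw [← neg_eq_zero, ← this]; module
  · left
    refine ⟨t / s, 1 - t / s, by positivity, by rw [sub_nonneg, div_le_one hs0]; exact hst,
      by ring, ?_⟩
    have : x - N = (t / s) • (y - N) := by
      rw [div_eq_inv_mul, mul_smul, key, smul_smul, inv_mul_cancel₀ hs0.ne', one_smul]
    rw [← sub_eq_zero] at this ⊢
    rw [← neg_eq_zero, ← this]; module

theorem segs_sublist {E : Type*} (l₁ l₂ : List E) : (segs l₂).Sublist (segs (l₁ ++ l₂)) := by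
  cases l₂ with
  | nil => simp
  | cons y l₂ => rw [segs_append_cons]; exact List.sublist_append_right _ _

theorem mem_carr_fst {E : Type*} [AddCommGroup E] [Module ℝ E] {l : List (E × E)} {e : E × E}
    (h : e ∈ l) : e.1 ∈ carr l := ⟨e, h, left_mem_segment ℝ _ _⟩
theorem mem_carr_snd {E : Type*} [AddCommGroup E] [Module ℝ E] {l : List (E × E)} {e : E × E}
    (h : e ∈ l) : e.2 ∈ carr l := ⟨e, h, right_mem_segment ℝ _ _⟩

theorem carr_mono {E : Type*} [AddCommGroup E] [Module ℝ E] {l l' : List (E × E)} (h : l ⊆ l') :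
    carr l ⊆ carr l' := fun _ ⟨e, he, hp⟩ => ⟨e, h he, hp⟩

theorem vertex_mem_carr {E : Type*} [AddCommGroup E] [Module ℝ E] {U : List E} {v : E}
    (h : v ∈ U) : v ∈ carr (cedges U) := by
  obtain ⟨e, he, rfl⟩ := exists_cedge_fst h
  exact mem_carr_fst he

theorem vertex_mem_carr_segs {E : Type*} [AddCommGroup E] [Module ℝ E] {l : List E} {v : E}
    (h : v ∈ l) (h2 : 2 ≤ l.length) : v ∈ carr (segs l) := by
  match l, h2 with
  | a :: b :: l, _ =>
    rcases List.mem_cons.1 h with rfl | h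
    · exact mem_carr_fst (e := (v, b)) (by simp)
    · rw [← map_snd_segs a (b :: l), List.mem_map] at h
      obtain ⟨e, he, rfl⟩ := h
      exact mem_carr_snd he

variable {b : Space} {m : List Space} {a N : Space} {X : List Space}

/-- The point `N` sees the arc `a, X, b` past the polygon. -/
def Sees (N : Space) (A O : List (Space × Space)) : Prop :=
  N ∉ carr O ∧ ∀ x ∈ carr A, ∀ y ∈ carr O, y ∈ segment ℝ x N → y = x

/-- The intermediate polygons of the cone: an initial part `Y` of the arc is replaced by `N`. The
two new edges meet the old polygon only in `a` and in the next kept vertex `w`, by visibility, and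
they meet each other only in `N`. -/
theorem simple_fan {Y Z : List Space} (hX : X = Y ++ Z) (hS : Simple (b :: m ++ [a] ++ X))
    (hN : Sees N (segs (a :: X ++ [b])) (cedges (b :: m ++ [a] ++ X))) :
    Simple (b :: m ++ [a] ++ N :: Z) := by
  obtain ⟨w, Z', hw⟩ : ∃ w Z', Z ++ [b] = w :: Z' := by
    cases Z with
    | nil => exact ⟨b, [], rfl⟩
    | cons z Z => exact ⟨z, Z ++ [b], rfl⟩
  have hO := cedges_arc b m a X
  have hE : cedges (b :: m ++ [a] ++ N :: Z)
      = segs (b :: m ++ [a]) ++ (a, N) :: (N, w) :: segs (w :: Z') := by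
    rw [cedges_arc]
    have : a :: N :: Z ++ [b] = a :: N :: w :: Z' := by simp [hw]
    rw [this]; rfl
  have hsub : (segs (b :: m ++ [a]) ++ segs (w :: Z')).Sublist (cedges (b :: m ++ [a] ++ X)) := by
    rw [hO, ← hw, hX]
    refine List.Sublist.append_left ?_ _
    have : a :: (Y ++ Z) ++ [b] = (a :: Y) ++ (Z ++ [b]) := by simp
    rw [this]
    exact segs_sublist _ _
  have haA : a ∈ carr (segs (a :: X ++ [b])) := vertex_mem_carr_segs (by simp) (by simp)
  have hwA : w ∈ carr (segs (a :: X ++ [b])) := by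
    refine vertex_mem_carr_segs ?_ (by simp)
    have : w ∈ Z ++ [b] := by rw [hw]; simp
    rw [hX]; simp at this ⊢; tauto
  have hAO : carr (segs (a :: X ++ [b])) ⊆ carr (cedges (b :: m ++ [a] ++ X)) :=
    carr_mono (by rw [hO]; exact List.subset_append_right _ _)
  have haN : a ≠ N := by rintro rfl; exact hN.1 (hAO haA)
  have hwN : w ≠ N := by rintro rfl; exact hN.1 (hAO hwA)
  have haw : a ≠ w := by
    have hnd : (b :: m ++ [a] ++ X).Nodup := hS.2.nodup
    rintro rfl
    have : a ∈ Z ++ [b] := by rw [hw]; simp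
    rw [List.mem_append, List.mem_singleton] at this
    rcases this with h | h
    · have h1 : a ∈ X := by rw [hX]; simp [h]
      rw [List.nodup_append] at hnd
      exact hnd.2.2 a (by simp) a h1 rfl
    · subst h
      simp at hnd
  have hd1 : ∀ p ∈ oseg (a, N), p ∉ carr (cedges (b :: m ++ [a] ++ X)) := by
    intro p hp hpO
    have := hN.2 a haA p hpO (oseg_subset_cseg _ hp)
    subst this
    exact left_notMem_oseg haN hp
  have hd2 : ∀ p ∈ oseg (N, w), p ∉ carr (cedges (b :: m ++ [a] ++ X)) := by
    intro p hp hpO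
    rw [← oseg_swap] at hp
    have := hN.2 w hwA p hpO (oseg_subset_cseg _ hp)
    subst this
    exact left_notMem_oseg hwN hp
  -- A common point would put `a` and `w` on one ray from `N`, so that one of them would hide the
  -- other.
  have hd3 : ∀ p ∈ oseg (a, N), p ∉ oseg (N, w) := by
    intro p hp hp'
    have hpN : p ≠ N := by rintro rfl; exact right_notMem_oseg haN hp
    rw [← oseg_swap] at hp'
    rcases sameRay_of_mem_segment (show p ∈ segment ℝ a N from oseg_subset_cseg _ hp)
      (show p ∈ segment ℝ w N from oseg_subset_cseg (N, w).swap hp') hpN with h | h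
    · exact haw (hN.2 w hwA a (hAO haA) h)
    · exact haw (hN.2 a haA w (hAO hwA) h).symm
  have hvO : ∀ v ∈ b :: m ++ [a] ++ Z, v ∈ carr (cedges (b :: m ++ [a] ++ X)) := by
    intro v hv
    apply vertex_mem_carr
    rw [hX]
    simp at hv ⊢; tauto
  refine ⟨?_, ?_, ?_, ?_⟩
  · simp; omega
  · have h1 : (b :: m ++ [a] ++ Z).Nodup := by
      refine List.Nodup.sublist ?_ hS.2.nodup
      rw [hX]
      exact List.Sublist.append_left (List.sublist_append_right _ _) _
    have hp : (b :: m ++ [a] ++ N :: Z).Perm (N :: (b :: m ++ [a] ++ Z)) := List.perm_middle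
    rw [hp.nodup_iff, List.nodup_cons]
    exact ⟨fun h => hN.1 (hvO N h), h1⟩
  · intro v hv e he
    rw [hE] at he
    have hv' : v = N ∨ v ∈ b :: m ++ [a] ++ Z := by simp at hv ⊢; tauto
    have he' : e = (a, N) ∨ e = (N, w) ∨ e ∈ segs (b :: m ++ [a]) ++ segs (w :: Z') := by
      simp at he ⊢; tauto
    rcases he' with rfl | rfl | he'
    · rcases hv' with rfl | hv'
      · exact right_notMem_oseg haN
      · exact fun h => hd1 v h (hvO v hv')
    · rcases hv' with rfl | hv'
      · exact left_notMem_oseg hwN.symm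
      · exact fun h => hd2 v h (hvO v hv')
    · rcases hv' with rfl | hv'
      · exact fun h => hN.1 ⟨e, hsub.subset he', oseg_subset_cseg _ h⟩
      · refine hS.2.vertex_notMem v ?_ e (hsub.subset he')
        rw [hX]
        simp at hv' ⊢; tauto
  · intro p
    have hp : (cedges (b :: m ++ [a] ++ N :: Z)).Perm
        ((a, N) :: (N, w) :: (segs (b :: m ++ [a]) ++ segs (w :: Z'))) := by
      rw [hE]
      exact List.perm_middle.trans (List.Perm.cons _ List.perm_middle)
    rw [cov_perm hp]
    have hle := (cov_sublist hsub p).trans (hS.2.cov_le p)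
    have hz : p ∉ carr (cedges (b :: m ++ [a] ++ X)) →
        cov (segs (b :: m ++ [a]) ++ segs (w :: Z')) p = 0 := fun h =>
      cov_eq_zero_iff.2 fun e he hpe => h ⟨e, hsub.subset he, oseg_subset_cseg _ hpe⟩
    by_cases h1 : p ∈ oseg (a, N)
    · rw [cov_cons_of_mem h1, cov_cons_of_notMem (hd3 p h1), hz (hd1 p h1)]
    · rw [cov_cons_of_notMem h1]
      by_cases h2 : p ∈ oseg (N, w)
      · rw [cov_cons_of_mem h2, hz (hd2 p h2)]
      · rw [cov_cons_of_notMem h2]; exact hle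

theorem mem_convexHull_triple {E : Type*} [AddCommGroup E] [Module ℝ E] {u w C z : E}
    (h : z ∈ convexHull ℝ {u, w, C}) : ∃ x ∈ segment ℝ w C, z ∈ segment ℝ x u := by
  rw [convexHull_insert ⟨w, by simp⟩, convexHull_pair, mem_convexJoin] at h
  obtain ⟨u', hu, x, hx, hz⟩ := h
  rw [Set.mem_singleton_iff] at hu
  subst hu
  rw [segment_symm] at hz
  exact ⟨x, hx, hz⟩

/-- Each point of the triangle `N`, `w`, `c` lies on a segment from `N` to a point `x` of the edge
`cw`. As `N` sees this edge, the old polygon can meet the triangle only at such an `x`, and of the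
edge `cw` only `w` is still present. So the triangle move that inserts `c` is admissible; read
backwards, it removes the next vertex of the arc. -/
theorem LEq.fan_step {Y Z : List Space} {c : Space} (hX : X = Y ++ c :: Z)
    (hS : Simple (b :: m ++ [a] ++ X))
    (hN : Sees N (segs (a :: X ++ [b])) (cedges (b :: m ++ [a] ++ X))) :
    LEq (b :: m ++ [a] ++ N :: Z) (b :: m ++ [a] ++ N :: c :: Z) := by
  obtain ⟨w, Z', hw⟩ : ∃ w Z', Z ++ [b] = w :: Z' := by
    cases Z with
    | nil => exact ⟨b, [], rfl⟩
    | cons z Z => exact ⟨z, Z ++ [b], rfl⟩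
  have h1 := simple_fan (Z := Z) (Y := Y ++ [c]) (by simp [hX]) hS hN
  have h2 := simple_fan (Z := c :: Z) (Y := Y) hX hS hN
  have e1 : b :: m ++ [a] ++ N :: Z = b :: (m ++ [a]) ++ [N] ++ Z := by simp
  have e2 : b :: m ++ [a] ++ N :: c :: Z = b :: (m ++ [a]) ++ [N] ++ c :: Z := by simp
  have hO := cedges_arc b m a X
  have hE : cedges (b :: m ++ [a] ++ N :: Z)
      = segs (b :: m ++ [a]) ++ (a, N) :: (N, w) :: segs (w :: Z') := by
    rw [cedges_arc]
    have : a :: N :: Z ++ [b] = a :: N :: w :: Z' := by simp [hw]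
    rw [this]; rfl
  have hAeq : segs (a :: X ++ [b]) = segs (a :: Y ++ [c]) ++ (c, w) :: segs (w :: Z') := by
    have : a :: X ++ [b] = (a :: Y) ++ c :: w :: Z' := by rw [hX]; simp [hw]
    rw [this, segs_append_cons_cons]
  have hcw : (c, w) ∈ segs (a :: X ++ [b]) := by rw [hAeq]; simp
  have hAO : segs (a :: X ++ [b]) ⊆ cedges (b :: m ++ [a] ++ X) := by
    rw [hO]; exact List.subset_append_right _ _
  have hnd : (b :: m ++ [a] ++ X).Nodup := hS.2.nodup
  have hc1 : c ∉ b :: m ++ [a] ++ Z := by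
    rw [hX] at hnd
    have hp : (b :: m ++ [a] ++ (Y ++ c :: Z)).Perm (c :: (b :: m ++ [a] ++ (Y ++ Z))) := by
      rw [← List.append_assoc, ← List.append_assoc]; exact List.perm_middle
    rw [hp.nodup_iff, List.nodup_cons] at hnd
    intro h
    apply hnd.1
    simp at h ⊢; tauto
  have haw : a ≠ w := by
    rintro rfl
    have : a ∈ Z ++ [b] := by rw [hw]; simp
    rw [List.mem_append, List.mem_singleton] at this
    rcases this with h | h
    · have h1 : a ∈ X := by rw [hX]; simp [h]
      rw [List.nodup_append] at hnd
      exact hnd.2.2 a (by simp) a h1 rfl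
    · subst h
      simp at hnd
  have hac : a ≠ c := by rintro rfl; exact hc1 (by simp)
  have haA : a ∈ carr (segs (a :: X ++ [b])) := vertex_mem_carr_segs (by simp) (by simp)
  rw [e1] at h1 hE
  rw [e2] at h2
  rw [e1, e2]
  refine LEq.insert_arc hw h1 h2 ?_
  rintro z ⟨hz, e, he, hze⟩
  obtain ⟨x, hx, hzx⟩ := mem_convexHull_triple hz
  have hxcw : x ∈ cseg (c, w) := by rw [← cseg_swap]; exact hx
  have hxA : x ∈ carr (segs (a :: X ++ [b])) := ⟨_, hcw, hxcw⟩
  rw [hE] at he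
  have he' : e = (a, N) ∨ e = (N, w) ∨ e ∈ segs (b :: m ++ [a]) ++ segs (w :: Z') := by
    simp at he ⊢; tauto
  by_cases hzN : z = N
  · rw [hzN]; exact left_mem_segment ℝ _ _
  rcases he' with rfl | rfl | he'
  · exfalso
    -- The point `z` lies on the segments from `x` and from `a` to `N`, so these are on one ray and
    -- visibility identifies `x` with `a`. But `a` is not on the edge `cw`.
    have hxa : x = a := by
      rcases sameRay_of_mem_segment hzx hze hzN with h | h
      · exact hN.2 a haA x (carr_mono hAO hxA) h
      · exact (hN.2 x hxA a (carr_mono hAO haA) h).symm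
    subst hxa
    rcases hS.2.mem_of_mem_cseg (by simp) (hAO hcw) hxcw with h | h
    · exact hac h
    · exact haw h
  · exact hze
  · have heO : e ∈ cedges (b :: m ++ [a] ++ X) := by
      rw [hO, hAeq]
      simp at he' ⊢; tauto
    have := hN.2 x hxA z ⟨e, heO, hze⟩ hzx
    subst this
    -- Here `z` lies on the edge `cw` and on another edge of a simple polygon, hence it is an end of
    -- `cw`; the end `c` is no longer a vertex of the polygon and is excluded afterwards.
    have hec : z ≠ c → z = w := by
      intro hzc
      by_contra hzw
      have hzo := mem_oseg_of_mem_cseg hxcw hzc hzw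
      rcases hS.2.meet (hAO hcw) heO hxcw hze with ⟨hzX, h3, -⟩ | ⟨h3, h4⟩
      · exact hS.2.vertex_notMem z hzX _ (hAO hcw) hzo
      · refine hS.2.disjoint_of_one (hAO hcw) heO ?_ h3 h4
        rintro rfl
        have hsl : ((c, w) :: (segs (b :: m ++ [a]) ++ segs (w :: Z'))).Subperm
            (cedges (b :: m ++ [a] ++ X)) := by
          rw [hO, hAeq, ← List.append_assoc]
          refine (List.perm_middle.symm.subperm).trans ?_
          refine List.Sublist.subperm ?_
          exact (List.sublist_append_left _ _).append (List.Sublist.refl _)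
        have hnd2 := (nodup_cedges hnd)
        obtain ⟨l', hp, hl'⟩ := hsl
        have := hp.nodup_iff.1 (hl'.nodup hnd2)
        exact (List.nodup_cons.1 this).1 he'
    by_cases hzc : z = c
    · exfalso
      subst hzc
      have hzX : z ∈ b :: m ++ [a] ++ X := by rw [hX]; simp
      have h3 := hS.2.mem_of_mem_cseg hzX heO hze
      apply hc1
      have hZ : ∀ u ∈ w :: Z', u ∈ b :: m ++ [a] ++ Z := by
        intro u hu; rw [← hw] at hu; simp at hu ⊢; tauto
      rcases List.mem_append.1 he' with h4 | h4
      · have h5 := fst_mem_of_mem_segs h4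
        have h6 : e.2 ∈ b :: m ++ [a] := List.mem_cons_of_mem _ (snd_mem_of_mem_segs h4)
        rcases h3 with h3 | h3 <;> rw [h3] <;> exact List.mem_append_left _ ‹_›
      · have h5 := hZ _ (fst_mem_of_mem_segs h4)
        have h6 := hZ _ (List.mem_cons_of_mem _ (snd_mem_of_mem_segs h4))
        rcases h3 with h3 | h3 <;> rw [h3] <;> assumption
    · rw [hec hzc]; exact right_mem_segment ℝ _ _

/-- Cone construction: an arc that is seen from `N` can be replaced by the arc through `N`. -/
theorem LEq.fan (hS : Simple (b :: m ++ [a] ++ X))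
    (hN : Sees N (segs (a :: X ++ [b])) (cedges (b :: m ++ [a] ++ X))) :
    LEq (b :: m ++ [a] ++ X) (b :: m ++ [a] ++ [N]) := by
  -- `Z` is the part of the arc that is still present behind `N`; its vertices are removed one at a
  -- time.
  have key : ∀ Z Y, X = Y ++ Z → LEq (b :: m ++ [a] ++ N :: Z) (b :: m ++ [a] ++ [N]) := by
    intro Z
    induction Z with
    | nil => exact fun Y hX => LEq.refl (simple_fan hX hS hN)
    | cons c Z ih =>
      intro Y hX
      exact (LEq.fan_step hX hS hN).symm.trans (ih (Y ++ [c]) (by simp [hX]))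
  refine LEq.trans ?_ (key X [] rfl)
  obtain ⟨w, Z', hw⟩ : ∃ w Z', X ++ [b] = w :: Z' := by
    cases X with
    | nil => exact ⟨b, [], rfl⟩
    | cons z Z => exact ⟨z, Z ++ [b], rfl⟩
  refine LEq.insert_arc hw hS (simple_fan (Y := []) rfl hS hN) ?_
  rintro z ⟨hz, hzO⟩
  have : ({a, w, N} : Set Space) = {N, a, w} := by
    ext x; simp; tauto
  rw [this] at hz
  obtain ⟨x, hx, hzx⟩ := mem_convexHull_triple hz
  have haw : (a, w) ∈ segs (a :: X ++ [b]) := by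
    rw [List.cons_append, hw]; simp
  have := hN.2 x ⟨_, haw, hx⟩ z hzO hzx
  rw [this]
  exact hx

end Fan

/-! ### Arcs over everything else are seen from far above -/

section Slope
variable {E : Type*} [NormedAddCommGroup E] [NormedSpace ℝ E]

/-- By homogeneity it suffices to treat `s + t = 1`. There the norm has a minimum by compactness,
and the minimum is positive because `d` and `d'` do not point in the same direction. -/
theorem exists_sameRay_bound {d d' : E} (h : ¬ SameRay ℝ d d') :
    ∃ κ : ℝ, 0 ≤ κ ∧ ∀ s t : ℝ, 0 ≤ s → 0 ≤ t → s + t ≤ κ * ‖s • d - t • d'‖ := by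
  have hc : Continuous fun r : ℝ => ‖(1 - r) • d - r • d'‖ := by fun_prop
  obtain ⟨r, hr, hmin⟩ := (isCompact_Icc (a := (0 : ℝ)) (b := 1)).exists_isMinOn ⟨0, by simp⟩
    hc.continuousOn
  have hpos : 0 < ‖(1 - r) • d - r • d'‖ := by
    rw [norm_pos_iff, sub_ne_zero]
    intro heq
    apply h
    rcases hr.1.eq_or_lt with h0 | h0
    · left; rw [← h0] at heq; simpa using heq
    rcases hr.2.eq_or_lt with h1 | h1
    · right; left; rw [h1] at heq; simpa using heq.symm
    · exact Or.inr (Or.inr ⟨1 - r, r, by linarith, h0, heq⟩)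
  refine ⟨1 / ‖(1 - r) • d - r • d'‖, by positivity, fun s t hs ht => ?_⟩
  rcases (add_nonneg hs ht).eq_or_lt with h0 | h0
  · rw [← h0]; positivity
  · have h1 := isMinOn_iff.1 hmin (t / (s + t)) ⟨by positivity, by
      rw [div_le_one h0]; linarith⟩
    have h2 : s • d - t • d' = (s + t) • ((1 - t / (s + t)) • d - (t / (s + t)) • d') := by
      rw [smul_sub, smul_smul, smul_smul]
      congr 2 <;> field_simp; ring
    rw [h2, norm_smul, Real.norm_of_nonneg h0.le, div_mul_eq_mul_div, one_mul, le_div_iff₀ hpos]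
    exact mul_le_mul_of_nonneg_left h1 h0.le

/-- At a corner, the distance of two points on different sides controls their distances from the
corner. If both sides point in the same direction, then a corner as the only common point forces one
of them to be degenerate. -/
theorem exists_corner_bound {p u w : E} (h : segment ℝ p u ∩ segment ℝ p w ⊆ {p}) :
    ∃ κ : ℝ, 0 ≤ κ ∧ ∀ x ∈ segment ℝ p u, ∀ y ∈ segment ℝ p w, ‖x - p‖ + ‖y - p‖ ≤ κ * ‖x - y‖ := by
  by_cases hs : SameRay ℝ (u - p) (w - p)
  · rcases hs with h0 | h0 | ⟨r, s, hr, hs, hrs⟩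
    · have hu : u = p := sub_eq_zero.1 h0
      subst hu
      refine ⟨1, zero_le_one, fun x hx y hy => ?_⟩
      rw [segment_same, Set.mem_singleton_iff] at hx
      rw [hx, sub_self, norm_zero, zero_add, one_mul, norm_sub_rev]
    · have hu : w = p := sub_eq_zero.1 h0
      subst hu
      refine ⟨1, zero_le_one, fun x hx y hy => ?_⟩
      rw [segment_same, Set.mem_singleton_iff] at hy
      rw [hy, sub_self, norm_zero, add_zero, one_mul]
    · have hmem : ∀ (v : E) (q : ℝ), 0 ≤ q → q ≤ 1 → p + q • (v - p) ∈ segment ℝ p v := by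
        intro v q h0 h1
        exact ⟨1 - q, q, by linarith, h0, by ring, by module⟩
      have h1 : p + (r / (r + s)) • (u - p) ∈ segment ℝ p u :=
        hmem _ _ (by positivity) (by rw [div_le_one (by positivity)]; linarith)
      have h2 : p + (s / (r + s)) • (w - p) ∈ segment ℝ p w :=
        hmem _ _ (by positivity) (by rw [div_le_one (by positivity)]; linarith)
      have h3 : (r / (r + s)) • (u - p) = (s / (r + s)) • (w - p) := by
        rw [div_eq_inv_mul, div_eq_inv_mul, mul_smul, mul_smul, hrs]
      have h4 := h ⟨h1, h3 ▸ h2⟩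
      have h5 : (r / (r + s)) • (u - p) = 0 := by simpa using h4
      have hu : u = p := by
        rcases smul_eq_zero.1 h5 with h6 | h6
        · have : 0 < r / (r + s) := by positivity
          exact absurd h6 this.ne'
        · exact sub_eq_zero.1 h6
      subst hu
      refine ⟨1, zero_le_one, fun x hx y hy => ?_⟩
      rw [segment_same, Set.mem_singleton_iff] at hx
      rw [hx, sub_self, norm_zero, zero_add, one_mul, norm_sub_rev]
  · obtain ⟨κ, hκ, hb⟩ := exists_sameRay_bound hs
    refine ⟨κ * (‖u - p‖ + ‖w - p‖), by positivity, ?_⟩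
    rintro x ⟨s', s, hs', hs, hss, rfl⟩ y ⟨t', t, ht', ht, htt, rfl⟩
    have e1 : s' = 1 - s := by linarith
    have e2 : t' = 1 - t := by linarith
    subst e1 e2
    have h1 : (1 - s) • p + s • u - p = s • (u - p) := by module
    have h2 : (1 - t) • p + t • w - p = t • (w - p) := by module
    have h3 : (1 - s) • p + s • u - ((1 - t) • p + t • w) = s • (u - p) - t • (w - p) := by module
    rw [h1, h2, h3, norm_smul, norm_smul, Real.norm_of_nonneg hs, Real.norm_of_nonneg ht]
    have h4 := hb s t hs ht
    have h5 := norm_nonneg (u - p)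
    have h6 := norm_nonneg (w - p)
    nlinarith

theorem segment_split {x y p q : E} (hp : p ∈ segment ℝ x y) (hq : q ∈ segment ℝ x y) :
    q ∈ segment ℝ p x ∨ q ∈ segment ℝ p y := by
  rcases mem_cseg_iff (e := (x, y)).1 hp with rfl | rfl | hp
  · exact Or.inr hq
  · rw [segment_symm] at hq; exact Or.inl hq
  · rcases mem_cseg_iff (e := (x, y)).1 hq with rfl | rfl | hq
    · exact Or.inl (right_mem_segment ℝ _ _)
    · exact Or.inr (right_mem_segment ℝ _ _)
    · rcases (mem_oseg_split hp q).1 hq with h | rfl | h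
      · left; rw [segment_symm]; exact oseg_subset_cseg _ h
      · exact Or.inl (left_mem_segment ℝ _ _)
      · right; exact oseg_subset_cseg _ h

/-- Cutting both segments at `p` produces four corners; the sum of their constants serves for all.
-/
theorem exists_meet_bound {e f : E × E} {p : E} (hpe : p ∈ cseg e) (hpf : p ∈ cseg f)
    (h : cseg e ∩ cseg f ⊆ {p}) :
    ∃ κ : ℝ, 0 ≤ κ ∧ ∀ x ∈ cseg e, ∀ y ∈ cseg f, ‖x - p‖ + ‖y - p‖ ≤ κ * ‖x - y‖ := by
  have hse : ∀ u ∈ cseg e, segment ℝ p u ⊆ cseg e := fun u hu =>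
    (convex_segment e.1 e.2).segment_subset hpe hu
  have hsf : ∀ u ∈ cseg f, segment ℝ p u ⊆ cseg f := fun u hu =>
    (convex_segment f.1 f.2).segment_subset hpf hu
  have key : ∀ u ∈ cseg e, ∀ w ∈ cseg f, ∃ κ : ℝ, 0 ≤ κ ∧ ∀ x ∈ segment ℝ p u,
      ∀ y ∈ segment ℝ p w, ‖x - p‖ + ‖y - p‖ ≤ κ * ‖x - y‖ := fun u hu w hw =>
    exists_corner_bound ((Set.inter_subset_inter (hse u hu) (hsf w hw)).trans h)
  have he1 : e.1 ∈ cseg e := left_mem_segment ℝ _ _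
  have he2 : e.2 ∈ cseg e := right_mem_segment ℝ _ _
  have hf1 : f.1 ∈ cseg f := left_mem_segment ℝ _ _
  have hf2 : f.2 ∈ cseg f := right_mem_segment ℝ _ _
  obtain ⟨k1, hk1, h1⟩ := key _ he1 _ hf1
  obtain ⟨k2, hk2, h2⟩ := key _ he1 _ hf2
  obtain ⟨k3, hk3, h3⟩ := key _ he2 _ hf1
  obtain ⟨k4, hk4, h4⟩ := key _ he2 _ hf2
  refine ⟨k1 + k2 + k3 + k4, by positivity, fun x hx y hy => ?_⟩
  have hn := norm_nonneg (x - y)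
  have m1 := mul_nonneg hk1 hn
  have m2 := mul_nonneg hk2 hn
  have m3 := mul_nonneg hk3 hn
  have m4 := mul_nonneg hk4 hn
  rcases segment_split hpe hx with hx | hx <;> rcases segment_split hpf hy with hy | hy
  · have := h1 x hx y hy; linarith
  · have := h2 x hx y hy; linarith
  · have := h3 x hx y hy; linarith
  · have := h4 x hx y hy; linarith

theorem isCompact_cseg (e : E × E) : IsCompact (cseg e) := by
  rw [cseg, segment_eq_image_lineMap]
  exact isCompact_Icc.image (AffineMap.lineMap_continuous)

end Slope

theorem exists_edge_slope {e : Space × Space} (h : (pe e).1 ≠ (pe e).2) :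
    ∃ M : ℝ, 0 ≤ M ∧ ∀ x ∈ cseg e, ∀ y ∈ cseg e, y.2 - x.2 ≤ M * ‖y.1 - x.1‖ := by
  have hd : 0 < ‖e.2.1 - e.1.1‖ := by rw [norm_pos_iff, sub_ne_zero]; exact h.symm
  refine ⟨|e.2.2 - e.1.2| / ‖e.2.1 - e.1.1‖, by positivity, fun x hx y hy => ?_⟩
  rw [cseg, segment_eq_image_lineMap] at hx hy
  obtain ⟨s, -, rfl⟩ := hx
  obtain ⟨t, -, rfl⟩ := hy
  have h1 : (AffineMap.lineMap e.1 e.2 t : Space).2 - (AffineMap.lineMap e.1 e.2 s : Space).2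
      = (t - s) * (e.2.2 - e.1.2) := by
    simp [AffineMap.lineMap_apply_module]; ring
  have h2 : (AffineMap.lineMap e.1 e.2 t : Space).1 - (AffineMap.lineMap e.1 e.2 s : Space).1
      = (t - s) • (e.2.1 - e.1.1) := by
    simp only [AffineMap.lineMap_apply_module, Prod.fst_add, Prod.smul_fst]; module
  rw [h1, h2, norm_smul, div_mul_eq_mul_div, le_div_iff₀ hd, Real.norm_eq_abs]
  have h3 : (t - s) * (e.2.2 - e.1.2) ≤ |t - s| * |e.2.2 - e.1.2| := by
    rw [← abs_mul]; exact le_abs_self _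
  nlinarith

/-- If the projections meet, at one point, then going from `x` to `y` by way of that point bounds
the gain in height by the slopes of the two edges and `exists_meet_bound`; the jump from `e` to `f`
over the meeting point is downwards. If the projections are disjoint, their distance is positive and
the heights are bounded. -/
theorem exists_pair_slope {e f : Space × Space} (he : (pe e).1 ≠ (pe e).2)
    (hf : (pe f).1 ≠ (pe f).2) (hss : (cseg (pe e) ∩ cseg (pe f)).Subsingleton)
    (ho : ∀ x ∈ cseg e, ∀ y ∈ cseg f, x.1 = y.1 → y.2 ≤ x.2) :
    ∃ M : ℝ, 0 ≤ M ∧ ∀ x ∈ cseg e, ∀ y ∈ cseg f, y.2 - x.2 ≤ M * ‖y.1 - x.1‖ := by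
  by_cases hn : (cseg (pe e) ∩ cseg (pe f)).Nonempty
  · obtain ⟨p, hpe, hpf⟩ := hn
    obtain ⟨κ, hκ, hb⟩ := exists_meet_bound hpe hpf fun q hq => hss hq ⟨hpe, hpf⟩
    obtain ⟨M₁, hM₁, h₁⟩ := exists_edge_slope he
    obtain ⟨M₂, hM₂, h₂⟩ := exists_edge_slope hf
    rw [cseg_pe] at hpe hpf
    obtain ⟨xe, hxe, rfl⟩ := hpe
    obtain ⟨yf, hyf, hxy⟩ := hpf
    refine ⟨(M₁ + M₂) * κ, by positivity, fun x hx y hy => ?_⟩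
    have h3 := h₁ x hx xe hxe
    have h4 := h₂ yf hyf y hy
    have h5 := ho xe hxe yf hyf hxy.symm
    have h6 := hb x.1 (mem_cseg_pe hx) y.1 (mem_cseg_pe hy)
    rw [hxy] at h4
    rw [norm_sub_rev] at h3
    rw [norm_sub_rev x.1 y.1] at h6
    have h7 := norm_nonneg (x.1 - xe.1)
    have h8 := norm_nonneg (y.1 - xe.1)
    nlinarith
  · have hK : IsCompact (cseg e ×ˢ cseg f) := (isCompact_cseg e).prod (isCompact_cseg f)
    have hne : (cseg e ×ˢ cseg f).Nonempty :=
      ⟨(e.1, f.1), left_mem_segment ℝ _ _, left_mem_segment ℝ _ _⟩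
    have hc1 : Continuous fun z : Space × Space => ‖z.2.1 - z.1.1‖ := by fun_prop
    have hc2 : Continuous fun z : Space × Space => z.2.2 - z.1.2 := by fun_prop
    obtain ⟨z, hz, hzm⟩ := hK.exists_isMinOn hne hc1.continuousOn
    obtain ⟨w, hw, hwm⟩ := hK.exists_isMaxOn hne hc2.continuousOn
    have hpos : 0 < ‖z.2.1 - z.1.1‖ := by
      rw [norm_pos_iff, sub_ne_zero]
      intro h
      refine hn ⟨z.1.1, mem_cseg_pe hz.1, ?_⟩
      rw [← h]; exact mem_cseg_pe hz.2
    refine ⟨|w.2.2 - w.1.2| / ‖z.2.1 - z.1.1‖, by positivity, fun x hx y hy => ?_⟩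
    have h1 := isMinOn_iff.1 hzm (x, y) ⟨hx, hy⟩
    have h2 := isMaxOn_iff.1 hwm (x, y) ⟨hx, hy⟩
    simp only at h1 h2
    calc y.2 - x.2 ≤ |w.2.2 - w.1.2| := h2.trans (le_abs_self _)
      _ = |w.2.2 - w.1.2| / ‖z.2.1 - z.1.1‖ * ‖z.2.1 - z.1.1‖ := by field_simp
      _ ≤ _ := mul_le_mul_of_nonneg_left h1 (by positivity)

/-- With two common points the edges would share a segment. All its inner points would be crossings
or vertices, of which there are finitely many. -/
theorem Gen.meet_subsingleton {U : List Plane} (h : Gen 2 U) (hfin : (crs U).Finite)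
    {e f : Plane × Plane} (he : e ∈ cedges U) (hf : f ∈ cedges U) (hef : e ≠ f) :
    (cseg e ∩ cseg f).Subsingleton := by
  intro p hp q hq
  by_contra hpq
  have h1 : oseg (p, q) ⊆ crs U ∪ {v | v ∈ U} := by
    intro r hr
    have hre : r ∈ cseg e := (convex_segment e.1 e.2).openSegment_subset hp.1 hq.1 hr
    have hrf : r ∈ cseg f := (convex_segment f.1 f.2).openSegment_subset hp.2 hq.2 hr
    rcases h.meet he hf hre hrf with ⟨h, -⟩ | ⟨h1, h2⟩
    · exact Or.inr h
    · exact Or.inl ((two_le_cov (nodup_cedges h.nodup)).2 ⟨e, he, f, hf, hef, h1, h2⟩)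
  exact infinite_oseg (e := (p, q)) hpq ((hfin.union (List.finite_toSet U)).subset h1)

/-- The edges in the first list lie over those in the second list. -/
def Over (A O : List (Space × Space)) : Prop :=
  ∀ e ∈ A, ∀ f ∈ O, ∀ x ∈ cseg e, ∀ y ∈ cseg f, x.1 = y.1 → y.2 ≤ x.2

theorem Diagram.exists_slope {V : List Space} (h : Diagram V) {A : List (Space × Space)}
    (hA : A ⊆ cedges V) (hO : Over A (cedges V)) {e f : Space × Space} (he : e ∈ A)
    (hf : f ∈ cedges V) :
    ∃ M : ℝ, 0 ≤ M ∧ ∀ x ∈ cseg e, ∀ y ∈ cseg f, y.2 - x.2 ≤ M * ‖y.1 - x.1‖ := by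
  by_cases hef : e = f
  · subst hef; exact exists_edge_slope (h.pe_ne hf)
  · exact exists_pair_slope (h.pe_ne (hA he)) (h.pe_ne hf)
      (h.gen.meet_subsingleton h.fin (Diagram.pe_mem (hA he)) (Diagram.pe_mem hf)
        fun h' => hef (h.pe_inj (hA he) hf h')) (hO e he f hf)

/-- A point of the polygon on the segment from `x` to the apex, other than `x`, rises above `x` with
slope `(H - x.2) / ‖x.1‖`. The slope of the polygon relative to the arc is bounded by
`exists_slope`, so this is impossible for large `H`. The apex stands over the origin, an arbitrary
choice. -/
theorem Diagram.eventually_sees {V : List Space} (h : Diagram V) {A : List (Space × Space)}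
    (hA : A ⊆ cedges V) (hO : Over A (cedges V)) :
    ∀ᶠ H : ℝ in atTop, Sees ((0, H) : Space) A (cedges V) := by
  have h1 : ∀ᶠ H : ℝ in atTop, ∀ f ∈ {f | f ∈ cedges V}, ((0, H) : Space) ∉ cseg f := by
    rw [eventually_all_finite (List.finite_toSet _)]
    intro f hf
    obtain ⟨z, -, hz⟩ := (isCompact_cseg f).exists_isMaxOn ⟨f.1, left_mem_segment ℝ _ _⟩
      (continuous_snd.continuousOn (s := cseg f))
    filter_upwards [eventually_gt_atTop z.2] with H hH hm
    have := isMaxOn_iff.1 hz _ hm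
    simp only at this
    linarith
  have h2 : ∀ᶠ H : ℝ in atTop, ∀ e ∈ {e | e ∈ A}, ∀ f ∈ {f | f ∈ cedges V}, ∀ x ∈ cseg e,
      ∀ y ∈ cseg f, y ∈ segment ℝ x (0, H) → y = x := by
    rw [eventually_all_finite (List.finite_toSet _)]
    intro e he
    rw [eventually_all_finite (List.finite_toSet _)]
    intro f hf
    obtain ⟨M, hM, hs⟩ := h.exists_slope hA hO he hf
    have hc : Continuous fun x : Space => x.2 + M * ‖x.1‖ := by fun_prop
    obtain ⟨z, -, hz⟩ := (isCompact_cseg e).exists_isMaxOn ⟨e.1, left_mem_segment ℝ _ _⟩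
      hc.continuousOn
    filter_upwards [eventually_gt_atTop (z.2 + M * ‖z.1‖)] with H hH x hx y hy hyx
    have hxz := isMaxOn_iff.1 hz _ hx
    obtain ⟨s, t, hs0, ht0, hst, rfl⟩ := hyx
    have es : s = 1 - t := by linarith
    subst es
    have h3 := hs x hx _ hy
    have e1 : ((1 - t) • x + t • ((0, H) : Space)).2 - x.2 = t * (H - x.2) := by
      simp; ring
    have e2 : ((1 - t) • x + t • ((0, H) : Space)).1 - x.1 = -(t • x.1) := by
      simp only [Prod.fst_add, Prod.smul_fst]; module
    rw [e1, e2, norm_neg, norm_smul, Real.norm_of_nonneg ht0] at h3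
    have ht : t = 0 := by
      by_contra htn
      have : 0 < t := lt_of_le_of_ne ht0 (Ne.symm htn)
      nlinarith
    subst ht
    simp
  filter_upwards [h1, h2] with H h1 h2
  refine ⟨fun ⟨f, hf, hm⟩ => h1 f hf hm, ?_⟩
  rintro x ⟨e, he, hx⟩ y ⟨f, hf, hy⟩ hyx
  exact h2 e he f hf x hx y hy hyx

/-- Two arcs with common endpoints that lie over everything else are interchangeable. -/
theorem LEq.overpass {b : Space} {m : List Space} {a : Space} {X Y : List Space}
    (hX : Diagram (b :: m ++ [a] ++ X)) (hY : Diagram (b :: m ++ [a] ++ Y))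
    (hXO : Over (segs (a :: X ++ [b])) (cedges (b :: m ++ [a] ++ X)))
    (hYO : Over (segs (a :: Y ++ [b])) (cedges (b :: m ++ [a] ++ Y))) :
    LEq (b :: m ++ [a] ++ X) (b :: m ++ [a] ++ Y) := by
  have hsub : ∀ Z : List Space, segs (a :: Z ++ [b]) ⊆ cedges (b :: m ++ [a] ++ Z) := fun Z => by
    rw [cedges_arc]; exact List.subset_append_right _ _
  -- One apex is high enough for both arcs; coning off either of them leads to the same polygon.
  obtain ⟨H, h1, h2⟩ := ((hX.eventually_sees (hsub X) hXO).and
    (hY.eventually_sees (hsub Y) hYO)).exists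
  exact (LEq.fan hX.simple h1).trans (LEq.fan hY.simple h2).symm

/-- The compact limit segment has a positive distance from `F`, and moving the endpoints by less
than `δ` moves every point of the segment by less than `δ`. -/
theorem eventually_disjoint_segment {E ι : Type*} [NormedAddCommGroup E] [NormedSpace ℝ E]
    {l : Filter ι} {a b : E} {f g : ι → E} (hf : Tendsto f l (𝓝 a)) (hg : Tendsto g l (𝓝 b))
    {F : Set E} (hF : IsClosed F) (h : ∀ x ∈ segment ℝ a b, x ∉ F) :
    ∀ᶠ i in l, ∀ x ∈ segment ℝ (f i) (g i), x ∉ F := by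
  obtain ⟨δ, hδ, hs⟩ := (isCompact_cseg (a, b)).exists_thickening_subset_open
    hF.isOpen_compl h
  filter_upwards [hf (Metric.ball_mem_nhds a hδ), hg (Metric.ball_mem_nhds b hδ)] with i h1 h2 x hx
  obtain ⟨s, t, hs0, ht0, hst, rfl⟩ := hx
  apply hs
  rw [Metric.mem_thickening_iff]
  refine ⟨s • a + t • b, ⟨s, t, hs0, ht0, hst, rfl⟩, ?_⟩
  have h3 : dist (f i) a < δ := h1
  have h4 : dist (g i) b < δ := h2
  rw [dist_eq_norm] at h3 h4 ⊢
  have h5 : s • f i + t • g i - (s • a + t • b) = s • (f i - a) + t • (g i - b) := by module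
  rw [h5]
  refine (norm_add_le _ _).trans_lt ?_
  rw [norm_smul, norm_smul, Real.norm_of_nonneg hs0, Real.norm_of_nonneg ht0]
  have h6 := norm_nonneg (f i - a)
  rcases hs0.eq_or_lt with h0 | h0
  · have : t = 1 := by linarith
    subst this; rw [← h0]; linarith
  · nlinarith

theorem isClosed_cseg (e : Plane × Plane) : IsClosed (cseg e) := (isCompact_cseg e).isClosed

/-! ### Sliding a crossing past a vertex: the thin triangle in the plane -/

/-- Planar determinant. -/
def det2 (p q : Plane) : ℝ := p.1 * q.2 - p.2 * q.1

theorem exists_smul_of_det2 {p q : Plane} (hp : p ≠ 0) (h : det2 p q = 0) : ∃ μ : ℝ, q = μ • p := by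
  rw [det2] at h
  by_cases h1 : p.1 = 0
  · have h2 : p.2 ≠ 0 := fun h2 => hp (Prod.ext h1 h2)
    refine ⟨q.2 / p.2, Prod.ext ?_ ?_⟩
    · rw [h1] at h
      have : p.2 * q.1 = 0 := by linarith
      rcases mul_eq_zero.1 this with h3 | h3
      · exact absurd h3 h2
      · simp [h1, h3]
    · simp [h2]
  · refine ⟨q.1 / p.1, Prod.ext ?_ ?_⟩
    · simp [h1]
    · simp only [Prod.smul_snd, smul_eq_mul]
      field_simp
      linarith

/-- Cramer's rule. In the slide, `φ` measures along the edge `T` and `ψ` along the edge from `a` to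
`b` that crosses it. -/
theorem exists_coords {u d : Plane} (h : det2 u d ≠ 0) :
    ∃ φ ψ : Plane →ₗ[ℝ] ℝ, φ u = 1 ∧ φ d = 0 ∧ ψ u = 0 ∧ ψ d = 1 ∧
      ∀ p, p = φ p • u + ψ p • d := by
  refine ⟨(det2 u d)⁻¹ • (d.2 • LinearMap.fst ℝ ℝ ℝ - d.1 • LinearMap.snd ℝ ℝ ℝ),
    (det2 u d)⁻¹ • (u.1 • LinearMap.snd ℝ ℝ ℝ - u.2 • LinearMap.fst ℝ ℝ ℝ), ?_, ?_, ?_, ?_, ?_⟩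
  · simp only [LinearMap.smul_apply, LinearMap.sub_apply, LinearMap.fst_apply,
      LinearMap.snd_apply, smul_eq_mul]
    rw [inv_mul_eq_one₀ h, det2]; ring
  · simp only [LinearMap.smul_apply, LinearMap.sub_apply, LinearMap.fst_apply,
      LinearMap.snd_apply, smul_eq_mul]
    ring
  · simp only [LinearMap.smul_apply, LinearMap.sub_apply, LinearMap.fst_apply,
      LinearMap.snd_apply, smul_eq_mul]
    ring
  · simp only [LinearMap.smul_apply, LinearMap.sub_apply, LinearMap.fst_apply,
      LinearMap.snd_apply, smul_eq_mul]
    rw [inv_mul_eq_one₀ h, det2]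
  · intro p
    have h' : u.1 * d.2 - u.2 * d.1 ≠ 0 := h
    ext <;> simp only [LinearMap.smul_apply, LinearMap.sub_apply, LinearMap.fst_apply,
      LinearMap.snd_apply, smul_eq_mul, Prod.fst_add, Prod.snd_add, Prod.smul_fst,
      Prod.smul_snd, det2]
    · linear_combination (-p.1) * (inv_mul_cancel₀ h')
    · linear_combination (-p.2) * (inv_mul_cancel₀ h')

/-- Edges that cross are not parallel. -/
theorem Gen.det2_ne {U : List Plane} (h : Gen 2 U) (h2 : 2 ≤ U.length) (hfin : (crs U).Finite)
    {e f : Plane × Plane} (he : e ∈ cedges U) (hf : f ∈ cedges U) (hef : e ≠ f) {p : Plane}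
    (hpe : p ∈ oseg e) (hpf : p ∈ oseg f) : det2 (e.2 - e.1) (f.2 - f.1) ≠ 0 := by
  intro h0
  have hne : e.2 - e.1 ≠ 0 := sub_ne_zero.2 (cedges_ne h.nodup h2 he).symm
  obtain ⟨μ, hμ⟩ := exists_smul_of_det2 hne h0
  have hss := h.meet_subsingleton hfin he hf hef
  -- From `p` one can go a little way in both directions along either edge; if the edges were
  -- parallel, this would give a second common point.
  have key : ∀ g : Plane × Plane, p ∈ oseg g → ∃ δ > 0, ∀ r : ℝ, |r| < δ →
      p + r • (g.2 - g.1) ∈ cseg g := by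
    rintro g ⟨s, t, hs, ht, hst, rfl⟩
    refine ⟨min s t, lt_min hs ht, fun r hr => ?_⟩
    obtain ⟨h1, h2⟩ := abs_lt.1 hr
    refine ⟨s - r, t + r, ?_, ?_, by linarith, by module⟩
    · have := min_le_left s t; linarith
    · have := min_le_right s t; linarith
  obtain ⟨δ, hδ, h3⟩ := key e hpe
  obtain ⟨δ', hδ', h4⟩ := key f hpf
  have hpos : 0 < min δ (δ' / (1 + |μ|)) := lt_min hδ (by positivity)
  by_cases hμ0 : μ = 0
  · rw [hμ0, zero_smul] at hμ
    exact (cedges_ne h.nodup h2 hf).symm (sub_eq_zero.1 hμ)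
  · set r := min δ (δ' * |μ|) / 2 with hr
    have hr0 : 0 < r := by have := abs_pos.2 hμ0; positivity
    have hr1 : r < δ := by
      have := min_le_left δ (δ' * |μ|); linarith
    have hr2 : r < δ' * |μ| := by
      have := min_le_right δ (δ' * |μ|); linarith
    have h5 := h3 r (by rwa [abs_of_pos hr0])
    have h6 := h4 (r / μ) (by
      rw [abs_div, abs_of_pos hr0, div_lt_iff₀ (abs_pos.2 hμ0)]; exact hr2)
    rw [hμ, smul_smul, div_mul_cancel₀ _ hμ0] at h6
    have h7 := hss ⟨oseg_subset_cseg _ hpe, oseg_subset_cseg _ hpf⟩ ⟨h5, h6⟩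
    have h8 : r • (e.2 - e.1) = 0 := by simpa using h7.symm
    rcases smul_eq_zero.1 h8 with h9 | h9
    · exact hr0.ne' h9
    · exact hne h9

/-- The edge from `a` to `b` crosses the edge `T` at `c`, and `Tn` is the edge after `T`. -/
structure Slide (b : Plane) (m : List Plane) (a : Plane) (T Tn : Plane × Plane) (c : Plane) :
    Prop where
  gen : Gen 2 (b :: m ++ [a])
  fin : (crs (b :: m ++ [a])).Finite
  memT : T ∈ segs (b :: m ++ [a])
  memTn : Tn ∈ segs (b :: m ++ [a])
  next : Tn.1 = T.2
  cT : c ∈ oseg T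
  cs : c ∈ oseg (a, b)

namespace Slide
variable {b : Plane} {m : List Plane} {a : Plane} {T Tn : Plane × Plane} {c : Plane}

theorem mem_cedges {f : Plane × Plane} (hf : f ∈ segs (b :: m ++ [a])) :
    f ∈ cedges (b :: m ++ [a]) := by
  rw [cedges_last]; exact List.mem_append_left _ hf

theorem s_mem : (a, b) ∈ cedges (b :: m ++ [a]) := by
  rw [cedges_last]; simp

theorem ne_s (hU : (b :: m ++ [a]).Nodup) {f : Plane × Plane} (hf : f ∈ segs (b :: m ++ [a])) :
    f ≠ (a, b) := by
  rintro rfl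
  have := nodup_cedges hU
  rw [cedges_last, List.nodup_append] at this
  exact this.2.2 _ hf _ (by simp) rfl

variable (S : Slide b m a T Tn c)
include S

theorem det_ne : det2 (T.2 - c) (b - a) ≠ 0 := by
  have h1 := S.gen.det2_ne (by simp) S.fin (mem_cedges S.memT) s_mem (ne_s S.gen.nodup S.memT)
    S.cT S.cs
  obtain ⟨s, t, hs, ht, hst, hc⟩ := S.cT
  have h2 : T.2 - c = s • (T.2 - T.1) := by
    rw [← hc]
    have : t = 1 - s := by linarith
    subst this; module
  rw [h2]
  have h3 : det2 (s • (T.2 - T.1)) (b - a) = s * det2 (T.2 - T.1) (b - a) := by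
    simp [det2]; ring
  rw [h3]
  exact mul_ne_zero hs.ne' h1

theorem segment_subset : segment ℝ c T.2 ⊆ cseg T :=
  (convex_segment _ _).segment_subset (oseg_subset_cseg _ S.cT) (right_mem_segment ℝ _ _)

theorem oseg_subset : oseg (c, T.2) ⊆ oseg T := fun p hp =>
  (mem_oseg_split S.cT p).2 (Or.inr (Or.inr hp))

/-- A crossing is only a double point, and at `c` the two strands are `T` and the edge from `a` to
`b`. -/
theorem c_mem_imp {f : Plane × Plane} (hf : f ∈ segs (b :: m ++ [a])) (h : c ∈ cseg f) :
    f = T := by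
  rcases S.gen.meet (mem_cedges S.memT) (mem_cedges hf) (oseg_subset_cseg _ S.cT) h with
    ⟨h1, -⟩ | ⟨-, h1⟩
  · exact absurd S.cT (S.gen.vertex_notMem c h1 _ (mem_cedges S.memT))
  · exact S.gen.eq_of_two s_mem (mem_cedges S.memT) (mem_cedges hf)
      (ne_s S.gen.nodup S.memT).symm (ne_s S.gen.nodup hf) S.cs S.cT h1

theorem v_mem : T.2 ∈ b :: m ++ [a] := List.mem_cons_of_mem _ (snd_mem_of_mem_segs S.memT)

theorem v_mem_imp {f : Plane × Plane} (hf : f ∈ segs (b :: m ++ [a])) (h : T.2 ∈ cseg f) :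
    f = T ∨ f = Tn := by
  rcases S.gen.mem_of_mem_cseg S.v_mem (mem_cedges hf) h with h | h
  · right
    refine cedges_fst_inj S.gen.nodup (mem_cedges hf) (mem_cedges S.memTn) ?_
    rw [← h, S.next]
  · left
    exact cedges_snd_inj S.gen.nodup (mem_cedges hf) (mem_cedges S.memT) h.symm

/-- The piece of `T` behind `c` is met by further edges only in honest crossings; the end at `c` is
excluded by double points and the end `T.2` by the choice of `f`. -/
theorem classify {f : Plane × Plane} (hf : f ∈ segs (b :: m ++ [a])) (hT : f ≠ T) (hTn : f ≠ Tn)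
    {p : Plane} (hp : p ∈ segment ℝ c T.2) (hpf : p ∈ cseg f) :
    p ∈ oseg f ∧ p ∈ oseg (c, T.2) := by
  have h1 : p ≠ c := by rintro rfl; exact hT (S.c_mem_imp hf hpf)
  have h2 : p ≠ T.2 := by
    rintro rfl
    rcases S.v_mem_imp hf hpf with h | h
    · exact hT h
    · exact hTn h
  have h3 : p ∈ oseg (c, T.2) := mem_oseg_of_mem_cseg hp h1 h2
  refine ⟨?_, h3⟩
  rcases S.gen.meet (mem_cedges S.memT) (mem_cedges hf) (S.segment_subset hp) hpf with
    ⟨h4, -⟩ | ⟨-, h4⟩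
  · exact absurd (S.oseg_subset h3) (S.gen.vertex_notMem p h4 _ (mem_cedges S.memT))
  · exact h4

end Slide

/-- The root of a wing of the thin triangle around the segment from `c` to `v`. -/
def wingRoot (c d : Plane) (η ε : ℝ) : Plane := c + (η * ε) • d

/-- The apex of the thin triangle around the segment from `c` to `v`. -/
def wingTip (c v d : Plane) (τ ε : ℝ) : Plane := v + ε • (v - c) + (τ * ε ^ 2) • d

theorem tendsto_wingRoot (c d : Plane) (η : ℝ) :
    Tendsto (wingRoot c d η) (𝓝[>] 0) (𝓝 c) := by
  have : Continuous (wingRoot c d η) := by unfold wingRoot; fun_prop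
  have h := this.tendsto 0
  rw [show wingRoot c d η 0 = c by simp [wingRoot]] at h
  exact h.mono_left nhdsWithin_le_nhds

theorem tendsto_wingTip (c v d : Plane) (τ : ℝ) :
    Tendsto (wingTip c v d τ) (𝓝[>] 0) (𝓝 v) := by
  have : Continuous (wingTip c v d τ) := by unfold wingTip; fun_prop
  have h := this.tendsto 0
  rw [show wingTip c v d τ 0 = v by simp [wingTip]] at h
  exact h.mono_left nhdsWithin_le_nhds

/-- The affine function that vanishes on a wing and is positive on its inner side, in terms of the
coordinates `x`, `y` with respect to `c`, `v - c` and `d`. -/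
def wingFun (η τ ε x y : ℝ) : ℝ := (1 + ε) * (ε - η * y) - x * (ε - η * τ * ε ^ 2)

set_option linter.unusedSectionVars false

section Wing
variable {c v d : Plane} {φ ψ : Plane →ₗ[ℝ] ℝ} (h1 : φ (v - c) = 1) (h2 : φ d = 0)
  (h3 : ψ (v - c) = 0) (h4 : ψ d = 1)
include h1 h2 h3 h4

theorem wing_root_coords (η ε : ℝ) :
    φ (wingRoot c d η ε - c) = 0 ∧ ψ (wingRoot c d η ε - c) = η * ε := by
  simp [wingRoot, h2, h4]

theorem wing_tip_coords (τ ε : ℝ) :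
    φ (wingTip c v d τ ε - c) = 1 + ε ∧ ψ (wingTip c v d τ ε - c) = τ * ε ^ 2 := by
  have : wingTip c v d τ ε - c = (1 + ε) • (v - c) + (τ * ε ^ 2) • d := by
    rw [wingTip]; module
  rw [this]
  simp only [map_add, map_smul, h1, h2, h3, h4, smul_eq_mul]
  constructor <;> ring

theorem wing_coords {η τ ε : ℝ} {p : Plane}
    (hp : p ∈ cseg (wingRoot c d η ε, wingTip c v d τ ε)) :
    ∃ t : ℝ, 0 ≤ t ∧ t ≤ 1 ∧ φ (p - c) = t * (1 + ε) ∧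
      ψ (p - c) = (1 - t) * (η * ε) + t * (τ * ε ^ 2) ∧
      (t = 0 → p = wingRoot c d η ε) ∧ (t = 1 → p = wingTip c v d τ ε) := by
  obtain ⟨s, t, hs, ht, hst, rfl⟩ := hp
  have es : s = 1 - t := by linarith
  subst es
  obtain ⟨r1, r2⟩ := wing_root_coords h1 h2 h3 h4 η ε
  obtain ⟨t1, t2⟩ := wing_tip_coords h1 h2 h3 h4 τ ε
  have e1 : (1 - t) • wingRoot c d η ε + t • wingTip c v d τ ε - c
      = (1 - t) • (wingRoot c d η ε - c) + t • (wingTip c v d τ ε - c) := by module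
  refine ⟨t, ht, by linarith, ?_, ?_, ?_, ?_⟩
  · simp only [e1, map_add, map_smul, r1, t1, smul_eq_mul]; ring
  · simp only [e1, map_add, map_smul, r2, t2, smul_eq_mul]
  · rintro rfl; simp
  · rintro rfl; simp

end Wing

/-- The segment from `R` to `C` meets the kept path only near the segment from `c` to the end
of the edge `T`, apart from the edge `Tn`. -/
structure WingGood (b : Plane) (m : List Plane) (a : Plane) (T Tn : Plane × Plane) (c : Plane)
    (R C : Plane) : Prop where
  near : ∀ f ∈ segs (b :: m ++ [a]), f ≠ Tn → ∀ p ∈ cseg f, p ∈ cseg (R, C) →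
    f ≠ T ∧ ∃ q, q ∈ oseg f ∧ q ∈ oseg (c, T.2)
  subsingleton : ∀ f ∈ segs (b :: m ++ [a]), f ≠ Tn → (cseg f ∩ cseg (R, C)).Subsingleton
  avoid : ∀ p, p ∈ crs (b :: m ++ [a]) ∨ p ∈ b :: m ++ [a] → p ∉ cseg (R, C)
  root : ∀ f ∈ segs (b :: m ++ [a]), R ∉ cseg f
  tip : ∀ f ∈ segs (b :: m ++ [a]), C ∉ cseg f

namespace Slide
variable {b : Plane} {m : List Plane} {a : Plane} {T Tn : Plane × Plane} {c : Plane}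
  (S : Slide b m a T Tn c) {φ ψ : Plane →ₗ[ℝ] ℝ}

include S in
theorem T_coords (h1 : φ (T.2 - c) = 1) (h3 : ψ (T.2 - c) = 0) {p : Plane} (hp : p ∈ cseg T) :
    φ (p - c) ≤ 1 ∧ ψ (p - c) = 0 := by
  obtain ⟨s, t, hs, ht, hst, rfl⟩ := hp
  obtain ⟨s', t', hs', ht', hst', hc⟩ := S.cT
  have e1 : T.1 - c = (-(t' / s')) • (T.2 - c) := by
    have : c = (1 - t') • T.1 + t' • T.2 := by rw [← hc]; congr 2; linarith
    have h5 : s' = 1 - t' := by linarith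
    have h6 : (1 - t') ≠ 0 := by rw [← h5]; exact hs'.ne'
    have h7 : s' • (T.1 - c) = s' • ((-(t' / s')) • (T.2 - c)) := by
      rw [smul_smul, mul_neg, mul_div_cancel₀ _ hs'.ne', h5, this]; module
    exact smul_right_injective _ hs'.ne' h7
  have e2 : s • T.1 + t • T.2 - c = s • (T.1 - c) + t • (T.2 - c) := by
    have : s = 1 - t := by linarith
    subst this; module
  rw [e2, e1]
  simp only [map_add, map_smul, h1, h3, smul_eq_mul]
  constructor
  · have : 0 < t' / s' := by positivity
    nlinarith
  · ring

/-- The function of one wing vanishes along that wing, and the function of the opposite wing is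
positive there except at the common tip `t = 1`. -/
theorem wingFun_wing {η τ ε : ℝ} (hη : η * η = 1) (t : ℝ) :
    wingFun η τ ε (t * (1 + ε)) ((1 - t) * (η * ε) + t * (τ * ε ^ 2)) = 0 ∧
    wingFun (-η) τ ε (t * (1 + ε)) ((1 - t) * (η * ε) + t * (τ * ε ^ 2))
      = (1 + ε) * (2 * (1 - t) * ε) := by
  simp only [wingFun]
  constructor
  · linear_combination (-(1 + ε) * (1 - t) * ε) * hη
  · linear_combination ((1 + ε) * (1 - t) * ε) * hη

/-- The sideways shift of the tip is of order `ε ^ 2`, the half-width at the root is `ε`, and the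
overshoot beyond the end of `T` is `ε`; so the whole of `T` stays strictly on the inner side. -/
theorem wingFun_T_pos {η τ ε x : ℝ} (hη : η = 1 ∨ η = -1) (hτ0 : 0 ≤ τ) (hτ1 : τ ≤ 1 / 2)
    (hε0 : 0 < ε) (hε1 : ε < 1) (hx : x ≤ 1) : 0 < wingFun η τ ε x 0 := by
  have h1 : 0 < ε - η * τ * ε ^ 2 := by
    rcases hη with rfl | rfl <;> nlinarith
  have h2 : 0 < (1 + ε) * ε - (ε - η * τ * ε ^ 2) := by
    have : 0 < 1 + η * τ := by rcases hη with rfl | rfl <;> linarith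
    have h3 : (1 + ε) * ε - (ε - η * τ * ε ^ 2) = ε ^ 2 * (1 + η * τ) := by ring
    rw [h3]; positivity
  simp only [wingFun]
  nlinarith

include S in
theorem T_notMem_wing (h1 : φ (T.2 - c) = 1) (h2 : φ (b - a) = 0) (h3 : ψ (T.2 - c) = 0)
    (h4 : ψ (b - a) = 1) {η τ ε : ℝ} (hη : η = 1 ∨ η = -1) (hτ0 : 0 ≤ τ) (hτ1 : τ ≤ 1 / 2)
    (hε0 : 0 < ε) (hε1 : ε < 1) {p : Plane} (hp : p ∈ cseg T) :
    p ∉ cseg (wingRoot c (b - a) η ε, wingTip c T.2 (b - a) τ ε) := by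
  intro hw
  obtain ⟨t, -, -, e1, e2, -⟩ := wing_coords h1 h2 h3 h4 hw
  obtain ⟨k1, k2⟩ := S.T_coords h1 h3 hp
  have hpos := wingFun_T_pos hη hτ0 hτ1 hε0 hε1 k1
  have h0 := (wingFun_wing (τ := τ) (ε := ε) (η := η) (by rcases hη with rfl | rfl <;> ring) t).1
  rw [← e1, ← e2, k2] at h0
  linarith

include S in
-- As `ε` tends to `0`, the wing tends to the segment from `c` to `T.2`. Edges that miss this
-- segment are missed by the wing, edges that cross it do so transversally and hence meet the wing
-- at most once, and `T` itself lies strictly on one side. The only delicate point is that the tip,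
-- which tends to the vertex `T.2`, must not lie on the next edge `Tn`.
theorem eventually_wingGood (h1 : φ (T.2 - c) = 1) (h2 : φ (b - a) = 0) (h3 : ψ (T.2 - c) = 0)
    (h4 : ψ (b - a) = 1) (h5 : ∀ p, p = φ p • (T.2 - c) + ψ p • (b - a))
    {η τ : ℝ} (hη : η = 1 ∨ η = -1) (hτ0 : 0 ≤ τ) (hτ1 : τ ≤ 1 / 2)
    (hτ : τ = 0 ↔ ψ (Tn.2 - Tn.1) ≠ 0) :
    ∀ᶠ ε in 𝓝[>] (0 : ℝ), WingGood b m a T Tn c (wingRoot c (b - a) η ε)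
      (wingTip c T.2 (b - a) τ ε) := by
  have hε : ∀ᶠ ε in 𝓝[>] (0 : ℝ), 0 < ε ∧ ε < 1 := Ioo_mem_nhdsGT one_pos
  have hR := tendsto_wingRoot c (b - a) η
  have hC := tendsto_wingTip c T.2 (b - a) τ
  have hfin := List.finite_toSet (segs (b :: m ++ [a]))
  have hnear : ∀ᶠ ε in 𝓝[>] (0 : ℝ), ∀ f ∈ {f | f ∈ segs (b :: m ++ [a])}, f ≠ Tn →
      ∀ p ∈ cseg f, p ∈ cseg (wingRoot c (b - a) η ε, wingTip c T.2 (b - a) τ ε) →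
      f ≠ T ∧ ∃ q, q ∈ oseg f ∧ q ∈ oseg (c, T.2) := by
    rw [eventually_all_finite hfin]
    intro f hf
    by_cases hTn : f = Tn
    · exact Eventually.of_forall fun ε h => absurd hTn h
    by_cases hT : f = T
    · subst hT
      filter_upwards [hε] with ε hε _ p hp hw
      exact absurd hw (S.T_notMem_wing h1 h2 h3 h4 hη hτ0 hτ1 hε.1 hε.2 hp)
    by_cases hq : ∃ q ∈ segment ℝ c T.2, q ∈ cseg f
    · obtain ⟨q, hq, hqf⟩ := hq
      exact Eventually.of_forall fun ε _ p _ _ => ⟨hT, q, S.classify hf hT hTn hq hqf⟩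
    · push Not at hq
      filter_upwards [eventually_disjoint_segment hR hC (isClosed_cseg f) hq] with ε hε _ p hp hw
      exact absurd hp (hε p hw)
  have hsub : ∀ᶠ ε in 𝓝[>] (0 : ℝ), ∀ f ∈ {f | f ∈ segs (b :: m ++ [a])}, f ≠ T →
      (∃ q, q ∈ oseg f ∧ q ∈ oseg (c, T.2)) →
      (cseg f ∩ cseg (wingRoot c (b - a) η ε, wingTip c T.2 (b - a) τ ε)).Subsingleton := by
    rw [eventually_all_finite hfin]
    intro f hf
    by_cases hT : f = T
    · exact Eventually.of_forall fun ε h => absurd hT h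
    by_cases hq : ∃ q, q ∈ oseg f ∧ q ∈ oseg (c, T.2)
    · obtain ⟨q, hqf, hq⟩ := hq
      have hdet := S.gen.det2_ne (by simp) S.fin (mem_cedges S.memT) (mem_cedges hf)
        (Ne.symm hT) (S.oseg_subset hq) hqf
      have hψ : ψ (f.2 - f.1) ≠ 0 := by
        intro h0
        have h6 := h5 (f.2 - f.1)
        rw [h0, zero_smul, add_zero] at h6
        obtain ⟨s, t, hs, ht, hst, hc⟩ := S.cT
        have h7 : T.2 - c = s • (T.2 - T.1) := by
          rw [← hc]
          have : t = 1 - s := by linarith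
          subst this; module
        rw [h7, smul_smul] at h6
        apply hdet
        rw [h6]
        simp [det2]; ring
      -- This is the determinant of the directions of `f` and of the wing in the coordinates `φ`,
      -- `ψ`. Its limit is nonzero, so the wing is not parallel to `f` for small `ε`.
      have hcont : Continuous fun ε : ℝ =>
          φ (f.2 - f.1) * (τ * ε ^ 2 - η * ε) - ψ (f.2 - f.1) * (1 + ε) := by fun_prop
      have ht := (hcont.tendsto 0).mono_left (nhdsWithin_le_nhds (s := Set.Ioi 0))
      have h0 : φ (f.2 - f.1) * (τ * 0 ^ 2 - η * 0) - ψ (f.2 - f.1) * (1 + 0)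
          = -ψ (f.2 - f.1) := by ring
      rw [h0] at ht
      have hev := ht.eventually (isOpen_ne.mem_nhds (neg_ne_zero.2 hψ))
      filter_upwards [hev, hε] with ε hev hε _ _ p hp p' hp'
      obtain ⟨t, -, -, e1, e2, -⟩ := wing_coords h1 h2 h3 h4 hp.2
      obtain ⟨t', -, -, e1', e2', -⟩ := wing_coords h1 h2 h3 h4 hp'.2
      have hd : ∀ x ∈ cseg f, ∀ y ∈ cseg f, ∃ r : ℝ, x - y = r • (f.2 - f.1) := by
        rintro x ⟨s, t, -, -, hst, rfl⟩ y ⟨s', t', -, -, hst', rfl⟩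
        refine ⟨t - t', ?_⟩
        have e1 : s = 1 - t := by linarith
        have e2 : s' = 1 - t' := by linarith
        subst e1 e2; module
      obtain ⟨r, hr⟩ := hd p hp.1 p' hp'.1
      have hr' : p - c - (p' - c) = r • (f.2 - f.1) := by rw [← hr]; abel
      have k1 : (t - t') * (1 + ε) = r * φ (f.2 - f.1) := by
        have := congrArg φ hr'
        rw [map_sub, map_smul, e1, e1', smul_eq_mul] at this
        rw [← this]; ring
      have k2 : (t - t') * (τ * ε ^ 2 - η * ε) = r * ψ (f.2 - f.1) := by
        have := congrArg ψ hr'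
        rw [map_sub, map_smul, e2, e2', smul_eq_mul] at this
        rw [← this]; ring
      have k3 : r * (φ (f.2 - f.1) * (τ * ε ^ 2 - η * ε) - ψ (f.2 - f.1) * (1 + ε)) = 0 := by
        linear_combination (1 + ε) * k2 - (τ * ε ^ 2 - η * ε) * k1
      rcases mul_eq_zero.1 k3 with h0 | h0
      · rw [h0, zero_smul] at hr
        exact sub_eq_zero.1 hr
      · exact absurd h0 hev
    · exact Eventually.of_forall fun ε _ h => absurd h hq
  have havoid : ∀ᶠ ε in 𝓝[>] (0 : ℝ), ∀ p ∈ crs (b :: m ++ [a]) ∪ {p | p ∈ b :: m ++ [a]},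
      p ∉ cseg (wingRoot c (b - a) η ε, wingTip c T.2 (b - a) τ ε) := by
    rw [eventually_all_finite (S.fin.union (List.finite_toSet _))]
    intro p _
    by_cases hp : p ∈ segment ℝ c T.2
    · filter_upwards [hε] with ε hε
      exact S.T_notMem_wing h1 h2 h3 h4 hη hτ0 hτ1 hε.1 hε.2 (S.segment_subset hp)
    · filter_upwards [eventually_disjoint_segment hR hC (isClosed_singleton (x := p))
        (fun x hx hxp => hp (by rw [Set.mem_singleton_iff] at hxp; exact hxp ▸ hx))] with ε hε h
      exact hε p h rfl
  have hroot : ∀ᶠ ε in 𝓝[>] (0 : ℝ), ∀ f ∈ {f | f ∈ segs (b :: m ++ [a])},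
      wingRoot c (b - a) η ε ∉ cseg f := by
    rw [eventually_all_finite hfin]
    intro f hf
    by_cases hc : c ∈ cseg f
    · have := S.c_mem_imp hf hc
      subst this
      filter_upwards [hε] with ε hε hm
      exact S.T_notMem_wing h1 h2 h3 h4 hη hτ0 hτ1 hε.1 hε.2 hm (left_mem_segment ℝ _ _)
    · exact hR ((isClosed_cseg f).isOpen_compl.mem_nhds hc)
  have htip : ∀ᶠ ε in 𝓝[>] (0 : ℝ), ∀ f ∈ {f | f ∈ segs (b :: m ++ [a])},
      wingTip c T.2 (b - a) τ ε ∉ cseg f := by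
    rw [eventually_all_finite hfin]
    intro f hf
    by_cases hv : T.2 ∈ cseg f
    · rcases S.v_mem_imp hf hv with rfl | rfl
      · filter_upwards [hε] with ε hε hm
        exact S.T_notMem_wing h1 h2 h3 h4 hη hτ0 hτ1 hε.1 hε.2 hm (right_mem_segment ℝ _ _)
      · filter_upwards [hε] with ε hε hm
        obtain ⟨s, t, hs, ht, hst, hst2⟩ := hm
        have e1 : wingTip c T.2 (b - a) τ ε - T.2 = t • (f.2 - f.1) := by
          rw [← hst2, ← S.next]
          have : s = 1 - t := by linarith
          subst this; module
        have e2 : wingTip c T.2 (b - a) τ ε - T.2 = ε • (T.2 - c) + (τ * ε ^ 2) • (b - a) := by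
          rw [wingTip]; module
        rw [e2] at e1
        have k1 := congrArg φ e1
        have k2 := congrArg ψ e1
        simp only [map_add, map_smul, h1, h2, h3, h4, smul_eq_mul] at k1 k2
        -- If `Tn` leaves the line of `T`, the tip on that line beyond `T.2` is off `Tn`. If `Tn`
        -- stays on the line, the shift by `τ * ε ^ 2` takes the tip off it.
        by_cases h0 : τ = 0
        · have h6 := hτ.1 h0
          rw [h0] at k2
          have h7 : t * ψ (f.2 - f.1) = 0 := by linarith
          rcases mul_eq_zero.1 h7 with h8 | h8
          · rw [h8] at k1; linarith [hε.1]
          · exact h6 h8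
        · have h6 : ψ (f.2 - f.1) = 0 := by
            by_contra h; exact h0 (hτ.2 h)
          rw [h6] at k2
          have h7 : 0 < τ * ε ^ 2 := by
            have := hε.1
            have : 0 < τ := lt_of_le_of_ne hτ0 (Ne.symm h0)
            positivity
          linarith
    · exact hC ((isClosed_cseg f).isOpen_compl.mem_nhds hv)
  filter_upwards [hnear, hsub, havoid, hroot, htip] with ε g1 g2 g3 g4 g5
  refine ⟨g1, fun f hf hTn p hp q hq => ?_, fun p hp => g3 p hp, g4, g5⟩
  obtain ⟨k1, k2⟩ := g1 f hf hTn p hp.1 hp.2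
  exact g2 f hf k1 k2 hp hq

end Slide

/-- The thin triangle that is used to slide a crossing past the end of an edge. -/
structure Tri (b : Plane) (m : List Plane) (a : Plane) (T Tn : Plane × Plane) (c : Plane)
    (α β : ℝ) (A B C : Plane) : Prop where
  pos : 0 < α
  lt : α < β
  lt_one : β < 1
  hA : A = AffineMap.lineMap a b α
  hB : B = AffineMap.lineMap a b β
  mem : c ∈ oseg (A, B)
  wingA : WingGood b m a T Tn c A C
  wingB : WingGood b m a T Tn c B C
  next : (cseg Tn ∩ (cseg (A, C) ∪ cseg (B, C))).Subsingleton
  inter : ∀ p ∈ cseg (A, C), p ∈ cseg (B, C) → p = C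
  lineA : ∀ p ∈ cseg (A, C), p ∈ cseg (a, b) → p = A
  lineB : ∀ p ∈ cseg (B, C), p ∈ cseg (a, b) → p = B
  base : ∀ f ∈ segs (b :: m ++ [a]), ∀ p ∈ cseg f, p ∈ cseg (A, B) → f = T ∧ p = c

namespace Slide
variable {b : Plane} {m : List Plane} {a : Plane} {T Tn : Plane × Plane} {c : Plane}
  (S : Slide b m a T Tn c) {φ ψ : Plane →ₗ[ℝ] ℝ}

include S in
-- All requirements hold for every sufficiently small `ε`. If `σ` is the position of `c` on the edge
-- from `a` to `b`, the roots of the two wings are at `σ - ε` and `σ + ε`.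
theorem exists_tri : ∃ α β A B C, Tri b m a T Tn c α β A B C := by
  obtain ⟨φ, ψ, h1, h2, h3, h4, h5⟩ := exists_coords S.det_ne
  obtain ⟨σ, hσ0, hσ1, hσ⟩ := exists_of_mem_oseg S.cs
  -- The tip is shifted sideways exactly when `Tn` is parallel to `T`; any `τ` in `(0, 1)` would do
  -- in that case.
  obtain ⟨τ, hτ0, hτ1, hτ⟩ : ∃ τ : ℝ, 0 ≤ τ ∧ τ ≤ 1 / 2 ∧ (τ = 0 ↔ ψ (Tn.2 - Tn.1) ≠ 0) := by
    by_cases h : ψ (Tn.2 - Tn.1) = 0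
    · exact ⟨1 / 2, by norm_num, le_rfl, by simp [h]⟩
    · exact ⟨0, le_rfl, by norm_num, fun _ => h, fun _ => rfl⟩
  have hbase : ∀ᶠ ε in 𝓝[>] (0 : ℝ), ∀ f ∈ {f | f ∈ segs (b :: m ++ [a])}, f ≠ T →
      ∀ x ∈ segment ℝ (wingRoot c (b - a) (-1) ε) (wingRoot c (b - a) 1 ε), x ∉ cseg f := by
    rw [eventually_all_finite (List.finite_toSet _)]
    intro f hf
    by_cases hT : f = T
    · exact Eventually.of_forall fun ε h => absurd hT h
    · filter_upwards [eventually_disjoint_segment (tendsto_wingRoot c (b - a) (-1))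
        (tendsto_wingRoot c (b - a) 1) (isClosed_cseg f) (by
          intro x hx hxf
          rw [segment_same, Set.mem_singleton_iff] at hx
          exact hT (S.c_mem_imp hf (hx ▸ hxf)))] with ε hε _
      exact hε
  have hε : ∀ᶠ ε in 𝓝[>] (0 : ℝ), 0 < ε ∧ ε < 1 := Ioo_mem_nhdsGT one_pos
  have hε2 : ∀ᶠ ε in 𝓝[>] (0 : ℝ), 0 < ε ∧ ε < σ := Ioo_mem_nhdsGT hσ0
  have hε3 : ∀ᶠ ε in 𝓝[>] (0 : ℝ), 0 < ε ∧ ε < 1 - σ := Ioo_mem_nhdsGT (by linarith)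
  obtain ⟨ε, hwA, hwB, hbase, ⟨hε0, hε1⟩, hε2, hε3⟩ :=
    ((S.eventually_wingGood h1 h2 h3 h4 h5 (Or.inr rfl) hτ0 hτ1 hτ).and
      ((S.eventually_wingGood h1 h2 h3 h4 h5 (Or.inl rfl) hτ0 hτ1 hτ).and
        (hbase.and (hε.and (hε2.and hε3))))).exists
  have hrootline : ∀ η : ℝ, wingRoot c (b - a) η ε = AffineMap.lineMap a b (σ + η * ε) := by
    intro η
    rw [wingRoot, hσ, AffineMap.lineMap_apply_module, AffineMap.lineMap_apply_module]
    module
  have hline : ∀ p ∈ cseg (a, b), φ (p - c) = 0 := by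
    rintro p ⟨s, t, -, -, hst, rfl⟩
    have es : s = 1 - t := by linarith
    subst es
    have : (1 - t) • a + t • b - c = (t - σ) • (b - a) := by
      rw [hσ, AffineMap.lineMap_apply_module]; module
    simp only [this, map_smul, h2, smul_zero]
  have hwline : ∀ η : ℝ, ∀ p ∈ cseg (wingRoot c (b - a) η ε, wingTip c T.2 (b - a) τ ε),
      p ∈ cseg (a, b) → p = wingRoot c (b - a) η ε := by
    intro η p hp hpab
    obtain ⟨t, -, -, e1, -, e3, -⟩ := wing_coords h1 h2 h3 h4 hp
    rw [hline p hpab] at e1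
    rcases mul_eq_zero.1 e1.symm with h0 | h0
    · exact e3 h0
    · linarith
  have hfun : ∀ η : ℝ, (η = 1 ∨ η = -1) →
      ∀ p ∈ cseg (wingRoot c (b - a) η ε, wingTip c T.2 (b - a) τ ε),
      wingFun η τ ε (φ (p - c)) (ψ (p - c)) = 0 ∧
      0 ≤ wingFun (-η) τ ε (φ (p - c)) (ψ (p - c)) ∧
      (wingFun (-η) τ ε (φ (p - c)) (ψ (p - c)) = 0 → p = wingTip c T.2 (b - a) τ ε) := by
    intro η hη p hp
    obtain ⟨t, ht0, ht1, e1, e2, -, e4⟩ := wing_coords h1 h2 h3 h4 hp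
    obtain ⟨k1, k2⟩ := wingFun_wing (τ := τ) (ε := ε) (η := η)
      (by rcases hη with rfl | rfl <;> ring) t
    rw [e1, e2]
    refine ⟨k1, ?_, fun h0 => e4 ?_⟩
    · rw [k2]
      have : 0 ≤ 1 - t := by linarith
      positivity
    · rw [k2] at h0
      rcases mul_eq_zero.1 h0 with h | h
      · linarith
      · rcases mul_eq_zero.1 h with h | h <;> linarith
  refine ⟨σ + (-1) * ε, σ + 1 * ε, wingRoot c (b - a) (-1) ε, wingRoot c (b - a) 1 ε,
    wingTip c T.2 (b - a) τ ε, by linarith, by linarith, by linarith, hrootline _, hrootline _,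
    ⟨1 / 2, 1 / 2, by norm_num, by norm_num, by norm_num, ?_⟩, hwA, hwB, ?_, ?_, hwline _,
    hwline _, ?_⟩
  · simp only [wingRoot]; module
  · have hv1 : 0 < wingFun 1 τ ε 1 0 := wingFun_T_pos (Or.inl rfl) hτ0 hτ1 hε0 hε1 le_rfl
    have hv2 : 0 < wingFun (-1) τ ε 1 0 := wingFun_T_pos (Or.inr rfl) hτ0 hτ1 hε0 hε1 le_rfl
    have hw : ∀ p ∈ cseg (wingRoot c (b - a) (-1) ε, wingTip c T.2 (b - a) τ ε) ∪
        cseg (wingRoot c (b - a) 1 ε, wingTip c T.2 (b - a) τ ε),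
        0 ≤ wingFun 1 τ ε (φ (p - c)) (ψ (p - c)) ∧
        0 ≤ wingFun (-1) τ ε (φ (p - c)) (ψ (p - c)) ∧
        (wingFun 1 τ ε (φ (p - c)) (ψ (p - c)) = 0 ∨
          wingFun (-1) τ ε (φ (p - c)) (ψ (p - c)) = 0) := by
      rintro p (hp | hp)
      · obtain ⟨k1, k2, -⟩ := hfun (-1) (Or.inr rfl) p hp
        rw [neg_neg] at k2
        exact ⟨k2, k1.ge, Or.inr k1⟩
      · obtain ⟨k1, k2, -⟩ := hfun 1 (Or.inl rfl) p hp
        exact ⟨k1.ge, k2, Or.inl k1⟩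
    -- `Tn` starts at `T.2`, strictly inside both wings. If a later point of it is on a wing,
    -- convexity keeps all earlier points strictly inside. So `Tn` meets the two wings together at
    -- most once, which is what the count at the tip of the finger needs.
    have hlt : ∀ s t : ℝ, 0 ≤ t → t < s → ∀ p q : Plane, p = T.2 + t • (Tn.2 - Tn.1) →
        q = T.2 + s • (Tn.2 - Tn.1) →
        p ∈ cseg (wingRoot c (b - a) (-1) ε, wingTip c T.2 (b - a) τ ε) ∪
          cseg (wingRoot c (b - a) 1 ε, wingTip c T.2 (b - a) τ ε) →
        q ∈ cseg (wingRoot c (b - a) (-1) ε, wingTip c T.2 (b - a) τ ε) ∪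
          cseg (wingRoot c (b - a) 1 ε, wingTip c T.2 (b - a) τ ε) → False := by
      intro s t ht hts p q hp hq hpw hqw
      obtain ⟨p1, p2, p3⟩ := hw p hpw
      obtain ⟨q1, q2, q3⟩ := hw q hqw
      have hs : 0 < s := by linarith
      set r := t / s with hr
      have hr0 : 0 ≤ r := by positivity
      have hr1 : r < 1 := by rw [hr, div_lt_one hs]; exact hts
      have e1 : p - c = (1 - r) • (T.2 - c) + r • (q - c) := by
        have : t = r * s := by rw [hr]; field_simp
        rw [hp, hq, this]; module
      have e2 : φ (p - c) = (1 - r) * 1 + r * φ (q - c) := by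
        rw [e1, map_add, map_smul, map_smul, h1]; rfl
      have e3 : ψ (p - c) = (1 - r) * 0 + r * ψ (q - c) := by
        rw [e1, map_add, map_smul, map_smul, h3]; rfl
      have hlin : ∀ η : ℝ, wingFun η τ ε (φ (p - c)) (ψ (p - c))
          = (1 - r) * wingFun η τ ε 1 0 + r * wingFun η τ ε (φ (q - c)) (ψ (q - c)) := by
        intro η
        rw [e2, e3]; simp only [wingFun]; ring
      have g1 : 0 < wingFun 1 τ ε (φ (p - c)) (ψ (p - c)) := by
        rw [hlin]; have := mul_nonneg hr0 q1
        have : 0 < (1 - r) * wingFun 1 τ ε 1 0 := mul_pos (by linarith) hv1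
        linarith
      have g2 : 0 < wingFun (-1) τ ε (φ (p - c)) (ψ (p - c)) := by
        rw [hlin]; have := mul_nonneg hr0 q2
        have : 0 < (1 - r) * wingFun (-1) τ ε 1 0 := mul_pos (by linarith) hv2
        linarith
      rcases p3 with p3 | p3 <;> linarith
    have hpar : ∀ p ∈ cseg Tn, ∃ t : ℝ, 0 ≤ t ∧ p = T.2 + t • (Tn.2 - Tn.1) := by
      rintro p ⟨s, t, -, ht, hst, rfl⟩
      refine ⟨t, ht, ?_⟩
      have es : s = 1 - t := by linarith
      subst es
      rw [← S.next]; module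
    rintro p ⟨hp, hpw⟩ q ⟨hq, hqw⟩
    obtain ⟨t, ht, hp⟩ := hpar p hp
    obtain ⟨s, hs, hq⟩ := hpar q hq
    rcases lt_trichotomy t s with h | h | h
    · exact (hlt s t ht h p q hp hq hpw hqw).elim
    · rw [hp, hq, h]
    · exact (hlt t s hs h q p hq hp hqw hpw).elim
  · intro p hp hp'
    obtain ⟨k1, -, -⟩ := hfun (-1) (Or.inr rfl) p hp
    exact (hfun 1 (Or.inl rfl) p hp').2.2 k1
  · intro f hf p hpf hp
    by_cases hT : f = T
    · refine ⟨hT, ?_⟩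
      subst hT
      obtain ⟨-, k2⟩ := S.T_coords h1 h3 hpf
      obtain ⟨s, t, hs, ht, hst, rfl⟩ := hp
      have e1 : s • wingRoot c (b - a) (-1) ε + t • wingRoot c (b - a) 1 ε - c
          = (t * ε - s * ε) • (b - a) := by
        have es : s = 1 - t := by linarith
        subst es
        simp only [wingRoot]; module
      simp only [e1, map_smul, h4, smul_eq_mul, mul_one] at k2
      rw [k2, zero_smul] at e1
      exact sub_eq_zero.1 e1
    · exact absurd hpf (hbase f hf hT p hp)

end Slide

theorem cedges_triangle {E : Type*} (b : E) (m : List E) (a A C B : E) :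
    cedges (b :: m ++ [a] ++ [A, C, B])
      = segs (b :: m ++ [a]) ++ [(a, A), (A, C), (C, B), (B, b)] := cedges_arc b m a [A, C, B]

namespace Tri
set_option linter.unusedSectionVars false
variable {b : Plane} {m : List Plane} {a : Plane} {T Tn : Plane × Plane} {c : Plane}
  {α β : ℝ} {A B C : Plane}

section
variable (S : Slide b m a T Tn c) (R : Tri b m a T Tn c α β A B C)
include S

theorem ab_ne : a ≠ b := cedges_ne (e := (a, b)) S.gen.nodup (by simp) Slide.s_mem

include R

theorem A_mem : A ∈ oseg (a, b) := by
  rw [R.hA]; exact lineMap_mem_oseg R.pos (R.lt.trans R.lt_one)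

theorem B_mem : B ∈ oseg (a, b) := by
  rw [R.hB]; exact lineMap_mem_oseg (R.pos.trans R.lt) R.lt_one

theorem B_mem' : B ∈ oseg (A, b) := by
  have h1 : 0 < 1 - α := by have := R.lt; have := R.lt_one; linarith
  have h2 : B = AffineMap.lineMap A b ((β - α) / (1 - α)) := by
    rw [R.hA, R.hB]
    simp only [AffineMap.lineMap_apply_module]
    have e : β = α + (β - α) / (1 - α) * (1 - α) := by field_simp; ring
    set r := (β - α) / (1 - α)
    rw [e]; module
  rw [h2]
  have := R.lt
  have := R.lt_one
  exact lineMap_mem_oseg (div_pos (by linarith) h1) (by rw [div_lt_one h1]; linarith)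

theorem A_ne_B : A ≠ B := by
  intro h
  rw [R.hA, R.hB] at h
  exact R.lt.ne (AffineMap.lineMap_injective ℝ (ab_ne S) h)

theorem A_ne_C : A ≠ C := by
  intro h
  refine A_ne_B S R (R.lineB A ?_ (oseg_subset_cseg _ (A_mem S R)))
  rw [h]; exact right_mem_segment ℝ _ _

theorem B_ne_C : B ≠ C := by
  intro h
  refine A_ne_B S R (R.lineA B ?_ (oseg_subset_cseg _ (B_mem S R))).symm
  rw [h]; exact right_mem_segment ℝ _ _

theorem sub_left : oseg (a, A) ⊆ oseg (a, b) := fun p hp =>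
  (mem_oseg_split (A_mem S R) p).2 (Or.inl hp)

theorem sub_mid : oseg (A, b) ⊆ oseg (a, b) := fun p hp =>
  (mem_oseg_split (A_mem S R) p).2 (Or.inr (Or.inr hp))

theorem sub_right' : oseg (B, b) ⊆ oseg (A, b) := fun p hp =>
  (mem_oseg_split (B_mem' S R) p).2 (Or.inr (Or.inr hp))

theorem sub_right : oseg (B, b) ⊆ oseg (a, b) := (sub_right' S R).trans (sub_mid S R)

theorem left_right {p : Plane} (h1 : p ∈ oseg (a, A)) (h2 : p ∈ oseg (B, b)) : False :=
  notMem_oseg_left_right (ab_ne S) (A_mem S R) h1 (sub_right' S R h2)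

theorem wing_line {p : Plane} (h : p ∈ oseg (A, C)) : p ∉ cseg (a, b) := fun h' => by
  have := R.lineA p (oseg_subset_cseg _ h) h'
  subst this
  exact left_notMem_oseg (A_ne_C S R) h

theorem wing_line' {p : Plane} (h : p ∈ oseg (C, B)) : p ∉ cseg (a, b) := fun h' => by
  rw [← oseg_swap] at h
  have := R.lineB p (oseg_subset_cseg _ h) h'
  subst this
  exact left_notMem_oseg (B_ne_C S R) h

theorem wing_wing {p : Plane} (h : p ∈ oseg (A, C)) : p ∉ oseg (C, B) := fun h' => by
  rw [← oseg_swap] at h'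
  have := R.inter p (oseg_subset_cseg _ h) (oseg_subset_cseg _ h')
  subst this
  exact right_notMem_oseg (A_ne_C S R) h

/-- The cover numbers of the new polygon away from the wings. -/
theorem cov_le_of_notMem {p : Plane} (h1 : p ∉ oseg (A, C)) (h2 : p ∉ oseg (C, B)) :
    cov [(a, A), (A, C), (C, B), (B, b)] p + cov [(A, B)] p ≤ cov [(a, b)] p := by
  have hAb : A ≠ b := by
    intro h; have := A_mem S R; rw [h] at this; exact right_notMem_oseg (ab_ne S) this
  have k1 := cov_split (ab_ne S) (A_mem S R) [] p
  have k2 := cov_split hAb (B_mem' S R) [] p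
  rw [cov_cons (a, A)] at k1
  rw [k1, cov_cons, cov_cons_of_notMem h1, cov_cons_of_notMem h2, k2, cov_cons (A, B)]
  rw [cov_cons (A, B), cov_nil]
  omega

/-- A wing meets the edge from `a` to `b` only in its root, the other wing only in the tip, and
avoids the old crossings. So inside a wing at most one other edge passes. -/
theorem wing_cov {p : Plane} (h : p ∈ oseg (A, C) ∨ p ∈ oseg (C, B)) :
    cov [(a, A), (A, C), (C, B), (B, b)] p = 1 ∧ p ∉ crs (b :: m ++ [a]) ∧
      cov (segs (b :: m ++ [a])) p ≤ 1 := by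
  have hp : p ∉ cseg (a, b) := h.elim (wing_line S R) (wing_line' S R)
  have hp1 : p ∉ oseg (a, A) := fun h => hp (oseg_subset_cseg _ (sub_left S R h))
  have hp2 : p ∉ oseg (B, b) := fun h => hp (oseg_subset_cseg _ (sub_right S R h))
  have hc : p ∉ crs (b :: m ++ [a]) := by
    rcases h with h | h
    · exact fun h' => R.wingA.avoid p (Or.inl h') (oseg_subset_cseg _ h)
    · rw [← oseg_swap] at h
      exact fun h' => R.wingB.avoid p (Or.inl h') (oseg_subset_cseg _ h)
  refine ⟨?_, hc, ?_⟩
  · rw [cov_cons_of_notMem hp1]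
    rcases h with h | h
    · rw [cov_cons_of_mem h, cov_cons_of_notMem (wing_wing S R h), cov_cons_of_notMem hp2, cov_nil]
    · have h' : p ∉ oseg (A, C) := fun h' => wing_wing S R h' h
      rw [cov_cons_of_notMem h', cov_cons_of_mem h, cov_cons_of_notMem hp2, cov_nil]
  · rw [crs, Set.mem_ofPred_eq, cedges_last, cov_append] at hc
    omega

theorem gen : Gen 2 (b :: m ++ [a] ++ [A, C, B]) := by
  have hA := A_mem S R
  have hB := B_mem S R
  have hU := S.gen
  have hAv : A ∉ b :: m ++ [a] := fun h => hU.vertex_notMem A h _ Slide.s_mem hA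
  have hBv : B ∉ b :: m ++ [a] := fun h => hU.vertex_notMem B h _ Slide.s_mem hB
  have hCv : C ∉ b :: m ++ [a] := fun h => R.wingA.avoid C (Or.inr h) (right_mem_segment ℝ _ _)
  have hAB := A_ne_B S R
  have hAC := A_ne_C S R
  have hBC := B_ne_C S R
  have haA : a ≠ A := by rintro rfl; exact hAv (by simp)
  have hBb : B ≠ b := by rintro rfl; exact hBv (by simp)
  refine ⟨?_, ?_, fun p => ?_⟩
  · rw [List.nodup_append]
    refine ⟨hU.nodup, by simp [hAB, hAC, hBC.symm], ?_⟩
    intro u hu w hw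
    simp only [List.mem_cons, List.not_mem_nil, or_false] at hw
    rintro rfl
    rcases hw with rfl | rfl | rfl
    · exact hAv hu
    · exact hCv hu
    · exact hBv hu
  · intro v hv e he
    rw [cedges_triangle] at he
    have he' : e ∈ segs (b :: m ++ [a]) ∨ e = (a, A) ∨ e = (A, C) ∨ e = (C, B) ∨ e = (B, b) := by
      rw [List.mem_append] at he; simpa using he
    have hv' : v ∈ b :: m ++ [a] ∨ v = A ∨ v = C ∨ v = B := by
      rw [List.mem_append] at hv; simpa using hv
    rcases hv' with hv | rfl | rfl | rfl
    · rcases he' with he | rfl | rfl | rfl | rfl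
      · exact hU.vertex_notMem v hv e (Slide.mem_cedges he)
      · exact fun h => hU.vertex_notMem v hv _ Slide.s_mem (sub_left S R h)
      · exact fun h => R.wingA.avoid v (Or.inr hv) (oseg_subset_cseg _ h)
      · rw [← oseg_swap]
        exact fun h => R.wingB.avoid v (Or.inr hv) (oseg_subset_cseg _ h)
      · exact fun h => hU.vertex_notMem v hv _ Slide.s_mem (sub_right S R h)
    · rcases he' with he | rfl | rfl | rfl | rfl
      · exact fun h => R.wingA.root e he (oseg_subset_cseg _ h)
      · exact right_notMem_oseg haA
      · exact left_notMem_oseg hAC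
      · exact fun h => wing_line' S R h (oseg_subset_cseg _ hA)
      · intro h
        have := sub_right' S R h
        refine left_notMem_oseg ?_ this
        rintro rfl
        exact hAv (by simp)
    · rcases he' with he | rfl | rfl | rfl | rfl
      · exact fun h => R.wingA.tip e he (oseg_subset_cseg _ h)
      · exact fun h => hAC (R.lineA v (right_mem_segment ℝ _ _)
          (oseg_subset_cseg _ (sub_left S R h))).symm
      · exact right_notMem_oseg hAC
      · exact left_notMem_oseg hBC.symm
      · exact fun h => hAC (R.lineA v (right_mem_segment ℝ _ _)
          (oseg_subset_cseg _ (sub_right S R h))).symm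
    · rcases he' with he | rfl | rfl | rfl | rfl
      · exact fun h => R.wingB.root e he (oseg_subset_cseg _ h)
      · exact fun h => notMem_oseg_left_right (ab_ne S) hA h (B_mem' S R)
      · exact fun h => wing_line S R h (oseg_subset_cseg _ hB)
      · exact right_notMem_oseg hBC.symm
      · exact left_notMem_oseg hBb
  · rw [cedges_triangle, cov_append]
    by_cases h : p ∈ oseg (A, C) ∨ p ∈ oseg (C, B)
    · obtain ⟨h1, -, h2⟩ := wing_cov S R h
      omega
    · push Not at h
      have h1 := cov_le_of_notMem S R h.1 h.2
      have h2 := hU.cov_le p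
      rw [cedges_last, cov_append] at h2
      omega

theorem subsingleton_wingA {f : Plane × Plane} (hf : f ∈ segs (b :: m ++ [a])) :
    (cseg f ∩ cseg (A, C)).Subsingleton := by
  by_cases h : f = Tn
  · subst h
    exact R.next.anti (Set.inter_subset_inter_right _ Set.subset_union_left)
  · exact R.wingA.subsingleton f hf h

theorem subsingleton_wingB {f : Plane × Plane} (hf : f ∈ segs (b :: m ++ [a])) :
    (cseg f ∩ cseg (B, C)).Subsingleton := by
  by_cases h : f = Tn
  · subst h
    exact R.next.anti (Set.inter_subset_inter_right _ Set.subset_union_right)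
  · exact R.wingB.subsingleton f hf h

/-- Away from the wings nothing new is covered, and each kept edge contributes at most one crossing
per wing. -/
theorem fin : (crs (b :: m ++ [a] ++ [A, C, B])).Finite := by
  have hsub : crs (b :: m ++ [a] ++ [A, C, B]) ⊆ crs (b :: m ++ [a]) ∪
      ⋃ f ∈ {f | f ∈ segs (b :: m ++ [a])}, (cseg f ∩ cseg (A, C)) ∪ (cseg f ∩ cseg (B, C)) := by
    intro p hp
    rw [crs, Set.mem_ofPred_eq, cedges_triangle, cov_append] at hp
    by_cases h : p ∈ oseg (A, C) ∨ p ∈ oseg (C, B)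
    · right
      obtain ⟨h1, -, -⟩ := wing_cov S R h
      obtain ⟨f, hf, hpf⟩ := cov_pos_iff.1 (by omega : 1 ≤ cov (segs (b :: m ++ [a])) p)
      simp only [Set.mem_iUnion]
      refine ⟨f, hf, ?_⟩
      rw [← oseg_swap (C, B)] at h
      rcases h with h | h
      · exact Or.inl ⟨oseg_subset_cseg _ hpf, oseg_subset_cseg _ h⟩
      · exact Or.inr ⟨oseg_subset_cseg _ hpf, oseg_subset_cseg _ h⟩
    · left
      push Not at h
      have h1 := cov_le_of_notMem S R h.1 h.2
      rw [crs, Set.mem_ofPred_eq, cedges_last, cov_append]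
      omega
  refine (S.fin.union ?_).subset hsub
  refine Set.Finite.biUnion (List.finite_toSet _) fun f hf => ?_
  exact ((subsingleton_wingA S R hf).finite).union (subsingleton_wingB S R hf).finite

end
end Tri

/-! ### Sliding a crossing past a vertex: the move in space -/

theorem simple_of_planar {V : List Space} (h3 : 3 ≤ V.length) (hg : Gen 2 (pl V))
    (h : ∀ e ∈ cedges V, ∀ f ∈ cedges V, e ≠ f → ∀ x ∈ oseg e, x ∈ oseg f → False) :
    Simple V := by
  have hnd : V.Nodup := List.Nodup.of_map _ hg.nodup
  refine ⟨h3, hnd, ?_, ?_⟩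
  · intro v hv e he hve
    exact hg.vertex_notMem v.1 (List.mem_map_of_mem hv) _ (Diagram.pe_mem he) (mem_oseg_pe hve)
  · intro p
    by_contra hp
    obtain ⟨e, he, f, hf, hef, h1, h2⟩ := (two_le_cov (nodup_cedges hnd)).1 (by omega :
      2 ≤ cov (cedges V) p)
    exact h e he f hf hef p h1 h2

/-- The root `R` does not project onto `f`, so a crossing of the projections sits at a parameter `t
> 0`. There the lifted wing has height `(1 - t) * R.2 + t * H`, which grows with `H`. -/
theorem eventually_above {R : Space} {C : Plane} {f : Space × Space}
    (hss : (cseg (pe f) ∩ cseg (R.1, C)).Subsingleton) (hR : R.1 ∉ cseg (pe f)) (hRC : R.1 ≠ C) :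
    ∀ᶠ H : ℝ in atTop, ∀ x ∈ cseg (R, ((C, H) : Space)), ∀ y ∈ cseg f, x.1 = y.1 → y.2 < x.2 := by
  have hpar : ∀ (H : ℝ), ∀ x ∈ cseg (R, ((C, H) : Space)), ∃ t : ℝ, 0 ≤ t ∧ t ≤ 1 ∧
      x.1 = AffineMap.lineMap R.1 C t ∧ x.2 = (1 - t) * R.2 + t * H := by
    rintro H x ⟨s, t, hs, ht, hst, rfl⟩
    have es : s = 1 - t := by linarith
    subst es
    refine ⟨t, ht, by linarith, ?_, by simp⟩
    rw [AffineMap.lineMap_apply_module]; rfl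
  by_cases hn : (cseg (pe f) ∩ cseg (R.1, C)).Nonempty
  · obtain ⟨p, hpf, hp⟩ := hn
    have hp' := hp
    rw [cseg, segment_eq_image_lineMap] at hp'
    obtain ⟨t, ⟨ht0, -⟩, rfl⟩ := hp'
    have ht : 0 < t := by
      rcases ht0.eq_or_lt with rfl | h
      · exact absurd hpf (by simpa using hR)
      · exact h
    obtain ⟨z, -, hz⟩ := (isCompact_cseg f).exists_isMaxOn ⟨f.1, left_mem_segment ℝ _ _⟩
      (continuous_snd.continuousOn (s := cseg f))
    filter_upwards [eventually_gt_atTop ((z.2 - (1 - t) * R.2) / t)] with H hH x hx y hy hxy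
    obtain ⟨t', ht0', ht1', e1, e2⟩ := hpar H x hx
    have h1 : x.1 ∈ cseg (pe f) ∩ cseg (R.1, C) :=
      ⟨hxy ▸ mem_cseg_pe hy, e1 ▸ lineMap_mem_cseg ht0' ht1'⟩
    have h2 := hss h1 ⟨hpf, hp⟩
    rw [e1] at h2
    have h3 := AffineMap.lineMap_injective ℝ hRC h2
    subst h3
    rw [div_lt_iff₀ ht] at hH
    have h4 := isMaxOn_iff.1 hz y hy
    rw [e2]
    linarith
  · refine Eventually.of_forall fun H x hx y hy hxy => (hn ⟨x.1, hxy ▸ mem_cseg_pe hy, ?_⟩).elim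
    obtain ⟨t', ht0', ht1', e1, -⟩ := hpar H x hx
    exact e1 ▸ lineMap_mem_cseg ht0' ht1'

/-- The crossing of the edge from `a` to `b`, the upper one, with the edge `T` can be slid past
the end of `T`. -/
theorem Diagram.exists_slide_over {b : Space} {m : List Space} {a : Space} {T Tn : Space × Space}
    {c : Plane} (D : Diagram (b :: m ++ [a])) (hT : T ∈ segs (b :: m ++ [a]))
    (hTn : Tn ∈ segs (b :: m ++ [a])) (hn : Tn.1 = T.2) (hcT : c ∈ oseg (pe T))
    (hcs : c ∈ oseg (pe (a, b)))
    (ho : ∀ x ∈ cseg (a, b), ∀ y ∈ cseg T, x.1 = c → y.1 = c → y.2 ≤ x.2) :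
    ∃ α β, ∃ A B C : Space, Tri b.1 (pl m) a.1 (pe T) (pe Tn) c α β A.1 B.1 C.1 ∧
      Diagram (b :: m ++ [a] ++ [A, C, B]) ∧ LEq (b :: m ++ [a]) (b :: m ++ [a] ++ [A, C, B]) := by
  have hpl : pl (b :: m ++ [a]) = b.1 :: pl m ++ [a.1] := pl_last b m a
  have hseg : ∀ {f}, f ∈ segs (b :: m ++ [a]) → pe f ∈ segs (b.1 :: pl m ++ [a.1]) := by
    intro f hf
    rw [← hpl, segs_pl]
    exact List.mem_map_of_mem hf
  have S : Slide b.1 (pl m) a.1 (pe T) (pe Tn) c :=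
    ⟨hpl ▸ D.gen, hpl ▸ D.fin, hseg hT, hseg hTn, by
      change Tn.1.1 = T.2.1
      rw [hn], hcT, hcs⟩
  obtain ⟨α, β, A', B', C', R⟩ := S.exists_tri
  have hsc : ∀ {f}, f ∈ segs (b :: m ++ [a]) → f ∈ cedges (b :: m ++ [a]) := fun hf => by
    rw [cedges_last]; exact List.mem_append_left _ hf
  have habm : (a, b) ∈ cedges (b :: m ++ [a]) := by rw [cedges_last]; simp
  have hab : a ≠ b := D.simple.ne habm
  obtain ⟨A, hA⟩ : ∃ A : Space, A = AffineMap.lineMap a b α := ⟨_, rfl⟩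
  obtain ⟨B, hB⟩ : ∃ B : Space, B = AffineMap.lineMap a b β := ⟨_, rfl⟩
  have hA1 : A' = A.1 := by
    rw [R.hA, hA, AffineMap.lineMap_apply_module, AffineMap.lineMap_apply_module]; rfl
  have hB1 : B' = B.1 := by
    rw [R.hB, hB, AffineMap.lineMap_apply_module, AffineMap.lineMap_apply_module]; rfl
  have hAm : A ∈ oseg (a, b) := by
    rw [hA]; exact lineMap_mem_oseg R.pos (R.lt.trans R.lt_one)
  have hBm : B ∈ oseg (a, b) := by
    rw [hB]; exact lineMap_mem_oseg (R.pos.trans R.lt) R.lt_one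
  have hBm' : B ∈ oseg (A, b) := by
    rcases (mem_oseg_split hAm B).1 hBm with h | h | h
    · exfalso
      have h' := mem_oseg_pe h
      exact notMem_oseg_left_right (Tri.ab_ne S) (Tri.A_mem S R) (by rw [hA1]; exact h')
        (by rw [← hB1]; exact Tri.B_mem' S R)
    · exfalso
      apply Tri.A_ne_B S R
      rw [hA1, hB1, h]
    · exact h
  subst hA1 hB1
  -- The tip is lifted so high that both wings pass over every kept edge that they cross.
  have hH : ∀ᶠ H : ℝ in atTop, ∀ f ∈ {f | f ∈ segs (b :: m ++ [a])},
      (∀ x ∈ cseg (A, ((C', H) : Space)), ∀ y ∈ cseg f, x.1 = y.1 → y.2 < x.2) ∧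
      (∀ x ∈ cseg (B, ((C', H) : Space)), ∀ y ∈ cseg f, x.1 = y.1 → y.2 < x.2) := by
    rw [eventually_all_finite (List.finite_toSet _)]
    intro f hf
    exact (eventually_above (Tri.subsingleton_wingA S R (hseg hf)) (R.wingA.root _ (hseg hf))
      (Tri.A_ne_C S R)).and (eventually_above (Tri.subsingleton_wingB S R (hseg hf))
      (R.wingB.root _ (hseg hf)) (Tri.B_ne_C S R))
  obtain ⟨H, hHH⟩ := hH.exists
  obtain ⟨C, hC⟩ : ∃ C : Space, C = (C', H) := ⟨_, rfl⟩
  have hC1 : C' = C.1 := by rw [hC]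
  rw [← hC] at hHH
  subst hC1
  have hplV : pl (b :: m ++ [a] ++ [A, C, B]) = b.1 :: pl m ++ [a.1] ++ [A.1, C.1, B.1] := by
    rw [pl_append, hpl]; rfl
  have hgen : Gen 2 (pl (b :: m ++ [a] ++ [A, C, B])) := hplV ▸ Tri.gen S R
  -- two different edges that cross, one of them a wing
  have hwing : ∀ e f, (e = (A, C) ∨ e = (C, B)) → f ∈ cedges (b :: m ++ [a] ++ [A, C, B]) →
      e ≠ f → ∀ p, p ∈ oseg (pe e) → p ∈ oseg (pe f) → f ∈ segs (b :: m ++ [a]) := by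
    intro e f he hf hef p hpe hpf
    rw [cedges_triangle] at hf
    have hf' : f ∈ segs (b :: m ++ [a]) ∨ f = (a, A) ∨ f = (A, C) ∨ f = (C, B) ∨ f = (B, b) := by
      rw [List.mem_append] at hf; simpa using hf
    have hp : p ∉ cseg (a.1, b.1) := by
      rcases he with rfl | rfl
      · exact Tri.wing_line S R hpe
      · exact Tri.wing_line' S R hpe
    rcases hf' with hf | rfl | rfl | rfl | rfl
    · exact hf
    · exact absurd (oseg_subset_cseg _ (Tri.sub_left S R hpf)) hp
    · rcases he with rfl | rfl
      · exact absurd rfl hef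
      · exact absurd hpe (Tri.wing_wing S R hpf)
    · rcases he with rfl | rfl
      · exact absurd hpf (Tri.wing_wing S R hpe)
      · exact absurd rfl hef
    · exact absurd (oseg_subset_cseg _ (Tri.sub_right S R hpf)) hp
  have habove : ∀ e f, (e = (A, C) ∨ e = (C, B)) → f ∈ segs (b :: m ++ [a]) →
      ∀ x ∈ cseg e, ∀ y ∈ cseg f, x.1 = y.1 → y.2 < x.2 := by
    intro e f he hf x hx y hy hxy
    rcases he with rfl | rfl
    · exact (hHH f hf).1 x hx y hy hxy
    · rw [← cseg_swap] at hx
      exact (hHH f hf).2 x hx y hy hxy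
  have hold : ∀ e, e ∈ cedges (b :: m ++ [a] ++ [A, C, B]) → (e = (A, C) ∨ e = (C, B)) ∨
      (∃ d ∈ cedges (b :: m ++ [a]), oseg e ⊆ oseg d ∧ (e ≠ d → d = (a, b) ∧ (e = (a, A) ∨
        e = (B, b)))) := by
    intro e he
    rw [cedges_triangle] at he
    have he' : e ∈ segs (b :: m ++ [a]) ∨ e = (a, A) ∨ e = (A, C) ∨ e = (C, B) ∨ e = (B, b) := by
      rw [List.mem_append] at he; simpa using he
    rcases he' with he | rfl | rfl | rfl | rfl
    · exact Or.inr ⟨e, hsc he, subset_rfl, fun h => absurd rfl h⟩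
    · exact Or.inr ⟨(a, b), habm, fun p hp => (mem_oseg_split hAm p).2 (Or.inl hp),
        fun _ => ⟨rfl, Or.inl rfl⟩⟩
    · exact Or.inl (Or.inl rfl)
    · exact Or.inl (Or.inr rfl)
    · exact Or.inr ⟨(a, b), habm, fun p hp => (mem_oseg_split hBm p).2 (Or.inr (Or.inr hp)),
        fun _ => ⟨rfl, Or.inr rfl⟩⟩
  have hsimple : Simple (b :: m ++ [a] ++ [A, C, B]) := by
    refine simple_of_planar (by simp) hgen ?_
    intro e he f hf hef x hxe hxf
    rcases hold e he with h1 | ⟨d, hd, hd1, hd2⟩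
    · have h2 := hwing e f h1 hf hef x.1 (mem_oseg_pe hxe) (mem_oseg_pe hxf)
      exact lt_irrefl _ (habove e f h1 h2 x (oseg_subset_cseg _ hxe) x (oseg_subset_cseg _ hxf) rfl)
    rcases hold f hf with h1 | ⟨d', hd', hd1', hd2'⟩
    · have h2 := hwing f e h1 he hef.symm x.1 (mem_oseg_pe hxf) (mem_oseg_pe hxe)
      exact lt_irrefl _ (habove f e h1 h2 x (oseg_subset_cseg _ hxf) x (oseg_subset_cseg _ hxe) rfl)
    by_cases hdd : d = d'
    · subst hdd
      have hnot : ∀ e f : Space × Space, (e = (a, A) ∨ e = (B, b)) → f = (a, b) →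
          f ∈ cedges (b :: m ++ [a] ++ [A, C, B]) → False := by
        rintro e f - rfl hf
        have h1 := cedges_fst_inj (List.Nodup.of_map _ hgen.nodup) hf
          (by rw [cedges_triangle]; simp : (a, A) ∈ cedges (b :: m ++ [a] ++ [A, C, B])) rfl
        have h2 : b = A := congrArg Prod.snd h1
        have := Tri.A_mem S R
        rw [← h2] at this
        exact right_notMem_oseg (Tri.ab_ne S) this
      by_cases h1 : e = d
      · subst h1
        obtain ⟨k1, k2⟩ := hd2' hef.symm
        exact hnot f e k2 k1 he
      · obtain ⟨k1, k2⟩ := hd2 h1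
        by_cases h2 : f = d
        · exact hnot e f k2 (h2.trans k1) hf
        · obtain ⟨-, k3⟩ := hd2' h2
          rcases k2 with rfl | rfl <;> rcases k3 with rfl | rfl
          · exact hef rfl
          · exact Tri.left_right S R (mem_oseg_pe hxe) (mem_oseg_pe hxf)
          · exact Tri.left_right S R (mem_oseg_pe hxf) (mem_oseg_pe hxe)
          · exact hef rfl
    · exact D.simple.2.disjoint_of_one hd hd' hdd (hd1 hxe) (hd1' hxf)
  have hD : Diagram (b :: m ++ [a] ++ [A, C, B]) := ⟨hsimple, hgen, hplV ▸ Tri.fin S R⟩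
  refine ⟨α, β, A, B, C, R, hD, ?_⟩
  -- the subdivided polygon
  have hAc : A.1 ∉ crs (pl (b :: m ++ [a])) := by
    rw [hpl]
    exact fun h => R.wingA.avoid _ (Or.inl h) (left_mem_segment ℝ _ _)
  have hBc : B.1 ∉ crs (pl (b :: m ++ [a])) := by
    rw [hpl]
    exact fun h => R.wingB.avoid _ (Or.inl h) (left_mem_segment ℝ _ _)
  obtain ⟨D1, c1⟩ := D.subdivide hAm hAc
  have L1 := LEq.subdivide D.simple hAm
  obtain ⟨D2, c2⟩ := Diagram.subdivide (b := b) (m := m ++ [a]) (a := A) (x := B)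
    (by simpa using D1) hBm' (by
      have : b :: (m ++ [a]) ++ [A] = b :: m ++ [a] ++ [A] := by simp
      rw [this, c1]; exact hBc)
  have L2 := LEq.subdivide (b := b) (m := m ++ [a]) (a := A) (x := B)
    (by simpa using D1.simple) hBm'
  have e1 : b :: (m ++ [a]) ++ [A] = b :: m ++ [a] ++ [A] := by simp
  rw [e1] at D2 L2
  have D3 : Diagram (B :: (b :: m ++ [a]) ++ [A] ++ []) := by
    rw [List.append_nil]; exact D2.rotate
  have L3 : LEq (b :: m ++ [a] ++ [A] ++ [B]) (B :: (b :: m ++ [a]) ++ [A] ++ []) := by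
    rw [List.append_nil]; exact LEq.rotate D2.simple
  have e2 : b :: m ++ [a] ++ [A, C, B] = (b :: m ++ [a] ++ [A, C]) ++ [B] := by simp
  have e3 : B :: (b :: m ++ [a]) ++ [A] ++ [C] = [B] ++ (b :: m ++ [a] ++ [A, C]) := by simp
  have D4 : Diagram (B :: (b :: m ++ [a]) ++ [A] ++ [C]) := by
    rw [e3]
    rw [e2] at hD
    exact hD.rotate
  have L4 : LEq (b :: m ++ [a] ++ [A, C, B]) (B :: (b :: m ++ [a]) ++ [A] ++ [C]) := by
    rw [e3, e2]
    rw [e2] at hsimple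
    exact LEq.rotate hsimple
  refine ((L1.trans L2).trans L3).trans (LEq.trans ?_ L4.symm)
  have hperm4 : (cedges (B :: (b :: m ++ [a]) ++ [A] ++ [C])).Perm
      (cedges (b :: m ++ [a] ++ [A, C, B])) := by
    rw [e3, e2]; exact cedges_append_perm _ _
  -- After subdivision at `A` and `B`, the edge `AB` crosses only `T`, at `c`, and is the upper
  -- strand there; the wings are high by the choice of `H`. So both `AB` and `A, C, B` lie over
  -- everything else.
  refine LEq.overpass D3 D4 ?_ ?_
  · intro e he f hf x hx y hy hxy
    have he' : e = (A, B) := by simpa using he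
    subst he'
    have heV : (A, B) ∈ cedges (B :: (b :: m ++ [a]) ++ [A] ++ []) := by
      rw [cedges_arc]; simp
    rcases D3.over heV hf hx hy hxy with h1 | ⟨hef, h1, h2⟩
    · rw [h1]
    · have hf' : f ∈ segs (b :: m ++ [a]) ∨ f = (B, b) ∨ f = (a, A) ∨ f = (A, B) := by
        rw [cedges_arc] at hf
        have e4 : B :: (b :: m ++ [a]) ++ [A] = B :: b :: m ++ a :: [A] := by simp
        rw [e4, segs_append_cons_cons] at hf
        have e5 : B :: b :: m ++ [a] = B :: b :: (m ++ [a]) := by simp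
        rw [e5, segs_cons_cons] at hf
        simp at hf ⊢
        tauto
      rcases hf' with hf' | rfl | rfl | rfl
      · have h3 := R.base _ (hseg hf') _ (oseg_subset_cseg _ h2) (oseg_subset_cseg _ h1)
        have h4 : f = T := D.pe_inj (hsc hf') (hsc hT) h3.1
        subst h4
        refine ho x ?_ y hy h3.2 (hxy ▸ h3.2)
        exact (convex_segment a b).segment_subset (oseg_subset_cseg _ hAm)
          (oseg_subset_cseg _ hBm) hx
      · exfalso
        refine notMem_oseg_left_right ?_ (Tri.B_mem' S R) h1 h2
        rintro h
        have := Tri.A_mem S R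
        rw [h] at this
        exact right_notMem_oseg (Tri.ab_ne S) this
      · exfalso
        refine notMem_oseg_left_right (Tri.ab_ne S) (Tri.A_mem S R) h2 ?_
        exact (mem_oseg_split (Tri.B_mem' S R) _).2 (Or.inl h1)
      · exact absurd rfl hef
  · intro e he f hf x hx y hy hxy
    have he' : e = (A, C) ∨ e = (C, B) := by simpa using he
    have heV : e ∈ cedges (B :: (b :: m ++ [a]) ++ [A] ++ [C]) := by
      rw [cedges_arc]
      exact List.mem_append_right _ he
    rcases D4.over heV hf hx hy hxy with h1 | ⟨hef, h1, h2⟩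
    · rw [h1]
    · exact (habove e f he' (hwing e f he' (hperm4.subset hf) hef _ h1 h2) x hx y hy hxy).le

/-- A crossing of the edge from `a` to `b` with the edge `T` can be slid past the end of `T`. -/
theorem Diagram.exists_slide {b : Space} {m : List Space} {a : Space} {T Tn : Space × Space}
    {c : Plane} (D : Diagram (b :: m ++ [a])) (hT : T ∈ segs (b :: m ++ [a]))
    (hTn : Tn ∈ segs (b :: m ++ [a])) (hn : Tn.1 = T.2) (hcT : c ∈ oseg (pe T))
    (hcs : c ∈ oseg (pe (a, b))) :
    ∃ α β, ∃ A B C : Space, Tri b.1 (pl m) a.1 (pe T) (pe Tn) c α β A.1 B.1 C.1 ∧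
      Diagram (b :: m ++ [a] ++ [A, C, B]) ∧ LEq (b :: m ++ [a]) (b :: m ++ [a] ++ [A, C, B]) := by
  have hsc : ∀ {f}, f ∈ segs (b :: m ++ [a]) → f ∈ cedges (b :: m ++ [a]) := fun hf => by
    rw [cedges_last]; exact List.mem_append_left _ hf
  have habm : (a, b) ∈ cedges (b :: m ++ [a]) := by rw [cedges_last]; simp
  have hcT' := hcT
  have hcs' := hcs
  rw [oseg_pe] at hcT' hcs'
  obtain ⟨y₀, hy₀, hy₀c⟩ := hcT'
  obtain ⟨x₀, hx₀, hx₀c⟩ := hcs'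
  have hux : ∀ x ∈ cseg (a, b), x.1 = c → x = x₀ := fun x hx hxc =>
    fst_injOn_cseg (D.pe_ne habm) hx (oseg_subset_cseg _ hx₀) (hxc.trans hx₀c.symm)
  have huy : ∀ y ∈ cseg T, y.1 = c → y = y₀ := fun y hy hyc =>
    fst_injOn_cseg (D.pe_ne (hsc hT)) hy (oseg_subset_cseg _ hy₀) (hyc.trans hy₀c.symm)
  rcases le_total y₀.2 x₀.2 with h | h
  · refine D.exists_slide_over hT hTn hn hcT hcs fun x hx y hy hxc hyc => ?_
    rw [hux x hx hxc, huy y hy hyc]; exact h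
  -- The edge from `a` to `b` is the lower strand: slide it in the mirror image, where it is the
  -- upper one, and reflect back.
  · have em : (b :: m ++ [a]).map mir = mir b :: m.map mir ++ [mir a] := by simp
    have D' := D.mirror
    rw [em] at D'
    have hmem : ∀ {f}, f ∈ segs (b :: m ++ [a]) →
        Prod.map mir mir f ∈ segs (mir b :: m.map mir ++ [mir a]) := by
      intro f hf
      rw [← em, segs_map]
      exact List.mem_map_of_mem hf
    obtain ⟨α, β, A, B, C, R, hD, hL⟩ := Diagram.exists_slide_over (T := Prod.map mir mir T)
      (Tn := Prod.map mir mir Tn) (c := c) D' (hmem hT) (hmem hTn) (congrArg mir hn) hcT hcs (by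
        intro x hx y hy hxc hyc
        have hx' : mir x ∈ cseg (a, b) := by
          have h1 : mir x ∈ cseg (Prod.map mir mir (mir a, mir b)) := by
            rw [cseg_map]; exact ⟨x, hx, rfl⟩
          simpa using h1
        have hy' : mir y ∈ cseg T := by
          have h1 : mir y ∈ cseg (Prod.map mir mir (Prod.map mir mir T)) := by
            rw [cseg_map]; exact ⟨y, hy, rfl⟩
          rwa [show Prod.map mir mir (Prod.map mir mir T) = T from
            Prod.ext (mir_mir T.1) (mir_mir T.2)] at h1
        have h1 := congrArg Prod.snd (hux _ hx' hxc)
        have h2 := congrArg Prod.snd (huy _ hy' hyc)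
        rw [mir_snd] at h1 h2
        linarith)
    have ep : pl (m.map mir) = pl m := pl_mir m
    have en : (mir b :: m.map mir ++ [mir a] ++ [A, C, B]).map mir
        = b :: m ++ [a] ++ [mir A, mir C, mir B] := by
      simp only [List.map_append, List.map_cons, map_mir_map_mir, mir_mir, List.map_nil]
    have eo : (mir b :: m.map mir ++ [mir a]).map mir = b :: m ++ [a] := by
      rw [← em, map_mir_map_mir]
    refine ⟨α, β, mir A, mir B, mir C, ?_, ?_, ?_⟩
    · rw [ep] at R
      exact R
    · rw [← en]; exact hD.mirror
    · have := hL.mirror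
      rwa [en, eo] at this

/-! ### Two arcs: pushing self-crossings of the second one off its end -/

/-- The projected edges of an open polygonal path. -/
def pes (l : List Space) : List (Plane × Plane) := (segs l).map pe

/-- The self-crossings of the projection of an open path. -/
def selfX (l : List Space) : Set Plane := {p | 2 ≤ cov (pes l) p}

/-- The crossings of the projections of two open paths. -/
def mutX (l l' : List Space) : Set Plane := {p | 1 ≤ cov (pes l) p ∧ 1 ≤ cov (pes l') p}

theorem pes_cons_cons (a b : Space) (l : List Space) :
    pes (a :: b :: l) = pe (a, b) :: pes (b :: l) := rfl

theorem mem_pes {l : List Space} {e : Plane × Plane} : e ∈ pes l ↔ ∃ f ∈ segs l, pe f = e :=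
  List.mem_map

theorem one_le_cov_pes {l : List Space} {p : Plane} :
    1 ≤ cov (pes l) p ↔ ∃ e ∈ segs l, p ∈ oseg (pe e) := by
  rw [cov_pos_iff]
  constructor
  · rintro ⟨e, he, hp⟩
    obtain ⟨f, hf, rfl⟩ := mem_pes.1 he
    exact ⟨f, hf, hp⟩
  · rintro ⟨f, hf, hp⟩
    exact ⟨_, mem_pes.2 ⟨f, hf, rfl⟩, hp⟩

theorem cov_cedges_pl (x : Space) (A : List Space) (y : Space) (B : List Space) (p : Plane) :
    cov (cedges (pl (x :: A ++ y :: B))) p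
      = cov (pes (x :: A ++ [y])) p + cov (pes (y :: B ++ [x])) p := by
  rw [cedges_pl, cedges_cons_append_cons, List.map_append, cov_append]; rfl

theorem mutX_subset_crs (x : Space) (A : List Space) (y : Space) (B : List Space) :
    mutX (x :: A ++ [y]) (y :: B ++ [x]) ⊆ crs (pl (x :: A ++ y :: B)) := by
  rintro p ⟨h1, h2⟩
  rw [crs, Set.mem_ofPred_eq, cov_cedges_pl]
  omega

theorem selfX_subset_crs (x : Space) (A : List Space) (y : Space) (B : List Space) :
    selfX (y :: B ++ [x]) ⊆ crs (pl (x :: A ++ y :: B)) := by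
  intro p h1
  rw [selfX, Set.mem_ofPred_eq] at h1
  rw [crs, Set.mem_ofPred_eq, cov_cedges_pl]
  omega

theorem Diagram.toSlide {b : Space} {m : List Space} {a : Space} {T Tn : Space × Space}
    {c : Plane} (D : Diagram (b :: m ++ [a])) (hT : T ∈ segs (b :: m ++ [a]))
    (hTn : Tn ∈ segs (b :: m ++ [a])) (hn : Tn.1 = T.2) (hcT : c ∈ oseg (pe T))
    (hcs : c ∈ oseg (pe (a, b))) : Slide b.1 (pl m) a.1 (pe T) (pe Tn) c := by
  have hpl : pl (b :: m ++ [a]) = b.1 :: pl m ++ [a.1] := pl_last b m a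
  have hseg : ∀ {f}, f ∈ segs (b :: m ++ [a]) → pe f ∈ segs (b.1 :: pl m ++ [a.1]) := by
    intro f hf
    rw [← hpl, segs_pl]
    exact List.mem_map_of_mem hf
  exact ⟨hpl ▸ D.gen, hpl ▸ D.fin, hseg hT, hseg hTn, congrArg Prod.fst hn, hcT, hcs⟩

/-- Sliding a crossing of the second arc of a polygon past the end of an edge. -/
theorem exists_slide_arc {x : Space} {A' : List Space} {y : Space} {B' L : List Space}
    {a b : Space} {R : List Space} {T Tn : Space × Space} {c : Plane}
    (D : Diagram (x :: A' ++ y :: B')) (hα : ∀ p, cov (pes (x :: A' ++ [y])) p ≤ 1)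
    (hB : y :: B' = L ++ a :: b :: R)
    (hT : T ∈ segs (y :: B' ++ [x])) (hTn : Tn ∈ cedges (x :: A' ++ y :: B'))
    (hTs : T ≠ (a, b)) (hTns : Tn ≠ (a, b)) (hn : Tn.1 = T.2)
    (hcT : c ∈ oseg (pe T)) (hcs : c ∈ oseg (pe (a, b)))
    (hfree : ∀ g ∈ segs (y :: B' ++ [x]), ∀ q ∈ oseg (c, T.2.1), q ∈ oseg (pe g) → g = T) :
    ∃ B'' A C B, y :: B'' = L ++ a :: A :: C :: B :: b :: R ∧
      Diagram (x :: A' ++ y :: B'') ∧ LEq (x :: A' ++ y :: B') (x :: A' ++ y :: B'') ∧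
      (mutX (x :: A' ++ [y]) (y :: B'' ++ [x])).ncard ≤ (mutX (x :: A' ++ [y]) (y :: B' ++ [x])).ncard
        + 2 * {q | q ∈ oseg (c, T.2.1) ∧ 1 ≤ cov (pes (x :: A' ++ [y])) q}.ncard + 1 ∧
      (Tn ∉ segs (x :: A' ++ [y]) → (mutX (x :: A' ++ [y]) (y :: B'' ++ [x])).ncard ≤
        (mutX (x :: A' ++ [y]) (y :: B' ++ [x])).ncard
        + 2 * {q | q ∈ oseg (c, T.2.1) ∧ 1 ≤ cov (pes (x :: A' ++ [y])) q}.ncard) ∧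
      c ∈ selfX (y :: B' ++ [x]) ∧ c ∉ selfX (y :: B'' ++ [x]) ∧
      (∀ f ∈ segs (y :: B' ++ [x]), f ≠ (a, b) → ∀ e ∈ [(A, C), (C, B)],
        ∀ p ∈ oseg (pe e), p ∈ oseg (pe f) → f = Tn) ∧
      (∀ e ∈ [(A, C), (C, B)], ∀ e' ∈ [(A, C), (C, B)], ∀ p ∈ oseg (pe e), ∀ p' ∈ oseg (pe e'),
        p ∈ oseg (pe Tn) → p' ∈ oseg (pe Tn) → p = p') ∧
      oseg (pe (a, A)) ⊆ oseg (pe (a, b)) ∧ oseg (pe (B, b)) ⊆ oseg (pe (a, b)) ∧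
      ∀ p ∈ selfX (y :: B'' ++ [x]), p ∈ selfX (y :: B' ++ [x]) ∨
        (∃ e ∈ [(A, C), (C, B)], p ∈ oseg (pe e) ∧ p ∈ oseg (pe Tn) ∧
          Tn ∈ segs (y :: B' ++ [x])) := by
  -- Renumber the polygon so that the edge from `a` to `b` becomes the closing edge, as the slide
  -- requires.
  obtain ⟨m, hm⟩ : ∃ m, m = R ++ x :: A' ++ L := ⟨_, rfl⟩
  have hV : x :: A' ++ y :: B' = (x :: A' ++ L ++ [a]) ++ (b :: R) := by rw [hB]; simp
  have hW : b :: R ++ (x :: A' ++ L ++ [a]) = b :: m ++ [a] := by rw [hm]; simp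
  have DW : Diagram (b :: m ++ [a]) := by rw [← hW]; rw [hV] at D; exact D.rotate
  have LW : LEq (x :: A' ++ y :: B') (b :: m ++ [a]) := by
    rw [← hW, hV]; rw [hV] at D; exact LEq.rotate D.simple
  have hβ : y :: B' ++ [x] = L ++ a :: b :: (R ++ [x]) := by rw [hB]; simp
  have hsegβ : segs (y :: B' ++ [x]) = segs (L ++ [a]) ++ (a, b) :: segs (b :: R ++ [x]) := by
    rw [hβ, segs_append_cons_cons]; rfl
  have hcyc : cedges (x :: A' ++ y :: B') = segs (x :: A' ++ [y]) ++ segs (y :: B' ++ [x]) :=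
    cedges_cons_append_cons x A' y B'
  have hmem : ∀ f ∈ cedges (x :: A' ++ y :: B'), f ≠ (a, b) → f ∈ segs (b :: m ++ [a]) := by
    intro f hf hne
    rw [hV] at hf
    have h1 := (cedges_append_perm _ _).subset hf
    rw [hW, cedges_last, List.mem_append, List.mem_singleton] at h1
    exact h1.resolve_right hne
  have hWV : ∀ f ∈ segs (b :: m ++ [a]), f ∈ cedges (x :: A' ++ y :: B') := by
    intro f hf
    rw [hV]
    refine (cedges_append_perm _ _).subset ?_
    rw [hW, cedges_last]
    exact List.mem_append_left _ hf
  have hab : (a, b) ∉ segs (b :: m ++ [a]) := by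
    have h1 := nodup_cedges DW.simple.2.nodup
    rw [cedges_last, List.nodup_append] at h1
    exact fun h => h1.2.2 _ h _ (List.mem_singleton_self _) rfl
  have hαW : ∀ f ∈ segs (x :: A' ++ [y]), f ∈ segs (b :: m ++ [a]) := by
    intro f hf
    refine hmem f (hcyc ▸ List.mem_append_left _ hf) ?_
    rintro rfl
    have h1 := nodup_cedges D.simple.2.nodup
    rw [hcyc, List.nodup_append] at h1
    exact h1.2.2 _ hf _ (by rw [hsegβ]; simp) rfl
  have hβW : ∀ f ∈ segs (y :: B' ++ [x]), f ≠ (a, b) → f ∈ segs (b :: m ++ [a]) := fun f hf hne =>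
    hmem f (hcyc ▸ List.mem_append_right _ hf) hne
  have hTW := hβW T hT hTs
  have hTnW := hmem Tn hTn hTns
  have S := DW.toSlide hTW hTnW hn hcT hcs
  obtain ⟨α, β, A, B, C, Q, D', L'⟩ := DW.exists_slide hTW hTnW hn hcT hcs
  obtain ⟨B'', hB''⟩ : ∃ B'', y :: B'' = L ++ a :: A :: C :: B :: b :: R := by
    cases L with
    | nil => simp only [List.nil_append, List.cons.injEq] at hB; exact ⟨_, by rw [hB.1]; rfl⟩
    | cons z L => simp only [List.cons_append, List.cons.injEq] at hB; exact ⟨_, by rw [hB.1]; rfl⟩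
  have hV'' : x :: A' ++ y :: B'' = (x :: A' ++ L ++ [a, A, C, B]) ++ (b :: R) := by rw [hB'']; simp
  have hW'' : b :: m ++ [a] ++ [A, C, B] = b :: R ++ (x :: A' ++ L ++ [a, A, C, B]) := by
    rw [hm]; simp
  have hsegβ'' : segs (y :: B'' ++ [x])
      = segs (L ++ [a]) ++ (a, A) :: (A, C) :: (C, B) :: (B, b) :: segs (b :: R ++ [x]) := by
    rw [hB'', List.append_assoc, List.cons_append, List.cons_append, segs_append_cons_cons]; rfl
  obtain ⟨K, hK⟩ : ∃ K, K = pes (L ++ [a]) ++ pes (b :: R ++ [x]) := ⟨_, rfl⟩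
  have hcβ : ∀ p, cov (pes (y :: B' ++ [x])) p = cov K p + cov [(a.1, b.1)] p := by
    intro p
    have e : pes (y :: B' ++ [x]) = pes (L ++ [a]) ++ ([(a.1, b.1)] ++ pes (b :: R ++ [x])) := by
      rw [pes, hsegβ, List.map_append]; rfl
    rw [e, hK]; simp only [cov_append]; omega
  have hcβ'' : ∀ p, cov (pes (y :: B'' ++ [x])) p
      = cov K p + cov [(a.1, A.1), (A.1, C.1), (C.1, B.1), (B.1, b.1)] p := by
    intro p
    have e : pes (y :: B'' ++ [x]) = pes (L ++ [a]) ++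
        ([(a.1, A.1), (A.1, C.1), (C.1, B.1), (B.1, b.1)] ++ pes (b :: R ++ [x])) := by
      rw [pes, hsegβ'', List.map_append]; rfl
    rw [e, hK]; simp only [cov_append]; omega
  have hKmem : ∀ p, 1 ≤ cov K p → ∃ f ∈ segs (y :: B' ++ [x]), f ≠ (a, b) ∧ p ∈ oseg (pe f) := by
    intro p hp
    rw [hK, cov_append] at hp
    have h1 := nodup_cedges D.simple.2.nodup
    rw [hcyc] at h1
    have h2 := (List.nodup_append.1 h1).2.1
    rw [hsegβ] at h2
    have h3 := (List.nodup_middle.1 h2)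
    rw [List.nodup_cons] at h3
    by_cases h : 1 ≤ cov (pes (L ++ [a])) p
    · obtain ⟨f, hf, hpf⟩ := one_le_cov_pes.1 h
      exact ⟨f, by rw [hsegβ]; simp [hf], fun h => h3.1 (by rw [← h]; simp [hf]), hpf⟩
    · obtain ⟨f, hf, hpf⟩ := one_le_cov_pes.1 (by omega : 1 ≤ cov (pes (b :: R ++ [x])) p)
      exact ⟨f, by rw [hsegβ]; exact List.mem_append_right _ (List.mem_cons_of_mem _ hf),
        fun h => h3.1 (by rw [← h]; exact List.mem_append_right _ hf), hpf⟩
  -- Apart from `Tn`, a wing crosses only edges that also cross the piece of `T` between `c` and its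
  -- end.
  have hnear : ∀ e ∈ [(A, C), (C, B)], ∀ p ∈ oseg (pe e), ∀ f ∈ segs (b :: m ++ [a]), f ≠ Tn →
      p ∈ oseg (pe f) → f ≠ T ∧ ∃ q, q ∈ oseg (pe f) ∧ q ∈ oseg (c, T.2.1) := by
    intro e he p hp f hf hfn hpf
    have h1 : pe f ∈ segs (b.1 :: pl m ++ [a.1]) := by
      rw [← pl_last, segs_pl]; exact List.mem_map_of_mem hf
    have h2 : pe f ≠ pe Tn := fun h => hfn (D.pe_inj (hWV f hf) hTn h)
    simp only [List.mem_cons, List.not_mem_nil, or_false] at he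
    rcases he with rfl | rfl
    · obtain ⟨k1, k2⟩ := Q.wingA.near _ h1 h2 p (oseg_subset_cseg _ hpf) (oseg_subset_cseg _ hp)
      exact ⟨fun h => k1 (h ▸ rfl), k2⟩
    · rw [← oseg_swap] at hp
      obtain ⟨k1, k2⟩ := Q.wingB.near _ h1 h2 p (oseg_subset_cseg _ hpf) (oseg_subset_cseg _ hp)
      exact ⟨fun h => k1 (h ▸ rfl), k2⟩
  have hsub : ∀ e ∈ [(A, C), (C, B)], ∀ f ∈ segs (b :: m ++ [a]), ∀ p ∈ oseg (pe e),
      ∀ p' ∈ oseg (pe e), p ∈ oseg (pe f) → p' ∈ oseg (pe f) → p = p' := by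
    intro e he f hf p hp p' hp' hpf hpf'
    have h1 : pe f ∈ segs (b.1 :: pl m ++ [a.1]) := by
      rw [← pl_last, segs_pl]; exact List.mem_map_of_mem hf
    simp only [List.mem_cons, List.not_mem_nil, or_false] at he
    rcases he with rfl | rfl
    · exact Tri.subsingleton_wingA S Q h1 ⟨oseg_subset_cseg _ hpf, oseg_subset_cseg _ hp⟩
        ⟨oseg_subset_cseg _ hpf', oseg_subset_cseg _ hp'⟩
    · rw [← oseg_swap] at hp hp'
      exact Tri.subsingleton_wingB S Q h1 ⟨oseg_subset_cseg _ hpf, oseg_subset_cseg _ hp⟩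
        ⟨oseg_subset_cseg _ hpf', oseg_subset_cseg _ hp'⟩
  have hnext : ∀ e ∈ [(A, C), (C, B)], ∀ e' ∈ [(A, C), (C, B)], ∀ p ∈ oseg (pe e),
      ∀ p' ∈ oseg (pe e'), p ∈ oseg (pe Tn) → p' ∈ oseg (pe Tn) → p = p' := by
    have h1 : ∀ e ∈ [(A, C), (C, B)], ∀ p ∈ oseg (pe e),
        p ∈ cseg (A.1, C.1) ∪ cseg (B.1, C.1) := by
      intro e he p hp
      simp only [List.mem_cons, List.not_mem_nil, or_false] at he
      rcases he with rfl | rfl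
      · exact Or.inl (oseg_subset_cseg _ hp)
      · rw [← oseg_swap] at hp
        exact Or.inr (oseg_subset_cseg _ hp)
    intro e he e' he' p hp p' hp' hpn hpn'
    exact Q.next ⟨oseg_subset_cseg _ hpn, h1 e he p hp⟩ ⟨oseg_subset_cseg _ hpn', h1 e' he' p' hp'⟩
  have hβn : ∀ f ∈ segs (y :: B' ++ [x]), f ≠ (a, b) → ∀ e ∈ [(A, C), (C, B)],
      ∀ p ∈ oseg (pe e), p ∈ oseg (pe f) → f = Tn := by
    intro f hf hne e he p hp hpf
    by_contra hfn
    obtain ⟨k1, q, k2, k3⟩ := hnear e he p hp f (hβW f hf hne) hfn hpf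
    exact k1 (hfree f hf q k3 k2)
  have hwing : ∀ p, (p ∈ oseg (A.1, C.1) ∨ p ∈ oseg (C.1, B.1)) ↔
      ∃ e ∈ [(A, C), (C, B)], p ∈ oseg (pe e) := by
    intro p; simp; rfl
  -- finiteness
  have hcv : oseg (c, T.2.1) ⊆ oseg (pe T) := fun q hq =>
    (mem_oseg_split hcT q).2 (Or.inr (Or.inr hq))
  obtain ⟨Z, hZ⟩ : ∃ Z, Z = {q | q ∈ oseg (c, T.2.1) ∧ 1 ≤ cov (pes (x :: A' ++ [y])) q} := ⟨_, rfl⟩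
  rw [← hZ]
  have hZf : Z.Finite := by
    refine D.fin.subset (fun q hq => mutX_subset_crs x A' y B' ?_)
    rw [hZ] at hq
    exact ⟨hq.2, one_le_cov_pes.2 ⟨T, hT, hcv hq.1⟩⟩
  have hMf : (mutX (x :: A' ++ [y]) (y :: B' ++ [x])).Finite :=
    D.fin.subset (mutX_subset_crs x A' y B')
  have hαnd : (pes (x :: A' ++ [y])).Nodup := by
    have := nodup_cedges D.gen.nodup
    rw [cedges_pl, hcyc, List.map_append] at this
    exact (List.nodup_append.1 this).1
  -- Charge each crossing of a wing with the first arc, outside `Tn`, to a crossing of the same edge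
  -- with the piece of `T` behind `c`. The charge is injective: the first arc is simple, so only one
  -- of its edges passes through a given point, and a wing meets an edge at most once. The two wings
  -- give the factor `2`.
  have hcard : ∀ e ∈ [(A, C), (C, B)], {p | p ∈ oseg (pe e) ∧ ∃ f ∈ segs (x :: A' ++ [y]), f ≠ Tn ∧
      p ∈ oseg (pe f)}.Finite ∧ {p | p ∈ oseg (pe e) ∧ ∃ f ∈ segs (x :: A' ++ [y]), f ≠ Tn ∧
      p ∈ oseg (pe f)}.ncard ≤ Z.ncard := by
    intro e he
    have h1 : ∀ p ∈ {p | p ∈ oseg (pe e) ∧ ∃ f ∈ segs (x :: A' ++ [y]), f ≠ Tn ∧ p ∈ oseg (pe f)},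
        ∃ q, ∃ f ∈ segs (x :: A' ++ [y]), p ∈ oseg (pe f) ∧ q ∈ oseg (pe f) ∧
          q ∈ oseg (c, T.2.1) := by
      rintro p ⟨hp, f, hf, hfn, hpf⟩
      obtain ⟨-, q, k2, k3⟩ := hnear e he p hp f (hαW f hf) hfn hpf
      exact ⟨q, f, hf, hpf, k2, k3⟩
    choose! g F hF h2 h3 h4 using h1
    have hmaps : ∀ p ∈ {p | p ∈ oseg (pe e) ∧ ∃ f ∈ segs (x :: A' ++ [y]), f ≠ Tn ∧
        p ∈ oseg (pe f)}, g p ∈ Z := by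
      intro p hp
      rw [hZ]
      exact ⟨h4 p hp, one_le_cov_pes.2 ⟨F p, hF p hp, h3 p hp⟩⟩
    have hinj : Set.InjOn g {p | p ∈ oseg (pe e) ∧ ∃ f ∈ segs (x :: A' ++ [y]), f ≠ Tn ∧
        p ∈ oseg (pe f)} := by
      intro p hp p' hp' hpp
      have hFF : pe (F p) = pe (F p') := by
        by_contra hne
        have := (two_le_cov (p := g p) hαnd).2 ⟨_, mem_pes.2 ⟨_, hF p hp, rfl⟩, _,
          mem_pes.2 ⟨_, hF p' hp', rfl⟩, hne, h3 p hp, hpp ▸ h3 p' hp'⟩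
        have := hα (g p)
        omega
      exact hsub e he _ (hαW _ (hF p hp)) p hp.1 p' hp'.1 (h2 p hp) (hFF ▸ h2 p' hp')
    exact ⟨Set.Finite.of_injOn hmaps hinj hZf, Set.ncard_le_ncard_of_injOn g hmaps hinj hZf⟩
  have hA := hcard (A, C) (by simp)
  have hB' := hcard (C, B) (by simp)
  have hmut : ∀ p ∈ mutX (x :: A' ++ [y]) (y :: B'' ++ [x]),
      p ∈ mutX (x :: A' ++ [y]) (y :: B' ++ [x]) ∨
      ∃ e ∈ [(A, C), (C, B)], p ∈ oseg (pe e) ∧ ∃ f ∈ segs (x :: A' ++ [y]), p ∈ oseg (pe f) := by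
    rintro p ⟨h1, h2⟩
    by_cases h : p ∈ oseg (A.1, C.1) ∨ p ∈ oseg (C.1, B.1)
    · obtain ⟨e, he, hpe⟩ := (hwing p).1 h
      exact Or.inr ⟨e, he, hpe, one_le_cov_pes.1 h1⟩
    · push Not at h
      have h3 := Tri.cov_le_of_notMem S Q h.1 h.2
      refine Or.inl ⟨h1, ?_⟩
      rw [hcβ'' p] at h2
      rw [hcβ p]; omega
  have hsubAB : ∀ p, p ∈ mutX (x :: A' ++ [y]) (y :: B' ++ [x]) ∪
      ({p | p ∈ oseg (pe (A, C)) ∧ ∃ f ∈ segs (x :: A' ++ [y]), f ≠ Tn ∧ p ∈ oseg (pe f)} ∪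
      {p | p ∈ oseg (pe (C, B)) ∧ ∃ f ∈ segs (x :: A' ++ [y]), f ≠ Tn ∧ p ∈ oseg (pe f)}) ∨
      (Tn ∈ segs (x :: A' ++ [y]) ∧ p ∈ {p | p ∈ oseg (pe Tn) ∧ ∃ e ∈ [(A, C), (C, B)],
        p ∈ oseg (pe e)}) ∨ p ∉ mutX (x :: A' ++ [y]) (y :: B'' ++ [x]) := by
    intro p
    by_cases hp : p ∈ mutX (x :: A' ++ [y]) (y :: B'' ++ [x])
    · rcases hmut p hp with h | ⟨e, he, hpe, f, hf, hpf⟩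
      · exact Or.inl (Or.inl h)
      · by_cases hfn : f = Tn
        · subst hfn
          exact Or.inr (Or.inl ⟨hf, hpf, e, he, hpe⟩)
        · simp only [List.mem_cons, List.not_mem_nil, or_false] at he
          rcases he with rfl | rfl
          · exact Or.inl (Or.inr (Or.inl ⟨hpe, f, hf, hfn, hpf⟩))
          · exact Or.inl (Or.inr (Or.inr ⟨hpe, f, hf, hfn, hpf⟩))
    · exact Or.inr (Or.inr hp)
  have hunion := (Set.ncard_union_le (mutX (x :: A' ++ [y]) (y :: B' ++ [x]))
      ({p | p ∈ oseg (pe (A, C)) ∧ ∃ f ∈ segs (x :: A' ++ [y]), f ≠ Tn ∧ p ∈ oseg (pe f)} ∪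
      {p | p ∈ oseg (pe (C, B)) ∧ ∃ f ∈ segs (x :: A' ++ [y]), f ≠ Tn ∧ p ∈ oseg (pe f)}))
  have hunion2 := (Set.ncard_union_le
      {p | p ∈ oseg (pe (A, C)) ∧ ∃ f ∈ segs (x :: A' ++ [y]), f ≠ Tn ∧ p ∈ oseg (pe f)}
      {p | p ∈ oseg (pe (C, B)) ∧ ∃ f ∈ segs (x :: A' ++ [y]), f ≠ Tn ∧ p ∈ oseg (pe f)})
  have hunionf := hMf.union (hA.1.union hB'.1)
  -- The two wings together meet `Tn` at most once, which costs one crossing with the first arc if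
  -- `Tn` belongs to it.
  have hXs : {p | p ∈ oseg (pe Tn) ∧ ∃ e ∈ [(A, C), (C, B)], p ∈ oseg (pe e)}.Subsingleton := by
    rintro p ⟨hp, e, he, hpe⟩ p' ⟨hp', e', he', hpe'⟩
    exact hnext e he e' he' p hpe p' hpe' hp hp'
  refine ⟨B'', A, C, B, hB'', ?_, ?_, ?_, ?_, ?_, ?_, hβn, hnext, Tri.sub_left S Q,
    Tri.sub_right S Q, ?_⟩
  · rw [hV'']; rw [hW''] at D'; exact D'.rotate
  · refine LW.trans (L'.trans ?_)
    rw [hV'', hW'']; rw [hW''] at D'; exact LEq.rotate D'.simple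
  · refine (Set.ncard_le_ncard (t := _ ∪ _) (fun p hp => ?_) (hunionf.union hXs.finite)).trans
      ((Set.ncard_union_le _ _).trans ?_)
    · rcases hsubAB p with h | h | h
      · exact Or.inl h
      · exact Or.inr h.2
      · exact absurd hp h
    · have : {p | p ∈ oseg (pe Tn) ∧ ∃ e ∈ [(A, C), (C, B)], p ∈ oseg (pe e)}.ncard ≤ 1 := by
        rcases hXs.eq_empty_or_singleton with h | ⟨q, h⟩ <;> rw [h] <;> simp
      have := hA.2
      have := hB'.2
      omega
  · intro hTnα
    refine (Set.ncard_le_ncard (fun p hp => ?_) hunionf).trans (hunion.trans ?_)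
    · rcases hsubAB p with h | h | h
      · exact h
      · exact absurd h.1 hTnα
      · exact absurd hp h
    · have := hA.2
      have := hB'.2
      omega
  · rw [selfX, Set.mem_ofPred_eq, hcβ, cov_cons_of_mem (e := (a.1, b.1)) hcs]
    have : 1 ≤ cov K c := by
      have h1 := one_le_cov_pes.2 ⟨T, hT, hcT⟩
      by_contra h0
      have h0 : cov K c = 0 := by omega
      rw [hK, cov_append, Nat.add_eq_zero_iff] at h0
      have h2 : T ∈ segs (L ++ [a]) ∨ T ∈ segs (b :: R ++ [x]) := by
        rw [hsegβ, List.mem_append, List.mem_cons] at hT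
        tauto
      rcases h2 with h2 | h2
      · exact cov_eq_zero_iff.1 h0.1 _ (mem_pes.2 ⟨T, h2, rfl⟩) hcT
      · exact cov_eq_zero_iff.1 h0.2 _ (mem_pes.2 ⟨T, h2, rfl⟩) hcT
    omega
  -- The piece from `A` to `B`, which contained `c`, is gone, so one of the two strands through `c`
  -- has been removed.
  · have h1 : c ∉ oseg (A.1, C.1) := fun h => Tri.wing_line S Q h (oseg_subset_cseg _ hcs)
    have h2 : c ∉ oseg (C.1, B.1) := fun h => Tri.wing_line' S Q h (oseg_subset_cseg _ hcs)
    have h3 := Tri.cov_le_of_notMem S Q h1 h2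
    have h4 : cov [(A.1, B.1)] c = 1 := by rw [cov_cons_of_mem Q.mem, cov_nil]
    have h5 := D.gen.cov_le c
    rw [cov_cedges_pl, hcβ] at h5
    rw [selfX, Set.mem_ofPred_eq, hcβ'']
    omega
  · intro p hp
    rw [selfX, Set.mem_ofPred_eq, hcβ''] at hp
    by_cases h : p ∈ oseg (A.1, C.1) ∨ p ∈ oseg (C.1, B.1)
    · obtain ⟨h1, -, -⟩ := Tri.wing_cov S Q h
      obtain ⟨f, hf, hne, hpf⟩ := hKmem p (by omega)
      obtain ⟨e, he, hpe⟩ := (hwing p).1 h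
      have := hβn f hf hne e he p hpe hpf
      subst this
      exact Or.inr ⟨e, he, hpe, hpf, hf⟩
    · push Not at h
      have h3 := Tri.cov_le_of_notMem S Q h.1 h.2
      left
      rw [selfX, Set.mem_ofPred_eq, hcβ]
      omega

theorem finite_mutX {x : Space} {A' : List Space} {y : Space} {B' : List Space}
    (D : Diagram (x :: A' ++ y :: B')) : (mutX (x :: A' ++ [y]) (y :: B' ++ [x])).Finite :=
  D.fin.subset (mutX_subset_crs x A' y B')

theorem finite_selfX {x : Space} {A' : List Space} {y : Space} {B' : List Space}
    (D : Diagram (x :: A' ++ y :: B')) : (selfX (y :: B' ++ [x])).Finite :=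
  D.fin.subset (selfX_subset_crs x A' y B')

theorem segs_tail_mem {x y : Space} {B' U : List Space} {u v : Space} {Z : List Space}
    (hB : y :: B' ++ [x] = U ++ u :: v :: Z) :
    segs (y :: B' ++ [x]) = segs (U ++ [u]) ++ (u, v) :: segs (v :: Z) := by
  rw [hB, segs_append_cons_cons]

/-- A crossing of the second arc with one of its later edges is pushed along the arc until it
has left the arc. -/
theorem exists_finger (Z : List Space) {x : Space} {A' : List Space} {y : Space} {B' U : List Space}
    {u v : Space} {s : Space × Space} {c : Plane}
    (D : Diagram (x :: A' ++ y :: B')) (hα : ∀ p, cov (pes (x :: A' ++ [y])) p ≤ 1)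
    (hB : y :: B' ++ [x] = U ++ u :: v :: Z) (hs : s ∈ segs (U ++ [u]))
    (hcs : c ∈ oseg (pe s)) (hcT : c ∈ oseg (pe (u, v)))
    (hpost : ∀ f ∈ segs (v :: Z), ∀ g ∈ segs (y :: B' ++ [x]), f ≠ g →
      ∀ p ∈ oseg (pe f), p ∉ oseg (pe g))
    (hfree : ∀ g ∈ segs (y :: B' ++ [x]), ∀ q ∈ oseg (c, v.1), q ∈ oseg (pe g) → g = (u, v)) :
    ∃ B'', Diagram (x :: A' ++ y :: B'') ∧ LEq (x :: A' ++ y :: B') (x :: A' ++ y :: B'') ∧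
      (selfX (y :: B'' ++ [x])).ncard < (selfX (y :: B' ++ [x])).ncard ∧
      (mutX (x :: A' ++ [y]) (y :: B'' ++ [x])).ncard ≤
        (mutX (x :: A' ++ [y]) (y :: B' ++ [x])).ncard
        + 2 * {q | (q ∈ oseg (c, v.1) ∨ 1 ≤ cov (pes (v :: Z)) q) ∧
            1 ≤ cov (pes (x :: A' ++ [y])) q}.ncard + 1 := by
  -- Each slide carries the crossing past one vertex, so `Z`, the rest of the second arc behind `v`,
  -- becomes shorter.
  induction hk : Z.length using Nat.strong_induction_on generalizing Z B' U u v s c with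
  | h k ih =>
  have hc : ∀ {f}, f ∈ segs (y :: B' ++ [x]) → f ∈ cedges (x :: A' ++ y :: B') := fun hf => by
    rw [cedges_cons_append_cons]; exact List.mem_append_right _ hf
  have hnd := nodup_cedges D.simple.2.nodup
  rw [cedges_cons_append_cons, List.nodup_append, segs_tail_mem hB] at hnd
  have hαβ := hnd.2.2
  have hnd2 := hnd.2.1
  rw [← segs_tail_mem hB] at hαβ
  have hsβ : s ∈ segs (y :: B' ++ [x]) := by
    rw [segs_tail_mem hB]; exact List.mem_append_left _ hs
  have hTβ : (u, v) ∈ segs (y :: B' ++ [x]) := by rw [segs_tail_mem hB]; simp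
  have hZβ : ∀ f ∈ segs (v :: Z), f ∈ segs (y :: B' ++ [x]) ∧ f ≠ (u, v) ∧ f ≠ s := by
    intro f hf
    refine ⟨by rw [segs_tail_mem hB]; simp [hf], ?_, ?_⟩
    · rintro rfl
      exact (List.nodup_cons.1 (List.nodup_append.1 hnd2).2.1).1 hf
    · rintro rfl
      exact (List.nodup_append.1 hnd2).2.2 _ hs _ (List.mem_cons_of_mem _ hf) rfl
  have hTs : (u, v) ≠ s := by
    rintro rfl
    exact (List.nodup_append.1 hnd2).2.2 _ hs _ List.mem_cons_self rfl
  obtain ⟨a, b⟩ := s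
  obtain ⟨L, R, hLR⟩ := segs_splitAt hs
  simp only at hLR
  obtain ⟨Z', x', hZ'⟩ : ∃ Z' x', v :: Z = Z' ++ [x'] :=
    ⟨_, _, (List.dropLast_append_getLast (List.cons_ne_nil v Z)).symm⟩
  have hB1 : y :: B' ++ [x] = L ++ a :: b :: (R ++ Z') ++ [x'] := by
    have : U ++ u :: v :: Z = (U ++ [u]) ++ (v :: Z) := by simp
    rw [hB, this, hLR, hZ']; simp
  obtain ⟨hB2, hx'⟩ := List.append_inj' hB1 rfl
  simp only [List.cons.injEq, and_true] at hx'
  subst hx'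
  have hB3 : ∀ {B'' : List Space} {A C B : Space},
      y :: B'' = L ++ a :: A :: C :: B :: b :: (R ++ Z') →
      y :: B'' ++ [x] = (L ++ a :: A :: C :: B :: b :: R) ++ v :: Z := by
    intro B'' A C B h
    rw [h, hZ']; simp
  have hcv : oseg (c, v.1) ⊆ oseg (pe (u, v)) := fun q hq =>
    (mem_oseg_split hcT q).2 (Or.inr (Or.inr hq))
  obtain ⟨W, hW⟩ : ∃ W, W = {q | (q ∈ oseg (c, v.1) ∨ 1 ≤ cov (pes (v :: Z)) q) ∧
    1 ≤ cov (pes (x :: A' ++ [y])) q} := ⟨_, rfl⟩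
  have hWf : W.Finite := by
    refine (finite_mutX D).subset ?_
    rw [hW]
    rintro q ⟨h1 | h1, h2⟩
    · exact ⟨h2, one_le_cov_pes.2 ⟨_, hTβ, hcv h1⟩⟩
    · obtain ⟨f, hf, hqf⟩ := one_le_cov_pes.1 h1
      exact ⟨h2, one_le_cov_pes.2 ⟨f, (hZβ f hf).1, hqf⟩⟩
  have hW1 : {q | q ∈ oseg (c, (u, v).2.1) ∧ 1 ≤ cov (pes (x :: A' ++ [y])) q} ⊆ W := by
    rw [hW]; exact fun q hq => ⟨Or.inl hq.1, hq.2⟩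
  have hW1c := Set.ncard_le_ncard hW1 hWf
  rw [← hW]
  -- If `v` is the end `x` of the second arc, the next edge is the first edge of the other arc: the
  -- self-crossing is lost, and at most one crossing of the two arcs appears at the tip. Otherwise
  -- the next edge still belongs to the second arc, and there is no such extra crossing.
  cases hZc : Z with
  | nil =>
    subst hZc
    obtain ⟨n, N, hN⟩ : ∃ n N, A' ++ [y] = n :: N := by
      cases A' with
      | nil => exact ⟨_, _, rfl⟩
      | cons z A' => exact ⟨_, _, rfl⟩
    have hv : v = x := by
      cases Z' with
      | nil => simpa using hZ'
      | cons z Z' =>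
        simp at hZ'
    subst hv
    have hn : (v, n) ∈ segs (v :: A' ++ [y]) := by
      rw [List.cons_append, hN]; simp
    obtain ⟨B'', A, C, B, e1, D1, L1, g1, g2, g3, g4, g5, g6, g7, g8, g9⟩ :=
      exists_slide_arc D hα hB2 hTβ (Tn := (v, n))
        (by rw [cedges_cons_append_cons]; exact List.mem_append_left _ hn) hTs
        (fun h => hαβ _ hn _ hsβ h) rfl hcT hcs hfree
    refine ⟨B'', D1, L1, ?_, by omega⟩
    refine Set.ncard_lt_ncard ⟨fun p hp => ?_, fun h => g4 (h g3)⟩ (finite_selfX D)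
    rcases g9 p hp with h | ⟨-, -, -, -, h⟩
    · exact h
    · exact absurd rfl (hαβ _ hn _ h)
  | cons w Z1 =>
    subst hZc
    have hn : (v, w) ∈ segs (v :: w :: Z1) := by simp
    obtain ⟨B'', A, C, B, e1, D1, L1, g1, g2, g3, g4, g5, g6, g7, g8, g9⟩ :=
      exists_slide_arc D hα hB2 hTβ (Tn := (v, w)) (hc (hZβ _ hn).1) hTs (hZβ _ hn).2.2 rfl hcT
        hcs hfree
    have g2 := g2 fun h => hαβ _ h _ (hZβ _ hn).1 rfl
    -- If a wing crosses the next edge, the single point `c'` takes over the role of `c` and is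
    -- pushed on along the arc; if not, the self-crossing has already disappeared.
    by_cases hmeet : ∃ e ∈ [(A, C), (C, B)], ∃ c', c' ∈ oseg (pe e) ∧ c' ∈ oseg (pe (v, w))
    · obtain ⟨e, he, c', hc', hc'n⟩ := hmeet
      have hB4 := hB3 e1
      have hseg : ∀ g ∈ segs (y :: B'' ++ [x]), (g ∈ segs (y :: B' ++ [x]) ∧ g ≠ (a, b)) ∨
          oseg (pe g) ⊆ oseg (pe (a, b)) ∨ g ∈ [(A, C), (C, B)] := by
        have h0 : segs (y :: B'' ++ [x]) = segs (L ++ [a]) ++ (a, A) :: (A, C) :: (C, B) :: (B, b) ::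
            segs (b :: (R ++ Z') ++ [x]) := by
          rw [e1, List.append_assoc, List.cons_append, List.cons_append, segs_append_cons_cons]; rfl
        have h1 : segs (y :: B' ++ [x]) = segs (L ++ [a]) ++ (a, b) ::
            segs (b :: (R ++ Z') ++ [x]) := by
          rw [hB2, List.append_assoc, List.cons_append, List.cons_append, segs_append_cons_cons]
        have h2 : (segs (L ++ [a]) ++ (a, b) :: segs (b :: (R ++ Z') ++ [x])).Nodup := by
          rw [← h1, segs_tail_mem hB]; exact hnd2
        have h3 := List.nodup_cons.1 (List.nodup_middle.1 h2)
        intro g hg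
        rw [h0, List.mem_append, List.mem_cons, List.mem_cons, List.mem_cons, List.mem_cons] at hg
        rcases hg with h | rfl | rfl | rfl | rfl | h
        · exact Or.inl ⟨by rw [h1]; exact List.mem_append_left _ h, fun h' => h3.1 (by
            rw [← h']; exact List.mem_append_left _ h)⟩
        · exact Or.inr (Or.inl g7)
        · exact Or.inr (Or.inr (by simp))
        · exact Or.inr (Or.inr (by simp))
        · exact Or.inr (Or.inl g8)
        · exact Or.inl ⟨by rw [h1]; exact List.mem_append_right _ (List.mem_cons_of_mem _ h),
            fun h' => h3.1 (by rw [← h']; exact List.mem_append_right _ h)⟩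
      have hsn : ∀ f ∈ segs (w :: Z1), f ≠ (v, w) := by
        rintro f hf rfl
        have h1 := (List.nodup_cons.1 (List.nodup_append.1 hnd2).2.1).2
        rw [segs_cons_cons, List.nodup_cons] at h1
        exact h1.1 hf
      have hwne : (v.1, w.1).1 ≠ (v.1, w.1).2 := D.pe_ne (hc (hZβ _ hn).1)
      have hc'w : c' ≠ w.1 := by
        rintro rfl
        exact right_notMem_oseg hwne hc'n
      have hcw : oseg (c', w.1) ⊆ oseg (pe (v, w)) := fun q hq =>
        (mem_oseg_split hc'n q).2 (Or.inr (Or.inr hq))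
      have hes : e ∈ segs ((L ++ a :: A :: C :: B :: b :: R) ++ [v]) := by
        have : (L ++ a :: A :: C :: B :: b :: R) ++ [v] = L ++ a :: A :: (C :: B :: b :: (R ++ [v])) := by
          simp
        rw [this, segs_append_cons_cons]
        simp only [List.mem_cons, List.not_mem_nil, or_false] at he
        rcases he with rfl | rfl <;> simp
      obtain ⟨B3, D3, L3, k1, k2⟩ := ih Z1.length (by rw [← hk]; simp) Z1 D1 hB4 hes hc' hc'n (by
        intro f hf g hg hfg p hpf hpg
        have hf' : f ∈ segs (v :: w :: Z1) := List.mem_cons_of_mem _ hf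
        rcases hseg g hg with ⟨h1, -⟩ | h1 | h1
        · exact hpost f hf' g h1 hfg p hpf hpg
        · exact hpost f hf' _ hsβ (hZβ _ hf').2.2 p hpf (h1 hpg)
        · exact hsn f hf (g5 f (hZβ _ hf').1 (hZβ _ hf').2.2 g h1 p hpg hpf)) (by
        intro g hg q hq hqg
        by_contra hne
        rcases hseg g hg with ⟨h1, -⟩ | h1 | h1
        · exact hpost _ hn g h1 (Ne.symm hne) q (hcw hq) hqg
        · exact hpost _ hn _ hsβ (hZβ _ hn).2.2 q (hcw hq) (h1 hqg)
        · have := g6 g h1 e he q hqg c' hc' (hcw hq) hc'n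
          subst this
          exact left_notMem_oseg hc'w hq) rfl
      refine ⟨B3, D3, L1.trans L3, lt_of_lt_of_le k1 ?_, k2.trans ?_⟩
      -- This slide only exchanges `c` for `c'`, so the strict decrease comes from the remaining
      -- slides.
      · have h1 : selfX (y :: B'' ++ [x]) ⊆ insert c' (selfX (y :: B' ++ [x]) \ {c}) := by
          intro p hp
          rcases g9 p hp with h | ⟨e', he', h, h', -⟩
          · exact Or.inr ⟨h, fun h => g4 (h ▸ hp)⟩
          · exact Or.inl (g6 e' he' e he p h c' hc' h' hc'n)
        have h2 := Set.ncard_le_ncard h1 (((finite_selfX D).sdiff).insert _)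
        have h3 := Set.ncard_insert_le c' (selfX (y :: B' ++ [x]) \ {c})
        have h4 := Set.ncard_sdiff_singleton_add_one g3 (finite_selfX D)
        omega
      · obtain ⟨W', hW'⟩ : ∃ W', W' = {q | (q ∈ oseg (c', w.1) ∨ 1 ≤ cov (pes (w :: Z1)) q) ∧
          1 ≤ cov (pes (x :: A' ++ [y])) q} := ⟨_, rfl⟩
        have hW'1 : ∀ q ∈ W', 1 ≤ cov (pes (v :: w :: Z1)) q := by
          rw [hW']
          rintro q ⟨h1, -⟩
          rw [pes_cons_cons]
          rcases h1 with h1 | h1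
          · rw [cov_cons_of_mem (hcw h1)]; omega
          · rw [cov_cons]; omega
        have hW'W : W' ⊆ W := by
          intro q hq
          have h1 := hW'1 q hq
          rw [hW'] at hq
          rw [hW]
          exact ⟨Or.inr h1, hq.2⟩
        -- Different slides run along disjoint pieces of the tail, so no crossing with the first arc
        -- is charged in two slides.
        have hdis : Disjoint {q | q ∈ oseg (c, (u, v).2.1) ∧ 1 ≤ cov (pes (x :: A' ++ [y])) q} W' := by
          rw [Set.disjoint_left]
          rintro q ⟨h1, -⟩ h2
          obtain ⟨f, hf, hqf⟩ := one_le_cov_pes.1 (hW'1 q h2)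
          exact hpost f hf _ hTβ (hZβ f hf).2.1 q hqf (hcv h1)
        have h1 := Set.ncard_union_eq hdis (hWf.subset hW1) (hWf.subset hW'W)
        have h2 := Set.ncard_le_ncard (Set.union_subset hW1 hW'W) hWf
        rw [← hW']
        omega
    · push Not at hmeet
      refine ⟨B'', D1, L1, ?_, by omega⟩
      refine Set.ncard_lt_ncard ⟨fun p hp => ?_, fun h => g4 (h g3)⟩ (finite_selfX D)
      rcases g9 p hp with h | ⟨e, he, h, h', -⟩
      · exact h
      · exact absurd h' (hmeet e he p h)

theorem exists_first {α : Type*} (P : α → Prop) {l : List α} (h : ∃ a ∈ l, P a) :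
    ∃ l₁ a l₂, l = l₁ ++ a :: l₂ ∧ P a ∧ ∀ b ∈ l₁, ¬ P b := by
  induction l with
  | nil => simp at h
  | cons x l ih =>
    by_cases hx : P x
    · exact ⟨[], x, l, rfl, hx, by simp⟩
    · obtain ⟨a, ha, hPa⟩ := h
      rcases List.mem_cons.1 ha with rfl | ha
      · exact absurd hPa hx
      · obtain ⟨l₁, b, l₂, rfl, hb, h₁⟩ := ih ⟨a, ha, hPa⟩
        refine ⟨x :: l₁, b, l₂, rfl, hb, fun c hc => ?_⟩
        rcases List.mem_cons.1 hc with rfl | hc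
        · exact hx
        · exact h₁ c hc

theorem exists_last {α : Type*} (P : α → Prop) {l : List α} (h : ∃ a ∈ l, P a) :
    ∃ l₁ a l₂, l = l₁ ++ a :: l₂ ∧ P a ∧ ∀ b ∈ l₂, ¬ P b := by
  obtain ⟨l₁, a, l₂, h1, h2, h3⟩ := exists_first P (l := l.reverse) (by simpa using h)
  refine ⟨l₂.reverse, a, l₁.reverse, ?_, h2, by simpa using h3⟩
  rw [← l.reverse_reverse, h1]; simp

theorem exists_first_last {α : Type*} (P : α → Prop) {l : List α} {x y : α} (hx : x ∈ l)
    (hy : y ∈ l) (hxy : x ≠ y) (hPx : P x) (hPy : P y) :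
    ∃ l₁ a m b l₂, l = l₁ ++ a :: (m ++ b :: l₂) ∧ P a ∧ P b ∧ (∀ c ∈ l₁, ¬ P c) ∧
      ∀ c ∈ l₂, ¬ P c := by
  obtain ⟨l₁, a, l', rfl, ha, h₁⟩ := exists_first P ⟨x, hx, hPx⟩
  have : ∃ z ∈ l', P z := by
    have h2 : ∀ z ∈ l₁ ++ a :: l', P z → z = a ∨ z ∈ l' := by
      intro z hz hPz
      rcases List.mem_append.1 hz with h | h
      · exact absurd hPz (h₁ z h)
      · exact List.mem_cons.1 h
    rcases h2 x hx hPx with rfl | h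
    · exact ⟨y, (h2 y hy hPy).resolve_left (Ne.symm hxy), hPy⟩
    · exact ⟨x, h, hPx⟩
  obtain ⟨m, b, l₂, rfl, hb, h₂⟩ := exists_last P this
  exact ⟨l₁, a, m, b, l₂, rfl, ha, hb, h₁, h₂⟩

theorem mem_selfX {x : Space} {A' : List Space} {y : Space} {B' : List Space}
    (D : Diagram (x :: A' ++ y :: B')) {p : Plane} : p ∈ selfX (y :: B' ++ [x]) ↔
      ∃ e ∈ segs (y :: B' ++ [x]), ∃ f ∈ segs (y :: B' ++ [x]), e ≠ f ∧ p ∈ oseg (pe e) ∧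
        p ∈ oseg (pe f) := by
  have hc : ∀ {f}, f ∈ segs (y :: B' ++ [x]) → f ∈ cedges (x :: A' ++ y :: B') := fun hf => by
    rw [cedges_cons_append_cons]; exact List.mem_append_right _ hf
  have hnd : (pes (y :: B' ++ [x])).Nodup := by
    have := nodup_cedges D.gen.nodup
    rw [cedges_pl, cedges_cons_append_cons, List.map_append] at this
    exact (List.nodup_append.1 this).2.1
  rw [selfX, Set.mem_ofPred_eq, two_le_cov hnd]
  constructor
  · rintro ⟨e, he, f, hf, hef, h1, h2⟩
    obtain ⟨e, he', rfl⟩ := mem_pes.1 he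
    obtain ⟨f, hf', rfl⟩ := mem_pes.1 hf
    exact ⟨e, he', f, hf', fun h => hef (h ▸ rfl), h1, h2⟩
  · rintro ⟨e, he, f, hf, hef, h1, h2⟩
    exact ⟨_, mem_pes.2 ⟨e, he, rfl⟩, _, mem_pes.2 ⟨f, hf, rfl⟩,
      fun h => hef (D.pe_inj (hc he) (hc hf) h), h1, h2⟩

/-- The last edge of the second arc with a self-crossing of the arc loses a crossing. -/
theorem exists_finger_last {x : Space} {A' : List Space} {y : Space} {B' : List Space}
    {T : Space × Space} {pre post : List (Space × Space)}
    (D : Diagram (x :: A' ++ y :: B')) (hα : ∀ p, cov (pes (x :: A' ++ [y])) p ≤ 1)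
    (hl : segs (y :: B' ++ [x]) = pre ++ T :: post)
    (hT : ∃ p ∈ oseg (pe T), p ∈ selfX (y :: B' ++ [x]))
    (hpost : ∀ f ∈ post, ∀ p ∈ oseg (pe f), p ∉ selfX (y :: B' ++ [x])) :
    ∃ B'', Diagram (x :: A' ++ y :: B'') ∧ LEq (x :: A' ++ y :: B') (x :: A' ++ y :: B'') ∧
      (selfX (y :: B'' ++ [x])).ncard < (selfX (y :: B' ++ [x])).ncard ∧
      (mutX (x :: A' ++ [y]) (y :: B'' ++ [x])).ncard ≤
        (mutX (x :: A' ++ [y]) (y :: B' ++ [x])).ncard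
        + 2 * {q | 1 ≤ cov ((T :: post).map pe) q ∧ 1 ≤ cov (pes (x :: A' ++ [y])) q}.ncard + 1 := by
  obtain ⟨U, Z, hB, hU, hZ⟩ := segs_eq_append hl
  obtain ⟨u, v⟩ := T
  simp only at hB hU hZ
  have hTβ : (u, v) ∈ segs (y :: B' ++ [x]) := by rw [hl]; simp
  have hZβ : ∀ f ∈ post, f ∈ segs (y :: B' ++ [x]) := fun f hf => by rw [hl]; simp [hf]
  -- the crossing closest to the end of the edge
  have hfin : (oseg (pe (u, v)) ∩ selfX (y :: B' ++ [x])).Finite :=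
    (finite_selfX D).subset Set.inter_subset_right
  obtain ⟨c, ⟨hcT, hcX⟩, hmin⟩ := Set.exists_min_image _ (fun p => ‖p - v.1‖) hfin hT
  have hcv : oseg (c, v.1) ⊆ oseg (pe (u, v)) := fun q hq =>
    (mem_oseg_split hcT q).2 (Or.inr (Or.inr hq))
  have hcv1 : c ≠ v.1 := by
    rintro rfl
    refine right_notMem_oseg (D.pe_ne (e := (u, v)) ?_) hcT
    rw [cedges_cons_append_cons]; exact List.mem_append_right _ hTβ
  have hfree : ∀ g ∈ segs (y :: B' ++ [x]), ∀ q ∈ oseg (c, v.1), q ∈ oseg (pe g) →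
      g = (u, v) := by
    intro g hg q hq hqg
    by_contra hne
    have h1 : q ∈ selfX (y :: B' ++ [x]) := (mem_selfX D).2 ⟨g, hg, _, hTβ, hne, hqg, hcv hq⟩
    have h2 : ‖c - v.1‖ ≤ ‖q - v.1‖ := hmin q ⟨hcv hq, h1⟩
    obtain ⟨s, t, hs, ht, hst, rfl⟩ := hq
    have h3 : s • c + t • v.1 - v.1 = s • (c - v.1) := by
      have : t = 1 - s := by linarith
      subst this; module
    have h4 : 0 < ‖c - v.1‖ := norm_pos_iff.2 (sub_ne_zero.2 hcv1)
    simp only [h3, norm_smul, Real.norm_of_nonneg hs.le] at h2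
    nlinarith
  obtain ⟨s, hs, hsT, hcs⟩ : ∃ s ∈ segs (y :: B' ++ [x]), s ≠ (u, v) ∧ c ∈ oseg (pe s) := by
    obtain ⟨e, he, f, hf, hef, h1, h2⟩ := (mem_selfX D).1 hcX
    by_cases h : e = (u, v)
    · exact ⟨f, hf, fun h' => hef (h.trans h'.symm), h2⟩
    · exact ⟨e, he, h, h1⟩
  -- The edges behind `T` carry no self-crossing, so the other strand through `c` comes before `T`.
  have hsU : s ∈ segs (U ++ [u]) := by
    rw [hl, List.mem_append, List.mem_cons] at hs
    rcases hs with h | h | h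
    · exact hU ▸ h
    · exact absurd h hsT
    · exact absurd hcX (hpost s h c hcs)
  obtain ⟨B'', D1, L1, h1, h2⟩ := exists_finger Z D hα hB hsU hcs hcT (by
    intro f hf g hg hfg p hpf hpg
    rw [hZ] at hf
    exact hpost f hf p hpf ((mem_selfX D).2 ⟨f, hZβ f hf, g, hg, hfg, hpf, hpg⟩)) hfree
  refine ⟨B'', D1, L1, h1, h2.trans ?_⟩
  have : {q | (q ∈ oseg (c, v.1) ∨ 1 ≤ cov (pes (v :: Z)) q) ∧ 1 ≤ cov (pes (x :: A' ++ [y])) q} ⊆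
      {q | 1 ≤ cov (((u, v) :: post).map pe) q ∧ 1 ≤ cov (pes (x :: A' ++ [y])) q} := by
    rintro q ⟨h1 | h1, h2⟩
    · refine ⟨?_, h2⟩
      rw [List.map_cons, cov_cons_of_mem (hcv h1)]; omega
    · refine ⟨?_, h2⟩
      rw [pes, hZ] at h1
      rw [List.map_cons, cov_cons]; omega
  have h3 := Set.ncard_le_ncard this (by
    refine (finite_mutX D).subset ?_
    rintro q ⟨h1, h2⟩
    refine ⟨h2, h1.trans ?_⟩
    rw [pes, hl, List.map_append, cov_append]
    omega)
  omega

theorem pes_reverse (l : List Space) (p : Plane) : cov (pes l.reverse) p = cov (pes l) p := by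
  have h : pes l.reverse = ((pes l).map Prod.swap).reverse := by
    rw [pes, segs_reverse, List.map_reverse, List.map_map, pes, List.map_map]; rfl
  rw [h, cov_perm (List.reverse_perm _), cov_map_swap]

/-- If the first arc of a diagram is simple, then a self-crossing of the second arc can be removed
so that the number of crossings of the arcs grows to at most twice the number plus one. -/
theorem exists_reduce {x : Space} {A' : List Space} {y : Space} {B' : List Space}
    (D : Diagram (x :: A' ++ y :: B')) (hα : ∀ p, cov (pes (x :: A' ++ [y])) p ≤ 1)
    (hX : (selfX (y :: B' ++ [x])).Nonempty) :
    ∃ x₁ A₁ y₁ B₁, Diagram (x₁ :: A₁ ++ y₁ :: B₁) ∧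
      LEq (x :: A' ++ y :: B') (x₁ :: A₁ ++ y₁ :: B₁) ∧
      (∀ p, cov (pes (x₁ :: A₁ ++ [y₁])) p ≤ 1) ∧
      (selfX (y₁ :: B₁ ++ [x₁])).ncard < (selfX (y :: B' ++ [x])).ncard ∧
      (mutX (x₁ :: A₁ ++ [y₁]) (y₁ :: B₁ ++ [x₁])).ncard ≤
        2 * (mutX (x :: A' ++ [y]) (y :: B' ++ [x])).ncard + 1 := by
  obtain ⟨p, hp⟩ := hX
  obtain ⟨e, he, f, hf, hef, hpe, hpf⟩ := (mem_selfX D).1 hp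
  -- `T'` and `T` are the first and the last edge with a self-crossing. A self-crossing involves two
  -- edges, so they are different and the two tails of the second arc have no common edge.
  obtain ⟨l₁, T', M, T, l₂, hl, hT', hT, h₁, h₂⟩ := exists_first_last
    (fun e => ∃ p ∈ oseg (pe e), p ∈ selfX (y :: B' ++ [x])) he hf hef ⟨p, hpe, hp⟩ ⟨p, hpf, hp⟩
  obtain ⟨F, hF⟩ : ∃ F, F = {q | 1 ≤ cov ((T :: l₂).map pe) q ∧
    1 ≤ cov (pes (x :: A' ++ [y])) q} := ⟨_, rfl⟩
  obtain ⟨F', hF'⟩ : ∃ F', F' = {q | 1 ≤ cov ((l₁ ++ [T']).map pe) q ∧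
    1 ≤ cov (pes (x :: A' ++ [y])) q} := ⟨_, rfl⟩
  have hcov : ∀ q, cov ((l₁ ++ [T']).map pe) q + cov ((T :: l₂).map pe) q
      ≤ cov (pes (y :: B' ++ [x])) q := by
    intro q
    rw [pes, hl]
    have : l₁ ++ T' :: (M ++ T :: l₂) = (l₁ ++ [T']) ++ (M ++ (T :: l₂)) := by simp
    rw [this, List.map_append (l₁ := l₁ ++ [T']), List.map_append (l₁ := M), cov_append, cov_append]
    omega
  -- A point on both tails and on the first arc would be a triple point. Hence the two tails
  -- together have at most as many crossings with the first arc as the whole second arc has, and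
  -- twice the smaller number is at most that.
  have hdis : Disjoint F F' := by
    rw [Set.disjoint_left, hF, hF']
    rintro q ⟨h3, h4⟩ ⟨h5, -⟩
    have h6 := D.gen.cov_le q
    rw [cov_cedges_pl] at h6
    have := hcov q
    omega
  have hFM : F ∪ F' ⊆ mutX (x :: A' ++ [y]) (y :: B' ++ [x]) := by
    rw [hF, hF']
    rintro q (⟨h3, h4⟩ | ⟨h3, h4⟩)
    · exact ⟨h4, by have := hcov q; omega⟩
    · exact ⟨h4, by have := hcov q; omega⟩
  have hMf := finite_mutX D
  have hcard := Set.ncard_le_ncard hFM hMf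
  rw [Set.ncard_union_eq hdis (hMf.subset (Set.subset_union_left.trans hFM))
    (hMf.subset (Set.subset_union_right.trans hFM))] at hcard
  rcases le_total F.ncard F'.ncard with hle | hle
  · obtain ⟨B'', D1, L1, k1, k2⟩ := exists_finger_last D hα (pre := l₁ ++ T' :: M) (T := T)
      (post := l₂) (by rw [hl]; simp) hT fun f hf p hp hpX => h₂ f hf ⟨p, hp, hpX⟩
    rw [← hF] at k2
    exact ⟨x, A', y, B'', D1, L1, hα, k1, by omega⟩
  -- The initial tail is the cheaper one: reverse the direction of travel, so that it becomes the
  -- final tail.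
  · have e1 : (x :: A' ++ y :: B').reverse = B'.reverse ++ (y :: A'.reverse ++ [x]) := by simp
    have e2 : y :: A'.reverse ++ x :: B'.reverse = (y :: A'.reverse ++ [x]) ++ B'.reverse := by simp
    have DR : Diagram (y :: A'.reverse ++ x :: B'.reverse) := by
      have := D.reverse
      rw [e1] at this
      rw [e2]; exact this.rotate
    have LR : LEq (x :: A' ++ y :: B') (y :: A'.reverse ++ x :: B'.reverse) := by
      refine (LEq.reverse D.simple).trans ?_
      have := D.reverse
      rw [e1] at this ⊢
      rw [e2]; exact LEq.rotate this.simple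
    have e3 : x :: B'.reverse ++ [y] = (y :: B' ++ [x]).reverse := by simp
    have e4 : y :: A'.reverse ++ [x] = (x :: A' ++ [y]).reverse := by simp
    have hself : selfX (x :: B'.reverse ++ [y]) = selfX (y :: B' ++ [x]) := by
      ext q; rw [selfX, selfX, e3]; simp only [Set.mem_ofPred_eq, pes_reverse]
    have hmut : mutX (y :: A'.reverse ++ [x]) (x :: B'.reverse ++ [y])
        = mutX (x :: A' ++ [y]) (y :: B' ++ [x]) := by
      ext q; rw [mutX, mutX, e3, e4]; simp only [Set.mem_ofPred_eq, pes_reverse]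
    have hαR : ∀ p, cov (pes (y :: A'.reverse ++ [x])) p ≤ 1 := by
      intro p; rw [e4, pes_reverse]; exact hα p
    have hsw : ∀ e : Space × Space, oseg (pe e.swap) = oseg (pe e) := fun e => oseg_swap (pe e)
    obtain ⟨B'', D1, L1, k1, k2⟩ := exists_finger_last DR hαR
      (pre := ((M ++ T :: l₂).map Prod.swap).reverse) (T := T'.swap)
      (post := (l₁.map Prod.swap).reverse) (by rw [e3, segs_reverse, hl]; simp)
      (by rw [hself, hsw]; exact hT') (by
        intro f hf p hp hpX
        rw [List.mem_reverse, List.mem_map] at hf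
        obtain ⟨g, hg, rfl⟩ := hf
        rw [hself] at hpX
        rw [hsw] at hp
        exact h₁ g hg ⟨p, hp, hpX⟩)
    have hset : {q | 1 ≤ cov ((T'.swap :: (l₁.map Prod.swap).reverse).map pe) q ∧
        1 ≤ cov (pes (y :: A'.reverse ++ [x])) q} = F' := by
      rw [hF']
      have e5 : (T'.swap :: (l₁.map Prod.swap).reverse).map pe
          = (((l₁ ++ [T']).map pe).map Prod.swap).reverse := by
        rw [List.map_append, List.map_append, List.reverse_append, List.map_cons, List.map_reverse,
          List.map_map, List.map_map, List.map_map (l := l₁)]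
        rfl
      ext q
      rw [e4, e5]
      simp only [Set.mem_ofPred_eq, pes_reverse]
      rw [cov_perm (List.reverse_perm _), cov_map_swap]
    rw [hself] at k1
    rw [hmut, hset] at k2
    exact ⟨y, A'.reverse, x, B'', D1, LR.trans L1, hαR, k1, by omega⟩

/-- If the first arc of a diagram is simple and has `a` crossings with the second arc, which has
`b` self-crossings, then there is an equivalent diagram made of two simple arcs with at most
`2 ^ b * (a + 1) - 1` crossings. -/
theorem exists_two_simple {x : Space} {A' : List Space} {y : Space} {B' : List Space}
    (D : Diagram (x :: A' ++ y :: B')) (hα : ∀ p, cov (pes (x :: A' ++ [y])) p ≤ 1) :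
    ∃ x₁ A₁ y₁ B₁, Diagram (x₁ :: A₁ ++ y₁ :: B₁) ∧
      LEq (x :: A' ++ y :: B') (x₁ :: A₁ ++ y₁ :: B₁) ∧
      (∀ p, cov (pes (x₁ :: A₁ ++ [y₁])) p ≤ 1) ∧ (∀ p, cov (pes (y₁ :: B₁ ++ [x₁])) p ≤ 1) ∧
      (mutX (x₁ :: A₁ ++ [y₁]) (y₁ :: B₁ ++ [x₁])).ncard + 1 ≤
        2 ^ (selfX (y :: B' ++ [x])).ncard *
          ((mutX (x :: A' ++ [y]) (y :: B' ++ [x])).ncard + 1) := by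
  induction hb : (selfX (y :: B' ++ [x])).ncard using Nat.strong_induction_on
    generalizing x A' y B' with
  | h b ih =>
    rcases (selfX (y :: B' ++ [x])).eq_empty_or_nonempty with h | h
    · refine ⟨x, A', y, B', D, LEq.refl D.simple, hα, fun p => ?_, ?_⟩
      · have h1 : p ∉ selfX (y :: B' ++ [x]) := by rw [h]; simp
        rw [selfX, Set.mem_ofPred_eq] at h1
        omega
      · rw [h, Set.ncard_empty] at hb
        subst hb
        simp
    · obtain ⟨x₁, A₁, y₁, B₁, D1, L1, α1, k1, k2⟩ := exists_reduce D hα h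
      obtain ⟨x₂, A₂, y₂, B₂, D2, L2, α2, β2, k3⟩ := ih _ (hb ▸ k1) D1 α1 rfl
      refine ⟨x₂, A₂, y₂, B₂, D2, L1.trans L2, α2, β2, k3.trans ?_⟩
      rw [hb] at k1
      -- Increased by one, the number of crossings of the arcs at most doubles, which is paid for by
      -- the drop in the exponent.
      calc _ ≤ 2 ^ (selfX (y₁ :: B₁ ++ [x₁])).ncard *
            (2 * ((mutX (x :: A' ++ [y]) (y :: B' ++ [x])).ncard + 1)) :=
            Nat.mul_le_mul_left _ (by omega)
        _ = 2 ^ ((selfX (y₁ :: B₁ ++ [x₁])).ncard + 1) *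
            ((mutX (x :: A' ++ [y]) (y :: B' ++ [x])).ncard + 1) := by rw [pow_succ]; ring
        _ ≤ _ := Nat.mul_le_mul_right _ (Nat.pow_le_pow_right (by norm_num) k1)

/-! ### Diagrams with at most one crossing on each edge -/

theorem exists_rotate_cedges {E : Type*} {V : List E} {P Q : List (E × E)} {e : E × E}
    (h : cedges V = P ++ e :: Q) : ∃ l₁ l₂, V = l₁ ++ l₂ ∧ cedges (l₂ ++ l₁) = e :: Q ++ P := by
  cases V with
  | nil => simp [cedges] at h
  | cons x A =>
    obtain ⟨m₁, m₂, h1, h2, h3⟩ := segs_eq_append (l := x :: A ++ [x]) h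
    obtain ⟨B, z, hB⟩ : ∃ B z, e.2 :: m₂ = B ++ [z] :=
      ⟨_, _, (List.dropLast_append_getLast (List.cons_ne_nil _ _)).symm⟩
    cases m₁ with
    | nil =>
      refine ⟨[], x :: A, rfl, ?_⟩
      rw [List.append_nil, h]
      simp only [List.nil_append, segs_singleton] at h2
      rw [← h2]; simp
    | cons w m₁ =>
      have h4 : (x :: A) ++ [x] = (w :: m₁ ++ e.1 :: B) ++ [z] := by
        rw [h1, hB]; simp
      obtain ⟨h5, h6⟩ := List.append_inj' h4 rfl
      have hw : w = x := by
        rw [List.cons_append, List.cons.injEq] at h5; exact h5.1.symm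
      have hz : x = z := by simpa using h6
      subst hw hz
      refine ⟨w :: m₁, e.1 :: B, h5, ?_⟩
      rw [cedges_cons_append_cons, List.cons_append, List.cons_append, ← h2]
      have h6 : segs (e.1 :: (B ++ [w])) = e :: Q := by rw [← hB, segs_cons_cons, h3]
      rw [h6]; simp

/-- A diagram on which each edge has at most one crossing. -/
def Sparse (V : List Space) : Prop :=
  ∀ e ∈ cedges V, (oseg (pe e) ∩ crs (pl V)).Subsingleton

theorem sum_sq_perm {l₁ l₂ : List (Space × Space)} (h : l₁.Perm l₂) (f : Space × Space → ℕ) :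
    (l₁.map f).sum = (l₂.map f).sum := (h.map f).sum_eq

/-- Each diagram can be subdivided so that each edge has at most one crossing. -/
theorem Diagram.exists_sparse {V : List Space} (D : Diagram V) :
    ∃ W, Diagram W ∧ LEq V W ∧ crs (pl W) = crs (pl V) ∧ Sparse W := by
  -- The sum of the squares of the numbers of crossings on the edges drops when an edge with `u + w`
  -- crossings is split into edges with `u > 0` and `w > 0` crossings.
  induction hN : ((cedges V).map fun e => (oseg (pe e) ∩ crs (pl V)).ncard ^ 2).sum
    using Nat.strong_induction_on generalizing V with
  | h N ih =>
    by_cases hS : Sparse V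
    · exact ⟨V, D, LEq.refl D.simple, rfl, hS⟩
    rw [Sparse] at hS
    push Not at hS
    obtain ⟨e, he, hne⟩ := hS
    obtain ⟨p, ⟨hpe, hpc⟩, p', ⟨hpe', hpc'⟩, hpp⟩ := hne
    obtain ⟨P, Q, hPQ⟩ := List.append_of_mem he
    obtain ⟨l₁, l₂, rfl, h2⟩ := exists_rotate_cedges (V := V) (e := e) (P := P ) (Q := Q) hPQ
    obtain ⟨a, b⟩ := e
    -- rotate the edge to the last place
    obtain ⟨l₃, l₄, h3, h4⟩ : ∃ l₃ l₄, l₁ ++ l₂ = l₃ ++ l₄ ∧ ∃ m, l₄ ++ l₃ = b :: m ++ [a] := by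
      have h5 : l₂ ++ l₁ ≠ [] := by
        intro h; rw [h] at h2; simp [cedges] at h2
      cases h6 : l₂ ++ l₁ with
      | nil => exact absurd h6 h5
      | cons z l =>
        rw [h6] at h2
        have hz : z = a := by
          have := congrArg (List.map Prod.fst) h2
          rw [map_fst_cedges] at this
          simp at this
          exact this.1
        have hb : ∃ m, l = b :: m := by
          cases l with
          | nil =>
            have := D.simple.1
            have h7 := congrArg List.length h6
            simp only [List.length_append, List.length_cons, List.length_nil] at h7 this
            omega
          | cons w m =>
            refine ⟨m, ?_⟩
            rw [cedges, List.cons_append, List.cons_append, segs_cons_cons] at h2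
            simp at h2
            rw [h2.1.2]
        obtain ⟨m, rfl⟩ := hb
        subst hz
        have h7 : (z :: b :: m) = [z] ++ (b :: m) := rfl
        rw [h7] at h6
        rcases List.append_eq_append_iff.1 h6 with ⟨c, h8, h9⟩ | ⟨c, h8, h9⟩
        · cases l₂ with
          | nil => exact ⟨[z], b :: m, by simpa using h6, m, rfl⟩
          | cons w l₂ =>
            simp only [List.cons_append, List.cons.injEq] at h8
            obtain ⟨rfl, h8⟩ := h8
            have h8' := List.append_eq_nil_iff.1 h8.symm
            obtain ⟨rfl, rfl⟩ := h8'
            refine ⟨l₁ ++ [z], [], by simp, m, by rw [h9]; simp⟩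
        · refine ⟨l₁ ++ [z], c, by rw [h8]; simp, m, ?_⟩
          rw [h9]; simp
    obtain ⟨m, hm⟩ := h4
    have DR : Diagram (b :: m ++ [a]) := by
      rw [← hm]; rw [h3] at D; exact D.rotate
    have LR : LEq (l₁ ++ l₂) (b :: m ++ [a]) := by
      rw [← hm, h3]; rw [h3] at D; exact LEq.rotate D.simple
    have hcR : crs (pl (b :: m ++ [a])) = crs (pl (l₁ ++ l₂)) := by
      rw [← hm, h3, pl_append, pl_append, crs_rotate]
    have hperm : (cedges (l₁ ++ l₂)).Perm (cedges (b :: m ++ [a])) := by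
      rw [← hm, h3]; exact cedges_append_perm _ _
    -- The new vertex is put between two crossings of the edge; only finitely many positions there
    -- are forbidden.
    obtain ⟨z, hz, hzc⟩ := ((infinite_oseg (e := (p, p')) hpp).sdiff D.fin).nonempty
    have hzab : z ∈ oseg (pe (a, b)) := by
      exact (convex_openSegment _ _).openSegment_subset hpe hpe' hz
    have hab : (pe (a, b)).1 ≠ (pe (a, b)).2 := D.pe_ne he
    rw [oseg_pe] at hzab
    obtain ⟨x, hx, rfl⟩ := hzab
    obtain ⟨D1, c1⟩ := DR.subdivide hx (by rw [hcR]; exact hzc)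
    have L1 := LEq.subdivide DR.simple hx
    have hxp : x.1 ∈ oseg (a.1, b.1) := mem_oseg_pe hx
    have hsplit : ∀ q, q ∈ crs (pl (l₁ ++ l₂)) → (q ∈ oseg (a.1, b.1) ↔
        q ∈ oseg (a.1, x.1) ∨ q ∈ oseg (x.1, b.1)) := by
      intro q hq
      rw [mem_oseg_split hxp]
      have : q ≠ x.1 := by rintro rfl; exact hzc hq
      tauto
    have hdis : ∀ q, q ∈ oseg (a.1, x.1) → q ∉ oseg (x.1, b.1) :=
      fun q h => notMem_oseg_left_right hab hxp h
    have hax : a.1 ≠ x.1 := by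
      intro h; rw [← h] at hxp; exact left_notMem_oseg hab hxp
    have hxb : x.1 ≠ b.1 := by
      intro h; rw [h] at hxp; exact right_notMem_oseg hab hxp
    have hset : oseg (pe (a, b)) ∩ crs (pl (l₁ ++ l₂))
        = (oseg (pe (a, x)) ∩ crs (pl (l₁ ++ l₂))) ∪ (oseg (pe (x, b)) ∩ crs (pl (l₁ ++ l₂))) := by
      ext q
      constructor
      · rintro ⟨h1, h2⟩
        exact ((hsplit q h2).1 h1).imp (fun h => ⟨h, h2⟩) (fun h => ⟨h, h2⟩)
      · rintro (⟨h1, h2⟩ | ⟨h1, h2⟩)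
        · exact ⟨(hsplit q h2).2 (Or.inl h1), h2⟩
        · exact ⟨(hsplit q h2).2 (Or.inr h1), h2⟩
    have hcard := Set.ncard_union_eq (s := oseg (pe (a, x)) ∩ crs (pl (l₁ ++ l₂)))
      (t := oseg (pe (x, b)) ∩ crs (pl (l₁ ++ l₂)))
      (Set.disjoint_left.2 fun q h h' => hdis q h.1 h'.1)
      (D.fin.subset Set.inter_subset_right) (D.fin.subset Set.inter_subset_right)
    rw [← hset] at hcard
    have hpos : 0 < (oseg (pe (a, x)) ∩ crs (pl (l₁ ++ l₂))).ncard ∧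
        0 < (oseg (pe (x, b)) ∩ crs (pl (l₁ ++ l₂))).ncard := by
      have hc1 : ∀ u w : Plane, u ≠ w → x.1 = w ∨ x.1 = u → ¬ (p ∈ oseg (u, w) ∧ p' ∈ oseg (u, w)) := by
        rintro u w huw h ⟨h1, h2⟩
        have h3 : x.1 ∈ oseg (u, w) := (convex_openSegment _ _).openSegment_subset h1 h2 hz
        rcases h with h | h
        · rw [h] at h3; exact right_notMem_oseg huw h3
        · rw [h] at h3; exact left_notMem_oseg huw h3
      have h1 := hc1 a.1 x.1 hax (Or.inl rfl)
      have h2 := hc1 x.1 b.1 hxb (Or.inr rfl)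
      have h3 := (hsplit p hpc).1 hpe
      have h4 := (hsplit p' hpc').1 hpe'
      rw [Set.ncard_pos (D.fin.subset Set.inter_subset_right),
        Set.ncard_pos (D.fin.subset Set.inter_subset_right)]
      constructor
      · rcases h3 with h3 | h3
        · exact ⟨p, h3, hpc⟩
        · rcases h4 with h4 | h4
          · exact ⟨p', h4, hpc'⟩
          · exact absurd ⟨h3, h4⟩ h2
      · rcases h3 with h3 | h3
        · rcases h4 with h4 | h4
          · exact absurd ⟨h3, h4⟩ h1
          · exact ⟨p', h4, hpc'⟩
        · exact ⟨p, h3, hpc⟩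
    obtain ⟨W, DW, LW, cW, SW⟩ := ih _ (by
      rw [← hN, c1, hcR, sum_sq_perm hperm, cedges_last, cedges_last_insert, List.map_append,
        List.map_append, List.sum_append, List.sum_append]
      simp only [List.map_cons, List.map_nil, List.sum_cons, List.sum_nil, hcard]
      have h1 := hpos.1
      have h2 := hpos.2
      set u := (oseg (pe (a, x)) ∩ crs (pl (l₁ ++ l₂))).ncard
      set w := (oseg (pe (x, b)) ∩ crs (pl (l₁ ++ l₂))).ncard
      nlinarith [Nat.mul_pos h1 h2]) D1 rfl
    exact ⟨W, DW, (LR.trans L1).trans LW, by rw [cW, c1, hcR], SW⟩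

/-! ### Removal of kinks -/

theorem exists_smul_of_mem_cseg {e : Plane × Plane} {p q : Plane} (hp : p ∈ cseg e)
    (hq : q ∈ cseg e) : ∃ x : ℝ, p - q = x • (e.2 - e.1) := by
  obtain ⟨s, t, -, -, hst, rfl⟩ := hp
  obtain ⟨s', t', -, -, hst', rfl⟩ := hq
  refine ⟨t - t', ?_⟩
  have h1 : s = 1 - t := by linarith
  have h2 : s' = 1 - t' := by linarith
  subst h1 h2; module

/-- A short chord that cuts off a corner at a crossing. -/
theorem Gen.exists_chord {U : List Plane} (h : Gen 2 U) (h2 : 2 ≤ U.length) (hfin : (crs U).Finite)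
    {T s : Plane × Plane} {c t w : Plane} (hT : T ∈ cedges U) (hs : s ∈ cedges U) (hTs : T ≠ s)
    (hcT : c ∈ oseg T) (hcs : c ∈ oseg s) (ht : t ∈ cseg T) (hw : w ∈ cseg s) (htc : t ≠ c)
    (hwc : w ≠ c) :
    ∃ E W, E ∈ oseg (c, t) ∧ W ∈ oseg (c, w) ∧ E ∉ crs U ∧ W ∉ crs U ∧ E ≠ W ∧
      c ∉ cseg (E, W) ∧
      ∀ f ∈ cedges U, ∀ p ∈ cseg f, p ∈ cseg (E, W) → (f = T ∧ p = E) ∨ (f = s ∧ p = W) := by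
  have hdet := h.det2_ne h2 hfin hT hs hTs hcT hcs
  obtain ⟨r, hr⟩ := exists_smul_of_mem_cseg ht (oseg_subset_cseg _ hcT)
  obtain ⟨r', hr'⟩ := exists_smul_of_mem_cseg hw (oseg_subset_cseg _ hcs)
  have hr0 : r ≠ 0 := by
    rintro rfl; rw [zero_smul, sub_eq_zero] at hr; exact htc hr
  have hr0' : r' ≠ 0 := by
    rintro rfl; rw [zero_smul, sub_eq_zero] at hr'; exact hwc hr'
  -- The ends of the chord are taken at the same small fraction `ε` of the way from `c` to `t` and
  -- to `w`. Near `c` there is no other crossing, and no edge but `T` and `s`.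
  have hE : Tendsto (fun ε : ℝ => c + ε • (t - c)) (𝓝[>] 0) (𝓝 c) := by
    have : Tendsto (fun ε : ℝ => c + ε • (t - c)) (𝓝 0) (𝓝 (c + (0 : ℝ) • (t - c))) :=
      Continuous.tendsto (by fun_prop) 0
    rw [zero_smul, add_zero] at this
    exact this.mono_left nhdsWithin_le_nhds
  have hW : Tendsto (fun ε : ℝ => c + ε • (w - c)) (𝓝[>] 0) (𝓝 c) := by
    have : Tendsto (fun ε : ℝ => c + ε • (w - c)) (𝓝 0) (𝓝 (c + (0 : ℝ) • (w - c))) :=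
      Continuous.tendsto (by fun_prop) 0
    rw [zero_smul, add_zero] at this
    exact this.mono_left nhdsWithin_le_nhds
  have hε : ∀ᶠ ε in 𝓝[>] (0 : ℝ), 0 < ε ∧ ε < 1 := Ioo_mem_nhdsGT one_pos
  have hcl : IsClosed (crs U \ {c}) := (hfin.subset Set.sdiff_subset).isClosed
  have hcE := hE.eventually (hcl.isOpen_compl.mem_nhds (by simp))
  have hcW := hW.eventually (hcl.isOpen_compl.mem_nhds (by simp))
  have hoth : ∀ᶠ ε in 𝓝[>] (0 : ℝ), ∀ f ∈ {f | f ∈ cedges U}, f ≠ T → f ≠ s →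
      ∀ x ∈ segment ℝ (c + ε • (t - c)) (c + ε • (w - c)), x ∉ cseg f := by
    rw [eventually_all_finite (List.finite_toSet _)]
    intro f hf
    by_cases hfT : f = T
    · exact Eventually.of_forall fun ε h => absurd hfT h
    by_cases hfs : f = s
    · exact Eventually.of_forall fun ε _ h => absurd hfs h
    filter_upwards [eventually_disjoint_segment hE hW (isClosed_cseg f) (by
      intro x hx hxf
      rw [segment_same, Set.mem_singleton_iff] at hx
      subst hx
      rcases h.meet hT hf (oseg_subset_cseg _ hcT) hxf with ⟨h3, -⟩ | ⟨-, h3⟩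
      · exact h.vertex_notMem x h3 T hT hcT
      · exact hfs (h.eq_of_two hT hs hf hTs hfT hcT hcs h3))] with ε hε _ _
    exact hε
  obtain ⟨ε, ⟨hε0, hε1⟩, hcE, hcW, hoth⟩ := (hε.and (hcE.and (hcW.and hoth))).exists
  have hmem : ∀ z : Plane, c + ε • (z - c) ∈ oseg (c, z) := fun z =>
    ⟨1 - ε, ε, by linarith, hε0, by ring, by module⟩
  have hne : ∀ z : Plane, z ≠ c → c + ε • (z - c) ≠ c := by
    intro z hz h0
    rw [add_eq_left] at h0
    rcases smul_eq_zero.1 h0 with h1 | h1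
    · exact hε0.ne' h1
    · exact hz (sub_eq_zero.1 h1)
  -- The edges are not parallel, so the chord leaves `T` immediately: the coefficient of the
  -- direction of `s` must vanish.
  have hT' : ∀ p ∈ cseg T, p ∈ cseg (c + ε • (t - c), c + ε • (w - c)) → p = c + ε • (t - c) := by
    rintro p hp ⟨u, v, hu, hv, huv, rfl⟩
    obtain ⟨x, hx⟩ := exists_smul_of_mem_cseg hp (oseg_subset_cseg _ hcT)
    have e1 : u = 1 - v := by linarith
    subst e1
    have h3 : x • (T.2 - T.1) = ((1 - v) * ε * r) • (T.2 - T.1) + (v * ε * r') • (s.2 - s.1) := by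
      rw [← hx, mul_smul _ r, mul_smul _ r', ← hr, ← hr']; module
    have h4 : (v * ε * r') * det2 (T.2 - T.1) (s.2 - s.1) = 0 := by
      have h5 := congrArg Prod.fst h3
      have h6 := congrArg Prod.snd h3
      simp only [Prod.smul_fst, Prod.smul_snd, Prod.fst_add, Prod.snd_add, smul_eq_mul] at h5 h6
      rw [det2]
      linear_combination (T.2 - T.1).2 * h5 - (T.2 - T.1).1 * h6
    have h5 : v = 0 := by
      rcases mul_eq_zero.1 h4 with h5 | h5
      · rcases mul_eq_zero.1 h5 with h5 | h5
        · rcases mul_eq_zero.1 h5 with h5 | h5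
          · exact h5
          · exact absurd h5 hε0.ne'
        · exact absurd h5 hr0'
      · exact absurd h5 hdet
    subst h5; module
  have hs' : ∀ p ∈ cseg s, p ∈ cseg (c + ε • (t - c), c + ε • (w - c)) → p = c + ε • (w - c) := by
    rintro p hp ⟨u, v, hu, hv, huv, rfl⟩
    obtain ⟨x, hx⟩ := exists_smul_of_mem_cseg hp (oseg_subset_cseg _ hcs)
    have e1 : u = 1 - v := by linarith
    subst e1
    have h3 : x • (s.2 - s.1) = ((1 - v) * ε * r) • (T.2 - T.1) + (v * ε * r') • (s.2 - s.1) := by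
      rw [← hx, mul_smul _ r, mul_smul _ r', ← hr, ← hr']; module
    have h4 : ((1 - v) * ε * r) * det2 (T.2 - T.1) (s.2 - s.1) = 0 := by
      have h5 := congrArg Prod.fst h3
      have h6 := congrArg Prod.snd h3
      simp only [Prod.smul_fst, Prod.smul_snd, Prod.fst_add, Prod.snd_add, smul_eq_mul] at h5 h6
      rw [det2]
      linear_combination (s.2 - s.1).1 * h6 - (s.2 - s.1).2 * h5
    have h5 : v = 1 := by
      rcases mul_eq_zero.1 h4 with h5 | h5
      · rcases mul_eq_zero.1 h5 with h5 | h5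
        · rcases mul_eq_zero.1 h5 with h5 | h5
          · linarith
          · exact absurd h5 hε0.ne'
        · exact absurd h5 hr0
      · exact absurd h5 hdet
    subst h5; module
  have hTc := oseg_subset_cseg _ hcT
  have hsc := oseg_subset_cseg _ hcs
  have hET : c + ε • (t - c) ∈ cseg T :=
    (convex_segment _ _).openSegment_subset hTc ht (hmem t)
  refine ⟨c + ε • (t - c), c + ε • (w - c), hmem t, hmem w, fun h3 => hcE ⟨h3, hne t htc⟩,
    fun h3 => hcW ⟨h3, hne w hwc⟩, ?_, fun h3 => hne t htc (hT' c hTc h3).symm, ?_⟩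
  · intro h3
    have h4 : c + ε • (t - c) ∈ cseg s := by
      rw [h3]; exact (convex_segment _ _).openSegment_subset hsc hw (hmem w)
    exact hne t htc (h.meet_subsingleton hfin hT hs hTs ⟨hET, h4⟩ ⟨hTc, hsc⟩)
  · intro f hf p hp hpc
    by_cases hfT : f = T
    · subst hfT; exact Or.inl ⟨rfl, hT' p hp hpc⟩
    by_cases hfs : f = s
    · subst hfs; exact Or.inr ⟨rfl, hs' p hp hpc⟩
    exact absurd hp (hoth f hf hfT hfs p hpc)

theorem crs_pl_rotate (l₁ l₂ : List Space) : crs (pl (l₁ ++ l₂)) = crs (pl (l₂ ++ l₁)) := by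
  rw [pl_append, crs_rotate, ← pl_append]

/-- Inserting a vertex into an edge of a diagram, away from the crossings. -/
theorem Diagram.insert_vertex {L : List Space} {a b : Space} {R : List Space} {x : Space}
    (D : Diagram (L ++ a :: b :: R)) (hx : x ∈ oseg (a, b))
    (hxc : x.1 ∉ crs (pl (L ++ a :: b :: R))) :
    Diagram (L ++ a :: x :: b :: R) ∧ LEq (L ++ a :: b :: R) (L ++ a :: x :: b :: R) ∧
      crs (pl (L ++ a :: x :: b :: R)) = crs (pl (L ++ a :: b :: R)) ∧
      ∀ f ∈ cedges (L ++ a :: x :: b :: R), ∃ g ∈ cedges (L ++ a :: b :: R), cseg f ⊆ cseg g := by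
  have e1 : L ++ a :: b :: R = (L ++ [a]) ++ (b :: R) := by simp
  have e2 : (b :: R) ++ (L ++ [a]) = b :: (R ++ L) ++ [a] := by simp
  have e3 : L ++ a :: x :: b :: R = (L ++ [a, x]) ++ (b :: R) := by simp
  have e4 : (b :: R) ++ (L ++ [a, x]) = b :: (R ++ L) ++ [a] ++ [x] := by simp
  have D1 : Diagram (b :: (R ++ L) ++ [a]) := by rw [← e2]; rw [e1] at D; exact D.rotate
  have c1 : crs (pl (b :: (R ++ L) ++ [a])) = crs (pl (L ++ a :: b :: R)) := by
    rw [← e2, e1, crs_pl_rotate]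
  obtain ⟨D2, c2⟩ := D1.subdivide hx (c1 ▸ hxc)
  have L2 := LEq.subdivide D1.simple hx
  refine ⟨?_, ?_, ?_, ?_⟩
  · rw [e3]; rw [← e4] at D2; exact D2.rotate
  · have h1 : LEq (L ++ a :: b :: R) (b :: (R ++ L) ++ [a]) := by
      rw [← e2, e1]; rw [e1] at D; exact LEq.rotate D.simple
    have h2 : LEq (b :: (R ++ L) ++ [a] ++ [x]) (L ++ a :: x :: b :: R) := by
      rw [e3, ← e4]; rw [← e4] at D2; exact LEq.rotate D2.simple
    exact (h1.trans L2).trans h2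
  · rw [← c1, ← c2, ← e4, e3, crs_pl_rotate]
  · intro f hf
    rw [e3] at hf
    have h1 := (cedges_append_perm _ _).subset hf
    rw [e4, cedges_last_insert] at h1
    have h2 : ∀ g ∈ cedges (b :: (R ++ L) ++ [a]), g ∈ cedges (L ++ a :: b :: R) := by
      intro g hg
      rw [← e2] at hg
      rw [e1]; exact (cedges_append_perm _ _).subset hg
    have h3 : f ∈ segs (b :: (R ++ L) ++ [a]) ∨ f = (a, x) ∨ f = (x, b) := by simpa using h1
    have hx' := oseg_subset_cseg _ hx
    rcases h3 with h3 | rfl | rfl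
    · exact ⟨f, h2 f (by rw [cedges_last]; exact List.mem_append_left _ h3), subset_rfl⟩
    · exact ⟨(a, b), h2 _ (by rw [cedges_last]; simp),
        (convex_segment _ _).segment_subset (left_mem_segment ℝ _ _) hx'⟩
    · exact ⟨(a, b), h2 _ (by rw [cedges_last]; simp),
        (convex_segment _ _).segment_subset hx' (right_mem_segment ℝ _ _)⟩

/-- A first Reidemeister move. The loop leaves `c` along `v₀v₁` and returns along `vw`. Cut it off
by a short chord from a point `e` just after `c` on the first edge to a point `u` just after `c` on
the second one. The removed arc from `e` to `u` has `c` as its only crossing and is the upper strand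
there; the chord crosses nothing. So both lie over everything else, and `LEq.overpass` exchanges
them. -/
theorem Diagram.exists_unkink_over {v₀ v₁ v w : Space} {X' X₀ R : List Space} {c : Plane}
    (D : Diagram (v₀ :: (v₁ :: X') ++ w :: R)) (hX : v₁ :: X' = X₀ ++ [v])
    (hc₁ : c ∈ oseg (pe (v₀, v₁))) (hc₂ : c ∈ oseg (pe (v, w)))
    (hfree : ∀ f ∈ segs (v₁ :: X'), ∀ p ∈ oseg (pe f), p ∉ crs (pl (v₀ :: (v₁ :: X') ++ w :: R)))
    (hone₁ : ∀ p ∈ oseg (pe (v₀, v₁)), p ∈ crs (pl (v₀ :: (v₁ :: X') ++ w :: R)) → p = c)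
    (hone₂ : ∀ p ∈ oseg (pe (v, w)), p ∈ crs (pl (v₀ :: (v₁ :: X') ++ w :: R)) → p = c)
    (hover : ∀ x ∈ cseg (v, w), ∀ y ∈ cseg (v₀, v₁), x.1 = c → y.1 = c → y.2 ≤ x.2) :
    ∃ W, Diagram W ∧ LEq (v₀ :: (v₁ :: X') ++ w :: R) W ∧
      (crs (pl W)).ncard < (crs (pl (v₀ :: (v₁ :: X') ++ w :: R))).ncard := by
  obtain ⟨V, hV⟩ : ∃ V, V = v₀ :: (v₁ :: X') ++ w :: R := ⟨_, rfl⟩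
  have hV1 : V = [] ++ v₀ :: v₁ :: (X' ++ w :: R) := by rw [hV]; simp
  have hV2 : V = (v₀ :: X₀) ++ v :: w :: R := by rw [hV, hX]; simp
  rw [← hV] at D hfree hone₁ hone₂ ⊢
  have hl : 2 ≤ (pl V).length := by
    have := D.simple.1
    rw [pl, List.length_map]; omega
  have h1 : (v₀, v₁) ∈ cedges V := by rw [hV, List.cons_append, List.cons_append, cedges]; simp
  have h2 : (v, w) ∈ cedges V := by
    rw [hV, cedges_cons_append_cons, hX]
    have : v₀ :: (X₀ ++ [v]) ++ [w] = (v₀ :: X₀) ++ v :: w :: [] := by simp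
    rw [this, segs_append_cons_cons]; simp
  have hne : (v₀, v₁) ≠ (v, w) := by
    intro h
    have h3 : v₀ = v := congrArg Prod.fst h
    have := D.simple.2.nodup
    rw [hV, hX, h3] at this
    simp at this
  have hpne : pe (v₀, v₁) ≠ pe (v, w) := fun h => hne (D.pe_inj h1 h2 h)
  have hr1 : (pe (v₀, v₁)).2 ≠ c := by
    rintro rfl; exact right_notMem_oseg (D.pe_ne h1) hc₁
  have hr2 : (pe (v, w)).2 ≠ c := by
    rintro rfl; exact right_notMem_oseg (D.pe_ne h2) hc₂
  obtain ⟨E, W, hE, hW, hEc, hWc, hEW, hcEW, hch⟩ := D.gen.exists_chord hl D.fin (Diagram.pe_mem h1)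
    (Diagram.pe_mem h2) hpne hc₁ hc₂ (right_mem_segment ℝ _ _) (right_mem_segment ℝ _ _)
    hr1 hr2
  have hE' : E ∈ oseg (pe (v₀, v₁)) := (mem_oseg_split hc₁ E).2 (Or.inr (Or.inr hE))
  have hW' : W ∈ oseg (pe (v, w)) := (mem_oseg_split hc₂ W).2 (Or.inr (Or.inr hW))
  have hE'' := hE'
  have hW'' := hW'
  rw [oseg_pe] at hE' hW'
  obtain ⟨e, he, rfl⟩ := hE'
  obtain ⟨u, hu, rfl⟩ := hW'
  -- insert the two vertices
  have D0 := D
  rw [hV1] at D0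
  obtain ⟨D1, L1, c1, s1⟩ := D0.insert_vertex he (hV1 ▸ hEc)
  rw [← hV1] at L1 c1 s1
  have hV3 : [] ++ v₀ :: e :: v₁ :: (X' ++ w :: R) = (v₀ :: e :: X₀) ++ v :: w :: R := by
    have : v₁ :: (X' ++ w :: R) = (v₁ :: X') ++ w :: R := rfl
    rw [this, hX]; simp
  rw [hV3] at D1 L1 c1 s1
  obtain ⟨D2, L2, c2, s2⟩ := D1.insert_vertex hu (c1 ▸ hWc)
  have hV4 : (v₀ :: e :: X₀) ++ v :: u :: w :: R = (v₀ :: e :: v₁ :: X') ++ (u :: w :: R) := by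
    have : v₀ :: e :: v₁ :: X' = v₀ :: e :: (X₀ ++ [v]) := by rw [hX]
    rw [this]; simp
  have hV5 : (u :: w :: R) ++ (v₀ :: e :: v₁ :: X')
      = u :: (w :: R ++ [v₀]) ++ [e] ++ (v₁ :: X') := by simp
  have hc2 : crs (pl (u :: (w :: R ++ [v₀]) ++ [e] ++ (v₁ :: X'))) = crs (pl V) := by
    rw [← hV5, crs_pl_rotate, ← hV4, c2, c1]
  rw [hV4] at D2 L2 s2
  have D3 : Diagram (u :: (w :: R ++ [v₀]) ++ [e] ++ (v₁ :: X')) := by rw [← hV5]; exact D2.rotate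
  have L3 : LEq V (u :: (w :: R ++ [v₀]) ++ [e] ++ (v₁ :: X')) := by
    rw [← hV5]; exact (L1.trans L2).trans (LEq.rotate D2.simple)
  have s3 : ∀ f ∈ cedges (u :: (w :: R ++ [v₀]) ++ [e] ++ (v₁ :: X')), ∃ g ∈ cedges V,
      cseg f ⊆ cseg g := by
    intro f hf
    rw [← hV5] at hf
    obtain ⟨g, hg, hfg⟩ := s2 f ((cedges_append_perm _ _).subset hf)
    obtain ⟨g', hg', hgg⟩ := s1 g hg
    exact ⟨g', hg', hfg.trans hgg⟩
  have hchord : ∀ p ∈ oseg (e.1, u.1), ∀ f ∈ cedges (u :: (w :: R ++ [v₀]) ++ [e] ++ (v₁ :: X')),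
      p ∉ cseg (pe f) := by
    intro p hp f hf hpf
    obtain ⟨g, hg, hfg⟩ := s3 f hf
    have hpg : p ∈ cseg (pe g) := by
      rw [cseg_pe] at hpf ⊢
      exact Set.image_mono hfg hpf
    rcases hch _ (Diagram.pe_mem hg) p hpg (oseg_subset_cseg _ hp) with ⟨-, rfl⟩ | ⟨-, rfl⟩
    · exact left_notMem_oseg hEW hp
    · exact right_notMem_oseg hEW hp
  have hced : cedges (u :: (w :: R ++ [v₀]) ++ [e] ++ (v₁ :: X'))
      = segs (u :: (w :: R ++ [v₀]) ++ [e]) ++ segs (e :: (v₁ :: X') ++ [u]) := cedges_arc _ _ _ _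
  have hced' : cedges (u :: (w :: R ++ [v₀]) ++ [e]) = segs (u :: (w :: R ++ [v₀]) ++ [e]) ++ [(e, u)] :=
    cedges_last _ _ _
  have harc : segs (e :: (v₁ :: X') ++ [u]) = (e, v₁) :: segs (v₁ :: X') ++ [(v, u)] := by
    have : e :: (v₁ :: X') ++ [u] = (e :: X₀) ++ v :: u :: [] := by rw [hX]; simp
    rw [this, segs_append_cons_cons]
    have : e :: X₀ ++ [v] = e :: v₁ :: X' := by rw [hX]; simp
    rw [this]; simp
  have hpc3 : ∀ p, cov (cedges (pl (u :: (w :: R ++ [v₀]) ++ [e] ++ (v₁ :: X')))) p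
      = cov (pes (u :: (w :: R ++ [v₀]) ++ [e])) p + cov (pes (e :: (v₁ :: X') ++ [u])) p := by
    intro p
    rw [cedges_pl, hced, List.map_append, cov_append]; rfl
  have hpc4 : ∀ p, cov (cedges (pl (u :: (w :: R ++ [v₀]) ++ [e]))) p
      = cov (pes (u :: (w :: R ++ [v₀]) ++ [e])) p + cov [(e.1, u.1)] p := by
    intro p
    rw [cedges_pl, hced', List.map_append, cov_append]; rfl
  have hchcov : ∀ p ∈ oseg (e.1, u.1), cov (cedges (pl (u :: (w :: R ++ [v₀]) ++ [e]))) p = 1 := by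
    intro p hp
    rw [hpc4, cov_cons_of_mem hp, cov_nil]
    have : cov (pes (u :: (w :: R ++ [v₀]) ++ [e])) p = 0 := by
      by_contra h0
      obtain ⟨f, hf, hpf⟩ := one_le_cov_pes.1 (Nat.one_le_iff_ne_zero.2 h0)
      exact hchord p hp f (by rw [hced]; exact List.mem_append_left _ hf) (oseg_subset_cseg _ hpf)
    omega
  have hcovle : ∀ p ∉ oseg (e.1, u.1), cov (cedges (pl (u :: (w :: R ++ [v₀]) ++ [e]))) p +
      cov (pes (e :: (v₁ :: X') ++ [u])) p
      = cov (cedges (pl (u :: (w :: R ++ [v₀]) ++ [e] ++ (v₁ :: X')))) p := by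
    intro p hp
    rw [hpc4, hpc3, cov_cons_of_notMem hp, cov_nil]; omega
  have hgen : Gen 2 (pl (u :: (w :: R ++ [v₀]) ++ [e])) := by
    have hsub : (u :: (w :: R ++ [v₀]) ++ [e]).Sublist (u :: (w :: R ++ [v₀]) ++ [e] ++ (v₁ :: X')) :=
      List.sublist_append_left _ _
    refine ⟨D3.gen.nodup.sublist (hsub.map _), ?_, ?_⟩
    · intro p hp f hf
      have hp' : p ∈ pl (u :: (w :: R ++ [v₀]) ++ [e] ++ (v₁ :: X')) := (hsub.map _).subset hp
      rw [cedges_pl, hced', List.map_append, List.mem_append] at hf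
      rcases hf with hf | hf
      · refine D3.gen.vertex_notMem p hp' f ?_
        rw [cedges_pl, hced, List.map_append]
        exact List.mem_append_left _ hf
      · have hf' : f = pe (e, u) := by simpa using hf
        subst hf'
        intro hpf
        obtain ⟨x, hx, rfl⟩ := List.mem_map.1 hp'
        obtain ⟨g, hg, rfl⟩ := exists_cedge_fst hx
        exact hchord _ hpf g hg (left_mem_segment ℝ _ _)
    · intro p
      by_cases hp : p ∈ oseg (e.1, u.1)
      · rw [hchcov p hp]; norm_num
      · have := hcovle p hp
        have := D3.gen.cov_le p
        omega
  -- The chord is covered only once, so it creates no crossing; and `c` loses the strand that runs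
  -- along the removed edge from `v` to `u`.
  have hsubc : crs (pl (u :: (w :: R ++ [v₀]) ++ [e])) ⊆ crs (pl V) \ {c} := by
    intro p hp
    rw [crs, Set.mem_ofPred_eq] at hp
    have hp' : p ∉ oseg (e.1, u.1) := by
      intro h; have := hchcov p h; omega
    have h3 := hcovle p hp'
    refine ⟨?_, ?_⟩
    · rw [← hc2, crs, Set.mem_ofPred_eq]; omega
    · rintro rfl
      have h4 := D3.gen.cov_le p
      have h5 : 1 ≤ cov (pes (e :: (v₁ :: X') ++ [u])) p := by
        refine one_le_cov_pes.2 ⟨(v, u), by rw [harc]; simp, ?_⟩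
        rcases (mem_oseg_split hW'' p).1 hc₂ with h | h | h
        · exact h
        · rw [h] at hcEW
          exact absurd (right_mem_segment ℝ _ _) hcEW
        · exact absurd ((mem_oseg_split hW _).2 (Or.inr (Or.inr h))) (left_notMem_oseg hr2.symm)
      omega
  have hcmem : c ∈ crs (pl V) := D.mem_crs.2 ⟨_, h1, _, h2, hne, hc₁, hc₂⟩
  have DK : Diagram (u :: (w :: R ++ [v₀]) ++ [e]) := by
    refine ⟨simple_of_planar (by simp) hgen ?_, hgen, D.fin.subset (hsubc.trans Set.sdiff_subset)⟩
    intro f hf g hg hfg x hxf hxg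
    have hm : ∀ f ∈ cedges (u :: (w :: R ++ [v₀]) ++ [e]), f = (e, u) ∨
        f ∈ cedges (u :: (w :: R ++ [v₀]) ++ [e] ++ (v₁ :: X')) := by
      intro f hf
      rw [hced', List.mem_append] at hf
      rcases hf with hf | hf
      · exact Or.inr (by rw [hced]; exact List.mem_append_left _ hf)
      · exact Or.inl (by simpa using hf)
    rcases hm f hf with rfl | hf'
    · rcases hm g hg with rfl | hg'
      · exact hfg rfl
      · exact hchord x.1 (mem_oseg_pe hxf) g hg' (oseg_subset_cseg _ (mem_oseg_pe hxg))
    · rcases hm g hg with rfl | hg'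
      · exact hchord x.1 (mem_oseg_pe hxg) f hf' (oseg_subset_cseg _ (mem_oseg_pe hxf))
      · exact D3.simple.2.disjoint_of_one hf' hg' hfg hxf hxg
  refine ⟨_, DK, L3.trans ?_, Set.ncard_lt_ncard ⟨hsubc.trans Set.sdiff_subset,
    fun h => (hsubc (h hcmem)).2 rfl⟩ D.fin⟩
  have DK' : Diagram (u :: (w :: R ++ [v₀]) ++ [e] ++ []) := by rw [List.append_nil]; exact DK
  have key := LEq.overpass D3 DK' ?_ ?_
  · rwa [List.append_nil] at key
  · intro f hf g hg x hx y hy hxy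
    have hf3 : f ∈ cedges (u :: (w :: R ++ [v₀]) ++ [e] ++ (v₁ :: X')) := by
      rw [hced]; exact List.mem_append_right _ hf
    rcases D3.over hf3 hg hx hy hxy with h | ⟨hfg, h3, h4⟩
    · rw [h]
    have hxc : x.1 ∈ crs (pl V) := by
      rw [← hc2]; exact D3.mem_crs.2 ⟨f, hf3, g, hg, hfg, h3, h4⟩
    rw [harc] at hf
    have hf' : f = (e, v₁) ∨ f ∈ segs (v₁ :: X') ∨ f = (v, u) := by simpa using hf
    rcases hf' with rfl | hf' | rfl
    · exfalso
      have h5 := hone₁ x.1 ((mem_oseg_split hE'' _).2 (Or.inr (Or.inr h3))) hxc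
      have h6 : c ∈ oseg (e.1, v₁.1) := h5 ▸ h3
      exact left_notMem_oseg hr1.symm ((mem_oseg_split hE _).2 (Or.inr (Or.inr h6)))
    · exact absurd hxc (hfree f hf' x.1 h3)
    · have h5 : x.1 = c := hone₂ x.1 ((mem_oseg_split hW'' _).2 (Or.inl h3)) hxc
      obtain ⟨g', hg', hgg⟩ := s3 g hg
      have hx' : x ∈ cseg (v, w) :=
        (convex_segment v w).segment_subset (left_mem_segment ℝ _ _) (oseg_subset_cseg _ hu) hx
      rcases D.over h2 hg' hx' (hgg hy) hxy with h | ⟨h6, h7, h8⟩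
      · rw [h]
      · have h9 : pe g' = pe (v₀, v₁) := D.gen.eq_of_two (Diagram.pe_mem h2) (Diagram.pe_mem h1)
          (Diagram.pe_mem hg') hpne.symm (fun h => h6 (D.pe_inj hg' h2 h).symm) h7 (h5 ▸ hc₁) h8
        have h10 := D.pe_inj hg' h1 h9
        subst h10
        exact hover x hx' y (hgg hy) h5 (hxy ▸ h5)
  · intro f hf g hg x hx y hy hxy
    have hf' : f = (e, u) := by simpa using hf
    subst hf'
    rw [List.append_nil] at hg
    rcases DK.over (by rw [hced']; simp) hg hx hy hxy with h | ⟨hfg, h3, h4⟩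
    · rw [h]
    · exfalso
      rw [hced', List.mem_append] at hg
      rcases hg with hg | hg
      · exact hchord x.1 h3 g (by rw [hced]; exact List.mem_append_left _ hg)
          (oseg_subset_cseg _ h4)
      · exact hfg (List.mem_singleton.1 hg).symm

/-- As each edge carries at most one crossing, the loop between the two passages through `c` has no
other crossing. If the returning strand is the lower one, reversing the direction of travel makes it
the outgoing strand. -/
theorem Diagram.exists_unkink {V : List Space} {e₁ e₂ : Space × Space} {M N : List (Space × Space)}
    {c : Plane} (D : Diagram V) (S : Sparse V) (hV : cedges V = e₁ :: M ++ e₂ :: N)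
    (hM : ∀ f ∈ M, ∀ p ∈ oseg (pe f), p ∉ crs (pl V))
    (hc₁ : c ∈ oseg (pe e₁)) (hc₂ : c ∈ oseg (pe e₂)) :
    ∃ W, Diagram W ∧ LEq V W ∧ (crs (pl W)).ncard < (crs (pl V)).ncard := by
  have h1 : e₁ ∈ cedges V := by rw [hV]; simp
  have h2 : e₂ ∈ cedges V := by rw [hV]; simp
  have hne : e₁ ≠ e₂ := by
    rintro rfl
    have := nodup_cedges D.simple.2.nodup
    rw [hV] at this
    simp at this
  have hcc : c ∈ crs (pl V) := D.mem_crs.2 ⟨_, h1, _, h2, hne, hc₁, hc₂⟩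
  obtain ⟨v₀, A, rfl⟩ : ∃ v₀ A, V = v₀ :: A := by
    cases V with
    | nil => simp [cedges] at hV
    | cons v₀ A => exact ⟨_, _, rfl⟩
  obtain ⟨m₁, m₂, k1, k2, k3⟩ := segs_eq_append (l := v₀ :: A ++ [v₀]) (l₁ := e₁ :: M) hV
  obtain ⟨v, w⟩ := e₂
  simp only at k1 k2 k3
  obtain ⟨v₁, X', k4⟩ : ∃ v₁ X', m₁ ++ [v] = v₀ :: v₁ :: X' := by
    rcases m₁ with _ | ⟨x, _ | ⟨y, m₁⟩⟩
    · simp at k2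
    · refine ⟨v, [], ?_⟩
      simp only [List.cons_append, List.cons.injEq] at k1
      rw [k1.1]; rfl
    · refine ⟨y, m₁ ++ [v], ?_⟩
      simp only [List.cons_append, List.cons.injEq] at k1
      rw [k1.1]; rfl
  rw [k4, segs_cons_cons, List.cons.injEq] at k2
  obtain ⟨rfl, k2⟩ := k2
  obtain ⟨R, z, k5⟩ : ∃ R z, w :: m₂ = R ++ [z] :=
    ⟨_, _, (List.dropLast_append_getLast (List.cons_ne_nil _ _)).symm⟩
  have k6 : v₀ :: A ++ [v₀] = v₀ :: (v₁ :: X') ++ R ++ [z] := by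
    rw [List.append_assoc, ← k5, ← k4, k1]; simp
  obtain ⟨k7, k8⟩ := List.append_inj' k6 rfl
  have hz : v₀ = z := by simpa using k8
  subst hz
  cases R with
  -- Here the second edge would end where the first one starts, so the two edges would share a
  -- vertex besides `c`.
  | nil =>
    exfalso
    have hw : w = v₀ := by
      rw [List.nil_append, List.cons.injEq] at k5; exact k5.1
    subst hw
    have h3 := D.gen.meet_subsingleton D.fin (Diagram.pe_mem h1) (Diagram.pe_mem h2)
      (fun h => hne (D.pe_inj h1 h2 h))
      ⟨oseg_subset_cseg _ hc₁, oseg_subset_cseg _ hc₂⟩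
      ⟨left_mem_segment ℝ _ _, right_mem_segment ℝ _ _⟩
    rw [h3] at hc₁
    exact left_notMem_oseg (D.pe_ne h1) hc₁
  | cons w' R =>
    have hw : w = w' := by
      rw [List.cons_append, List.cons.injEq] at k5; exact k5.1
    subst hw
    rw [k7] at D S hM h1 h2 hcc ⊢
    obtain ⟨X₀, hX⟩ : ∃ X₀, v₁ :: X' = X₀ ++ [v] := by
      cases m₁ with
      | nil => simp at k4
      | cons x m₁ =>
        rw [List.cons_append, List.cons.injEq] at k4
        exact ⟨m₁, k4.2.symm⟩
    have hone : ∀ e ∈ cedges (v₀ :: (v₁ :: X') ++ w :: R), c ∈ oseg (pe e) → ∀ p ∈ oseg (pe e),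
        p ∈ crs (pl (v₀ :: (v₁ :: X') ++ w :: R)) → p = c := fun e he hce p hp hpc =>
      S e he ⟨hp, hpc⟩ ⟨hce, hcc⟩
    have hxy : (∀ x ∈ cseg (v, w), ∀ y ∈ cseg (v₀, v₁), x.1 = c → y.1 = c → y.2 ≤ x.2) ∨
        (∀ x ∈ cseg (v, w), ∀ y ∈ cseg (v₀, v₁), x.1 = c → y.1 = c → x.2 ≤ y.2) := by
      have hc₁' := hc₁
      have hc₂' := hc₂
      rw [oseg_pe] at hc₁' hc₂'
      obtain ⟨y₀, hy₀, rfl⟩ := hc₁'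
      obtain ⟨x₀, hx₀, hxy⟩ := hc₂'
      have hux : ∀ x ∈ cseg (v, w), x.1 = y₀.1 → x = x₀ := fun x hx h =>
        fst_injOn_cseg (D.pe_ne h2) hx (oseg_subset_cseg _ hx₀) (h.trans hxy.symm)
      have huy : ∀ y ∈ cseg (v₀, v₁), y.1 = y₀.1 → y = y₀ := fun y hy h =>
        fst_injOn_cseg (D.pe_ne h1) hy (oseg_subset_cseg _ hy₀) h
      rcases le_total y₀.2 x₀.2 with h | h
      · exact Or.inl fun x hx y hy hxc hyc => by rw [hux x hx hxc, huy y hy hyc]; exact h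
      · exact Or.inr fun x hx y hy hxc hyc => by rw [hux x hx hxc, huy y hy hyc]; exact h
    rcases hxy with ho | ho
    · exact D.exists_unkink_over hX hc₁ hc₂ (fun f hf => hM f (k2 ▸ hf)) (hone _ h1 hc₁)
        (hone _ h2 hc₂) ho
    · have e1 : (v₀ :: (v₁ :: X') ++ w :: R).reverse
          = R.reverse ++ (w :: (v₁ :: X').reverse ++ [v₀]) := by simp
      have e2 : w :: (v₁ :: X').reverse ++ v₀ :: R.reverse
          = (w :: (v₁ :: X').reverse ++ [v₀]) ++ R.reverse := by simp
      have e3 : (v₁ :: X').reverse = v :: X₀.reverse := by rw [hX]; simp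
      have e4 : v :: X₀.reverse = X'.reverse ++ [v₁] := by rw [← e3]; simp
      have DR : Diagram (w :: (v :: X₀.reverse) ++ v₀ :: R.reverse) := by
        have := D.reverse
        rw [e1] at this
        rw [← e3, e2]; exact this.rotate
      have LR : LEq (v₀ :: (v₁ :: X') ++ w :: R) (w :: (v :: X₀.reverse) ++ v₀ :: R.reverse) := by
        refine (LEq.reverse D.simple).trans ?_
        have := D.reverse
        rw [e1] at this ⊢
        rw [← e3, e2]; exact LEq.rotate this.simple
      have cR : crs (pl (w :: (v :: X₀.reverse) ++ v₀ :: R.reverse))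
          = crs (pl (v₀ :: (v₁ :: X') ++ w :: R)) := by
        rw [← e3, e2, crs_pl_rotate, ← e1, pl_reverse, crs_reverse]
      have hsw : ∀ e : Space × Space, oseg (pe e.swap) = oseg (pe e) := fun e => oseg_swap (pe e)
      obtain ⟨W, DW, LW, hW⟩ := DR.exists_unkink_over (c := c) e4 (hsw (v, w) ▸ hc₂)
        (hsw (v₀, v₁) ▸ hc₁) (by
          rw [cR, ← e3, segs_reverse]
          intro f hf p hp
          rw [List.mem_reverse, List.mem_map] at hf
          obtain ⟨g, hg, rfl⟩ := hf
          rw [hsw] at hp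
          exact hM g (k2 ▸ hg) p hp)
        (by rw [cR]; intro p hp; exact hone _ h2 hc₂ p (hsw (v, w) ▸ hp))
        (by rw [cR]; intro p hp; exact hone _ h1 hc₁ p (hsw (v₀, v₁) ▸ hp))
        (by
          intro x hx y hy hxc hyc
          exact ho y (cseg_swap (v, w) ▸ hy) x (cseg_swap (v₀, v₁) ▸ hx) hyc hxc)
      exact ⟨W, DW, LR.trans LW, cR ▸ hW⟩

/-! ### Winding numbers of closed polygons -/

/-- The plane as the complex numbers. -/
noncomputable def toC : Plane →L[ℝ] ℂ := Complex.equivRealProdCLM.symm.toContinuousLinearMap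

theorem toC_re (p : Plane) : (toC p).re = p.1 := by simp [toC]
theorem toC_im (p : Plane) : (toC p).im = p.2 := by simp [toC]

theorem toC_eq_zero {p : Plane} : toC p = 0 ↔ p = 0 := by
  constructor
  · intro h
    refine Prod.ext ?_ ?_
    · rw [← toC_re, h]; rfl
    · rw [← toC_im, h]; rfl
  · rintro rfl; exact map_zero _

/-- The quotient whose argument is the angle under which an edge is seen from a point. -/
noncomputable def ratio (e : Plane × Plane) (x : Plane) : ℂ := toC (e.2 - x) / toC (e.1 - x)

/-- The total angle under which the edges are seen from a point. -/
noncomputable def wind (l : List (Plane × Plane)) (x : Plane) : ℝ :=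
  (l.map fun e => (ratio e x).arg).sum

theorem wind_cons (e : Plane × Plane) (l : List (Plane × Plane)) (x : Plane) :
    wind (e :: l) x = (ratio e x).arg + wind l x := rfl

theorem wind_append (l₁ l₂ : List (Plane × Plane)) (x : Plane) :
    wind (l₁ ++ l₂) x = wind l₁ x + wind l₂ x := by simp [wind]

/-- A quotient `-s` with `s ≥ 0` would give `x = (s • e.1 + e.2) / (1 + s)`, a point of the edge. So
off the edge the principal argument is continuous. -/
theorem ratio_mem_slitPlane {e : Plane × Plane} {x : Plane} (hx : x ∉ cseg e) :
    ratio e x ∈ Complex.slitPlane := by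
  by_contra h
  rw [Complex.mem_slitPlane_iff, not_or, not_not, not_lt] at h
  have h1 : toC (e.1 - x) ≠ 0 := by
    rw [Ne, toC_eq_zero, sub_eq_zero]
    rintro rfl
    exact hx (left_mem_segment ℝ _ _)
  obtain ⟨s, hs⟩ : ∃ s : ℝ, s = -(ratio e x).re := ⟨_, rfl⟩
  have hs0 : 0 ≤ s := by rw [hs]; linarith [h.1]
  have h2 : ratio e x = ((-s : ℝ) : ℂ) := by
    apply Complex.ext
    · rw [Complex.ofReal_re, hs, neg_neg]
    · rw [Complex.ofReal_im, h.2]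
  rw [ratio, div_eq_iff h1] at h2
  have h3 : toC (e.2 - x + s • (e.1 - x)) = 0 := by
    rw [map_add, map_smul, h2, Complex.real_smul]
    push_cast; ring
  rw [toC_eq_zero] at h3
  apply hx
  have h4 : 0 < 1 + s := by linarith
  refine ⟨s / (1 + s), 1 / (1 + s), by positivity, by positivity, by field_simp; ring, ?_⟩
  have h5 : (1 + s) • x = s • e.1 + e.2 := by
    have : s • e.1 + e.2 - (1 + s) • x = e.2 - x + s • (e.1 - x) := by module
    rw [h3] at this
    exact (sub_eq_zero.1 this).symm
  have h6 : (s / (1 + s)) • e.1 + (1 / (1 + s)) • e.2 = (1 / (1 + s)) • (s • e.1 + e.2) := by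
    rw [smul_add, smul_smul]; congr 2; ring
  rw [h6, ← h5, smul_smul, one_div, inv_mul_cancel₀ h4.ne', one_smul]

theorem continuousAt_ratio {e : Plane × Plane} {x : Plane} (hx : x ≠ e.1) :
    ContinuousAt (ratio e) x := by
  refine ContinuousAt.div (by fun_prop) (by fun_prop) ?_
  rw [Ne, toC_eq_zero, sub_eq_zero]
  exact hx.symm

theorem continuousAt_wind {l : List (Plane × Plane)} {x : Plane} (hx : ∀ e ∈ l, x ∉ cseg e) :
    ContinuousAt (wind l) x := by
  induction l with
  | nil => exact continuousAt_const
  | cons e l ih =>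
    have h1 : x ∉ cseg e := hx e (by simp)
    have h2 : x ≠ e.1 := fun h => h1 (h ▸ left_mem_segment ℝ _ _)
    have h3 := (continuousAt_ratio h2).tendsto
    exact ((Complex.continuousAt_arg (ratio_mem_slitPlane h1)).comp (continuousAt_ratio h2)).add
      (ih fun f hf => hx f (by simp [hf]))

theorem exists_exp_wind {l : List (Plane × Plane)} {x : Plane} (hx : ∀ e ∈ l, x ∉ cseg e) :
    ∃ R : ℝ, 0 < R ∧ (R : ℂ) * Complex.exp (wind l x * Complex.I)
      = (l.map fun e => ratio e x).prod := by
  induction l with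
  | nil => exact ⟨1, one_pos, by simp [wind]⟩
  | cons e l ih =>
    obtain ⟨R, hR, h⟩ := ih fun f hf => hx f (by simp [hf])
    have h1 : ratio e x ≠ 0 := Complex.slitPlane_ne_zero (ratio_mem_slitPlane (hx e (by simp)))
    refine ⟨‖ratio e x‖ * R, mul_pos (norm_pos_iff.2 h1) hR, ?_⟩
    rw [wind_cons, List.map_cons, List.prod_cons, ← h]
    conv_rhs => rw [← Complex.norm_mul_exp_arg_mul_I (ratio e x)]
    push_cast
    rw [add_mul, Complex.exp_add]
    ring

/-- Around a closed polygon the product of the quotients is `1`, since numerators and denominators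
run through the same vertices. The total angle is an argument of this product. -/
theorem exists_wind_eq {l : List Plane} {x : Plane} (hx : ∀ e ∈ cedges l, x ∉ cseg e) :
    ∃ k : ℤ, wind (cedges l) x = k * (2 * Real.pi) := by
  obtain ⟨R, hR, h⟩ := exists_exp_wind hx
  have h1 : ((cedges l).map fun e => ratio e x).prod = 1 := by
    have h2 : ∀ l' : List (Plane × Plane), (∀ e ∈ l', x ≠ e.1) →
        (l'.map fun e => ratio e x).prod * (l'.map fun e => toC (e.1 - x)).prod
          = (l'.map fun e => toC (e.2 - x)).prod := by
      intro l' hl'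
      induction l' with
      | nil => simp
      | cons e l' ih =>
        have h4 : toC (e.1 - x) ≠ 0 := by
          rw [Ne, toC_eq_zero, sub_eq_zero]; exact (hl' e (by simp)).symm
        simp only [List.map_cons, List.prod_cons]
        rw [← ih fun f hf => hl' f (by simp [hf]), ratio]
        field_simp
    have h3 := h2 (cedges l) fun e he h => hx e he (h ▸ left_mem_segment ℝ _ _)
    have h4 : ((cedges l).map fun e => toC (e.1 - x)).prod = (l.map fun v => toC (v - x)).prod := by
      conv_rhs => rw [← map_fst_cedges l, List.map_map]
      rfl
    have h5 : ((cedges l).map fun e => toC (e.2 - x)).prod = (l.map fun v => toC (v - x)).prod := by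
      have := ((map_snd_cedges_perm l).map fun v => toC (v - x)).prod_eq
      rw [List.map_map] at this
      exact this
    rw [h4, h5] at h3
    refine mul_right_cancel₀ ?_ (h3.trans (one_mul _).symm)
    apply List.prod_ne_zero
    intro h6
    obtain ⟨v, hv, h7⟩ := List.mem_map.1 h6
    obtain ⟨e, he, rfl⟩ := exists_cedge_fst hv
    rw [toC_eq_zero, sub_eq_zero] at h7
    exact hx e he (h7 ▸ left_mem_segment ℝ _ _)
  rw [h1] at h
  have h2 := congrArg norm h
  rw [norm_mul, Complex.norm_exp_ofReal_mul_I, Complex.norm_real, Real.norm_of_nonneg hR.le,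
    norm_one, mul_one] at h2
  rw [h2, Complex.ofReal_one, one_mul, Complex.exp_eq_one_iff] at h
  obtain ⟨k, hk⟩ := h
  refine ⟨k, ?_⟩
  have h3 : (wind (cedges l) x : ℂ) = (k : ℂ) * (2 * Real.pi) := by
    refine mul_right_cancel₀ Complex.I_ne_zero (hk.trans (by ring))
  exact_mod_cast h3

/-- The winding number is constant along segments off the polygon. -/
theorem wind_eq_of_segment {l : List Plane} {a b : Plane}
    (h : ∀ x ∈ segment ℝ a b, ∀ e ∈ cedges l, x ∉ cseg e) :
    wind (cedges l) a = wind (cedges l) b := by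
  have hcon : ContinuousOn (wind (cedges l)) (segment ℝ a b) := fun x hx =>
    (continuousAt_wind (h x hx)).continuousWithinAt
  have hpre := (convex_segment (𝕜 := ℝ) a b).isPreconnected.image _ hcon
  -- If two values differed, the intermediate value `2πk + π` would be attained, which is not a
  -- multiple of `2π`.
  have key : ∀ x ∈ segment ℝ a b, ∀ y ∈ segment ℝ a b,
      ¬ wind (cedges l) x < wind (cedges l) y := by
    intro x hx y hy hxy
    obtain ⟨k, hk⟩ := exists_wind_eq (h x hx)
    obtain ⟨m, hm⟩ := exists_wind_eq (h y hy)
    have hpi := Real.pi_pos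
    rw [hk, hm] at hxy
    have h1 : (k : ℝ) < m := lt_of_mul_lt_mul_right hxy (by positivity)
    have h2 : (k : ℝ) + 1 ≤ m := by exact_mod_cast (by exact_mod_cast h1 : k < m)
    have h3 : (k : ℝ) * (2 * Real.pi) + Real.pi ∈ wind (cedges l) '' segment ℝ a b := by
      refine hpre.Icc_subset (Set.mem_image_of_mem _ hx) (Set.mem_image_of_mem _ hy) ⟨?_, ?_⟩
      · rw [hk]; linarith
      · rw [hm]; nlinarith
    obtain ⟨z, hz, hzk⟩ := h3
    obtain ⟨j, hj⟩ := exists_wind_eq (h z hz)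
    rw [hj] at hzk
    have h4 : ((2 * (j - k) : ℤ) : ℝ) = 1 := by
      push_cast
      refine mul_right_cancel₀ hpi.ne' ?_
      linarith
    have h5 : 2 * (j - k) = 1 := by exact_mod_cast h4
    omega
  exact le_antisymm (not_lt.1 (key b (right_mem_segment ℝ _ _) a (left_mem_segment ℝ _ _)))
    (not_lt.1 (key a (left_mem_segment ℝ _ _) b (right_mem_segment ℝ _ _)))

theorem wind_eq_of_segs {l : List Plane} {a : Plane} {m : List Plane}
    (h : ∀ f ∈ segs (a :: m), ∀ x ∈ cseg f, ∀ e ∈ cedges l, x ∉ cseg e) :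
    ∀ y ∈ a :: m, wind (cedges l) y = wind (cedges l) a := by
  induction m generalizing a with
  | nil => simp
  | cons b m ih =>
    intro y hy
    rcases List.mem_cons.1 hy with rfl | hy
    · rfl
    · rw [ih (fun f hf => h f (by simp [hf])) y hy]
      exact (wind_eq_of_segment (h (a, b) (by simp))).symm

/-- The angle under which an edge is seen jumps by a full turn at an inner point of the edge. -/
theorem tendsto_arg_ratio {e : Plane × Plane} {q d : Plane} (hq : q ∈ oseg e)
    (hd : 0 < det2 (e.2 - e.1) d) :
    Tendsto (fun t : ℝ => (ratio e (q + t • d)).arg) (𝓝[>] 0) (𝓝 Real.pi) ∧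
      Tendsto (fun t : ℝ => (ratio e (q + t • d)).arg) (𝓝[<] 0) (𝓝 (-Real.pi)) := by
  obtain ⟨s, r, hs, hr, hsr, hq⟩ := hq
  have es : s = 1 - r := by linarith
  subst es
  have h1 : e.1 - q = (-r) • (e.2 - e.1) := by rw [← hq]; module
  have h2 : e.2 - q = (1 - r) • (e.2 - e.1) := by rw [← hq]; module
  have hne : e.2 - e.1 ≠ 0 := by
    intro h; rw [h, det2] at hd; simp at hd
  have hC : toC (e.2 - e.1) ≠ 0 := by rwa [Ne, toC_eq_zero]
  have hr0 : ratio e q = (((1 - r) / (-r) : ℝ) : ℂ) := by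
    have h3 : ((-r : ℝ) : ℂ) ≠ 0 := by exact_mod_cast (neg_ne_zero.2 hr.ne')
    rw [ratio, h1, h2, map_smul, map_smul, Complex.real_smul, Complex.real_smul,
      mul_div_mul_right _ _ hC, Complex.ofReal_div]
  have hqe : q ≠ e.1 := by
    intro h
    rw [h, sub_self] at h1
    rcases smul_eq_zero.1 h1.symm with h | h
    · linarith
    · exact hne h
  have hlim : Tendsto (fun t : ℝ => ratio e (q + t • d)) (𝓝 0) (𝓝 (ratio e q)) := by
    have h3 : Tendsto (fun t : ℝ => q + t • d) (𝓝 0) (𝓝 (q + (0 : ℝ) • d)) :=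
      Continuous.tendsto (by fun_prop) 0
    rw [zero_smul, add_zero] at h3
    exact (continuousAt_ratio hqe).tendsto.comp h3
  -- The sign of the imaginary part is that of `t`: the quotient approaches the negative real axis
  -- from above for `t > 0` and from below for `t < 0`.
  have him : ∀ t : ℝ, (ratio e (q + t • d)).im
      = t * det2 (e.2 - e.1) d / Complex.normSq (toC (e.1 - (q + t • d))) := by
    intro t
    rw [ratio, Complex.div_im, ← sub_div, toC_im, toC_im, toC_re, toC_re]
    congr 1
    have e1 : e.1 - (q + t • d) = (-r) • (e.2 - e.1) - t • d := by rw [← h1]; abel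
    have e2 : e.2 - (q + t • d) = (1 - r) • (e.2 - e.1) - t • d := by rw [← h2]; abel
    rw [e1, e2]
    simp only [Prod.fst_sub, Prod.snd_sub, Prod.smul_fst, Prod.smul_snd, smul_eq_mul, det2]
    ring
  have hre : (ratio e q).re < 0 := by
    rw [hr0, Complex.ofReal_re]
    exact div_neg_of_pos_of_neg hs (by linarith)
  have hi0 : (ratio e q).im = 0 := by rw [hr0, Complex.ofReal_im]
  have hev : ∀ᶠ t in 𝓝 (0 : ℝ), (ratio e (q + t • d)).re < 0 :=
    (Complex.continuous_re.tendsto _).comp hlim |>.eventually (gt_mem_nhds hre)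
  constructor
  · refine (Complex.tendsto_arg_nhdsWithin_im_nonneg_of_re_neg_of_im_zero hre hi0).comp ?_
    refine tendsto_nhdsWithin_iff.2 ⟨hlim.mono_left nhdsWithin_le_nhds, ?_⟩
    filter_upwards [self_mem_nhdsWithin] with t ht
    have ht : 0 < t := ht
    change 0 ≤ (ratio e (q + t • d)).im
    rw [him]
    exact div_nonneg (by positivity) (Complex.normSq_nonneg _)
  · refine (Complex.tendsto_arg_nhdsWithin_im_neg_of_re_neg_of_im_zero hre hi0).comp ?_
    refine tendsto_nhdsWithin_iff.2 ⟨hlim.mono_left nhdsWithin_le_nhds, ?_⟩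
    filter_upwards [self_mem_nhdsWithin, hev.filter_mono nhdsWithin_le_nhds] with t ht hret
    have ht : t < 0 := ht
    change (ratio e (q + t • d)).im < 0
    rw [him]
    refine div_neg_of_neg_of_pos (mul_neg_of_neg_of_pos ht hd) (Complex.normSq_pos.2 ?_)
    intro h0
    rw [ratio, h0, div_zero] at hret
    simp at hret

/-- The winding number jumps when an edge is crossed. -/
theorem wind_jump {l : List Plane} {e : Plane × Plane} {l₁ l₂ : List (Plane × Plane)} {q d : Plane}
    (hl : cedges l = l₁ ++ e :: l₂) (hq : q ∈ oseg e) (hd : det2 (e.2 - e.1) d ≠ 0)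
    (h : ∀ f ∈ l₁ ++ l₂, q ∉ cseg f) :
    ¬ ∀ᶠ t in 𝓝[>] (0 : ℝ), wind (cedges l) (q + t • d) = wind (cedges l) (q - t • d) := by
  have hsum : ∀ x, wind (cedges l) x = (ratio e x).arg + wind (l₁ ++ l₂) x := by
    intro x; rw [hl, wind_append, wind_cons, wind_append]; ring
  have hO := continuousAt_wind h
  have key : ∀ d : Plane, 0 < det2 (e.2 - e.1) d →
      ¬ ∀ᶠ t in 𝓝[>] (0 : ℝ), wind (cedges l) (q + t • d) = wind (cedges l) (q - t • d) := by
    intro d hd hev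
    obtain ⟨h1, h2⟩ := tendsto_arg_ratio hq hd
    have h3 : Tendsto (fun t : ℝ => (ratio e (q - t • d)).arg) (𝓝[>] 0) (𝓝 (-Real.pi)) := by
      have h4 : Tendsto (fun t : ℝ => -t) (𝓝[>] 0) (𝓝[<] 0) := by
        have := tendsto_neg_nhdsGT (a := (0 : ℝ))
        rwa [neg_zero] at this
      have := h2.comp h4
      refine this.congr fun t => ?_
      simp only [Function.comp_apply, neg_smul, sub_eq_add_neg]
    have hp : Tendsto (fun t : ℝ => q + t • d) (𝓝[>] 0) (𝓝 q) := by
      have h3 : Tendsto (fun t : ℝ => q + t • d) (𝓝 0) (𝓝 (q + (0 : ℝ) • d)) :=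
        Continuous.tendsto (by fun_prop) 0
      rw [zero_smul, add_zero] at h3
      exact h3.mono_left nhdsWithin_le_nhds
    have hm : Tendsto (fun t : ℝ => q - t • d) (𝓝[>] 0) (𝓝 q) := by
      have h3 : Tendsto (fun t : ℝ => q - t • d) (𝓝 0) (𝓝 (q - (0 : ℝ) • d)) :=
        Continuous.tendsto (by fun_prop) 0
      rw [zero_smul, sub_zero] at h3
      exact h3.mono_left nhdsWithin_le_nhds
    -- The other edges contribute the same limit on both sides, so the difference tends to `2π`,
    -- whereas it is assumed to be `0`.
    have h4 := (h1.add (hO.tendsto.comp hp)).sub (h3.add (hO.tendsto.comp hm))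
    have h5 : Tendsto (fun _ : ℝ => (0 : ℝ)) (𝓝[>] 0)
        (𝓝 (Real.pi + wind (l₁ ++ l₂) q - (-Real.pi + wind (l₁ ++ l₂) q))) := by
      refine h4.congr' ?_
      filter_upwards [hev] with t ht
      rw [hsum, hsum] at ht
      simp only [Function.comp_apply]
      linarith
    have h6 := tendsto_nhds_unique h5 tendsto_const_nhds
    have := Real.pi_pos
    linarith
  rcases lt_or_gt_of_ne hd with hd | hd
  · intro hev
    refine key (-d) ?_ ?_
    · have : det2 (e.2 - e.1) (-d) = -det2 (e.2 - e.1) d := by simp [det2]; ring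
      rw [this]; linarith
    · filter_upwards [hev] with t ht
      rw [smul_neg, ← sub_eq_add_neg, sub_neg_eq_add]
      exact ht.symm
  · exact key d hd

/-- The points lie on the edge in the order `a`, `p`, `E`, `b`. -/
theorem disjoint_ends {a b p E y : Plane} (hab : a ≠ b) (hp : p ∈ oseg (a, b))
    (hE : E ∈ oseg (p, b)) (hy : y ∈ cseg (a, p)) : y ∉ cseg (E, b) := by
  intro hy'
  have hEab : E ∈ oseg (a, b) := (mem_oseg_split hp E).2 (Or.inr (Or.inr hE))
  have hpE : p ∈ oseg (a, E) := by
    rcases (mem_oseg_split hEab p).1 hp with h | h | h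
    · exact h
    · subst h
      have hpb : p ≠ b := by rintro rfl; exact right_notMem_oseg hab hp
      exact absurd hE (left_notMem_oseg hpb)
    · exact absurd hE fun h' => by
        have hpb : p ≠ b := by rintro rfl; exact right_notMem_oseg hab hp
        exact left_notMem_oseg hpb ((mem_oseg_split h' p).2 (Or.inr (Or.inr h)))
  have hya : y ∈ cseg (a, p) := hy
  have haE : a ≠ E := by rintro rfl; exact left_notMem_oseg hab hEab
  have h1 : y = a ∨ y ∈ oseg (a, E) := by
    rcases mem_cseg_iff.1 hy with h | h | h
    · exact Or.inl h
    · right; rw [h]; exact hpE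
    · exact Or.inr ((mem_oseg_split hpE y).2 (Or.inl h))
  have h2 : y = E ∨ y = b ∨ y ∈ oseg (E, b) := mem_cseg_iff.1 hy'
  rcases h1 with rfl | h1
  · rcases h2 with h2 | h2 | h2
    · exact haE h2
    · exact hab h2
    · exact left_notMem_oseg hab ((mem_oseg_split hEab y).2 (Or.inr (Or.inr h2)))
  · rcases h2 with rfl | rfl | h2
    · exact right_notMem_oseg haE h1
    · exact right_notMem_oseg hab ((mem_oseg_split hEab y).2 (Or.inl h1))
    · exact notMem_oseg_left_right hab hEab h1 h2

set_option maxHeartbeats 2000000 in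
/-- A loop of a plane curve is not crossed exactly once by the rest of the curve. -/
theorem Gen.not_crossed_once {U : List Plane} {e₁ e₂ e₃ f : Plane × Plane}
    {M₁ M₂ N₁ N₂ : List (Plane × Plane)} {p q : Plane} (h : Gen 2 U) (hfin : (crs U).Finite)
    (hl : 2 ≤ U.length)
    (hU : cedges U = e₁ :: (M₁ ++ e₂ :: M₂) ++ e₃ :: (N₁ ++ f :: N₂))
    (hM : ∀ g ∈ M₁ ++ M₂, ∀ r ∈ oseg g, r ∉ crs U)
    (hp₁ : p ∈ oseg e₁) (hp₃ : p ∈ oseg e₃) (hq₂ : q ∈ oseg e₂) (hqf : q ∈ oseg f)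
    (h₁ : ∀ r ∈ oseg e₁, r ∈ crs U → r = p) (h₂ : ∀ r ∈ oseg e₂, r ∈ crs U → r = q)
    (h₃ : ∀ r ∈ oseg e₃, r ∈ crs U → r = p) : False := by
  have hnd := nodup_cedges h.nodup
  rw [hU] at hnd
  have hm₁ : e₁ ∈ cedges U := by rw [hU]; simp
  have hm₂ : e₂ ∈ cedges U := by rw [hU]; simp
  have hm₃ : e₃ ∈ cedges U := by rw [hU]; simp
  obtain ⟨Lp, hLp⟩ : ∃ Lp, Lp = M₁ ++ e₂ :: M₂ := ⟨_, rfl⟩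
  obtain ⟨Rs, hRs⟩ : ∃ Rs, Rs = N₁ ++ f :: N₂ := ⟨_, rfl⟩
  have hfR : f ∈ Rs := by rw [hRs]; simp
  have h2L : e₂ ∈ Lp := by rw [hLp]; simp
  rw [← hLp, ← hRs] at hU hnd
  obtain ⟨hnd1, hnd2, hnd3⟩ := List.nodup_append.1 hnd
  rw [List.nodup_cons] at hnd1 hnd2
  have hmL : ∀ k ∈ Lp, k ∈ cedges U := fun k hk => by rw [hU]; simp [hk]
  have hmR : ∀ g ∈ Rs, g ∈ cedges U := fun g hg => by rw [hU]; simp [hg]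
  have hmf := hmR f hfR
  have h13 : e₁ ≠ e₃ := hnd3 _ (by simp) _ (by simp)
  have h1R : ∀ g ∈ Rs, g ≠ e₁ := fun g hg => (hnd3 _ (by simp) _ (by simp [hg])).symm
  have h3R : ∀ g ∈ Rs, g ≠ e₃ := fun g hg hge => hnd2.1 (hge ▸ hg)
  have hLR : ∀ k ∈ Lp, ∀ g ∈ Rs, g ≠ k := fun k hk g hg =>
    (hnd3 _ (by simp [hk]) _ (by simp [hg])).symm
  have h1L : ∀ k ∈ Lp, k ≠ e₁ := fun k hk hke => hnd1.1 (hke ▸ hk)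
  have h3L : ∀ k ∈ Lp, k ≠ e₃ := fun k hk => hnd3 _ (by simp [hk]) _ (by simp)
  have hML : ∀ k ∈ Lp, k ≠ e₂ → k ∈ M₁ ++ M₂ := by
    intro k hk hne
    rw [hLp] at hk
    simp only [List.mem_append, List.mem_cons] at hk ⊢
    tauto
  have hcr : ∀ g ∈ cedges U, ∀ k ∈ cedges U, g ≠ k → ∀ y ∈ oseg g, y ∈ oseg k → y ∈ crs U :=
    fun g hg k hk hgk y h1 h2 => (two_le_cov (nodup_cedges h.nodup)).2 ⟨g, hg, k, hk, hgk, h1, h2⟩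
  have hqc : q ∈ crs U := hcr _ hm₂ _ hmf (hLR _ h2L _ hfR).symm q hq₂ hqf
  have hpc : p ∈ crs U := hcr _ hm₁ _ hm₃ h13 p hp₁ hp₃
  have hqp : q ≠ p := by
    rintro rfl
    exact h3L e₂ h2L (h.eq_of_two hm₁ hm₃ hm₂ h13 (h1L _ h2L) hp₁ hp₃ hq₂)
  -- the vertices
  obtain ⟨v₀, A, rfl⟩ : ∃ v₀ A, U = v₀ :: A := by
    cases U with
    | nil => simp at hl
    | cons v₀ A => exact ⟨_, _, rfl⟩
  obtain ⟨m₁, m₂, k1, k2, k3⟩ := segs_eq_append (l := v₀ :: A ++ [v₀]) (l₁ := e₁ :: Lp) hU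
  obtain ⟨Y', k4⟩ : ∃ Y', m₁ ++ [e₃.1] = v₀ :: e₁.2 :: Y' := by
    have : ∃ a b Y', m₁ ++ [e₃.1] = a :: b :: Y' := by
      rcases m₁ with _ | ⟨a, _ | ⟨b, m₁⟩⟩
      · simp at k2
      · exact ⟨_, _, [], rfl⟩
      · exact ⟨a, b, m₁ ++ [e₃.1], rfl⟩
    obtain ⟨a, b, Y', hY⟩ := this
    have ha : a = v₀ := by
      have : v₀ :: A ++ [v₀] = (m₁ ++ [e₃.1]) ++ e₃.2 :: m₂ := by rw [k1]; simp
      rw [hY] at this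
      simp only [List.cons_append, List.cons.injEq] at this
      exact this.1.symm
    rw [hY, segs_cons_cons, List.cons.injEq] at k2
    exact ⟨Y', by rw [hY, ha, ← k2.1]⟩
  have hv₀ : e₁.1 = v₀ ∧ segs (e₁.2 :: Y') = Lp := by
    rw [k4, segs_cons_cons, List.cons.injEq] at k2
    exact ⟨by rw [← k2.1], k2.2⟩
  obtain ⟨hv₀, hY⟩ := hv₀
  obtain ⟨Y₀, hY₀⟩ : ∃ Y₀, e₁.2 :: Y' = Y₀ ++ [e₃.1] := by
    cases m₁ with
    | nil => simp at k4
    | cons x m₁ =>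
      rw [List.cons_append, List.cons.injEq] at k4
      exact ⟨m₁, k4.2.symm⟩
  have hYR : ∀ v ∈ e₃.2 :: m₂, v ∉ e₁.2 :: Y' := by
    obtain ⟨R, z, hR⟩ : ∃ R z, e₃.2 :: m₂ = R ++ [z] :=
      ⟨_, _, (List.dropLast_append_getLast (List.cons_ne_nil _ _)).symm⟩
    have k5 : v₀ :: A ++ [v₀] = (v₀ :: e₁.2 :: Y' ++ R) ++ [z] := by
      rw [List.append_assoc, ← hR, ← k4, k1]; simp
    obtain ⟨k6, k7⟩ := List.append_inj' k5 rfl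
    have hz : v₀ = z := by simpa using k7
    have hn := h.nodup
    rw [k6, List.cons_append, List.nodup_cons] at hn
    intro v hv hvY
    rw [hR, List.mem_append, List.mem_singleton] at hv
    rcases hv with hv | rfl
    · exact (List.nodup_append.1 hn.2).2.2 v hvY v hv rfl
    · rw [← hz] at hvY
      exact hn.1 (List.mem_append_left _ hvY)
  have hv₀m : v₀ ∈ e₃.2 :: m₂ := by
    have k5 : v₀ :: A ++ [v₀] = (v₀ :: e₁.2 :: Y') ++ (e₃.2 :: m₂) := by rw [← k4, k1]; simp
    have k6 := congrArg (fun l => l.getLast?) k5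
    simp only [List.getLast?_append, List.getLast?_singleton, Option.some_or] at k6
    rw [List.getLast?_eq_some_getLast (List.cons_ne_nil e₃.2 m₂)] at k6
    simp only [Option.some_or, Option.some.injEq] at k6
    rw [k6]; exact List.getLast_mem _
  have hgR : ∀ g ∈ Rs, g.1 ∉ e₁.2 :: Y' ∧ g.2 ∉ e₁.2 :: Y' := by
    intro g hg
    rw [← k3] at hg
    exact ⟨hYR _ (fst_mem_of_mem_segs hg),
      hYR _ (List.mem_cons_of_mem _ (snd_mem_of_mem_segs hg))⟩
  have hkY : ∀ k ∈ Lp, k.1 ∈ e₁.2 :: Y' ∧ k.2 ∈ e₁.2 :: Y' := by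
    intro k hk
    rw [← hY] at hk
    exact ⟨fst_mem_of_mem_segs hk, List.mem_cons_of_mem _ (snd_mem_of_mem_segs hk)⟩
  have he1Y : e₁.1 ∉ e₁.2 :: Y' := hv₀ ▸ hYR _ hv₀m
  have he3Y : e₃.2 ∉ e₁.2 :: Y' := hYR _ (by simp)
  have he3Y' : e₃.1 ∈ e₁.2 :: Y' := by rw [hY₀]; simp
  have hne₁ : e₁.1 ≠ e₁.2 := cedges_ne h.nodup hl hm₁
  have hne₃ : e₃.1 ≠ e₃.2 := cedges_ne h.nodup hl hm₃
  have hp1 : e₁.2 ≠ p := by rintro rfl; exact right_notMem_oseg hne₁ hp₁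
  have hp3 : e₃.1 ≠ p := by rintro rfl; exact left_notMem_oseg hne₃ hp₃
  -- the chord closing the loop
  obtain ⟨E, W, hE, hW, -, -, hEW, hpEW, hch⟩ := h.exists_chord hl hfin hm₁ hm₃ h13 hp₁ hp₃
    (right_mem_segment ℝ _ _) (left_mem_segment ℝ _ _) hp1 hp3
  have hp₃' : p ∈ oseg (e₃.2, e₃.1) := by rw [← oseg_swap]; exact hp₃
  have hd₁ : ∀ y ∈ cseg (e₁.1, p), y ∉ cseg (E, e₁.2) := fun y hy => disjoint_ends hne₁ hp₁ hE hy
  have hd₃ : ∀ y ∈ cseg (e₃.2, p), y ∉ cseg (W, e₃.1) := fun y hy =>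
    disjoint_ends hne₃.symm hp₃' hW hy
  have hsub₁ : cseg (E, e₁.2) ⊆ cseg e₁ := (convex_segment _ _).segment_subset
    ((convex_segment _ _).openSegment_subset (oseg_subset_cseg _ hp₁) (right_mem_segment ℝ _ _) hE)
    (right_mem_segment ℝ _ _)
  have hsub₃ : cseg (W, e₃.1) ⊆ cseg e₃ := (convex_segment _ _).segment_subset
    ((convex_segment _ _).openSegment_subset (oseg_subset_cseg _ hp₃) (left_mem_segment ℝ _ _) hW)
    (left_mem_segment ℝ _ _)
  -- `Q` is the loop from `p` back to `p` with its corner at `p` cut off by the chord. The rest of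
  -- the curve, including `p` itself, then avoids `Q` except at `q`.
  obtain ⟨Q, hQ⟩ : ∃ Q, Q = E :: (e₁.2 :: Y') ++ [W] := ⟨_, rfl⟩
  have hcQ : cedges Q = (E, e₁.2) :: Lp ++ [(e₃.1, W), (W, E)] := by
    have e1 : cedges Q = segs (E :: (e₁.2 :: Y') ++ [W] ++ [E]) := by rw [hQ]; rfl
    have e2 : E :: (e₁.2 :: Y') ++ [W] ++ [E] = (E :: Y₀) ++ e₃.1 :: W :: [E] := by rw [hY₀]; simp
    have e3 : E :: Y₀ ++ [e₃.1] = E :: e₁.2 :: Y' := by rw [List.cons_append, ← hY₀]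
    rw [e1, e2, segs_append_cons_cons, e3, segs_cons_cons, hY]; rfl
  have hOff : ∀ y, (∀ k ∈ Lp, y ∉ cseg k) → y ∉ cseg (E, e₁.2) → y ∉ cseg (W, e₃.1) →
      y ∉ cseg (E, W) → ∀ e ∈ cedges Q, y ∉ cseg e := by
    intro y h1 h2 h3 h4 e he
    have he' : e = (E, e₁.2) ∨ e ∈ Lp ∨ e = (e₃.1, W) ∨ e = (W, E) := by
      rw [hcQ] at he; simpa using he
    rcases he' with rfl | he | rfl | rfl
    · exact h2
    · exact h1 e he
    · rw [← cseg_swap]; exact h3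
    · rw [← cseg_swap]; exact h4
  have hendp₁ : ∀ y, y = e₁.1 ∨ y = p → y ∈ cseg (e₁.1, p) := by
    rintro y (rfl | rfl)
    · exact left_mem_segment ℝ _ _
    · exact right_mem_segment ℝ _ _
  have hendp₃ : ∀ y, y = e₃.2 ∨ y = p → y ∈ cseg (e₃.2, p) := by
    rintro y (rfl | rfl)
    · exact left_mem_segment ℝ _ _
    · exact right_mem_segment ℝ _ _
  have hrest : ∀ g ∈ Rs, ∀ y ∈ cseg g, y ≠ q → ∀ e ∈ cedges Q, y ∉ cseg e := by
    intro g hg y hy hyq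
    refine hOff y ?_ ?_ ?_ ?_
    · intro k hk hyk
      rcases h.meet (hmR g hg) (hmL k hk) hy hyk with ⟨-, h1, h2⟩ | ⟨h1, h2⟩
      · have h3 : y ∈ e₁.2 :: Y' := by
          rcases h2 with rfl | rfl
          · exact (hkY k hk).1
          · exact (hkY k hk).2
        rcases h1 with rfl | rfl
        · exact (hgR g hg).1 h3
        · exact (hgR g hg).2 h3
      · have h3 := hcr _ (hmR g hg) _ (hmL k hk) (hLR k hk g hg) y h1 h2
        by_cases hk2 : k = e₂
        · subst hk2; exact hyq (h₂ y h2 h3)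
        · exact hM k (hML k hk hk2) y h2 h3
    · intro hyE
      rcases h.meet (hmR g hg) hm₁ hy (hsub₁ hyE) with ⟨-, h1, h2 | h2⟩ | ⟨h1, h2⟩
      · exact hd₁ y (hendp₁ y (Or.inl h2)) hyE
      · have h3 : y ∈ e₁.2 :: Y' := by rw [h2]; simp
        rcases h1 with rfl | rfl
        · exact (hgR g hg).1 h3
        · exact (hgR g hg).2 h3
      · exact hd₁ y (hendp₁ y (Or.inr (h₁ y h2
          (hcr _ (hmR g hg) _ hm₁ (h1R g hg) y h1 h2)))) hyE
    · intro hyW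
      rcases h.meet (hmR g hg) hm₃ hy (hsub₃ hyW) with ⟨-, h1, h2 | h2⟩ | ⟨h1, h2⟩
      · have h3 : y ∈ e₁.2 :: Y' := by rw [h2]; exact he3Y'
        rcases h1 with rfl | rfl
        · exact (hgR g hg).1 h3
        · exact (hgR g hg).2 h3
      · exact hd₃ y (hendp₃ y (Or.inl h2)) hyW
      · exact hd₃ y (hendp₃ y (Or.inr (h₃ y h2
          (hcr _ (hmR g hg) _ hm₃ (h3R g hg) y h1 h2)))) hyW
    · intro hyc
      rcases hch g (hmR g hg) y hy hyc with ⟨h1, -⟩ | ⟨h1, -⟩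
      · exact h1R g hg h1
      · exact h3R g hg h1
  have hss := h.meet_subsingleton hfin hm₁ hm₃ h13
  have hpp : ∀ y, y ∈ cseg e₁ → y ∈ cseg e₃ → y = p := fun y h1 h2 =>
    hss ⟨h1, h2⟩ ⟨oseg_subset_cseg _ hp₁, oseg_subset_cseg _ hp₃⟩
  have hpL : ∀ k ∈ Lp, p ∉ oseg k := fun k hk hpk =>
    h3L k hk (h.eq_of_two hm₁ hm₃ (hmL k hk) h13 (h1L k hk) hp₁ hp₃ hpk)
  have harm₁ : ∀ y ∈ cseg (e₁.1, p), ∀ e ∈ cedges Q, y ∉ cseg e := by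
    intro y hy
    have hy₁ : y ∈ cseg e₁ := (convex_segment _ _).segment_subset (left_mem_segment ℝ _ _)
      (oseg_subset_cseg _ hp₁) hy
    refine hOff y ?_ (hd₁ y hy) ?_ ?_
    · intro k hk hyk
      rcases h.meet hm₁ (hmL k hk) hy₁ hyk with ⟨-, h1 | h1, h2⟩ | ⟨h1, h2⟩
      · refine he1Y (h1 ▸ ?_)
        rcases h2 with rfl | rfl
        · exact (hkY k hk).1
        · exact (hkY k hk).2
      · exact hd₁ y hy (h1 ▸ right_mem_segment ℝ _ _)
      · have h3 := h₁ y h1 (hcr _ hm₁ _ (hmL k hk) (h1L k hk).symm y h1 h2)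
        exact hpL k hk (h3 ▸ h2)
    · intro hyW
      have h3 := hpp y hy₁ (hsub₃ hyW)
      exact hd₃ y (hendp₃ y (Or.inr h3)) hyW
    · intro hyc
      rcases hch e₁ hm₁ y hy₁ hyc with ⟨-, h1⟩ | ⟨h1, -⟩
      · exact hd₁ y hy (h1 ▸ left_mem_segment ℝ _ _)
      · exact h13 h1
  have harm₃ : ∀ y ∈ cseg (e₃.2, p), ∀ e ∈ cedges Q, y ∉ cseg e := by
    intro y hy
    have hy₃ : y ∈ cseg e₃ := (convex_segment _ _).segment_subset (right_mem_segment ℝ _ _)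
      (oseg_subset_cseg _ hp₃) hy
    refine hOff y ?_ ?_ (hd₃ y hy) ?_
    · intro k hk hyk
      rcases h.meet hm₃ (hmL k hk) hy₃ hyk with ⟨-, h1 | h1, h2⟩ | ⟨h1, h2⟩
      · exact hd₃ y hy (h1 ▸ right_mem_segment ℝ _ _)
      · refine he3Y (h1 ▸ ?_)
        rcases h2 with rfl | rfl
        · exact (hkY k hk).1
        · exact (hkY k hk).2
      · have h3 := h₃ y h1 (hcr _ hm₃ _ (hmL k hk) (h3L k hk).symm y h1 h2)
        exact hpL k hk (h3 ▸ h2)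
    · intro hyE
      have h3 := hpp y (hsub₁ hyE) hy₃
      exact hd₁ y (hendp₁ y (Or.inr h3)) hyE
    · intro hyc
      rcases hch e₃ hm₃ y hy₃ hyc with ⟨h1, -⟩ | ⟨-, h1⟩
      · exact h13 h1.symm
      · exact hd₃ y hy (h1 ▸ left_mem_segment ℝ _ _)
  -- the other edges of the loop are off the crossing
  have hqv : ∀ g ∈ cedges (v₀ :: A), q ∈ cseg g → g ≠ e₂ → q ∈ oseg g := by
    intro g hg hqg hne
    rcases h.meet hg hm₂ hqg (oseg_subset_cseg _ hq₂) with ⟨h1, -⟩ | ⟨h1, -⟩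
    · exact absurd hq₂ (h.vertex_notMem q h1 e₂ hm₂)
    · exact h1
  have hq1 : q ∉ cseg e₁ := fun h1 =>
    hqp (h₁ q (hqv e₁ hm₁ h1 (h1L e₂ h2L).symm) hqc)
  have hq3 : q ∉ cseg e₃ := fun h1 =>
    hqp (h₃ q (hqv e₃ hm₃ h1 (h3L e₂ h2L).symm) hqc)
  have hoth : ∀ e ∈ ((E, e₁.2) :: M₁) ++ (M₂ ++ [(e₃.1, W), (W, E)]), q ∉ cseg e := by
    have hMq : ∀ k ∈ M₁ ++ M₂, q ∉ cseg k := by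
      intro k hk hqk
      have hkL : k ∈ Lp := by
        rw [hLp]; simp only [List.mem_append, List.mem_cons] at hk ⊢; tauto
      have hke : k ≠ e₂ := by
        rintro rfl
        rw [hLp] at hnd1
        exact (List.nodup_cons.1 (List.nodup_middle.1 hnd1.2)).1 hk
      exact hM k hk q (hqv k (hmL k hkL) hqk hke) hqc
    have hqc' : q ∉ cseg (E, W) := by
      intro h1
      rcases hch e₂ hm₂ q (oseg_subset_cseg _ hq₂) h1 with ⟨h2, -⟩ | ⟨h2, -⟩
      · exact h1L e₂ h2L h2
      · exact h3L e₂ h2L h2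
    intro e he
    have he' : e = (E, e₁.2) ∨ e ∈ M₁ ++ M₂ ∨ e = (e₃.1, W) ∨ e = (W, E) := by
      simp only [List.mem_append, List.mem_cons, List.not_mem_nil, or_false] at he ⊢; tauto
    rcases he' with rfl | he | rfl | rfl
    · exact fun h1 => hq1 (hsub₁ h1)
    · exact hMq e he
    · rw [← cseg_swap]; exact fun h1 => hq3 (hsub₃ h1)
    · rw [← cseg_swap]; exact hqc'
  -- going round
  obtain ⟨n₁, n₂, j1, j2, j3⟩ := segs_eq_append (k3.trans hRs)
  have hqN : ∀ g ∈ N₁ ++ N₂, q ∉ cseg g := by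
    intro g hg hqg
    have hgR' : g ∈ Rs := by
      rw [hRs]; simp only [List.mem_append, List.mem_cons] at hg ⊢; tauto
    have h1 := hqv g (hmR g hgR') hqg (hLR e₂ h2L g hgR')
    have h2 := h.eq_of_two hm₂ hmf (hmR g hgR') (hLR e₂ h2L f hfR).symm (hLR e₂ h2L g hgR') hq₂ hqf h1
    subst h2
    rw [hRs] at hnd2
    exact (List.nodup_cons.1 (List.nodup_middle.1 hnd2.2)).1 hg
  have hN : ∀ g ∈ N₁ ++ N₂, ∀ y ∈ cseg g, ∀ e ∈ cedges Q, y ∉ cseg e := by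
    intro g hg y hy
    refine hrest g ?_ y hy ?_
    · rw [hRs]; simp only [List.mem_append, List.mem_cons] at hg ⊢; tauto
    · rintro rfl; exact hqN g hg hy
  have hw1 : wind (cedges Q) f.1 = wind (cedges Q) e₃.2 := by
    obtain ⟨n', hn'⟩ : ∃ n', n₁ ++ [f.1] = e₃.2 :: n' := by
      cases n₁ with
      | nil =>
        rw [List.nil_append, List.cons.injEq] at j1
        exact ⟨[], by rw [j1.1]; rfl⟩
      | cons x n₁ =>
        rw [List.cons_append, List.cons.injEq] at j1
        exact ⟨n₁ ++ [f.1], by rw [j1.1]; rfl⟩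
    rw [hn'] at j2
    refine wind_eq_of_segs (fun g hg => hN g (List.mem_append_left _ (j2 ▸ hg))) f.1 ?_
    rw [← hn']; simp
  have hw2 : wind (cedges Q) v₀ = wind (cedges Q) f.2 := by
    refine wind_eq_of_segs (fun g hg => hN g (List.mem_append_right _ (j3 ▸ hg))) v₀ ?_
    have k5 : v₀ :: A ++ [v₀] = (m₁ ++ [e₃.1]) ++ (n₁ ++ [f.1]) ++ (f.2 :: n₂) := by
      rw [k1, j1]; simp
    have k6 := congrArg (fun l => l.getLast?) k5
    simp only [List.getLast?_append, List.getLast?_singleton, Option.some_or] at k6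
    rw [List.getLast?_eq_some_getLast (List.cons_ne_nil f.2 n₂)] at k6
    simp only [Option.some_or, Option.some.injEq] at k6
    rw [k6]; exact List.getLast_mem _
  have hw3 : wind (cedges Q) e₁.1 = wind (cedges Q) p := wind_eq_of_segment harm₁
  have hw4 : wind (cedges Q) e₃.2 = wind (cedges Q) p := wind_eq_of_segment harm₃
  -- From the end of `f` one can go on along the curve to `p`, through `e₁`, and back from `p`
  -- through `e₃` to the start of `f`, without meeting `Q`. But `f` crosses `Q` once, at `q`, where
  -- the winding number jumps.
  have hw : wind (cedges Q) f.2 = wind (cedges Q) f.1 := by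
    rw [hw1, hw4, ← hw3, hv₀, hw2]
  have hdet := h.det2_ne hl hfin hm₂ hmf (hLR e₂ h2L f hfR).symm hq₂ hqf
  have hcQ' : cedges Q = ((E, e₁.2) :: M₁) ++ e₂ :: (M₂ ++ [(e₃.1, W), (W, E)]) := by
    rw [hcQ, hLp]; simp
  refine wind_jump hcQ' hq₂ hdet hoth ?_
  have hqf' := hqf
  obtain ⟨s, r, hs, hr, hsr, hqe⟩ := hqf'
  have es : s = 1 - r := by linarith
  subst es
  have hd0 : f.2 - f.1 ≠ 0 := by
    intro h0; rw [h0] at hdet; simp [det2] at hdet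
  have hlin : ∀ u : ℝ, u ≠ 0 → q + u • (f.2 - f.1) ≠ q := by
    intro u hu h0
    rw [add_eq_left] at h0
    exact (smul_ne_zero hu hd0) h0
  have hfc : ∀ u : ℝ, -r ≤ u → u ≤ 1 - r → q + u • (f.2 - f.1) ∈ cseg f := by
    intro u h1 h2
    refine ⟨1 - r - u, r + u, by linarith, by linarith, by ring, ?_⟩
    rw [← hqe]; module
  have hf2 : f.2 = q + (1 - r) • (f.2 - f.1) := by rw [← hqe]; module
  have hf1 : f.1 = q + (-r) • (f.2 - f.1) := by rw [← hqe]; module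
  filter_upwards [Ioo_mem_nhdsGT (lt_min hs hr)] with t ht
  have ht1 : t < 1 - r := ht.2.trans_le (min_le_left _ _)
  have ht2 : t < r := ht.2.trans_le (min_le_right _ _)
  have ht0 : 0 < t := ht.1
  have hw5 : wind (cedges Q) (q + t • (f.2 - f.1)) = wind (cedges Q) f.2 := by
    refine wind_eq_of_segment fun x hx => ?_
    have hx' : ∃ u : ℝ, 0 < u ∧ u ≤ 1 - r ∧ x = q + u • (f.2 - f.1) := by
      obtain ⟨a, b, ha, hb, hab, rfl⟩ := hx
      refine ⟨a * t + b * (1 - r), ?_, ?_, ?_⟩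
      · rcases ha.eq_or_lt with rfl | ha
        · have : b = 1 := by linarith
          subst this; linarith
        · have := mul_pos ha ht0
          have := mul_nonneg hb hs.le
          linarith
      · have e1 : b = 1 - a := by linarith
        subst e1; nlinarith
      · have e1 : a = 1 - b := by linarith
        subst e1
        nth_rw 2 [hf2]
        module
    obtain ⟨u, hu0, hu1, rfl⟩ := hx'
    exact hrest f hfR _ (hfc u (by linarith) hu1) (hlin u hu0.ne')
  have hw6 : wind (cedges Q) (q - t • (f.2 - f.1)) = wind (cedges Q) f.1 := by
    refine wind_eq_of_segment fun x hx => ?_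
    have hx' : ∃ u : ℝ, 0 < u ∧ u ≤ r ∧ x = q + (-u) • (f.2 - f.1) := by
      obtain ⟨a, b, ha, hb, hab, rfl⟩ := hx
      refine ⟨a * t + b * r, ?_, ?_, ?_⟩
      · rcases ha.eq_or_lt with rfl | ha
        · have : b = 1 := by linarith
          subst this; linarith
        · have := mul_pos ha ht0
          have := mul_nonneg hb hr.le
          linarith
      · have e1 : b = 1 - a := by linarith
        subst e1; nlinarith
      · have e1 : a = 1 - b := by linarith
        subst e1
        rw [show b • f.1 = b • (q + (-r) • (f.2 - f.1)) from congrArg _ hf1]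
        module
    obtain ⟨u, hu0, hu1, rfl⟩ := hx'
    exact hrest f hfR _ (hfc (-u) (by linarith) (by linarith)) (hlin (-u) (neg_ne_zero.2 hu0.ne'))
  rw [hw5, hw6, hw]

/-! ### Minimal diagrams: the first three crossings are distinct -/

theorem Sparse.rotate {l₁ l₂ : List Space} (h : Sparse (l₁ ++ l₂)) : Sparse (l₂ ++ l₁) := by
  intro e he
  rw [crs_pl_rotate]
  exact h e ((cedges_append_perm l₂ l₁).mem_iff.1 he)

/-- No diagram joined to `V` by triangle moves has fewer crossings. -/
def Minimal (V : List Space) : Prop :=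
  ∀ W, Diagram W → LEq V W → (crs (pl V)).ncard ≤ (crs (pl W)).ncard

theorem Minimal.of_lEq {V W : List Space} (h : Minimal V) (hL : LEq V W)
    (hc : crs (pl W) = crs (pl V)) : Minimal W := by
  intro X hX hWX
  rw [hc]
  exact h X hX (hL.trans hWX)

theorem Diagram.exists_other_edge {V : List Space} (D : Diagram V) {e : Space × Space}
    {p : Plane} (he : e ∈ cedges V) (hp : p ∈ crs (pl V)) (h : p ∈ oseg (pe e)) :
    ∃ f ∈ cedges V, f ≠ e ∧ p ∈ oseg (pe f) := by
  obtain ⟨f, hf, g, hg, hfg, h1, h2⟩ := D.mem_crs.1 hp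
  by_cases hfe : f = e
  · subst hfe
    exact ⟨g, hg, hfg.symm, h2⟩
  · exact ⟨f, hf, hfe, h1⟩

theorem crs_eq_union {x y : Space} {A B : List Space}
    (hα : ∀ p, cov (pes (x :: A ++ [y])) p ≤ 1) :
    crs (pl (x :: A ++ y :: B))
      = mutX (x :: A ++ [y]) (y :: B ++ [x]) ∪ selfX (y :: B ++ [x]) := by
  refine Set.Subset.antisymm ?_ (Set.union_subset (mutX_subset_crs _ _ _ _)
    (selfX_subset_crs _ _ _ _))
  intro p hp
  rw [crs, Set.mem_ofPred_eq, cov_cedges_pl] at hp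
  have := hα p
  simp only [mutX, selfX, Set.mem_union, Set.mem_ofPred_eq]
  omega

/-- The first three crossings met on a minimal diagram are distinct. -/
theorem exists_three_crossings {V : List Space} (D : Diagram V) (S : Sparse V) (hmin : Minimal V)
    {e₁ : Space × Space} {R : List (Space × Space)} {p : Plane} (hV : cedges V = e₁ :: R)
    (hp : p ∈ crs (pl V)) (hpe : p ∈ oseg (pe e₁)) :
    ∃ M₁ e₂ M₂ e₃ g N q r, cedges V = (e₁ :: M₁ ++ e₂ :: M₂) ++ e₃ :: (g :: N) ∧
      (∀ f ∈ M₁ ++ M₂, ∀ s ∈ oseg (pe f), s ∉ crs (pl V)) ∧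
      q ∈ oseg (pe e₂) ∧ q ∈ crs (pl V) ∧ r ∈ oseg (pe e₃) ∧ r ∈ crs (pl V) ∧
      p ≠ q ∧ q ≠ r ∧ p ≠ r := by
  -- In a minimal diagram two successive passages never go through the same crossing, since the kink
  -- between them could be removed. This is stated for renumbered polygons too, so as to start at
  -- any edge.
  have hun : ∀ {W : List Space} {e₁ e₂ : Space × Space} {M N : List (Space × Space)} {c : Plane},
      Diagram W → Sparse W → LEq V W → crs (pl W) = crs (pl V) → cedges W = e₁ :: M ++ e₂ :: N →
      (∀ f ∈ M, ∀ p ∈ oseg (pe f), p ∉ crs (pl V)) → c ∈ oseg (pe e₁) → c ∉ oseg (pe e₂) := by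
    intro W e₁ e₂ M N c DW SW hL hcr hW hM h1 h2
    rw [← hcr] at hM
    obtain ⟨X, DX, hX, hlt⟩ := DW.exists_unkink SW hW hM h1 h2
    have := (hmin.of_lEq hL hcr) X DX hX
    omega
  have hnd := nodup_cedges D.simple.2.nodup
  have he₁ : e₁ ∈ cedges V := by rw [hV]; simp
  obtain ⟨f₁, hf₁, hf₁e, hpf₁⟩ := D.exists_other_edge he₁ hp hpe
  have hf₁R : f₁ ∈ R := by
    rw [hV, List.mem_cons] at hf₁
    exact hf₁.resolve_left hf₁e
  obtain ⟨M₁, e₂, R₂, rfl, ⟨q, hqe, hq⟩, hM₁⟩ :=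
    exists_first (fun e => ∃ s ∈ oseg (pe e), s ∈ crs (pl V)) ⟨f₁, hf₁R, p, hpf₁, hp⟩
  have hM₁' : ∀ f ∈ M₁, ∀ s ∈ oseg (pe f), s ∉ crs (pl V) :=
    fun f hf s hs hc => hM₁ f hf ⟨s, hs, hc⟩
  have hp₂ : p ∉ oseg (pe e₂) :=
    hun D S (LEq.refl D.simple) rfl (by rw [hV]; rfl) hM₁' hpe
  have hpq : p ≠ q := by rintro rfl; exact hp₂ hqe
  have hf₁2 : f₁ ∈ R₂ := by
    rcases List.mem_append.1 hf₁R with h | h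
    · exact absurd hp (hM₁' f₁ h p hpf₁)
    · rcases List.mem_cons.1 h with rfl | h
      · exact absurd hpf₁ hp₂
      · exact h
  obtain ⟨M₂, e₃, N, rfl, ⟨r, hre, hr⟩, hM₂⟩ :=
    exists_first (fun e => ∃ s ∈ oseg (pe e), s ∈ crs (pl V)) ⟨f₁, hf₁2, p, hpf₁, hp⟩
  have hM₂' : ∀ f ∈ M₂, ∀ s ∈ oseg (pe f), s ∉ crs (pl V) :=
    fun f hf s hs hc => hM₂ f hf ⟨s, hs, hc⟩
  have hM : ∀ f ∈ M₁ ++ M₂, ∀ s ∈ oseg (pe f), s ∉ crs (pl V) := fun f hf =>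
    (List.mem_append.1 hf).elim (hM₁' f) (hM₂' f)
  have he₂ : e₂ ∈ cedges V := by rw [hV]; simp
  have he₃ : e₃ ∈ cedges V := by rw [hV]; simp
  have hqr : q ≠ r := by
    rintro rfl
    obtain ⟨l₁, l₂, rfl, h2⟩ := exists_rotate_cedges
      (show cedges V = (e₁ :: M₁) ++ e₂ :: (M₂ ++ e₃ :: N) by rw [hV]; simp)
    exact hun D.rotate S.rotate (LEq.rotate D.simple) (crs_pl_rotate _ _)
      (N := N ++ e₁ :: M₁) (by rw [h2]; simp) hM₂' hqe hre
  obtain ⟨f₂, hf₂, hf₂e, hqf₂⟩ := D.exists_other_edge he₂ hq hqe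
  have hf₂N : f₂ ∈ N := by
    rw [hV] at hf₂
    have h1 : f₂ ≠ e₁ := by
      rintro rfl
      exact hpq (S _ he₁ ⟨hpe, hp⟩ ⟨hqf₂, hq⟩)
    have h3 : f₂ ≠ e₃ := by
      rintro rfl
      exact hqr (S _ he₃ ⟨hqf₂, hq⟩ ⟨hre, hr⟩)
    have h4 : f₂ ∉ M₁ ++ M₂ := fun h => hM f₂ h q hqf₂ hq
    simp only [List.mem_cons, List.mem_append] at hf₂ h4
    tauto
  -- Otherwise the curve runs through `p`, `q`, `p`, and the loop at `p` is crossed by the rest only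
  -- once, by the other strand `f₂` through `q`.
  have hpr : p ≠ r := by
    rintro rfl
    obtain ⟨N₁, N₂, rfl⟩ := List.append_of_mem hf₂N
    refine Gen.not_crossed_once (U := pl V) (e₁ := pe e₁) (e₂ := pe e₂) (e₃ := pe e₃) (f := pe f₂)
      (M₁ := M₁.map pe) (M₂ := M₂.map pe) (N₁ := N₁.map pe) (N₂ := N₂.map pe) D.gen D.fin
      ?_ ?_ ?_ hpe hre hqe hqf₂ ?_ ?_ ?_
    · rw [pl, List.length_map]
      exact le_trans (by norm_num) D.simple.1
    · rw [cedges_pl, hV]; simp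
    · intro g hg
      rw [← List.map_append] at hg
      obtain ⟨f, hf, rfl⟩ := List.mem_map.1 hg
      exact hM f hf
    · exact fun s h1 h2 => S _ he₁ ⟨h1, h2⟩ ⟨hpe, hp⟩
    · exact fun s h1 h2 => S _ he₂ ⟨h1, h2⟩ ⟨hqe, hq⟩
    · exact fun s h1 h2 => S _ he₃ ⟨h1, h2⟩ ⟨hre, hr⟩
  -- The other strand through `q` comes after `e₃`, so the arc that ends with `e₃` is not the whole
  -- polygon.
  cases N with
  | nil => simp at hf₂N
  | cons g N =>
    exact ⟨M₁, e₂, M₂, e₃, g, N, q, r, by rw [hV]; simp, hM, hqe, hq, hre, hr, hpq, hqr, hpr⟩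

/-- A minimal diagram contains an arc without self-crossings that meets the rest of the diagram in
at least three crossings. -/
theorem exists_simple_arc {V : List Space} (D : Diagram V) (S : Sparse V) (hmin : Minimal V)
    (hne : (crs (pl V)).Nonempty) :
    ∃ x A y B, Diagram (x :: A ++ y :: B) ∧ LEq V (x :: A ++ y :: B) ∧
      (∀ p, cov (pes (x :: A ++ [y])) p ≤ 1) ∧
      3 ≤ (mutX (x :: A ++ [y]) (y :: B ++ [x])).ncard ∧
      (mutX (x :: A ++ [y]) (y :: B ++ [x])).ncard + (selfX (y :: B ++ [x])).ncard
        = (crs (pl V)).ncard := by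
  obtain ⟨p, hp⟩ := hne
  obtain ⟨e₁, he₁, -, -, -, hpe, -⟩ := D.mem_crs.1 hp
  obtain ⟨P, Q, hPQ⟩ := List.append_of_mem he₁
  obtain ⟨l₁, l₂, rfl, hV⟩ := exists_rotate_cedges hPQ
  have hL := LEq.rotate D.simple
  have hc := crs_pl_rotate l₁ l₂
  replace hmin := hmin.of_lEq hL hc.symm
  replace D := D.rotate
  replace S := S.rotate
  rw [hc] at hp ⊢
  obtain ⟨V, rfl⟩ : ∃ V, l₂ ++ l₁ = V := ⟨_, rfl⟩
  generalize l₂ ++ l₁ = V at *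
  obtain ⟨M₁, e₂, M₂, e₃, g, N, q, r, hV', hM, hqe, hq, hre, hr, hpq, hqr, hpr⟩ :=
    exists_three_crossings D S hmin (R := Q ++ P) hV hp hpe
  cases V with
  | nil => simp [cedges] at hV
  | cons x T =>
    obtain ⟨m₁, m₂, h1, h2, h3⟩ := segs_eq_append
      (show segs (x :: T ++ [x]) = (e₁ :: M₁ ++ e₂ :: M₂) ++ e₃ :: (g :: N) from hV')
    obtain ⟨A₀, rfl⟩ : ∃ A₀, m₁ = x :: A₀ := by
      cases m₁ with
      | nil => simp at h2
      | cons z A₀ =>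
        rw [List.cons_append, List.cons_append, List.cons.injEq] at h1
        exact ⟨A₀, by rw [h1.1]⟩
    obtain ⟨m', w, rfl⟩ : ∃ m' w, m₂ = m' ++ [w] := by
      rcases List.eq_nil_or_concat m₂ with rfl | ⟨m', w, rfl⟩
      · simp at h3
      · exact ⟨m', w, by simp⟩
    have h4 : T ++ [x] = (A₀ ++ e₃.1 :: e₃.2 :: m') ++ [w] := by
      simpa using h1
    obtain ⟨h5, h6⟩ := List.append_inj' h4 rfl
    have h7 : w = x := by simpa using h6.symm
    subst h7
    -- The first arc consists of the edges from `e₁` up to and including `e₃`; the polygon is cut at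
    -- the end of `e₃`.
    have hVV : w :: T = w :: (A₀ ++ [e₃.1]) ++ e₃.2 :: m' := by rw [h5]; simp
    have hα : segs (w :: (A₀ ++ [e₃.1]) ++ [e₃.2]) = (e₁ :: M₁ ++ e₂ :: M₂) ++ [e₃] := by
      rw [← h2]
      have := segs_append_cons (w :: A₀) e₃.1 [e₃.2]
      simpa using this
    have hsub : ∀ k ∈ segs (w :: (A₀ ++ [e₃.1]) ++ [e₃.2]), k ∈ cedges (w :: T) := by
      intro k hk
      rw [hα] at hk
      rw [hV']
      simp only [List.mem_append, List.mem_cons, List.not_mem_nil, or_false] at hk ⊢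
      tauto
    have hm₁ : e₁ ∈ segs (w :: (A₀ ++ [e₃.1]) ++ [e₃.2]) := by rw [hα]; simp
    have hm₂ : e₂ ∈ segs (w :: (A₀ ++ [e₃.1]) ++ [e₃.2]) := by rw [hα]; simp
    have hm₃ : e₃ ∈ segs (w :: (A₀ ++ [e₃.1]) ++ [e₃.2]) := by rw [hα]; simp
    have hsimple : ∀ s, cov (pes (w :: (A₀ ++ [e₃.1]) ++ [e₃.2])) s ≤ 1 := by
      intro s
      by_contra! hs
      have hnd : (pes (w :: (A₀ ++ [e₃.1]) ++ [e₃.2])).Nodup := by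
        have h8 := nodup_cedges D.gen.nodup
        rw [hVV, cedges_pl, cedges_cons_append_cons, List.map_append] at h8
        exact (List.nodup_append.1 h8).1
      obtain ⟨k, hk, k', hk', hkk, hsk, hsk'⟩ := (two_le_cov hnd).1 hs
      obtain ⟨f, hf, rfl⟩ := mem_pes.1 hk
      obtain ⟨f', hf', rfl⟩ := mem_pes.1 hk'
      have hff : f ≠ f' := by rintro rfl; exact hkk rfl
      have hsc : s ∈ crs (pl (w :: T)) :=
        D.mem_crs.2 ⟨f, hsub f hf, f', hsub f' hf', hff, hsk, hsk'⟩
      -- Each crossing on the first arc determines its edge there, because `p`, `q`, `r` are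
      -- distinct and lie on one edge each.
      have key : ∀ f ∈ segs (w :: (A₀ ++ [e₃.1]) ++ [e₃.2]), s ∈ oseg (pe f) →
          (f = e₁ ∧ s = p) ∨ (f = e₂ ∧ s = q) ∨ (f = e₃ ∧ s = r) := by
        intro f hf hsf
        have h9 : f = e₁ ∨ f = e₂ ∨ f = e₃ ∨ f ∈ M₁ ++ M₂ := by
          rw [hα] at hf
          simp only [List.mem_append, List.mem_cons, List.not_mem_nil, or_false] at hf ⊢
          tauto
        rcases h9 with rfl | rfl | rfl | h9
        · exact Or.inl ⟨rfl, S _ (hsub _ hf) ⟨hsf, hsc⟩ ⟨hpe, hp⟩⟩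
        · exact Or.inr (Or.inl ⟨rfl, S _ (hsub _ hf) ⟨hsf, hsc⟩ ⟨hqe, hq⟩⟩)
        · exact Or.inr (Or.inr ⟨rfl, S _ (hsub _ hf) ⟨hsf, hsc⟩ ⟨hre, hr⟩⟩)
        · exact absurd hsc (hM f h9 s hsf)
      rcases key f hf hsk with ⟨a1, a2⟩ | ⟨a1, a2⟩ | ⟨a1, a2⟩ <;>
        rcases key f' hf' hsk' with ⟨b1, b2⟩ | ⟨b1, b2⟩ | ⟨b1, b2⟩
      · exact hff (a1.trans b1.symm)
      · exact hpq (a2.symm.trans b2)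
      · exact hpr (a2.symm.trans b2)
      · exact hpq (b2.symm.trans a2)
      · exact hff (a1.trans b1.symm)
      · exact hqr (a2.symm.trans b2)
      · exact hpr (b2.symm.trans a2)
      · exact hqr (b2.symm.trans a2)
      · exact hff (a1.trans b1.symm)
    rw [hVV] at D hL hp hq hr ⊢
    have hmut : ∀ {s f}, f ∈ segs (w :: (A₀ ++ [e₃.1]) ++ [e₃.2]) → s ∈ oseg (pe f) →
        s ∈ crs (pl (w :: (A₀ ++ [e₃.1]) ++ e₃.2 :: m')) →
        s ∈ mutX (w :: (A₀ ++ [e₃.1]) ++ [e₃.2]) (e₃.2 :: m' ++ [w]) := by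
      intro s f hf hsf hsc
      refine ⟨one_le_cov_pes.2 ⟨f, hf, hsf⟩, ?_⟩
      rw [crs, Set.mem_ofPred_eq, cov_cedges_pl] at hsc
      have := hsimple s
      omega
    have hfin := D.fin
    have hfm := hfin.subset (mutX_subset_crs w (A₀ ++ [e₃.1]) e₃.2 m')
    have hfs := hfin.subset (selfX_subset_crs w (A₀ ++ [e₃.1]) e₃.2 m')
    refine ⟨w, A₀ ++ [e₃.1], e₃.2, m', D, hL, hsimple, ?_, ?_⟩
    · have h3 : ({p, q, r} : Set Plane).ncard = 3 :=
        Set.ncard_eq_three.2 ⟨p, q, r, hpq, hpr, hqr, rfl⟩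
      rw [← h3]
      refine Set.ncard_le_ncard ?_ hfm
      rintro s (rfl | rfl | rfl)
      · exact hmut hm₁ hpe hp
      · exact hmut hm₂ hqe hq
      · exact hmut hm₃ hre hr
    · rw [crs_eq_union hsimple, Set.ncard_union_eq _ hfm hfs]
      rw [Set.disjoint_left]
      rintro s ⟨h8, h9⟩ h10
      rw [selfX, Set.mem_ofPred_eq] at h10
      have h11 := D.gen.cov_le s
      rw [cov_cedges_pl] at h11
      omega

/-! ### Two simple arcs make a straight diagram -/

theorem strictMono_append {a b : ℕ} {s : Fin a → ℝ} {t : Fin b → ℝ} (hs : StrictMono s)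
    (ht : StrictMono t) (h : ∀ i j, s i < t j) : StrictMono (Fin.append s t) := by
  intro i j
  refine Fin.addCases (fun i => ?_) (fun i => ?_) i <;>
    refine Fin.addCases (fun j => ?_) (fun j => ?_) j <;> intro hij <;>
    simp only [Fin.append_left, Fin.append_right]
  · exact hs hij
  · exact h i j
  · rw [Fin.lt_def] at hij
    simp only [Fin.val_natAdd, Fin.val_castAdd] at hij
    omega
  · exact ht ((Fin.natAdd_lt_natAdd_iff a).1 hij)

/-- A diagram cut into two arcs, each of which passes every crossing exactly once, is straight. -/
theorem isStraight_of_bijOn (P : PolygonalKnot) {m : ℝ} (hm : 0 < m) (hm' : m < P.size)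
    (hfin : P.crossings.Finite) (h₀ : (P.path 0).1 ∉ P.crossings)
    (hmc : (P.path m).1 ∉ P.crossings)
    (hα : Set.BijOn (fun u => (P.path u).1) {u | 0 < u ∧ u < m ∧ (P.path u).1 ∈ P.crossings}
      P.crossings)
    (hβ : Set.BijOn (fun u => (P.path u).1)
      {u | m < u ∧ u < P.size ∧ (P.path u).1 ∈ P.crossings} P.crossings) : P.IsStraight := by
  obtain ⟨S, hS⟩ : ∃ S, S = {u : ℝ | 0 < u ∧ u < m ∧ (P.path u).1 ∈ P.crossings} := ⟨_, rfl⟩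
  obtain ⟨T, hT⟩ : ∃ T, T = {u : ℝ | m < u ∧ u < P.size ∧ (P.path u).1 ∈ P.crossings} := ⟨_, rfl⟩
  rw [← hS] at hα
  rw [← hT] at hβ
  -- Each stretch meets every crossing once, so its moments can be listed increasingly by indices as
  -- many as there are crossings.
  have key : ∀ R : Set ℝ, Set.BijOn (fun u => (P.path u).1) R P.crossings →
      ∃ t : Fin P.crossings.ncard → ℝ, StrictMono t ∧ Set.range t = R := by
    intro R hR
    have hRf : R.Finite := Set.Finite.of_finite_image (hR.image_eq ▸ hfin) hR.injOn
    have hcard : hRf.toFinset.card = P.crossings.ncard := by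
      rw [← Set.ncard_eq_toFinset_card R hRf, ← hR.image_eq, hR.injOn.ncard_image]
    refine ⟨hRf.toFinset.orderEmbOfFin hcard, (hRf.toFinset.orderEmbOfFin hcard).strictMono, ?_⟩
    rw [Finset.range_orderEmbOfFin, Set.Finite.coe_toFinset]
  obtain ⟨tα, hmα, hrα⟩ := key S hα
  obtain ⟨tβ, hmβ, hrβ⟩ := key T hβ
  have hiα : Function.Injective fun i => (P.path (tα i)).1 := fun i j hij =>
    hmα.injective (hα.injOn (hrα ▸ ⟨i, rfl⟩) (hrα ▸ ⟨j, rfl⟩) hij)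
  have hiβ : Function.Injective fun i => (P.path (tβ i)).1 := fun i j hij =>
    hmβ.injective (hβ.injOn (hrβ ▸ ⟨i, rfl⟩) (hrβ ▸ ⟨j, rfl⟩) hij)
  have hsα : Set.range (fun i => (P.path (tα i)).1) = P.crossings := by
    have h1 : Set.range (fun i => (P.path (tα i)).1) = (fun u => (P.path u).1) '' Set.range tα :=
      Set.range_comp (fun u => (P.path u).1) tα
    rw [h1, hrα, hα.image_eq]
  have hsβ : ∀ j, ∃ i, (P.path (tα i)).1 = (P.path (tβ j)).1 := by
    intro j
    have h1 : (P.path (tβ j)).1 ∈ P.crossings := hβ.mapsTo (hrβ ▸ ⟨j, rfl⟩)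
    rw [← hsα] at h1
    exact h1
  choose s hs using hsβ
  have hinj : Function.Injective s := fun i j hij => hiβ (by
    change (P.path (tβ i)).1 = (P.path (tβ j)).1
    rw [← hs i, ← hs j, hij])
  have hσ : ∀ j, (Equiv.ofBijective s (Finite.injective_iff_bijective.1 hinj)) j = s j :=
    fun j => rfl
  have hSm : ∀ i, 0 < tα i ∧ tα i < m ∧ (P.path (tα i)).1 ∈ P.crossings := fun i => by
    have h1 : tα i ∈ S := hrα ▸ ⟨i, rfl⟩
    rw [hS] at h1; exact h1
  have hTm : ∀ i, m < tβ i ∧ tβ i < P.size ∧ (P.path (tβ i)).1 ∈ P.crossings := fun i => by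
    have h1 : tβ i ∈ T := hrβ ▸ ⟨i, rfl⟩
    rw [hT] at h1; exact h1
  -- Start at the parameter `0` in the given direction and label the crossings in their order along
  -- the first stretch. The permutation sends `j` to the label of the `j`-th crossing of the second
  -- stretch.
  refine ⟨P.crossings.ncard, Equiv.ofBijective s (Finite.injective_iff_bijective.1 hinj), 0, 1,
    Fin.append tα tβ, fun i => (P.path (tα i)).1, h₀, Or.inl rfl, hiα, hsα, ?_, ?_, ?_, ?_⟩
  · exact strictMono_append hmα hmβ fun i j => (hSm i).2.1.trans (hTm j).1
  · simp only [zero_add, one_mul]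
    ext u
    constructor
    · rintro ⟨i, rfl⟩
      refine Fin.addCases (fun i => ?_) (fun i => ?_) i <;>
        simp only [Fin.append_left, Fin.append_right]
      · exact ⟨(hSm i).1, (hSm i).2.1.trans hm', (hSm i).2.2⟩
      · exact ⟨hm.trans (hTm i).1, (hTm i).2.1, (hTm i).2.2⟩
    · rintro ⟨h1, h2, h3⟩
      rcases lt_trichotomy u m with h | rfl | h
      · have h4 : u ∈ S := by rw [hS]; exact ⟨h1, h, h3⟩
        rw [← hrα] at h4
        obtain ⟨i, rfl⟩ := h4
        exact ⟨Fin.castAdd _ i, Fin.append_left _ _ i⟩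
      · exact absurd h3 hmc
      · have h4 : u ∈ T := by rw [hT]; exact ⟨h, h2, h3⟩
        rw [← hrβ] at h4
        obtain ⟨i, rfl⟩ := h4
        exact ⟨Fin.natAdd _ i, Fin.append_right _ _ i⟩
  · intro j
    simp only [zero_add, one_mul]
    refine Fin.addCases (fun j => ?_) (fun j => ?_) j
    · simp
    · simp only [Fin.append_right]
      rw [hσ, hs]
  · intro j
    refine Fin.addCases (fun j => ?_) (fun j => ?_) j
    · intro k hk
      rw [Fin.append_left] at hk
      exact ⟨Fin.castAdd _ k, hk, Fin.append_left _ _ k⟩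
    · intro k hk
      refine ⟨Fin.castAdd _ k, ?_, Fin.append_left _ _ k⟩
      rw [Fin.lt_def]
      simp only [Fin.val_natAdd, Fin.val_castAdd]
      omega

theorem path_ofList_fst {V : List Space} (h : Simple V) (i : ℕ) {s : ℝ} (h0 : 0 ≤ s) (h1 : s < 1) :
    ((ofList V h).path (i + s)).1
      = AffineMap.lineMap (vtx V i).1 (vtx V (i + 1)).1 s := by
  have := polygonalPath_add (vtx V) i h0 h1
  rw [path, ofList]
  simp only [Int.cast_natCast] at this
  rw [this]
  simp [AffineMap.lineMap_apply_module]

theorem Diagram.path_natCast {V : List Space} (D : Diagram V) (i : ℕ) :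
    ((ofList V D.simple).path i).1 ∉ (ofList V D.simple).crossings := by
  have := path_ofList_fst D.simple i le_rfl one_pos
  rw [add_zero, AffineMap.lineMap_apply_zero] at this
  rw [this]
  exact D.isRegular.vertex_not_crossing i

/-- A stretch of a diagram in which each crossing lies on exactly one edge passes each crossing
exactly once. -/
theorem Diagram.bijOn_path {V : List Space} (D : Diagram V) {a b : ℕ}
    (hex : ∀ p ∈ crs (pl V), ∃ i : ℕ, a ≤ i ∧ i < b ∧ p ∈ oseg (pe (vtx V i, vtx V (i + 1))))
    (huniq : ∀ p ∈ crs (pl V), ∀ i j : ℕ, a ≤ i → i < b → a ≤ j → j < b →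
      p ∈ oseg (pe (vtx V i, vtx V (i + 1))) → p ∈ oseg (pe (vtx V j, vtx V (j + 1))) → i = j) :
    Set.BijOn (fun u => ((ofList V D.simple).path u).1)
      {u | (a : ℝ) < u ∧ u < b ∧
        ((ofList V D.simple).path u).1 ∈ (ofList V D.simple).crossings}
      (ofList V D.simple).crossings := by
  -- A moment at a crossing is not an integer, since vertices do not lie over crossings.
  have hdec : ∀ u ∈ {u : ℝ | (a : ℝ) < u ∧ u < b ∧
      ((ofList V D.simple).path u).1 ∈ (ofList V D.simple).crossings},
      ∃ (i : ℕ) (s : ℝ), a ≤ i ∧ i < b ∧ 0 < s ∧ s < 1 ∧ u = i + s := by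
    rintro u ⟨h1, h2, h3⟩
    have hu : 0 ≤ u := (Nat.cast_nonneg a).trans h1.le
    refine ⟨⌊u⌋₊, u - ⌊u⌋₊, Nat.le_floor h1.le, (Nat.floor_lt hu).2 h2, ?_, ?_, by ring⟩
    · refine lt_of_le_of_ne (sub_nonneg.2 (Nat.floor_le hu)) fun h0 => ?_
      rw [sub_eq_zero.1 h0.symm] at h3
      exact D.path_natCast _ h3
    · have := Nat.lt_floor_add_one u
      linarith
  refine ⟨fun u hu => hu.2.2, ?_, ?_⟩
  · intro u hu u' hu' huu
    obtain ⟨i, s, hi, hi', hs, hs', rfl⟩ := hdec u hu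
    obtain ⟨j, r, hj, hj', hr, hr', rfl⟩ := hdec u' hu'
    have hc := hu.2.2
    rw [D.crossings_eq] at hc
    simp only at huu
    rw [path_ofList_fst D.simple i hs.le hs'] at huu hc
    rw [path_ofList_fst D.simple j hr.le hr'] at huu
    have hij : i = j := huniq _ hc i j hi hi' hj hj' (lineMap_mem_oseg hs hs')
      (huu ▸ lineMap_mem_oseg hr hr')
    subst hij
    have hmem : (vtx V i, vtx V (i + 1)) ∈ cedges V :=
      vtx_pair_mem (by have := D.simple.1; omega) i
    rw [AffineMap.lineMap_injective ℝ (D.pe_ne hmem) huu]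
  · intro p hp
    have hp' := hp
    rw [D.crossings_eq] at hp'
    obtain ⟨i, hi, hi', hpi⟩ := hex p hp'
    obtain ⟨s, hs, hs', hps⟩ := exists_of_mem_oseg hpi
    have h1 : ((ofList V D.simple).path (i + s)).1 = p := by
      rw [path_ofList_fst D.simple i hs.le hs', hps]
    refine ⟨i + s, ⟨?_, ?_, ?_⟩, h1⟩
    · have : (a : ℝ) ≤ i := by exact_mod_cast hi
      linarith
    · have : (i : ℝ) + 1 ≤ b := by exact_mod_cast hi'
      linarith
    · rw [h1]; exact hp

theorem length_segs (x : Space) (l : List Space) : (segs (x :: l)).length = l.length := by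
  rw [← List.length_map (f := Prod.snd), map_snd_segs]

/-- A diagram made of two arcs without self-crossings is straight. -/
theorem Diagram.isStraight {x : Space} {A : List Space} {y : Space} {B : List Space}
    (D : Diagram (x :: A ++ y :: B)) (hα : ∀ p, cov (pes (x :: A ++ [y])) p ≤ 1)
    (hβ : ∀ p, cov (pes (y :: B ++ [x])) p ≤ 1) : (ofList _ D.simple).IsStraight := by
  have hce : cedges (x :: A ++ y :: B) = segs (x :: A ++ [y]) ++ segs (y :: B ++ [x]) :=
    cedges_cons_append_cons _ _ _ _
  have hlα : (segs (x :: A ++ [y])).length = A.length + 1 := by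
    rw [List.cons_append, length_segs]; simp
  have hlβ : (segs (y :: B ++ [x])).length = B.length + 1 := by
    rw [List.cons_append, length_segs]; simp
  have hlV : (x :: A ++ y :: B).length = (A.length + 1) + (B.length + 1) := by
    simp only [List.length_append, List.length_cons]
  have hcr : ∀ p ∈ crs (pl (x :: A ++ y :: B)),
      1 ≤ cov (pes (x :: A ++ [y])) p ∧ 1 ≤ cov (pes (y :: B ++ [x])) p := by
    intro p hp
    rw [crs, Set.mem_ofPred_eq, cov_cedges_pl] at hp
    have h1 := hα p
    have h2 := hβ p
    omega
  have hnd : (pes (x :: A ++ [y]) ++ pes (y :: B ++ [x])).Nodup := by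
    have h8 := nodup_cedges D.gen.nodup
    rw [cedges_pl, cedges_cons_append_cons, List.map_append] at h8
    exact h8
  have huniq : ∀ {l : List Space}, (pes l).Nodup → (∀ p, cov (pes l) p ≤ 1) →
      ∀ p i j (hi : i < (segs l).length) (hj : j < (segs l).length),
      p ∈ oseg (pe (segs l)[i]) → p ∈ oseg (pe (segs l)[j]) → i = j := by
    intro l hl h1 p i j hi hj hpi hpj
    by_contra hij
    have hi' : i < (pes l).length := by rw [pes, List.length_map]; exact hi
    have hj' : j < (pes l).length := by rw [pes, List.length_map]; exact hj
    have := (two_le_cov (p := p) hl).2 ⟨(pes l)[i], List.getElem_mem _, (pes l)[j],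
      List.getElem_mem _, fun h => hij ((List.Nodup.getElem_inj_iff hl).1 h),
      by simpa [pes] using hpi, by simpa [pes] using hpj⟩
    have := h1 p
    omega
  have hvα : ∀ i : ℕ, ∀ hi : i < (segs (x :: A ++ [y])).length,
      (vtx (x :: A ++ y :: B) i, vtx (x :: A ++ y :: B) (i + 1)) = (segs (x :: A ++ [y]))[i] := by
    intro i hi
    rw [vtx_pair_natCast _ (by omega), List.getElem_of_eq hce, List.getElem_append_left]
  have hvβ : ∀ i : ℕ, ∀ hi : i < (segs (y :: B ++ [x])).length,
      (vtx (x :: A ++ y :: B) ((A.length + 1 + i : ℕ) : ℤ),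
        vtx (x :: A ++ y :: B) (((A.length + 1 + i : ℕ) : ℤ) + 1))
        = (segs (y :: B ++ [x]))[i] := by
    intro i hi
    rw [vtx_pair_natCast _ (by omega), List.getElem_of_eq hce,
      List.getElem_append_right (by omega)]
    simp only [hlα, Nat.add_sub_cancel_left]
  have b1 := D.bijOn_path (a := 0) (b := A.length + 1)
    (by
      intro p hp
      obtain ⟨e, he, hpe⟩ := one_le_cov_pes.1 (hcr p hp).1
      obtain ⟨i, hi, rfl⟩ := List.getElem_of_mem he
      exact ⟨i, Nat.zero_le _, hlα ▸ hi, by rw [hvα i hi]; exact hpe⟩)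
    (by
      intro p _ i j _ hi _ hj hpi hpj
      rw [hvα i (by omega)] at hpi
      rw [hvα j (by omega)] at hpj
      exact huniq (List.nodup_append.1 hnd).1 hα p i j _ _ hpi hpj)
  have b2 := D.bijOn_path (a := A.length + 1) (b := (x :: A ++ y :: B).length)
    (by
      intro p hp
      obtain ⟨e, he, hpe⟩ := one_le_cov_pes.1 (hcr p hp).2
      obtain ⟨i, hi, rfl⟩ := List.getElem_of_mem he
      exact ⟨A.length + 1 + i, by omega, by omega, by rw [hvβ i hi]; exact hpe⟩)
    (by
      intro p _ i j hi hi' hj hj' hpi hpj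
      obtain ⟨i, rfl⟩ := Nat.exists_eq_add_of_le hi
      obtain ⟨j, rfl⟩ := Nat.exists_eq_add_of_le hj
      rw [hvβ i (by omega)] at hpi
      rw [hvβ j (by omega)] at hpj
      rw [huniq (List.nodup_append.1 hnd).2.1 hβ p i j _ _ hpi hpj])
  have h0 := D.path_natCast 0
  rw [Nat.cast_zero] at h0 b1
  refine isStraight_of_bijOn (ofList _ D.simple) (m := ((A.length + 1 : ℕ) : ℝ)) ?_ ?_
    D.isRegular.finite_crossings h0 (D.path_natCast _) b1 b2
  · positivity
  · change ((A.length + 1 : ℕ) : ℝ) < ((x :: A ++ y :: B).length : ℕ)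
    rw [hlV]
    exact_mod_cast (by omega)

end KnotDiagram

/-! ### The bound for the straight number -/

open KnotDiagram

theorem theorem3p2 (K : PolygonalKnot) (n : ℕ) (hn : 1 ≤ n)
    (hK : K.crossingNumber = (n : ℕ∞)) :
    K.straightNumber ≤ ((2 ^ (n - 1) - 1 : ℕ) : ℕ∞) := by
  -- The infimum of the empty set is `⊤`, so a finite crossing number is attained by a diagram.
  have hne : {k : ℕ∞ | ∃ P : PolygonalKnot, K.Equivalent P ∧ P.IsRegular ∧
      P.crossings.encard = k}.Nonempty := by
    by_contra h
    rw [Set.not_nonempty_iff_eq_empty] at h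
    rw [PolygonalKnot.crossingNumber, h, sInf_empty] at hK
    exact ENat.natCast_ne_top n hK.symm
  obtain ⟨P, hKP, hP, hPn⟩ := csInf_mem hne
  replace hPn : P.crossings.encard = n := hPn.trans hK
  obtain ⟨V, D, hV, hcV, S⟩ := (diagram_toList hP).exists_sparse
  have hKV : ∀ {W : List Space}, LEq V W → ∃ h, K.Equivalent (ofList W h) := by
    rintro W ⟨h, h', hVW⟩
    obtain ⟨_, _, hPV⟩ := hV
    exact ⟨h', hKP.trans _ _ _ ((equivalent_ofList_toList P).trans _ _ _ (hPV.trans _ _ _ hVW))⟩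
  have hVn : (crs (pl V)).ncard = n := by
    rw [hcV, ← crossings_eq_toList hP, Set.ncard, hPn, ENat.toNat_natCast]
  have hmin : Minimal V := by
    intro W hW hVW
    obtain ⟨h, hKW⟩ := hKV hVW
    have h1 : K.crossingNumber ≤ (ofList W h).crossings.encard :=
      sInf_le ⟨ofList W h, hKW, hW.isRegular, rfl⟩
    rw [hW.crossings_eq, hK, ← hW.fin.cast_ncard_eq] at h1
    rw [hVn]
    exact_mod_cast h1
  obtain ⟨x, A, y, B, D₁, h₁, hα, h3, hsum⟩ := exists_simple_arc D S hmin
    (Set.nonempty_of_ncard_ne_zero (by omega))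
  obtain ⟨x', A', y', B', D₂, h₂, hα', hβ', hle⟩ := exists_two_simple D₁ hα
  obtain ⟨h, hKW⟩ := hKV (h₁.trans h₂)
  have hst : K.straightNumber ≤ (ofList _ D₂.simple).crossings.encard :=
    sInf_le ⟨_, hKW, D₂.isRegular, D₂.isStraight hα' hβ', rfl⟩
  refine hst.trans ?_
  rw [D₂.crossings_eq, ← D₂.fin.cast_ncard_eq]
  have hsub : (crs (pl (x' :: A' ++ y' :: B'))).ncard
      ≤ (mutX (x' :: A' ++ [y']) (y' :: B' ++ [x'])).ncard := by
    refine Set.ncard_le_ncard ?_ (D₂.fin.subset (mutX_subset_crs _ _ _ _))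
    intro p hp
    rw [crs, Set.mem_ofPred_eq, cov_cedges_pl] at hp
    have := hα' p
    have := hβ' p
    exact ⟨by omega, by omega⟩
  rw [hVn] at hsum
  generalize (mutX (x :: A ++ [y]) (y :: B ++ [x])).ncard = a at *
  generalize (selfX (y :: B ++ [x])).ncard = b at *
  obtain ⟨a, rfl⟩ := Nat.exists_eq_add_of_le h3
  -- From here `a` is the excess over three of the number of crossings of the two arcs. This is
  -- where three crossings are needed: with only two, the left side would be `3` and the right side
  -- `2`.
  have hpow : 3 + a + 1 ≤ 2 ^ (a + 2) := by
    have := Nat.lt_two_pow_self (n := a)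
    rw [pow_add]
    omega
  have hexp : 2 ^ (n - 1) = 2 ^ b * 2 ^ (a + 2) := by
    rw [← pow_add]
    congr 1
    omega
  have := Nat.mul_le_mul_left (2 ^ b) hpow
  have hfinal : (crs (pl (x' :: A' ++ y' :: B'))).ncard ≤ 2 ^ (n - 1) - 1 := by omega
  exact_mod_cast hfinal
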